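/- Let $k$ be a field of characteristic zero. **Setting.** Let $\Delta$ be the formal disk over $k$ with coordinate $z$, $B=\Delta\times\mathbb G_m$ the (trivialized) principal $\mathbb G_m$-bundle over $\Delta$, with coordinate $u$ on $\mathbb G_m$ and base point $y_0=(0,1)$, and let $B^*$ be the complement of the fibre over $z=0$. The functions on $B$ are $k[[z]][u,u^{-1}]$ and those on $B^*$ are $k((z))[u,u^{-1}]$. Let $E=\bigoplus_{n\in\mathbb Z}E_n$ be a finite dimensional graded $k$-vector space, with weight filtration $W^{-n}(E)=\bigoplus_{m\ge n}E_m$. Let $\mathbb G_m$ act on the trivial bundle $\tilde E=B\times E$ through its action on $B$ and the action of $t$ on $E$ by $t^n$ on $E_n$. * A *$W$-connection* on $\tilde E$ over $B^*$ is a connection $\nabla=d+A\,dz+C\,\frac{du}{u}$, with $A,C$ functions on $B^*$ with values in $\mathrm{End}(E)$, which preserves the filtration and induces the trivial connection on the associated graded (i.e. $A$ and $C$ map $W^{-n}$ into $W^{-n-1}$ for all $n$). It is *flat* if $[\nabla_{\partial_z},\nabla_{u\partial_u}]=0$. * Two connections are *$W$-equivalent* (on $B$) if they are conjugate by a $\mathbb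 G_m$-invariant automorphism of $\tilde E$ that is regular on $B$ together with its inverse, preserves the filtration and induces the identity on the associated graded. * A section of $B$ through $y_0$ is given by a power series $v\in k[[z]]$ with $v(0)=1$; it defines the trivialization $(z,u)\mapsto u\cdot(z,v(z))=(z,v(z)u)$ of $B$, and $\nabla^{v}$ denotes the pull-back of $\nabla$ by it. A $W$-connection $\nabla$ is *equisingular* if it is $\mathbb G_m$-invariant and $\nabla^{v}$, $\nabla^{v'}$ are $W$-equivalent on $B$ for any two such $v,v'$. **The category $\mathcal E$ of equisingular flat bundles.** An object $(E,\nabla)$ is a finite dimensional $\mathbb Z$-graded $k$-vector space $E$ with a $W$-equivalence class of flat equisingular $W$-connections $\nabla$ on $\tilde E$ over $B^*$. A morphism $(E,\nabla)\to(E',\nabla')$ is a linear map $T:E\to E'$ compatible with the gradings such that the connections $$\begin{pmatrix}\nabla' & T\nabla-\nabla'T\\ 0&\nabla\end{pmatrix},\qquad \begin{pmatrix}\nabla'&0\\0&\nabla\end{pmatrix}$$ on $\tilde E'\oplus\tilde E$ are $W$-equivalent on $B$. The tensor product is $(E\otimes E',\nabla\otimes1+1\otimes\nabla')$, with unit object $k$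 in degree $0$ with the trivial connection, and with the usual associativity, commutativity and unit isomorphisms. Let $\omega$ be the functor $\omega(E,\nabla)=E$ to finite dimensional $k$-vector spaces. **The group scheme $U^*$.** Let $L$ be the free graded Lie algebra over $k$ on generators $e_{-n}$ of degree $n$, one for each integer $n>0$, and let $U$ be the pro-unipotent affine group scheme with Lie algebra $L$ (completed), that is, $U=\mathrm{Spec}\,H_u$, where $H_u$ is the graded dual of the enveloping algebra $\mathcal U(L)$: the space with basis the words in letters $f_n$ ($n>0$, $f_n$ of degree $n$), with the shuffle product and the deconcatenation coproduct. Let $U^*=U\rtimes\mathbb G_m$, where $\mathbb G_m$ acts through the grading: $t\in A^\times$ maps $\varphi\in U(A)=\mathrm{Hom}_{k\text{-alg}}(H_u,A)$ to $w\mapsto t^{|w|}\varphi(w)$. A finite dimensional representation of $U^*$ is a finite dimensional $k$-vector space $V$ with group homomorphisms $U^*(A)\to\mathrm{Aut}_A(A\otimes_kV)$, functorial in the commutative $k$-algebra $A$. **Theorem.** 1. $\mathcal E$ is a (neutral) Tannakian category over $k$: it is a $k$-linear abelian symmetric monoidal category with $k$-bilinear tensor product, in which every object has a dual, with $k\simeq\mathrm{End}(1)$,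 and it has a fibre functor to finite dimensional $k$-vector spaces. 2. $\omega$ is a fibre functor, i.e. an exact faithful $k$-linear symmetric monoidal functor to finite dimensional $k$-vector spaces. 3. $\mathcal E$ is equivalent to the category of finite dimensional representations of $U^*$. More precisely, there is a $k$-linear equivalence of symmetric monoidal categories whose composite with the forgetful functor of representations is isomorphic to $\omega$ as a monoidal functor. -/

import Mathlib

set_option linter.unusedSectionVars false
set_option linter.unusedVariables false

open CategoryTheory
open scoped TensorProduct

universe u

noncomputable section

namespace Equising

/-! ### Tensor products over a base ring -/

section Odot

variable {k R E F G E₁ F₁ : Type*} [CommRing k] [CommRing R] [Algebra k R]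
  [AddCommGroup E] [Module k E] [AddCommGroup F] [Module k F] [AddCommGroup G] [Module k G]
  [AddCommGroup E₁] [Module k E₁] [AddCommGroup F₁] [Module k F₁]

/-- The external product `(R ⊗ E) × (R ⊗ F) → R ⊗ (E ⊗ F)`, `(r ⊗ e, s ⊗ f) ↦ rs ⊗ (e ⊗ f)`. -/
def odot (m : R ⊗[k] E) (n : R ⊗[k] F) : R ⊗[k] (E ⊗[k] F) :=
  (TensorProduct.AlgebraTensorModule.distribBaseChange k R E F).symm (m ⊗ₜ[R] n)

@[simp] theorem odot_tmul (r s : R) (e : E) (f : F) :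
    odot (r ⊗ₜ[k] e) (s ⊗ₜ[k] f) = (r * s) ⊗ₜ[k] (e ⊗ₜ[k] f) :=
  TensorProduct.AlgebraTensorModule.distribBaseChange_symm_tmul ..

theorem odot_add (m : R ⊗[k] E) (n n₁ : R ⊗[k] F) : odot m (n + n₁) = odot m n + odot m n₁ := by
  simp [odot, TensorProduct.tmul_add]

theorem add_odot (m m₁ : R ⊗[k] E) (n : R ⊗[k] F) : odot (m + m₁) n = odot m n + odot m₁ n := by
  simp [odot, TensorProduct.add_tmul]

theorem odot_sub (m : R ⊗[k] E) (n n₁ : R ⊗[k] F) : odot m (n - n₁) = odot m n - odot m n₁ := by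
  simp [odot, TensorProduct.tmul_sub]

theorem sub_odot (m m₁ : R ⊗[k] E) (n : R ⊗[k] F) : odot (m - m₁) n = odot m n - odot m₁ n := by
  simp [odot, TensorProduct.sub_tmul]

@[simp] theorem zero_odot (n : R ⊗[k] F) : odot (0 : R ⊗[k] E) n = 0 := by
  simp [odot]

@[simp] theorem odot_zero (m : R ⊗[k] E) : odot m (0 : R ⊗[k] F) = 0 := by
  simp [odot]

theorem smul_odot (r : R) (m : R ⊗[k] E) (n : R ⊗[k] F) : odot (r • m) n = r • odot m n := by
  simp [odot, ← TensorProduct.smul_tmul']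

theorem odot_smul (r : R) (m : R ⊗[k] E) (n : R ⊗[k] F) : odot m (r • n) = r • odot m n := by
  simp [odot]

theorem odot_induction {p : R ⊗[k] (E ⊗[k] F) → Prop} (x : R ⊗[k] (E ⊗[k] F))
    (h₀ : p 0) (h : ∀ (m : R ⊗[k] E) (n : R ⊗[k] F), p (odot m n))
    (h₂ : ∀ x y, p x → p y → p (x + y)) : p x := by
  obtain ⟨y, rfl⟩ := (TensorProduct.AlgebraTensorModule.distribBaseChange k R E F).symm.surjective x
  induction y using TensorProduct.induction_on with
  | zero => simpa using h₀
  | tmul m n => exact h m n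
  | add x y hx hy => rw [map_add]; exact h₂ _ _ hx hy

/-- `f ⊗ g` for `R`-linear maps `f : R ⊗ E → R ⊗ E₁` and `g : R ⊗ F → R ⊗ F₁`. -/
def box (f : R ⊗[k] E →ₗ[R] R ⊗[k] E₁) (g : R ⊗[k] F →ₗ[R] R ⊗[k] F₁) :
    R ⊗[k] (E ⊗[k] F) →ₗ[R] R ⊗[k] (E₁ ⊗[k] F₁) :=
  (TensorProduct.AlgebraTensorModule.distribBaseChange k R E₁ F₁).symm.toLinearMap ∘ₗ
    TensorProduct.map f g ∘ₗ
      (TensorProduct.AlgebraTensorModule.distribBaseChange k R E F).toLinearMap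

@[simp] theorem box_odot (f : R ⊗[k] E →ₗ[R] R ⊗[k] E₁) (g : R ⊗[k] F →ₗ[R] R ⊗[k] F₁)
    (m : R ⊗[k] E) (n : R ⊗[k] F) : box f g (odot m n) = odot (f m) (g n) := by
  simp [box, odot]

theorem assoc_odot (m : R ⊗[k] E) (n : R ⊗[k] F) (p : R ⊗[k] G) :
    (TensorProduct.assoc k E F G).toLinearMap.baseChange R (odot (odot m n) p) =
      odot m (odot n p) := by
  induction m using TensorProduct.induction_on with
  | zero => simp
  | add x y hx hy => simp only [add_odot, map_add, hx, hy]
  | tmul r e =>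
    induction n using TensorProduct.induction_on with
    | zero => simp
    | add x y hx hy => simp only [add_odot, odot_add, map_add, hx, hy]
    | tmul s f =>
      induction p using TensorProduct.induction_on with
      | zero => simp
      | add x y hx hy => simp only [odot_add, map_add, hx, hy]
      | tmul t g => simp [mul_assoc]

theorem comm_odot (m : R ⊗[k] E) (n : R ⊗[k] F) :
    (TensorProduct.comm k E F).toLinearMap.baseChange R (odot m n) = odot n m := by
  induction m using TensorProduct.induction_on with
  | zero => simp
  | add x y hx hy => simp only [add_odot, odot_add, map_add, hx, hy]
  | tmul r e =>
    induction n using TensorProduct.induction_on with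
    | zero => simp
    | add x y hx hy => simp only [add_odot, odot_add, map_add, hx, hy]
    | tmul s f => simp [mul_comm]

theorem lid_odot (r : R) (c : k) (n : R ⊗[k] E) :
    (TensorProduct.lid k E).toLinearMap.baseChange R (odot (r ⊗ₜ[k] c) n) = (c • r) • n := by
  induction n using TensorProduct.induction_on with
  | zero => simp
  | add x y hx hy => simp only [odot_add, map_add, hx, hy, smul_add]
  | tmul s f =>
    rw [odot_tmul, LinearMap.baseChange_tmul, LinearEquiv.coe_coe, TensorProduct.lid_tmul,
      ← TensorProduct.smul_tmul, ← smul_mul_assoc, TensorProduct.smul_tmul', smul_eq_mul]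

theorem rid_odot (r : R) (c : k) (m : R ⊗[k] E) :
    (TensorProduct.rid k E).toLinearMap.baseChange R (odot m (r ⊗ₜ[k] c)) = (c • r) • m := by
  induction m using TensorProduct.induction_on with
  | zero => simp
  | add x y hx hy => simp only [add_odot, map_add, hx, hy, smul_add]
  | tmul s f =>
    rw [odot_tmul, LinearMap.baseChange_tmul, LinearEquiv.coe_coe, TensorProduct.rid_tmul,
      ← TensorProduct.smul_tmul, ← mul_smul_comm, TensorProduct.smul_tmul', smul_eq_mul, mul_comm]

theorem baseChange_map_odot (f : E →ₗ[k] E₁) (g : F →ₗ[k] F₁) (m : R ⊗[k] E) (n : R ⊗[k] F) :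
    (TensorProduct.map f g).baseChange R (odot m n) =
      odot (f.baseChange R m) (g.baseChange R n) := by
  induction m using TensorProduct.induction_on with
  | zero => simp
  | add x y hx hy => simp only [add_odot, map_add, hx, hy]
  | tmul r e =>
    induction n using TensorProduct.induction_on with
    | zero => simp
    | add x y hx hy => simp only [odot_add, map_add, hx, hy]
    | tmul s f => simp

end Odot

/-! ### Functions on `B` and on `B*` -/

section Functions

variable (k : Type u) [Field k]

/-- The coefficientwise `k`-algebra structure on Laurent series. -/
instance (priority := high) laurentAlgebra : Algebra k (LaurentSeries k) :=
  HahnSeries.instAlgebra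

/-- The ring `k((z))[u, u⁻¹]` of functions on `B* = Δ* × 𝔾ₘ`, where `Δ*` is the formal punctured
disk with coordinate `z` and `u` is the coordinate of `𝔾ₘ`. -/
def FunBStar : Type u := LaurentPolynomial (LaurentSeries k)

instance : CommRing (FunBStar k) := inferInstanceAs (CommRing (LaurentPolynomial (LaurentSeries k)))

instance : Algebra k (FunBStar k) :=
  inferInstanceAs (Algebra k (LaurentPolynomial (LaurentSeries k)))

/-- The inclusion into the functions on `B*` of the ring `k[[z]][u, u⁻¹]` of functions on
`B = Δ × 𝔾ₘ`. -/
def funB : LaurentPolynomial (PowerSeries k) →ₐ[k] FunBStar k :=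
  (AddMonoidAlgebra.mapAlgHom ℤ (HahnSeries.ofPowerSeriesAlg ℤ k) :
    LaurentPolynomial (PowerSeries k) →ₐ[k] LaurentPolynomial (LaurentSeries k))

variable {k}

/-- The function `f(z) uⁿ` on `B*`. -/
def mono (n : ℤ) (f : LaurentSeries k) : FunBStar k :=
  (AddMonoidAlgebra.single n f : LaurentPolynomial (LaurentSeries k))

theorem mono_add (n : ℤ) (f g : LaurentSeries k) : mono n (f + g) = mono n f + mono n g :=
  AddMonoidAlgebra.single_add ..

theorem mono_smul (n : ℤ) (c : k) (f : LaurentSeries k) : mono n (c • f) = c • mono n f :=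
  (AddMonoidAlgebra.smul_single ..).symm

theorem mono_mul_mono (m n : ℤ) (f g : LaurentSeries k) :
    mono m f * mono n g = mono (m + n) (f * g) :=
  AddMonoidAlgebra.single_mul_single ..

theorem mono_zero_one : (mono 0 1 : FunBStar k) = 1 := rfl

/-- The map `∑ fₙ uⁿ ↦ ∑ aₙ(fₙ) uⁿ`. -/
def coeffwise (a : ℤ → (LaurentSeries k →ₗ[k] LaurentSeries k)) : FunBStar k →ₗ[k] FunBStar k :=
  ((AddMonoidAlgebra.coeffLinearEquiv k).symm.toLinearMap ∘ₗ
    Finsupp.lsum k (fun n => Finsupp.lsingle n ∘ₗ a n) ∘ₗ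
      (AddMonoidAlgebra.coeffLinearEquiv k).toLinearMap :
    LaurentPolynomial (LaurentSeries k) →ₗ[k] LaurentPolynomial (LaurentSeries k))

@[simp] theorem coeffwise_mono (a : ℤ → (LaurentSeries k →ₗ[k] LaurentSeries k)) (n : ℤ)
    (f : LaurentSeries k) : coeffwise a (mono n f) = mono n (a n f) := by
  change AddMonoidAlgebra.ofCoeff
    (Finsupp.lsum k (fun n => Finsupp.lsingle n ∘ₗ a n) (Finsupp.single n f)) =
      AddMonoidAlgebra.single n (a n f)
  simp

theorem funBStar_induction {p : FunBStar k → Prop} (x : FunBStar k)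
    (h : ∀ n f, p (mono n f)) (h₂ : ∀ x y, p x → p y → p (x + y)) : p x := by
  refine AddMonoidAlgebra.induction_linear (motive := p) x ?_ (fun x y hx hy => h₂ x y hx hy)
    (fun n f => h n f)
  have := h 0 0
  rw [mono, AddMonoidAlgebra.single_zero] at this
  exact this

theorem coeffwise_mul {a b c : ℤ → (LaurentSeries k →ₗ[k] LaurentSeries k)}
    (h : ∀ m n f g, a (m + n) (f * g) = b m f * g + f * c n g) (x y : FunBStar k) :
    coeffwise a (x * y) = coeffwise b x * y + x * coeffwise c y := by
  induction x using funBStar_induction with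
  | h₂ x x' hx hx' => simp only [add_mul, map_add, hx, hx']; abel
  | h m f =>
    induction y using funBStar_induction with
    | h₂ x x' hx hx' => simp only [mul_add, map_add, hx, hx']; abel
    | h n g => simp only [coeffwise_mono, mono_mul_mono, h, mono_add]

theorem derivative_mul (f g : LaurentSeries k) :
    LaurentSeries.derivative k (f * g) =
      LaurentSeries.derivative k f * g + f * LaurentSeries.derivative k g := by
  let θ (f : LaurentSeries k) : LaurentSeries k :=
    HahnSeries.single (1 : ℤ) (1 : k) * LaurentSeries.derivative k f
  have hc (f : LaurentSeries k) (n : ℤ) : (θ f).coeff n = (n : k) * f.coeff n := by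
    have := HahnSeries.coeff_single_mul_add (r := (1 : k)) (x := LaurentSeries.derivative k f)
      (a := n - 1) (b := (1 : ℤ))
    rw [sub_add_cancel] at this
    rw [this, LaurentSeries.derivative_apply, LaurentSeries.hasseDeriv_coeff]
    simp
  have hs (f : LaurentSeries k) : (θ f).support ⊆ f.support := by
    intro n hn
    rw [HahnSeries.mem_support, hc] at hn
    exact right_ne_zero_of_mul hn
  have key : θ (f * g) = θ f * g + f * θ g := by
    ext n
    rw [HahnSeries.coeff_add, hc, HahnSeries.coeff_mul_left' f.isPWO_support (hs f),
      HahnSeries.coeff_mul_right' g.isPWO_support (hs g), HahnSeries.coeff_mul, Finset.mul_sum,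
      ← Finset.sum_add_distrib]
    refine Finset.sum_congr rfl fun p hp => ?_
    have : p.1 + p.2 = n := (Finset.mem_antidiagonal.mp hp).2.2
    rw [hc, hc, ← this]
    push_cast
    ring
  have hinv : HahnSeries.single (-1 : ℤ) (1 : k) * HahnSeries.single (1 : ℤ) (1 : k) = 1 := by
    simp
  have hd (f : LaurentSeries k) :
      LaurentSeries.derivative k f = HahnSeries.single (-1 : ℤ) (1 : k) * θ f := by
    rw [← mul_assoc, hinv, one_mul]
  rw [hd (f * g), key, hd f, hd g]
  ring

/-- `d/dz` as a derivation of `k((z))`. -/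
def laurentDeriv (k : Type u) [Field k] : Derivation k (LaurentSeries k) (LaurentSeries k) :=
  Derivation.mk' (LaurentSeries.derivative k) fun f g => by
    rw [derivative_mul, smul_eq_mul, smul_eq_mul, add_comm, mul_comm g]

/-- The partial derivative `∂/∂z` on functions on `B*`. -/
def dz : FunBStar k →ₗ[k] FunBStar k := coeffwise fun _ => LaurentSeries.derivative k

/-- The derivation `u ∂/∂u` on functions on `B*`. -/
def du : FunBStar k →ₗ[k] FunBStar k := coeffwise fun n => (n : k) • LinearMap.id

/-- The substitution `u ↦ w u`, `z ↦ z` on functions on `B*`. -/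
def substU (w : LaurentSeries k) : FunBStar k →ₗ[k] FunBStar k :=
  coeffwise fun n => LinearMap.mulLeft k (w ^ n)

theorem dz_mul (x y : FunBStar k) : dz (x * y) = dz x * y + x * dz y :=
  coeffwise_mul (fun _ _ => derivative_mul) x y

theorem du_mul (x y : FunBStar k) : du (x * y) = du x * y + x * du y :=
  coeffwise_mul (fun m n f g => by
    simp only [LinearMap.smul_apply, LinearMap.id_apply, Int.cast_add, smul_mul_assoc,
      mul_smul_comm]
    rw [← add_smul]) x y

theorem dz_algebraMap (c : k) : dz (algebraMap k (FunBStar k) c) = 0 := by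
  have := dz_mul (k := k) 1 1
  rw [Algebra.algebraMap_eq_smul_one, map_smul]
  simp_all

theorem du_algebraMap (c : k) : du (algebraMap k (FunBStar k) c) = 0 := by
  have := du_mul (k := k) 1 1
  rw [Algebra.algebraMap_eq_smul_one, map_smul]
  simp_all

theorem dz_du (x : FunBStar k) : dz (du x) = du (dz x) := by
  induction x using funBStar_induction with
  | h₂ x y hx hy => simp only [map_add, hx, hy]
  | h n f => simp only [dz, du, coeffwise_mono, LinearMap.smul_apply, LinearMap.id_apply, map_smul]

theorem substU_mul {w : LaurentSeries k} (hw : w ≠ 0) (x y : FunBStar k) :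
    substU w (x * y) = substU w x * substU w y := by
  induction x using funBStar_induction with
  | h₂ x x' hx hx' => simp only [add_mul, map_add, hx, hx']
  | h m f =>
    induction y using funBStar_induction with
    | h₂ x x' hx hx' => simp only [mul_add, map_add, hx, hx']
    | h n g =>
      simp only [substU, coeffwise_mono, mono_mul_mono,
        LinearMap.mulLeft_apply, zpow_add₀ hw]
      congr 1
      ring

theorem substU_one (w : LaurentSeries k) : substU w 1 = 1 := by
  rw [← mono_zero_one, substU, coeffwise_mono]
  simp

theorem substU_inv {w : LaurentSeries k} (hw : w ≠ 0) (x : FunBStar k) :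
    substU w (substU w⁻¹ x) = x := by
  induction x using funBStar_induction with
  | h₂ x y hx hy => simp only [map_add, hx, hy]
  | h n f =>
    simp only [substU, coeffwise_mono, LinearMap.mulLeft_apply, ← mul_assoc]
    rw [← mul_zpow, mul_inv_cancel₀ hw, one_zpow, one_mul]

/-- The chain rule for `u ↦ w(z) u`. -/
theorem dz_substU {w : LaurentSeries k} (hw : w ≠ 0) (x : FunBStar k) :
    dz (substU w x) = substU w (dz x) +
      mono 0 (LaurentSeries.derivative k w * w⁻¹) * substU w (du x) := by
  induction x using funBStar_induction with
  | h₂ x y hx hy => simp only [map_add, hx, hy, mul_add]; abel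
  | h n f =>
    have h := (laurentDeriv k).leibniz_zpow w n
    change LaurentSeries.derivative k (w ^ n) = n • w ^ (n - 1) • LaurentSeries.derivative k w at h
    rw [zpow_sub_one₀ hw] at h
    simp only [dz, du, substU, coeffwise_mono, LinearMap.mulLeft_apply, derivative_mul, h,
      LinearMap.smul_apply, LinearMap.id_apply]
    rw [mono_mul_mono, zero_add, ← mono_add]
    congr 1
    rw [Algebra.smul_def (n : k) f, map_intCast, zsmul_eq_mul, smul_eq_mul]
    ring

theorem du_substU (w : LaurentSeries k) (x : FunBStar k) :
    du (substU w x) = substU w (du x) := by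
  induction x using funBStar_induction with
  | h₂ x y hx hy => simp only [map_add, hx, hy]
  | h n f =>
    simp only [du, substU, coeffwise_mono, LinearMap.mulLeft_apply, LinearMap.smul_apply,
      LinearMap.id_apply, mul_smul_comm]

end Functions
end Equising
namespace Equising

/-! ### Graded vector spaces -/

/-- A finite dimensional `ℤ`-graded vector space. -/
structure GrVec (k : Type u) [Field k] where
  V : Type u
  [grp : AddCommGroup V]
  [mod : Module k V]
  [fin : Module.Finite k V]
  gr : ℤ → Submodule k V
  internal : DirectSum.IsInternal gr

attribute [instance] GrVec.grp GrVec.mod GrVec.fin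

namespace GrVec

variable {k : Type u} [Field k]

instance : CoeSort (GrVec k) (Type u) := ⟨GrVec.V⟩

/-- The endomorphism `t^Y` of `E`: multiplication by `tⁿ` on the component of degree `n`. -/
def act (E : GrVec k) (t : k) : E →ₗ[k] E :=
  DirectSum.toModule k ℤ E (fun n => t ^ n • (E.gr n).subtype) ∘ₗ
    (LinearEquiv.ofBijective (DirectSum.coeLinearMap E.gr)
      (show Function.Bijective (DirectSum.coeLinearMap E.gr) from E.internal)).symm.toLinearMap

theorem act_of_mem (E : GrVec k) (t : k) {n : ℤ} {x : E} (hx : x ∈ E.gr n) :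
    E.act t x = t ^ n • x := by
  have : (LinearEquiv.ofBijective (DirectSum.coeLinearMap E.gr)
      (show Function.Bijective (DirectSum.coeLinearMap E.gr) from E.internal)).symm x =
      DirectSum.lof k ℤ (fun n => E.gr n) n ⟨x, hx⟩ := by
    rw [LinearEquiv.symm_apply_eq, LinearEquiv.ofBijective_apply, DirectSum.coeLinearMap_lof]
  rw [act, LinearMap.comp_apply, LinearEquiv.coe_coe, this, DirectSum.toModule_lof]
  rfl

theorem iSup_gr (E : GrVec k) : ⨆ n, E.gr n = ⊤ := E.internal.submodule_iSup_eq_top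

@[elab_as_elim]
theorem induction (E : GrVec k) {p : E → Prop} (x : E) (h : ∀ n, ∀ x ∈ E.gr n, p x)
    (h₂ : ∀ x y, p x → p y → p (x + y)) : p x :=
  Submodule.iSup_induction E.gr (motive := p) (by rw [E.iSup_gr]; trivial) h
    (h 0 0 (Submodule.zero_mem _)) h₂

/-- The step `W^{-n}(E) = ⨁_{m ≥ n} E_m` of the weight filtration. -/
def wfil (E : GrVec k) (n : ℤ) : Submodule k E := ⨆ (m : ℤ) (_ : n ≤ m), E.gr m

theorem gr_le_wfil (E : GrVec k) {m n : ℤ} (h : n ≤ m) : E.gr m ≤ E.wfil n :=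
  le_iSup₂_of_le m h le_rfl

theorem wfil_anti (E : GrVec k) {m n : ℤ} (h : n ≤ m) : E.wfil m ≤ E.wfil n :=
  iSup₂_le fun _ hi => E.gr_le_wfil (h.trans hi)

theorem internal_of_act [CharZero k] {V : Type u} [AddCommGroup V] [Module k V]
    (gr : ℤ → Submodule k V) (f : Module.End k V)
    (hf : ∀ n, ∀ x ∈ gr n, f x = (2 : k) ^ n • x) (h : ⨆ n, gr n = ⊤) :
    DirectSum.IsInternal gr := by
  rw [DirectSum.isInternal_submodule_iff_iSupIndep_and_iSup_eq_top]
  refine ⟨?_, h⟩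
  have hi : Function.Injective fun n : ℤ => (2 : k) ^ n := by
    intro m n hmn
    have h2 : ((2 : ℚ) ^ m : ℚ) = (2 : ℚ) ^ n := by
      have : (((2 : ℚ) ^ m : ℚ) : k) = (((2 : ℚ) ^ n : ℚ) : k) := by push_cast; exact hmn
      exact_mod_cast this
    exact zpow_right_injective₀ (by norm_num) (by norm_num) h2
  refine (f.eigenspaces_iSupIndep.comp hi).mono fun n x hx => ?_
  exact Module.End.mem_eigenspace_iff.mpr (hf n x hx)

/-- The direct sum of graded vector spaces. -/
def prod [CharZero k] (E F : GrVec k) : GrVec k where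
  V := E × F
  gr n := (E.gr n).prod (F.gr n)
  internal := by
    refine internal_of_act _ (LinearMap.prodMap (E.act 2) (F.act 2)) ?_ ?_
    · rintro n ⟨x, y⟩ ⟨hx, hy⟩
      simp only [LinearMap.prodMap_apply, E.act_of_mem 2 hx, F.act_of_mem 2 hy, Prod.smul_mk]
    · rw [eq_top_iff]
      rintro ⟨x, y⟩ -
      have h1 : (x, (0 : F)) ∈ ⨆ n, (E.gr n).prod (F.gr n) := by
        induction x using E.induction with
        | h n x hx => exact Submodule.mem_iSup_of_mem n ⟨hx, Submodule.zero_mem _⟩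
        | h₂ x x' hx hx' => simpa using Submodule.add_mem _ hx hx'
      have h2 : ((0 : E), y) ∈ ⨆ n, (E.gr n).prod (F.gr n) := by
        induction y using F.induction with
        | h n x hx => exact Submodule.mem_iSup_of_mem n ⟨Submodule.zero_mem _, hx⟩
        | h₂ x x' hx hx' => simpa using Submodule.add_mem _ hx hx'
      simpa using Submodule.add_mem _ h1 h2

/-- The tensor product of graded vector spaces. -/
def tensor [CharZero k] (E F : GrVec k) : GrVec k where
  V := E ⊗[k] F
  gr n := Submodule.span k
    {x | ∃ i j : ℤ, i + j = n ∧ ∃ e ∈ E.gr i, ∃ f ∈ F.gr j, x = e ⊗ₜ[k] f}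
  internal := by
    refine internal_of_act _ (TensorProduct.map (E.act 2) (F.act 2)) ?_ ?_
    · intro n x hx
      induction hx using Submodule.span_induction with
      | mem x hx =>
        obtain ⟨i, j, rfl, e, he, f, hf, rfl⟩ := hx
        rw [TensorProduct.map_tmul, E.act_of_mem 2 he, F.act_of_mem 2 hf,
          TensorProduct.smul_tmul_smul, zpow_add₀ two_ne_zero]
      | zero => simp
      | add x y _ _ hx hy => rw [map_add, hx, hy, smul_add]
      | smul c x _ hx => rw [map_smul, hx, smul_comm]
    · rw [eq_top_iff]
      rintro x -
      induction x using TensorProduct.induction_on with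
      | zero => exact Submodule.zero_mem _
      | add x y hx hy => exact Submodule.add_mem _ hx hy
      | tmul x y =>
        induction x using E.induction with
        | h₂ x x' hx hx' => rw [TensorProduct.add_tmul]; exact Submodule.add_mem _ hx hx'
        | h i x hx =>
          induction y using F.induction with
          | h₂ x x' hx hx' => rw [TensorProduct.tmul_add]; exact Submodule.add_mem _ hx hx'
          | h j y hy =>
            exact Submodule.mem_iSup_of_mem (i + j)
              (Submodule.subset_span ⟨i, j, rfl, x, hx, y, hy, rfl⟩)

theorem tmul_mem [CharZero k] {E F : GrVec k} {i j : ℤ} {x : E} {y : F} (hx : x ∈ E.gr i)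
    (hy : y ∈ F.gr j) :
    (show (tensor E F).V from (x ⊗ₜ[k] y : E ⊗[k] F)) ∈ (tensor E F).gr (i + j) := by
  have : (x ⊗ₜ[k] y : E ⊗[k] F) ∈ Submodule.span k
      {x | ∃ i' j' : ℤ, i' + j' = i + j ∧ ∃ e ∈ E.gr i', ∃ f ∈ F.gr j', x = e ⊗ₜ[k] f} :=
    Submodule.subset_span ⟨i, j, rfl, x, hx, y, hy, rfl⟩
  exact this

/-- The one-dimensional graded vector space `k` placed in degree `0`. -/
def unit (k : Type u) [Field k] [CharZero k] : GrVec k where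
  V := k
  gr n := if n = 0 then ⊤ else ⊥
  internal := by
    refine internal_of_act _ LinearMap.id ?_ ?_
    · intro n x hx
      split_ifs at hx with h
      · simp [h]
      · simp [(Submodule.mem_bot k).mp hx]
    · rw [eq_top_iff]
      exact le_iSup_of_le 0 (by simp)

/-- Linear maps compatible with the grading. -/
def IsGraded {E F : GrVec k} (T : E →ₗ[k] F) : Prop := ∀ n, ∀ x ∈ E.gr n, T x ∈ F.gr n

theorem IsGraded.act {E F : GrVec k} {T : E →ₗ[k] F} (hT : IsGraded T) (t : k) (x : E) :
    T (E.act t x) = F.act t (T x) := by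
  induction x using E.induction with
  | h n x hx => rw [E.act_of_mem t hx, F.act_of_mem t (hT n x hx), map_smul]
  | h₂ x y hx hy => simp only [map_add, hx, hy]

theorem IsGraded.wfil {E F : GrVec k} {T : E →ₗ[k] F} (hT : IsGraded T) (n : ℤ) :
    E.wfil n ≤ (F.wfil n).comap T :=
  iSup₂_le fun m hm x hx => F.gr_le_wfil hm (hT m x hx)

theorem tensor_act [CharZero k] (E F : GrVec k) {t : k} (ht : t ≠ 0) (x : E) (y : F) :
    (tensor E F).act t (x ⊗ₜ[k] y : E ⊗[k] F) = (E.act t x ⊗ₜ[k] F.act t y : E ⊗[k] F) := by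
  induction x using E.induction with
  | h₂ x x' hx hx' =>
    rw [TensorProduct.add_tmul, map_add, TensorProduct.add_tmul, ← hx, ← hx']
    exact map_add ((tensor E F).act t) _ _
  | h i x hx =>
    induction y using F.induction with
    | h₂ x x' hx hx' =>
      rw [TensorProduct.tmul_add, map_add, TensorProduct.tmul_add, ← hx, ← hx']
      exact map_add ((tensor E F).act t) _ _
    | h j y hy =>
      rw [E.act_of_mem t hx, F.act_of_mem t hy, TensorProduct.smul_tmul_smul, ← zpow_add₀ ht]
      exact (tensor E F).act_of_mem t (tmul_mem hx hy)

end GrVec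

end Equising

namespace Equising

open GrVec

variable {k : Type u} [Field k]

/-! ### Sections of the trivial bundle `B* × E` -/

/-- The sections over `B*` of the trivial bundle with fibre `E`. -/
abbrev Sec (E : GrVec k) : Type u := FunBStar k ⊗[k] E.V

/-- The sections which are regular on `B`. -/
def regSec (E : GrVec k) : Submodule k (Sec E) :=
  LinearMap.range (TensorProduct.map (funB k).toLinearMap (LinearMap.id : E.V →ₗ[k] E.V))

/-- The step `W^{-n}` of the weight filtration of the trivial bundle with fibre `E`. -/
def wSec (E : GrVec k) (n : ℤ) : Submodule (FunBStar k) (Sec E) := (E.wfil n).baseChange (FunBStar k)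

/-- The action of `t ∈ 𝔾ₘ` on sections, `(t s)(z, u) = t^Y s(z, t⁻¹ u)`. -/
def rho (E : GrVec k) (t : kˣ) : Sec E →ₗ[k] Sec E :=
  TensorProduct.map (substU (algebraMap k (LaurentSeries k) (t⁻¹ : kˣ))) (E.act t)

/-- The `k`-linear map on sections `f ⊗ e ↦ δ f ⊗ e`. -/
def onSec (E : GrVec k) (δ : FunBStar k →ₗ[k] FunBStar k) : Sec E →ₗ[k] Sec E :=
  LinearMap.rTensor E.V δ

section Maps

variable {E F G : GrVec k}

/-- The bundle map over `B*` extends to `B`. -/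
def IsRegular (f : Sec E →ₗ[FunBStar k] Sec F) : Prop := ∀ x ∈ regSec E, f x ∈ regSec F

/-- `𝔾ₘ`-invariance of an operator between sections. -/
def IsInvariant (f : Sec E → Sec F) : Prop := ∀ (t : kˣ) (x : Sec E), f (rho E t x) = rho F t (f x)

/-- The bundle map sends `W^{-n}` to `W^{-n-1}` for all `n`, that is, it respects the weight
filtrations and induces `0` on the associated graded bundles. -/
def RaisesWeight (f : Sec E →ₗ[FunBStar k] Sec F) : Prop :=
  ∀ n, ∀ x ∈ wSec E n, f x ∈ wSec F (n + 1)

theorem IsRegular.baseChange (T : E.V →ₗ[k] F.V) : IsRegular (T.baseChange (FunBStar k)) := by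
  rintro _ ⟨y, rfl⟩
  induction y using TensorProduct.induction_on with
  | zero => simp
  | add x y hx hy => rw [map_add, map_add]; exact Submodule.add_mem _ hx hy
  | tmul r e => exact ⟨r ⊗ₜ T e, by simp⟩

theorem IsRegular.comp {g : Sec F →ₗ[FunBStar k] Sec G} {f : Sec E →ₗ[FunBStar k] Sec F}
    (hg : IsRegular g) (hf : IsRegular f) : IsRegular (g ∘ₗ f) := fun x hx => hg _ (hf x hx)

theorem IsRegular.add {f g : Sec E →ₗ[FunBStar k] Sec F} (hf : IsRegular f) (hg : IsRegular g) :
    IsRegular (f + g) := fun x hx => Submodule.add_mem _ (hf x hx) (hg x hx)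

theorem IsRegular.sub {f g : Sec E →ₗ[FunBStar k] Sec F} (hf : IsRegular f) (hg : IsRegular g) :
    IsRegular (f - g) := fun x hx => Submodule.sub_mem _ (hf x hx) (hg x hx)

theorem IsInvariant.baseChange {T : E.V →ₗ[k] F.V} (hT : IsGraded T) :
    IsInvariant (T.baseChange (FunBStar k)) := by
  intro t x
  induction x using TensorProduct.induction_on with
  | zero => simp
  | add x y hx hy => simp only [map_add, hx, hy]
  | tmul r e => simp [rho, hT.act]

theorem wSec_anti {m n : ℤ} (h : n ≤ m) : wSec E m ≤ wSec E n :=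
  Submodule.baseChange_mono _ (E.wfil_anti h)

theorem tmul_mem_wSec {m n : ℤ} (h : n ≤ m) {x : E.V} (hx : x ∈ E.gr m) (r : FunBStar k) :
    r ⊗ₜ[k] x ∈ wSec E n :=
  Submodule.tmul_mem_baseChange_of_mem r (E.gr_le_wfil h hx)

theorem wSec_le {n : ℤ} {N : Submodule (FunBStar k) (Sec E)}
    (h : ∀ m, n ≤ m → ∀ x ∈ E.gr m, (1 : FunBStar k) ⊗ₜ[k] x ∈ N) : wSec E n ≤ N := by
  rw [wSec, Submodule.baseChange_eq_span, Submodule.span_le]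
  rintro _ ⟨y, hy, rfl⟩
  have : E.wfil n ≤ (N.restrictScalars k).comap (TensorProduct.mk k (FunBStar k) E.V 1) :=
    iSup₂_le fun m hm x hx => h m hm x hx
  exact this hy

theorem RaisesWeight.of_gr {f : Sec E →ₗ[FunBStar k] Sec F}
    (h : ∀ n, ∀ x ∈ E.gr n, f (1 ⊗ₜ[k] x) ∈ wSec F (n + 1)) : RaisesWeight f := fun n =>
  wSec_le (N := (wSec F (n + 1)).comap f) fun m hm x hx =>
    wSec_anti (by omega) (h m x hx)

theorem baseChange_wSec {T : E.V →ₗ[k] F.V} (hT : IsGraded T) {n : ℤ} {x : Sec E}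
    (hx : x ∈ wSec E n) : T.baseChange (FunBStar k) x ∈ wSec F n :=
  wSec_le (N := (wSec F n).comap (T.baseChange (FunBStar k)))
    (fun _ hm x hx => tmul_mem_wSec hm (hT _ x hx) 1) hx

end Maps

/-! ### Connections -/

/-- A pair of `k`-linear operators on the sections over `B*`. -/
@[ext] structure Ops (E : GrVec k) where
  z : Sec E →ₗ[k] Sec E
  u : Sec E →ₗ[k] Sec E

/-- A connection `d + ω`, `ω = A_z dz + A_u du/u`, on the trivial bundle with fibre `E` over `B*`,
given by the `End(E)`-valued functions `A_z` and `A_u` on `B*`. -/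
@[ext] structure Conn (E : GrVec k) where
  z : Sec E →ₗ[FunBStar k] Sec E
  u : Sec E →ₗ[FunBStar k] Sec E

/-- The covariant derivatives `∇_{∂/∂z}` and `∇_{u ∂/∂u}` of the connection `∇ = d + ω`. -/
def Conn.nabla {E : GrVec k} (A : Conn E) : Ops E where
  z := onSec E dz + A.z.restrictScalars k
  u := onSec E du + A.u.restrictScalars k

/-- `W`-equivalence (on `B`): there is an automorphism of the trivial bundle with fibre `E`, regular
on `B`, `𝔾ₘ`-invariant, preserving the weight filtration and inducing the identity on the associated
graded bundle, which conjugates the two connections. -/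
def GaugeEquiv {E : GrVec k} (D D' : Ops E) : Prop :=
  ∃ h : Sec E ≃ₗ[FunBStar k] Sec E,
    IsRegular h.toLinearMap ∧ IsRegular h.symm.toLinearMap ∧ IsInvariant h ∧
    RaisesWeight (h.toLinearMap - LinearMap.id) ∧ RaisesWeight (h.symm.toLinearMap - LinearMap.id) ∧
    (∀ x, h (D.z x) = D'.z (h x)) ∧ (∀ x, h (D.u x) = D'.u (h x))

/-- The pull-back of a connection under the automorphism `(z, u) ↦ (z, v(z) u)` of the principal
bundle. By the chain rule the covariant derivatives of the pull-back satisfy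
`(v^*∇)_{∂/∂z} (v^* s) = v^*(∇_{∂/∂z} s) + (v'/v) v^*(∇_{u ∂/∂u} s)` and
`(v^*∇)_{u ∂/∂u} (v^* s) = v^*(∇_{u ∂/∂u} s)`, where `(v^* s)(z, u) = s(z, v(z) u)`. -/
def Ops.pull {E : GrVec k} (D : Ops E) (w : LaurentSeries k) : Ops E where
  z := onSec E (substU w) ∘ₗ D.z ∘ₗ onSec E (substU w⁻¹) +
    (LinearMap.lsmul (FunBStar k) (Sec E)
      (mono 0 (LaurentSeries.derivative k w * w⁻¹))).restrictScalars k ∘ₗ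
        onSec E (substU w) ∘ₗ D.u ∘ₗ onSec E (substU w⁻¹)
  u := onSec E (substU w) ∘ₗ D.u ∘ₗ onSec E (substU w⁻¹)

/-- Equisingularity. A section `z ↦ (z, v(z))` of `B` with value `y₀ = (0, 1)` at `0` is a power
series `v` with `v(0) = 1`; it trivializes `B` by `(z, u) ↦ u·(z, v(z)) = (z, v(z) u)`. The condition
is that the connections read in the trivializations given by any two such sections are
`W`-equivalent on `B`. -/
def IsEquisingular {E : GrVec k} (D : Ops E) : Prop :=
  ∀ v v' : PowerSeries k, PowerSeries.constantCoeff v = 1 → PowerSeries.constantCoeff v' = 1 →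
    GaugeEquiv (D.pull (HahnSeries.ofPowerSeries ℤ k v)) (D.pull (HahnSeries.ofPowerSeries ℤ k v'))

/-- Flat equisingular `W`-connections. -/
structure IsFlatEquisingular {E : GrVec k} (A : Conn E) : Prop where
  weight_z : RaisesWeight A.z
  weight_u : RaisesWeight A.u
  flat : ∀ x, A.nabla.z (A.nabla.u x) = A.nabla.u (A.nabla.z x)
  invariant_z : IsInvariant A.nabla.z
  invariant_u : IsInvariant A.nabla.u
  equisingular : IsEquisingular A.nabla

theorem GaugeEquiv.refl {E : GrVec k} (D : Ops E) : GaugeEquiv D D := by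
  refine ⟨LinearEquiv.refl _ _, fun x hx => hx, fun x hx => hx, fun t x => rfl, ?_, ?_,
    fun x => rfl, fun x => rfl⟩ <;>
  · intro n x _
    simp

theorem GaugeEquiv.symm {E : GrVec k} {D D' : Ops E} : GaugeEquiv D D' → GaugeEquiv D' D := by
  rintro ⟨h, h1, h2, h3, h4, h5, h6, h7⟩
  refine ⟨h.symm, h2, h1, fun t x => ?_, h5, h4, fun x => ?_, fun x => ?_⟩
  · rw [LinearEquiv.symm_apply_eq, h3, LinearEquiv.apply_symm_apply]
  · rw [LinearEquiv.symm_apply_eq, h6, LinearEquiv.apply_symm_apply]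
  · rw [LinearEquiv.symm_apply_eq, h7, LinearEquiv.apply_symm_apply]

theorem raises_comp {E : GrVec k} {f g : Sec E →ₗ[FunBStar k] Sec E}
    (hf : RaisesWeight (f - LinearMap.id)) (hg : RaisesWeight (g - LinearMap.id)) :
    RaisesWeight (f ∘ₗ g - LinearMap.id) := by
  intro n x hx
  have h1 : g x - x ∈ wSec E (n + 1) := hg n x hx
  have h2 : f (g x - x) - (g x - x) ∈ wSec E (n + 1 + 1) := hf _ _ h1
  have h3 : f x - x ∈ wSec E (n + 1) := hf n x hx
  have : f (g x) - x = (f (g x - x) - (g x - x)) + (f x - x) + (g x - x) := by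
    rw [map_sub]
    abel
  change f (g x) - x ∈ _
  rw [this]
  exact Submodule.add_mem _ (Submodule.add_mem _ (wSec_anti (by omega) h2) h3) h1

theorem GaugeEquiv.trans {E : GrVec k} {D D' D'' : Ops E} :
    GaugeEquiv D D' → GaugeEquiv D' D'' → GaugeEquiv D D'' := by
  rintro ⟨h, h1, h2, h3, h4, h5, h6, h7⟩ ⟨g, g1, g2, g3, g4, g5, g6, g7⟩
  refine ⟨h.trans g, g1.comp h1, h2.comp g2, fun t x => ?_, raises_comp g4 h4, raises_comp h5 g5,
    fun x => ?_, fun x => ?_⟩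
  · simp only [LinearEquiv.trans_apply, h3 t x, g3 t]
  · simp only [LinearEquiv.trans_apply, h6, g6]
  · simp only [LinearEquiv.trans_apply, h7, g7]

end Equising

namespace Equising

open GrVec

section Morphisms

variable {k : Type u} [Field k] [CharZero k] {E F G : GrVec k}

/-- The inclusion of the first summand of `F ⊕ E`. -/
def inl₀ (F E : GrVec k) : F.V →ₗ[k] (prod F E).V := LinearMap.inl k F.V E.V
/-- The inclusion of the second summand of `F ⊕ E`. -/
def inr₀ (F E : GrVec k) : E.V →ₗ[k] (prod F E).V := LinearMap.inr k F.V E.V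
/-- The projection of `F ⊕ E` to the first summand. -/
def fst₀ (F E : GrVec k) : (prod F E).V →ₗ[k] F.V := LinearMap.fst k F.V E.V
/-- The projection of `F ⊕ E` to the second summand. -/
def snd₀ (F E : GrVec k) : (prod F E).V →ₗ[k] E.V := LinearMap.snd k F.V E.V

/-- The map on sections induced by a linear map of fibres. -/
def ext₀ (T : E.V →ₗ[k] F.V) : Sec E →ₗ[FunBStar k] Sec F := T.baseChange (FunBStar k)

theorem ext₀_comp (S : F.V →ₗ[k] G.V) (T : E.V →ₗ[k] F.V) (x : Sec E) :
    ext₀ S (ext₀ T x) = ext₀ (S ∘ₗ T) x := by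
  rw [ext₀, ext₀, ext₀, LinearMap.baseChange_comp]; rfl

theorem ext₀_id (x : Sec E) : ext₀ (LinearMap.id : E.V →ₗ[k] E.V) x = x := by
  rw [ext₀, LinearMap.baseChange_id]; rfl

theorem ext₀_zero (x : Sec E) : ext₀ (0 : E.V →ₗ[k] F.V) x = 0 := by
  rw [ext₀, LinearMap.baseChange_zero]; rfl

theorem ext₀_add (S T : E.V →ₗ[k] F.V) (x : Sec E) : ext₀ (S + T) x = ext₀ S x + ext₀ T x := by
  rw [ext₀, LinearMap.baseChange_add]; rfl

@[simp] theorem fst_inl (x : Sec F) : ext₀ (fst₀ F E) (ext₀ (inl₀ F E) x) = x := by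
  rw [ext₀_comp, show fst₀ F E ∘ₗ inl₀ F E = LinearMap.id from LinearMap.fst_comp_inl .., ext₀_id]

@[simp] theorem snd_inr (x : Sec E) : ext₀ (snd₀ F E) (ext₀ (inr₀ F E) x) = x := by
  rw [ext₀_comp, show snd₀ F E ∘ₗ inr₀ F E = LinearMap.id from LinearMap.snd_comp_inr .., ext₀_id]

@[simp] theorem fst_inr (x : Sec E) : ext₀ (fst₀ F E) (ext₀ (inr₀ F E) x) = 0 := by
  rw [ext₀_comp, show fst₀ F E ∘ₗ inr₀ F E = 0 from LinearMap.fst_comp_inr .., ext₀_zero]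

@[simp] theorem snd_inl (x : Sec F) : ext₀ (snd₀ F E) (ext₀ (inl₀ F E) x) = 0 := by
  rw [ext₀_comp, show snd₀ F E ∘ₗ inl₀ F E = 0 from LinearMap.snd_comp_inl .., ext₀_zero]

theorem inl_fst_add_inr_snd (x : Sec (prod F E)) :
    ext₀ (inl₀ F E) (ext₀ (fst₀ F E) x) + ext₀ (inr₀ F E) (ext₀ (snd₀ F E) x) = x := by
  rw [ext₀_comp, ext₀_comp, ← ext₀_add]
  have : inl₀ F E ∘ₗ fst₀ F E + inr₀ F E ∘ₗ snd₀ F E = LinearMap.id := by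
    refine LinearMap.ext fun x => ?_
    exact Prod.ext (add_zero _) (zero_add _)
  rw [this, ext₀_id]

theorem graded_inl : IsGraded (inl₀ F E) := fun _ _ hx => ⟨hx, Submodule.zero_mem _⟩
theorem graded_inr : IsGraded (inr₀ F E) := fun _ _ hx => ⟨Submodule.zero_mem _, hx⟩
theorem graded_fst : IsGraded (fst₀ F E) := fun _ _ hx => hx.1
theorem graded_snd : IsGraded (snd₀ F E) := fun _ _ hx => hx.2

/-- The block operator `[[D', T D - D' T], [0, D]]` on sections of `F ⊕ E`, for operators `D'` on
sections of `F`, `D` on sections of `E` and a linear map `T : E → F`. -/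
def blockOp (T : E.V →ₗ[k] F.V) (D : Sec E →ₗ[k] Sec E) (D' : Sec F →ₗ[k] Sec F) :
    Sec (prod F E) →ₗ[k] Sec (prod F E) :=
  let i₁ := (ext₀ (inl₀ F E)).restrictScalars k
  let i₂ := (ext₀ (inr₀ F E)).restrictScalars k
  let p₁ := (ext₀ (fst₀ F E)).restrictScalars k
  let p₂ := (ext₀ (snd₀ F E)).restrictScalars k
  let T' := (ext₀ T).restrictScalars k
  i₁ ∘ₗ D' ∘ₗ p₁ + i₁ ∘ₗ (T' ∘ₗ D - D' ∘ₗ T') ∘ₗ p₂ + i₂ ∘ₗ D ∘ₗ p₂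

theorem blockOp_apply (T : E.V →ₗ[k] F.V) (D : Sec E →ₗ[k] Sec E) (D' : Sec F →ₗ[k] Sec F)
    (x : Sec (prod F E)) :
    blockOp T D D' x = ext₀ (inl₀ F E) (D' (ext₀ (fst₀ F E) x)) +
      ext₀ (inl₀ F E) (ext₀ T (D (ext₀ (snd₀ F E) x)) - D' (ext₀ T (ext₀ (snd₀ F E) x))) +
      ext₀ (inr₀ F E) (D (ext₀ (snd₀ F E) x)) := rfl

/-- The operators of the connection `[[∇', T ∇ - ∇' T], [0, ∇]]`. -/
def Ops.block (T : E.V →ₗ[k] F.V) (D : Ops E) (D' : Ops F) : Ops (prod F E) where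
  z := blockOp T D.z D'.z
  u := blockOp T D.u D'.u

/-- The condition on a linear map `T : E → F` to be a morphism `(E, ∇) → (F, ∇')`: the connections
`[[∇', T ∇ - ∇' T], [0, ∇]]` and `[[∇', 0], [0, ∇]]` on `F ⊕ E` are `W`-equivalent. -/
def IsMor (T : E.V →ₗ[k] F.V) (D : Ops E) (D' : Ops F) : Prop :=
  GaugeEquiv (Ops.block T D D') (Ops.block 0 D D')

/-- There is a horizontal invariant bundle map, regular on `B` and compatible with the weight
filtrations, which induces `T` on the associated graded bundles. -/
def HasLift (T : E.V →ₗ[k] F.V) (D : Ops E) (D' : Ops F) : Prop :=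
  ∃ τ : Sec E →ₗ[FunBStar k] Sec F, IsRegular τ ∧ IsInvariant τ ∧ RaisesWeight (τ - ext₀ T) ∧
    (∀ x, τ (D.z x) = D'.z (τ x)) ∧ ∀ x, τ (D.u x) = D'.u (τ x)

theorem blockOp_shear (T : E.V →ₗ[k] F.V) (D : Sec E →ₗ[k] Sec E) (D' : Sec F →ₗ[k] Sec F)
    (x : Sec E) :
    blockOp T D D' (ext₀ (inr₀ F E) x + ext₀ (inl₀ F E) (ext₀ T x)) =
      ext₀ (inr₀ F E) (D x) + ext₀ (inl₀ F E) (ext₀ T (D x)) := by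
  rw [blockOp_apply]
  simp only [map_add, fst_inl, fst_inr, snd_inl, snd_inr, zero_add, add_zero, map_sub]
  abel

theorem fst_blockOp_zero (D : Sec E →ₗ[k] Sec E) (D' : Sec F →ₗ[k] Sec F)
    (x : Sec (prod F E)) :
    ext₀ (fst₀ F E) (blockOp 0 D D' x) = D' (ext₀ (fst₀ F E) x) := by
  rw [blockOp_apply]
  simp [ext₀_zero]

theorem IsMor.hasLift {T : E.V →ₗ[k] F.V} (hT : IsGraded T) {D : Ops E} {D' : Ops F} :
    IsMor T D D' → HasLift T D D' := by
  rintro ⟨h, h1, -, h3, h4, -, h6, h7⟩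
  refine ⟨ext₀ (fst₀ F E) ∘ₗ h.toLinearMap ∘ₗ
    (ext₀ (inr₀ F E) + ext₀ (inl₀ F E) ∘ₗ ext₀ T), ?_, ?_, ?_, ?_, ?_⟩
  · exact (IsRegular.baseChange _).comp (h1.comp ((IsRegular.baseChange _).add
      ((IsRegular.baseChange _).comp (IsRegular.baseChange _))))
  · intro t x
    change ext₀ (fst₀ F E) (h (ext₀ (inr₀ F E) (rho E t x) + ext₀ (inl₀ F E) (ext₀ T (rho E t x)))) =
      rho F t (ext₀ (fst₀ F E) (h (ext₀ (inr₀ F E) x + ext₀ (inl₀ F E) (ext₀ T x))))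
    rw [show ext₀ T (rho E t x) = rho F t (ext₀ T x) from IsInvariant.baseChange hT t x,
      show ext₀ (inr₀ F E) (rho E t x) = _ from IsInvariant.baseChange graded_inr t x,
      show ext₀ (inl₀ F E) (rho F t _) = _ from IsInvariant.baseChange graded_inl t _,
      ← map_add, h3 t]
    exact IsInvariant.baseChange graded_fst t _
  · intro n x hx
    change ext₀ (fst₀ F E) (h (ext₀ (inr₀ F E) x + ext₀ (inl₀ F E) (ext₀ T x))) - ext₀ T x ∈ _
    have hy : ext₀ (inr₀ F E) x + ext₀ (inl₀ F E) (ext₀ T x) ∈ wSec (prod F E) n :=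
      Submodule.add_mem _ (baseChange_wSec graded_inr hx)
        (baseChange_wSec graded_inl (baseChange_wSec hT hx))
    have := baseChange_wSec (graded_fst (F := F) (E := E)) (h4 n _ hy)
    change ext₀ (fst₀ F E) (h (ext₀ (inr₀ F E) x + ext₀ (inl₀ F E) (ext₀ T x)) -
      (ext₀ (inr₀ F E) x + ext₀ (inl₀ F E) (ext₀ T x))) ∈ _ at this
    rw [map_sub, map_add (ext₀ (fst₀ F E)) (ext₀ (inr₀ F E) x), fst_inr, fst_inl, zero_add] at this
    exact this
  · intro x
    change ext₀ (fst₀ F E) (h (ext₀ (inr₀ F E) (D.z x) + ext₀ (inl₀ F E) (ext₀ T (D.z x)))) =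
      D'.z (ext₀ (fst₀ F E) (h (ext₀ (inr₀ F E) x + ext₀ (inl₀ F E) (ext₀ T x))))
    rw [← blockOp_shear T D.z D'.z]
    exact (congrArg _ (h6 _)).trans (fst_blockOp_zero D.z D'.z _)
  · intro x
    change ext₀ (fst₀ F E) (h (ext₀ (inr₀ F E) (D.u x) + ext₀ (inl₀ F E) (ext₀ T (D.u x)))) =
      D'.u (ext₀ (fst₀ F E) (h (ext₀ (inr₀ F E) x + ext₀ (inl₀ F E) (ext₀ T x))))
    rw [← blockOp_shear T D.u D'.u]
    exact (congrArg _ (h7 _)).trans (fst_blockOp_zero D.u D'.u _)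

/-- The unipotent automorphism `[[1, s], [0, 1]]` of sections of `F ⊕ E`. -/
def shear (s : Sec E →ₗ[FunBStar k] Sec F) :
    Sec (prod F E) ≃ₗ[FunBStar k] Sec (prod F E) :=
  LinearEquiv.ofLinearMap
    (LinearMap.id + ext₀ (inl₀ F E) ∘ₗ s ∘ₗ ext₀ (snd₀ F E))
    (LinearMap.id - ext₀ (inl₀ F E) ∘ₗ s ∘ₗ ext₀ (snd₀ F E))
    (LinearMap.ext fun x => by simp) (LinearMap.ext fun x => by simp)

theorem shear_apply (s : Sec E →ₗ[FunBStar k] Sec F) (x : Sec (prod F E)) :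
    shear s x = x + ext₀ (inl₀ F E) (s (ext₀ (snd₀ F E) x)) := rfl

theorem shear_block {T : E.V →ₗ[k] F.V} {D : Sec E →ₗ[k] Sec E} {D' : Sec F →ₗ[k] Sec F}
    {τ : Sec E →ₗ[FunBStar k] Sec F} (h : ∀ x, τ (D x) = D' (τ x)) (x : Sec (prod F E)) :
    shear (τ - ext₀ T) (blockOp T D D' x) = blockOp 0 D D' (shear (τ - ext₀ T) x) := by
  simp only [blockOp_apply, shear_apply, map_add, map_sub, LinearMap.sub_apply, snd_inl, fst_inl,
    snd_inr, ext₀_zero, h, map_zero, add_zero, sub_zero]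
  abel

theorem HasLift.isMor {T : E.V →ₗ[k] F.V} (hT : IsGraded T) {D : Ops E} {D' : Ops F} :
    HasLift T D D' → IsMor T D D' := by
  rintro ⟨τ, h1, h2, h3, h4, h5⟩
  have hr : IsRegular (ext₀ (inl₀ F E) ∘ₗ (τ - ext₀ T) ∘ₗ ext₀ (snd₀ F E)) :=
    (IsRegular.baseChange _).comp ((h1.sub (IsRegular.baseChange _)).comp (IsRegular.baseChange _))
  have hw : RaisesWeight (ext₀ (inl₀ F E) ∘ₗ (τ - ext₀ T) ∘ₗ ext₀ (snd₀ F E)) := fun n x hx =>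
    baseChange_wSec graded_inl (h3 n _ (baseChange_wSec graded_snd hx))
  refine ⟨shear (τ - ext₀ T), ?_, ?_, ?_, ?_, ?_, shear_block h4, shear_block h5⟩
  · exact fun x hx => Submodule.add_mem _ hx (hr x hx)
  · exact fun x hx => Submodule.sub_mem _ hx (hr x hx)
  · intro t x
    simp only [shear_apply, map_add, LinearMap.sub_apply]
    rw [show ext₀ (snd₀ F E) (rho _ t x) = _ from IsInvariant.baseChange graded_snd t x, h2 t,
      show ext₀ T (rho E t _) = _ from IsInvariant.baseChange hT t _, ← map_sub (rho F t),
      show ext₀ (inl₀ F E) (rho F t _) = _ from IsInvariant.baseChange graded_inl t _]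
    rfl
  · intro n x hx
    have := hw n x hx
    change x + ext₀ (inl₀ F E) ((τ - ext₀ T) (ext₀ (snd₀ F E) x)) - x ∈ _
    rwa [add_sub_cancel_left]
  · intro n x hx
    have := Submodule.neg_mem _ (hw n x hx)
    change x - ext₀ (inl₀ F E) ((τ - ext₀ T) (ext₀ (snd₀ F E) x)) - x ∈ _
    rwa [sub_sub_cancel_left]

theorem isMor_iff {T : E.V →ₗ[k] F.V} (hT : IsGraded T) {D : Ops E} {D' : Ops F} :
    IsMor T D D' ↔ HasLift T D D' := ⟨IsMor.hasLift hT, HasLift.isMor hT⟩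

theorem GaugeEquiv.hasLift {D D' : Ops E} : GaugeEquiv D D' → HasLift LinearMap.id D D' := by
  rintro ⟨h, h1, -, h3, h4, -, h6, h7⟩
  refine ⟨h.toLinearMap, h1, h3, ?_, h6, h7⟩
  rwa [ext₀, LinearMap.baseChange_id]

theorem HasLift.comp {S : F.V →ₗ[k] G.V} {T : E.V →ₗ[k] F.V} (hS : IsGraded S) (hT : IsGraded T)
    {D : Ops E} {D' : Ops F} {D'' : Ops G} :
    HasLift S D' D'' → HasLift T D D' → HasLift (S ∘ₗ T) D D'' := by
  rintro ⟨σ, s1, s2, s3, s4, s5⟩ ⟨τ, t1, t2, t3, t4, t5⟩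
  refine ⟨σ ∘ₗ τ, s1.comp t1, fun t x => ?_, fun n x hx => ?_, fun x => ?_, fun x => ?_⟩
  · rw [LinearMap.comp_apply, t2 t, s2 t]; rfl
  · have ht : τ x - ext₀ T x ∈ wSec F (n + 1) := t3 n x hx
    have h1 : σ (ext₀ T x) - ext₀ S (ext₀ T x) ∈ wSec G (n + 1) :=
      s3 n _ (baseChange_wSec hT hx)
    have h2 : σ (τ x - ext₀ T x) - ext₀ S (τ x - ext₀ T x) ∈ wSec G (n + 1 + 1) := s3 _ _ ht
    have h3 : ext₀ S (τ x - ext₀ T x) ∈ wSec G (n + 1) := baseChange_wSec hS ht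
    change σ (τ x) - ext₀ (S ∘ₗ T) x ∈ _
    have : σ (τ x) - ext₀ (S ∘ₗ T) x = (σ (τ x - ext₀ T x) - ext₀ S (τ x - ext₀ T x)) +
        ext₀ S (τ x - ext₀ T x) + (σ (ext₀ T x) - ext₀ S (ext₀ T x)) := by
      rw [← ext₀_comp, map_sub σ]; abel
    rw [this]
    exact Submodule.add_mem _ (Submodule.add_mem _ (wSec_anti (by omega) h2) h3) h1
  · rw [LinearMap.comp_apply, t4, s4]; rfl
  · rw [LinearMap.comp_apply, t5, s5]; rfl

theorem HasLift.id (D : Ops E) : HasLift LinearMap.id D D := (GaugeEquiv.refl D).hasLift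

theorem isGraded_id : IsGraded (LinearMap.id : E.V →ₗ[k] E.V) := fun _ _ hx => hx

theorem IsGraded.comp {S : F.V →ₗ[k] G.V} {T : E.V →ₗ[k] F.V} (hS : IsGraded S)
    (hT : IsGraded T) : IsGraded (S ∘ₗ T) := fun n x hx => hS n _ (hT n x hx)

theorem HasLift.congr {T : E.V →ₗ[k] F.V} (hT : IsGraded T) {D₁ D₂ : Ops E} {D₁' D₂' : Ops F}
    (h : GaugeEquiv D₁ D₂) (h' : GaugeEquiv D₁' D₂') (H : HasLift T D₁ D₁') : HasLift T D₂ D₂' :=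
  h'.hasLift.comp isGraded_id hT (H.comp hT isGraded_id h.symm.hasLift)

theorem HasLift.add {S T : E.V →ₗ[k] F.V} {D : Ops E} {D' : Ops F} :
    HasLift S D D' → HasLift T D D' → HasLift (S + T) D D' := by
  rintro ⟨σ, s1, s2, s3, s4, s5⟩ ⟨τ, t1, t2, t3, t4, t5⟩
  refine ⟨σ + τ, s1.add t1, fun t x => ?_, fun n x hx => ?_, fun x => ?_, fun x => ?_⟩
  · rw [LinearMap.add_apply, LinearMap.add_apply, s2 t, t2 t, map_add]
  · change σ x + τ x - ext₀ (S + T) x ∈ _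
    rw [ext₀_add, add_sub_add_comm]
    exact Submodule.add_mem _ (s3 n x hx) (t3 n x hx)
  · rw [LinearMap.add_apply, LinearMap.add_apply, s4, t4, map_add]
  · rw [LinearMap.add_apply, LinearMap.add_apply, s5, t5, map_add]

theorem HasLift.smul (c : k) {T : E.V →ₗ[k] F.V} {D : Ops E} {D' : Ops F} :
    HasLift T D D' → HasLift (c • T) D D' := by
  rintro ⟨τ, t1, t2, t3, t4, t5⟩
  refine ⟨c • τ, fun x hx => Submodule.smul_mem _ c (t1 x hx), fun t x => ?_, fun n x hx => ?_,
    fun x => ?_, fun x => ?_⟩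
  · rw [LinearMap.smul_apply, LinearMap.smul_apply, t2 t, map_smul]
  · change c • τ x - ext₀ (c • T) x ∈ _
    rw [ext₀, LinearMap.baseChange_smul]
    change c • τ x - c • ext₀ T x ∈ _
    have h := Submodule.smul_of_tower_mem (wSec F (n + 1)) c (t3 n x hx)
    rwa [LinearMap.sub_apply, smul_sub] at h
  · rw [LinearMap.smul_apply, LinearMap.smul_apply, t4, map_smul]
  · rw [LinearMap.smul_apply, LinearMap.smul_apply, t5, map_smul]

theorem HasLift.zero (D : Ops E) (D' : Ops F) : HasLift (0 : E.V →ₗ[k] F.V) D D' := by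
  refine ⟨0, fun x _ => Submodule.zero_mem _, fun t x => ?_, fun n x _ => ?_, fun x => ?_,
    fun x => ?_⟩
  · rw [LinearMap.zero_apply, LinearMap.zero_apply, map_zero]
  · change 0 - ext₀ (0 : E.V →ₗ[k] F.V) x ∈ _
    rw [ext₀_zero, sub_zero]
    exact Submodule.zero_mem _
  · rw [LinearMap.zero_apply, LinearMap.zero_apply, map_zero]
  · rw [LinearMap.zero_apply, LinearMap.zero_apply, map_zero]

/-- A graded linear map which commutes with the operators. -/
theorem HasLift.of_commute {T : E.V →ₗ[k] F.V} (hT : IsGraded T) {D : Ops E} {D' : Ops F}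
    (hz : ∀ x, ext₀ T (D.z x) = D'.z (ext₀ T x)) (hu : ∀ x, ext₀ T (D.u x) = D'.u (ext₀ T x)) :
    HasLift T D D' := by
  refine ⟨ext₀ T, IsRegular.baseChange T, IsInvariant.baseChange hT, fun n x _ => ?_, hz, hu⟩
  change ext₀ T x - ext₀ T x ∈ _
  rw [sub_self]
  exact Submodule.zero_mem _

end Morphisms

end Equising

namespace Equising

open GrVec

section Tensor

variable {k : Type u} [Field k] [CharZero k] {E F G E₁ F₁ : GrVec k}

/-- The external product of sections. -/
def sodot (m : Sec E) (n : Sec F) : Sec (tensor E F) := odot m n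

/-- The tensor product of bundle maps. -/
def sbox (f : Sec E →ₗ[FunBStar k] Sec E₁) (g : Sec F →ₗ[FunBStar k] Sec F₁) :
    Sec (tensor E F) →ₗ[FunBStar k] Sec (tensor E₁ F₁) := box f g

theorem sbox_sodot (f : Sec E →ₗ[FunBStar k] Sec E₁) (g : Sec F →ₗ[FunBStar k] Sec F₁) (m : Sec E)
    (n : Sec F) : sbox f g (sodot m n) = sodot (f m) (g n) := box_odot f g m n

theorem sodot_add (m : Sec E) (n n₁ : Sec F) : sodot m (n + n₁) = sodot m n + sodot m n₁ :=
  odot_add m n n₁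

theorem add_sodot (m m₁ : Sec E) (n : Sec F) : sodot (m + m₁) n = sodot m n + sodot m₁ n :=
  add_odot m m₁ n

theorem sodot_sub (m : Sec E) (n n₁ : Sec F) : sodot m (n - n₁) = sodot m n - sodot m n₁ :=
  odot_sub m n n₁

theorem sub_sodot (m m₁ : Sec E) (n : Sec F) : sodot (m - m₁) n = sodot m n - sodot m₁ n :=
  sub_odot m m₁ n

theorem zero_sodot (n : Sec F) : sodot (0 : Sec E) n = 0 := zero_odot n

theorem sodot_zero (m : Sec E) : sodot m (0 : Sec F) = 0 := odot_zero m

theorem smul_sodot (r : FunBStar k) (m : Sec E) (n : Sec F) : sodot (r • m) n = r • sodot m n :=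
  smul_odot r m n

theorem sodot_smul (r : FunBStar k) (m : Sec E) (n : Sec F) : sodot m (r • n) = r • sodot m n :=
  odot_smul r m n

/-- `sodot` as a linear map in the first variable. -/
def sodotL (n : Sec F) : Sec E →ₗ[FunBStar k] Sec (tensor E F) where
  toFun m := sodot m n
  map_add' m m₁ := add_sodot m m₁ n
  map_smul' r m := smul_sodot r m n

/-- `sodot` as a linear map in the second variable. -/
def sodotR (m : Sec E) : Sec F →ₗ[FunBStar k] Sec (tensor E F) where
  toFun n := sodot m n
  map_add' n n₁ := sodot_add m n n₁
  map_smul' r n := sodot_smul r m n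

theorem sodot_induction {p : Sec (tensor E F) → Prop} (x : Sec (tensor E F)) (h₀ : p 0)
    (h : ∀ (m : Sec E) (n : Sec F), p (sodot m n)) (h₂ : ∀ x y, p x → p y → p (x + y)) : p x :=
  odot_induction x h₀ h h₂

theorem onSec_smul {δ : FunBStar k →ₗ[k] FunBStar k}
    (hδ : ∀ x y, δ (x * y) = δ x * y + x * δ y) (r : FunBStar k) (m : Sec E) :
    onSec E δ (r • m) = δ r • m + r • onSec E δ m := by
  induction m using TensorProduct.induction_on with
  | zero => simp
  | add x y hx hy => simp only [map_add, smul_add, hx, hy]; abel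
  | tmul s e =>
    simp only [onSec, TensorProduct.smul_tmul', LinearMap.rTensor_tmul, smul_eq_mul, hδ,
      TensorProduct.add_tmul]

theorem onSec_sodot {δ : FunBStar k →ₗ[k] FunBStar k}
    (hδ : ∀ x y, δ (x * y) = δ x * y + x * δ y) (m : Sec E) (n : Sec F) :
    onSec (tensor E F) δ (sodot m n) = sodot (onSec E δ m) n + sodot m (onSec F δ n) := by
  induction m using TensorProduct.induction_on with
  | zero => simp only [map_zero, zero_sodot, zero_add]
  | add x y hx hy => simp only [map_add, add_sodot, hx, hy]; abel
  | tmul r e =>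
    induction n using TensorProduct.induction_on with
    | zero => simp only [map_zero, sodot_zero, zero_add]
    | add x y hx hy => simp only [map_add, sodot_add, hx, hy]; abel
    | tmul s f =>
      change onSec (tensor E F) δ (odot (r ⊗ₜ[k] e) (s ⊗ₜ[k] f)) =
        odot (δ r ⊗ₜ[k] e) (s ⊗ₜ[k] f) + odot (r ⊗ₜ[k] e) (δ s ⊗ₜ[k] f)
      rw [odot_tmul, odot_tmul, odot_tmul, ← TensorProduct.add_tmul, ← hδ]
      rfl

theorem onSec_sodot_hom {φ : FunBStar k →ₗ[k] FunBStar k}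
    (hφ : ∀ x y, φ (x * y) = φ x * φ y) (m : Sec E) (n : Sec F) :
    onSec (tensor E F) φ (sodot m n) = sodot (onSec E φ m) (onSec F φ n) := by
  induction m using TensorProduct.induction_on with
  | zero => simp only [map_zero, zero_sodot]
  | add x y hx hy => simp only [map_add, add_sodot, hx, hy]
  | tmul r e =>
    induction n using TensorProduct.induction_on with
    | zero => simp only [map_zero, sodot_zero]
    | add x y hx hy => simp only [map_add, sodot_add, hx, hy]
    | tmul s f =>
      change onSec (tensor E F) φ (odot (r ⊗ₜ[k] e) (s ⊗ₜ[k] f)) =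
        odot (φ r ⊗ₜ[k] e) (φ s ⊗ₜ[k] f)
      rw [odot_tmul, odot_tmul, ← hφ]
      rfl

theorem scalar_ne_zero (t : kˣ) : algebraMap k (LaurentSeries k) (t⁻¹ : kˣ) ≠ 0 := by
  rw [Ne, FaithfulSMul.algebraMap_eq_zero_iff]
  exact Units.ne_zero _

theorem rho_sodot (t : kˣ) (m : Sec E) (n : Sec F) :
    rho (tensor E F) t (sodot m n) = sodot (rho E t m) (rho F t n) := by
  induction m using TensorProduct.induction_on with
  | zero => simp only [map_zero, zero_sodot]
  | add x y hx hy => simp only [map_add, add_sodot, hx, hy]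
  | tmul r e =>
    induction n using TensorProduct.induction_on with
    | zero => simp only [map_zero, sodot_zero]
    | add x y hx hy => simp only [map_add, sodot_add, hx, hy]
    | tmul s f =>
      change rho (tensor E F) t (odot (r ⊗ₜ[k] e) (s ⊗ₜ[k] f)) =
        odot (substU _ r ⊗ₜ[k] E.act t e) (substU _ s ⊗ₜ[k] F.act t f)
      rw [odot_tmul, odot_tmul, ← substU_mul (scalar_ne_zero t), ← tensor_act E F t.ne_zero]
      rfl

theorem sodot_mem_wSec {a b : ℤ} {m : Sec E} {n : Sec F} (hm : m ∈ wSec E a) (hn : n ∈ wSec F b) :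
    sodot m n ∈ wSec (tensor E F) (a + b) := by
  refine wSec_le (N := (wSec (tensor E F) (a + b)).comap (sodotL n)) (fun i hi e he => ?_) hm
  refine wSec_le (N := (wSec (tensor E F) (a + b)).comap (sodotR ((1 : FunBStar k) ⊗ₜ[k] e)))
    (fun j hj f hf => ?_) hn
  have : odot ((1 : FunBStar k) ⊗ₜ[k] e) ((1 : FunBStar k) ⊗ₜ[k] f) ∈
      wSec (tensor E F) (a + b) := by
    rw [odot_tmul]
    exact tmul_mem_wSec (E := tensor E F) (add_le_add hi hj) (tmul_mem he hf) _
  exact this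

theorem RaisesWeight.of_tensor {f : Sec (tensor E F) →ₗ[FunBStar k] Sec G}
    (h : ∀ i j, ∀ m ∈ wSec E i, ∀ n ∈ wSec F j, f (sodot m n) ∈ wSec G (i + j + 1)) :
    RaisesWeight f := by
  refine RaisesWeight.of_gr fun n x hx => ?_
  have key : (tensor E F).gr n ≤ ((wSec G (n + 1)).restrictScalars k).comap
      (f.restrictScalars k ∘ₗ TensorProduct.mk k (FunBStar k) (tensor E F).V 1) := by
    refine Submodule.span_le.mpr ?_
    rintro _ ⟨i, j, rfl, e, he, f', hf, rfl⟩
    have := h i j _ (tmul_mem_wSec le_rfl he 1) _ (tmul_mem_wSec le_rfl hf 1)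
    change f (odot _ _) ∈ _ at this
    rw [odot_tmul, one_mul] at this
    exact this
  exact key hx

theorem sodot_mem_regSec {m : Sec E} {n : Sec F} (hm : m ∈ regSec E) (hn : n ∈ regSec F) :
    sodot m n ∈ regSec (tensor E F) := by
  obtain ⟨x, rfl⟩ := hm
  obtain ⟨y, rfl⟩ := hn
  induction x using TensorProduct.induction_on with
  | zero => rw [map_zero, zero_sodot]; exact Submodule.zero_mem _
  | add x x' hx hx' => rw [map_add, add_sodot]; exact Submodule.add_mem _ hx hx'
  | tmul r e =>
    induction y using TensorProduct.induction_on with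
    | zero => rw [map_zero, sodot_zero]; exact Submodule.zero_mem _
    | add x x' hx hx' => rw [map_add, sodot_add]; exact Submodule.add_mem _ hx hx'
    | tmul s f =>
      refine ⟨(r * s) ⊗ₜ[k] (e ⊗ₜ[k] f : E.V ⊗[k] F.V), ?_⟩
      change funB k (r * s) ⊗ₜ[k] (e ⊗ₜ[k] f : E.V ⊗[k] F.V) =
        odot (funB k r ⊗ₜ[k] e) (funB k s ⊗ₜ[k] f)
      rw [odot_tmul, map_mul]

theorem IsRegular.of_tensor {f : Sec (tensor E F) →ₗ[FunBStar k] Sec G}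
    (h : ∀ m ∈ regSec E, ∀ n ∈ regSec F, f (sodot m n) ∈ regSec G) : IsRegular f := by
  rintro _ ⟨y, rfl⟩
  induction y using TensorProduct.induction_on with
  | zero => rw [map_zero, map_zero]; exact Submodule.zero_mem _
  | add x y hx hy => rw [map_add, map_add]; exact Submodule.add_mem _ hx hy
  | tmul r x =>
    change f (funB k r ⊗ₜ[k] x) ∈ _
    let g : E.V ⊗[k] F.V →ₗ[k] Sec G :=
      f.restrictScalars k ∘ₗ TensorProduct.mk k (FunBStar k) (tensor E F).V (funB k r)
    have key : ∀ y : E.V ⊗[k] F.V, g y ∈ regSec G := by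
      intro y
      induction y using TensorProduct.induction_on with
      | zero => rw [map_zero]; exact Submodule.zero_mem _
      | add x y hx hy => rw [map_add]; exact Submodule.add_mem _ hx hy
      | tmul e e' =>
        have := h (funB k r ⊗ₜ[k] e) ⟨r ⊗ₜ e, rfl⟩ (funB k 1 ⊗ₜ[k] e') ⟨1 ⊗ₜ e', rfl⟩
        change f (odot _ _) ∈ _ at this
        rw [odot_tmul, map_one, mul_one] at this
        exact this
    exact key x

/-! ### The tensor product of connections -/

/-- The tensor product `∇ ⊗ 1 + 1 ⊗ ∇'` of connections. -/
def Conn.tensor (A : Conn E) (B : Conn F) : Conn (tensor E F) where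
  z := sbox A.z LinearMap.id + sbox LinearMap.id B.z
  u := sbox A.u LinearMap.id + sbox LinearMap.id B.u

/-- The operators `D` on the sections of `E ⊗ F` satisfy `D (m ⊗ n) = D₁ m ⊗ n + m ⊗ D₂ n`. -/
structure IsProdOps (D : Ops (GrVec.tensor E F)) (D₁ : Ops E) (D₂ : Ops F) : Prop where
  z : ∀ m n, D.z (sodot m n) = sodot (D₁.z m) n + sodot m (D₂.z n)
  u : ∀ m n, D.u (sodot m n) = sodot (D₁.u m) n + sodot m (D₂.u n)

theorem isProdOps_tensor (A : Conn E) (B : Conn F) :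
    IsProdOps (A.tensor B).nabla A.nabla B.nabla := by
  constructor
  · intro m n
    change onSec _ dz (sodot m n) + (sbox A.z LinearMap.id (sodot m n) +
      sbox LinearMap.id B.z (sodot m n)) =
        sodot (onSec E dz m + A.z m) n + sodot m (onSec F dz n + B.z n)
    rw [sbox_sodot, sbox_sodot, onSec_sodot dz_mul, add_sodot, sodot_add]
    simp only [LinearMap.id_apply]
    abel
  · intro m n
    change onSec _ du (sodot m n) + (sbox A.u LinearMap.id (sodot m n) +
      sbox LinearMap.id B.u (sodot m n)) =
        sodot (onSec E du m + A.u m) n + sodot m (onSec F du n + B.u n)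
    rw [sbox_sodot, sbox_sodot, onSec_sodot du_mul, add_sodot, sodot_add]
    simp only [LinearMap.id_apply]
    abel

theorem IsProdOps.pull {D : Ops (GrVec.tensor E F)} {D₁ : Ops E} {D₂ : Ops F}
    (h : IsProdOps D D₁ D₂) {w : LaurentSeries k} (hw : w ≠ 0) :
    IsProdOps (D.pull w) (D₁.pull w) (D₂.pull w) := by
  have hinv {E : GrVec k} (x : Sec E) : onSec E (substU w) (onSec E (substU w⁻¹) x) = x := by
    induction x using TensorProduct.induction_on with
    | zero => simp only [map_zero]
    | add x y hx hy => simp only [map_add, hx, hy]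
    | tmul r e => simp only [onSec, LinearMap.rTensor_tmul, substU_inv hw]
  have hs : ∀ (m : Sec E) (n : Sec F), onSec _ (substU w) (sodot m n) = _ :=
    onSec_sodot_hom (substU_mul hw)
  have hs' : ∀ (m : Sec E) (n : Sec F), onSec _ (substU w⁻¹) (sodot m n) = _ :=
    onSec_sodot_hom (substU_mul (inv_ne_zero hw))
  constructor
  · intro m n
    simp only [Ops.pull, LinearMap.add_apply, LinearMap.comp_apply, LinearMap.restrictScalars_apply,
      LinearMap.lsmul_apply, hs', h.z, h.u, map_add, hs, hinv, add_sodot, sodot_add,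
      smul_sodot, sodot_smul]
    abel
  · intro m n
    simp only [Ops.pull, LinearMap.comp_apply, hs', h.u, map_add, hs, hinv]

/-- The tensor product of automorphisms. -/
def sboxEquiv (h : Sec E ≃ₗ[FunBStar k] Sec E) (g : Sec F ≃ₗ[FunBStar k] Sec F) :
    Sec (GrVec.tensor E F) ≃ₗ[FunBStar k] Sec (GrVec.tensor E F) :=
  LinearEquiv.ofLinearMap (sbox h.toLinearMap g.toLinearMap)
    (sbox h.symm.toLinearMap g.symm.toLinearMap)
    (LinearMap.ext fun x => by
      induction x using sodot_induction with
      | h₀ => simp only [map_zero]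
      | h₂ x y hx hy => rw [map_add, hx, hy, map_add]
      | h m n => simp [sbox_sodot])
    (LinearMap.ext fun x => by
      induction x using sodot_induction with
      | h₀ => simp only [map_zero]
      | h₂ x y hx hy => rw [map_add, hx, hy, map_add]
      | h m n => simp [sbox_sodot])

theorem IsRegular.sbox {f : Sec E →ₗ[FunBStar k] Sec E₁} {g : Sec F →ₗ[FunBStar k] Sec F₁}
    (hf : IsRegular f) (hg : IsRegular g) : IsRegular (sbox f g) :=
  IsRegular.of_tensor fun m hm n hn => by
    rw [sbox_sodot]; exact sodot_mem_regSec (hf m hm) (hg n hn)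

theorem IsInvariant.sbox {f : Sec E →ₗ[FunBStar k] Sec E₁} {g : Sec F →ₗ[FunBStar k] Sec F₁}
    (hf : IsInvariant f) (hg : IsInvariant g) : IsInvariant (sbox f g) := by
  intro t x
  induction x using sodot_induction with
  | h₀ => simp only [map_zero]
  | h₂ x y hx hy => simp only [map_add, hx, hy]
  | h m n => rw [rho_sodot, sbox_sodot, sbox_sodot, rho_sodot, hf t, hg t]

theorem ext₀_sodot {S : E.V →ₗ[k] E₁.V} {T : F.V →ₗ[k] F₁.V} (m : Sec E) (n : Sec F) :
    ext₀ (E := GrVec.tensor E F) (F := GrVec.tensor E₁ F₁) (TensorProduct.map S T) (sodot m n) =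
      sodot (ext₀ S m) (ext₀ T n) :=
  baseChange_map_odot S T m n

theorem RaisesWeight.sbox {f : Sec E →ₗ[FunBStar k] Sec E₁} {g : Sec F →ₗ[FunBStar k] Sec F₁}
    {S : E.V →ₗ[k] E₁.V} {T : F.V →ₗ[k] F₁.V} (hS : IsGraded S) (hT : IsGraded T)
    (hf : RaisesWeight (f - ext₀ S)) (hg : RaisesWeight (g - ext₀ T)) :
    RaisesWeight (sbox f g -
      ext₀ (E := GrVec.tensor E F) (F := GrVec.tensor E₁ F₁) (TensorProduct.map S T)) := by
  refine RaisesWeight.of_tensor fun i j m hm n hn => ?_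
  rw [LinearMap.sub_apply, sbox_sodot, ext₀_sodot]
  have h1 : f m - ext₀ S m ∈ wSec E₁ (i + 1) := hf i m hm
  have h2 : g n - ext₀ T n ∈ wSec F₁ (j + 1) := hg j n hn
  have h3 : ext₀ S m ∈ wSec E₁ i := baseChange_wSec hS hm
  have h4 : ext₀ T n ∈ wSec F₁ j := baseChange_wSec hT hn
  have : sodot (f m) (g n) - sodot (ext₀ S m) (ext₀ T n) =
      sodot (f m - ext₀ S m) (g n - ext₀ T n) + sodot (f m - ext₀ S m) (ext₀ T n) +
        sodot (ext₀ S m) (g n - ext₀ T n) := by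
    simp only [sub_sodot, sodot_sub]; abel
  rw [this]
  refine Submodule.add_mem _ (Submodule.add_mem _ ?_ ?_) ?_
  · exact wSec_anti (by omega) (sodot_mem_wSec h1 h2)
  · exact wSec_anti (by omega) (sodot_mem_wSec h1 h4)
  · exact wSec_anti (by omega) (sodot_mem_wSec h3 h2)

theorem GaugeEquiv.tensor {D D' : Ops (GrVec.tensor E F)} {D₁ D₁' : Ops E} {D₂ D₂' : Ops F}
    (h : IsProdOps D D₁ D₂) (h' : IsProdOps D' D₁' D₂') :
    GaugeEquiv D₁ D₁' → GaugeEquiv D₂ D₂' → GaugeEquiv D D' := by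
  rintro ⟨f, f1, f2, f3, f4, f5, f6, f7⟩ ⟨g, g1, g2, g3, g4, g5, g6, g7⟩
  have key {f : Sec E →ₗ[FunBStar k] Sec E} {g : Sec F →ₗ[FunBStar k] Sec F}
      (hf : RaisesWeight (f - LinearMap.id)) (hg : RaisesWeight (g - LinearMap.id)) :
      RaisesWeight (Equising.sbox f g - LinearMap.id) := by
    refine RaisesWeight.of_tensor fun i j m hm n hn => ?_
    have h1 : f m - m ∈ wSec E (i + 1) := hf i m hm
    have h2 : g n - n ∈ wSec F (j + 1) := hg j n hn
    have : sodot (f m) (g n) - sodot m n = sodot (f m - m) (g n - n) + sodot (f m - m) n +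
        sodot m (g n - n) := by
      simp only [sub_sodot, sodot_sub]; abel
    rw [LinearMap.sub_apply, sbox_sodot, LinearMap.id_apply, this]
    refine Submodule.add_mem _ (Submodule.add_mem _ ?_ ?_) ?_
    · exact wSec_anti (by omega) (sodot_mem_wSec h1 h2)
    · exact wSec_anti (by omega) (sodot_mem_wSec h1 hn)
    · exact wSec_anti (by omega) (sodot_mem_wSec hm h2)
  refine ⟨sboxEquiv f g, f1.sbox g1, f2.sbox g2, IsInvariant.sbox (f := f.toLinearMap)
    (g := g.toLinearMap) f3 g3, key f4 g4, key f5 g5, fun x => ?_, fun x => ?_⟩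
  · change Equising.sbox f.toLinearMap g.toLinearMap (D.z x) =
      D'.z (Equising.sbox f.toLinearMap g.toLinearMap x)
    induction x using sodot_induction with
    | h₀ => simp only [map_zero]
    | h₂ x y hx hy => simp only [map_add, hx, hy]
    | h m n =>
      simp only [h.z, h'.z, map_add, sbox_sodot, LinearEquiv.coe_coe, f6, g6]
  · change Equising.sbox f.toLinearMap g.toLinearMap (D.u x) =
      D'.u (Equising.sbox f.toLinearMap g.toLinearMap x)
    induction x using sodot_induction with
    | h₀ => simp only [map_zero]
    | h₂ x y hx hy => simp only [map_add, hx, hy]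
    | h m n =>
      simp only [h.u, h'.u, map_add, sbox_sodot, LinearEquiv.coe_coe, f7, g7]

theorem HasLift.tensor {S : E.V →ₗ[k] E₁.V} {T : F.V →ₗ[k] F₁.V} (hS : IsGraded S)
    (hT : IsGraded T) {D : Ops (GrVec.tensor E F)} {D₁ : Ops E} {D₂ : Ops F}
    {D' : Ops (GrVec.tensor E₁ F₁)} {D₁' : Ops E₁} {D₂' : Ops F₁}
    (h : IsProdOps D D₁ D₂) (h' : IsProdOps D' D₁' D₂') :
    HasLift S D₁ D₁' → HasLift T D₂ D₂' →
      HasLift (E := GrVec.tensor E F) (F := GrVec.tensor E₁ F₁) (TensorProduct.map S T) D D' := by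
  rintro ⟨f, f1, f2, f3, f4, f5⟩ ⟨g, g1, g2, g3, g4, g5⟩
  refine ⟨Equising.sbox f g, f1.sbox g1, f2.sbox g2, RaisesWeight.sbox hS hT f3 g3,
    fun x => ?_, fun x => ?_⟩
  · induction x using sodot_induction with
    | h₀ => simp only [map_zero]
    | h₂ x y hx hy => simp only [map_add, hx, hy]
    | h m n => simp only [h.z, h'.z, map_add, sbox_sodot, f4, g4]
  · induction x using sodot_induction with
    | h₀ => simp only [map_zero]
    | h₂ x y hx hy => simp only [map_add, hx, hy]
    | h m n => simp only [h.u, h'.u, map_add, sbox_sodot, f5, g5]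

theorem ofPowerSeries_ne_zero {v : PowerSeries k} (hv : PowerSeries.constantCoeff v = 1) :
    HahnSeries.ofPowerSeries ℤ k v ≠ 0 := by
  intro h
  have : v = 0 := HahnSeries.ofPowerSeries_injective (by rw [h, map_zero])
  rw [this, map_zero] at hv
  exact zero_ne_one hv

theorem IsFlatEquisingular.tensor {A : Conn E} {B : Conn F} (hA : IsFlatEquisingular A)
    (hB : IsFlatEquisingular B) : IsFlatEquisingular (A.tensor B) := by
  have hP := isProdOps_tensor A B
  have hw {f : Sec E →ₗ[FunBStar k] Sec E} {g : Sec F →ₗ[FunBStar k] Sec F}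
      (hf : RaisesWeight f) (hg : RaisesWeight g) :
      RaisesWeight (sbox f LinearMap.id + sbox LinearMap.id g) := by
    refine RaisesWeight.of_tensor fun i j m hm n hn => ?_
    rw [LinearMap.add_apply, sbox_sodot, sbox_sodot]
    exact Submodule.add_mem _ (wSec_anti (by omega) (sodot_mem_wSec (hf i m hm) hn))
      (wSec_anti (by omega) (sodot_mem_wSec hm (hg j n hn)))
  refine ⟨hw hA.weight_z hB.weight_z, hw hA.weight_u hB.weight_u, fun x => ?_, fun t x => ?_,
    fun t x => ?_, fun v v' hv hv' => ?_⟩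
  · induction x using sodot_induction with
    | h₀ => simp only [map_zero]
    | h₂ x y hx hy => simp only [map_add, hx, hy]
    | h m n => simp only [hP.z, hP.u, map_add, hA.flat, hB.flat]; abel
  · induction x using sodot_induction with
    | h₀ => simp only [map_zero]
    | h₂ x y hx hy => simp only [map_add, hx, hy]
    | h m n => simp only [rho_sodot, hP.z, map_add, hA.invariant_z t, hB.invariant_z t]
  · induction x using sodot_induction with
    | h₀ => simp only [map_zero]
    | h₂ x y hx hy => simp only [map_add, hx, hy]
    | h m n => simp only [rho_sodot, hP.u, map_add, hA.invariant_u t, hB.invariant_u t]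
  · exact GaugeEquiv.tensor (hP.pull (ofPowerSeries_ne_zero hv))
      (hP.pull (ofPowerSeries_ne_zero hv')) (hA.equisingular v v' hv hv')
      (hB.equisingular v v' hv hv')

/-! ### The trivial connection -/

/-- The trivial connection `d`. -/
def Conn.trivial (E : GrVec k) : Conn E := ⟨0, 0⟩

theorem pull_trivial (E : GrVec k) {w : LaurentSeries k} (hw : w ≠ 0) :
    (Conn.trivial E).nabla.pull w = (Conn.trivial E).nabla := by
  have hi : substU w⁻¹ ∘ₗ substU w = (LinearMap.id : FunBStar k →ₗ[k] FunBStar k) := by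
    refine LinearMap.ext fun x => ?_
    have := substU_inv (inv_ne_zero hw) x
    rwa [inv_inv] at this
  have hsurj (x : FunBStar k) : ∃ y, x = substU w y := ⟨_, (substU_inv hw x).symm⟩
  have hinv (y : FunBStar k) : substU w⁻¹ (substU w y) = y := LinearMap.congr_fun hi y
  refine Ops.ext (LinearMap.ext fun x => ?_) (LinearMap.ext fun x => ?_)
  · induction x using TensorProduct.induction_on with
    | zero => simp only [map_zero]
    | add x y hx hy => simp only [map_add, hx, hy]
    | tmul r e =>
      obtain ⟨y, rfl⟩ := hsurj r
      simp only [Ops.pull, Conn.nabla, Conn.trivial, LinearMap.add_apply, LinearMap.comp_apply,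
        LinearMap.restrictScalars_apply, LinearMap.lsmul_apply, LinearMap.zero_apply, add_zero,
        onSec, LinearMap.rTensor_tmul, hinv, dz_substU hw, TensorProduct.add_tmul,
        TensorProduct.smul_tmul', smul_eq_mul]
  · induction x using TensorProduct.induction_on with
    | zero => simp only [map_zero]
    | add x y hx hy => simp only [map_add, hx, hy]
    | tmul r e =>
      obtain ⟨y, rfl⟩ := hsurj r
      simp only [Ops.pull, Conn.nabla, Conn.trivial, LinearMap.add_apply, LinearMap.comp_apply,
        LinearMap.restrictScalars_apply, LinearMap.zero_apply, add_zero,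
        onSec, LinearMap.rTensor_tmul, hinv, du_substU]

theorem IsFlatEquisingular.trivial (E : GrVec k) : IsFlatEquisingular (Conn.trivial E) := by
  have hsub (t : kˣ) (x : FunBStar k) :
      dz (substU (algebraMap k (LaurentSeries k) (t⁻¹ : kˣ)) x) =
        substU (algebraMap k (LaurentSeries k) (t⁻¹ : kˣ)) (dz x) := by
    have h0 : LaurentSeries.derivative k (algebraMap k (LaurentSeries k) (t⁻¹ : kˣ)) = 0 :=
      (laurentDeriv k).map_algebraMap _
    rw [dz_substU (scalar_ne_zero t), h0, zero_mul]
    have : (mono 0 0 : FunBStar k) = 0 := AddMonoidAlgebra.single_zero _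
    rw [this, zero_mul, add_zero]
  refine ⟨fun n x _ => Submodule.zero_mem _, fun n x _ => Submodule.zero_mem _, fun x => ?_,
    fun t x => ?_, fun t x => ?_, fun v v' hv hv' => ?_⟩
  · induction x using TensorProduct.induction_on with
    | zero => simp only [map_zero]
    | add x y hx hy => simp only [map_add, hx, hy]
    | tmul r e => simp [Conn.nabla, Conn.trivial, onSec, dz_du]
  · induction x using TensorProduct.induction_on with
    | zero => simp only [map_zero]
    | add x y hx hy => simp only [map_add, hx, hy]
    | tmul r e => simp only [Conn.nabla, Conn.trivial, LinearMap.add_apply,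
        LinearMap.restrictScalars_apply, LinearMap.zero_apply, add_zero, onSec, rho,
        TensorProduct.map_tmul, LinearMap.rTensor_tmul, hsub]
  · induction x using TensorProduct.induction_on with
    | zero => simp only [map_zero]
    | add x y hx hy => simp only [map_add, hx, hy]
    | tmul r e => simp only [Conn.nabla, Conn.trivial, LinearMap.add_apply,
        LinearMap.restrictScalars_apply, LinearMap.zero_apply, add_zero, onSec, rho,
        TensorProduct.map_tmul, LinearMap.rTensor_tmul, du_substU]
  · rw [pull_trivial E (ofPowerSeries_ne_zero hv), pull_trivial E (ofPowerSeries_ne_zero hv')]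
    exact GaugeEquiv.refl _

end Tensor

end Equising

namespace Equising

open GrVec

section Category

variable {k : Type u} [Field k] [CharZero k]

/-- `W`-equivalence of flat equisingular `W`-connections. -/
def connSetoid (E : GrVec k) : Setoid {A : Conn E // IsFlatEquisingular A} where
  r A B := GaugeEquiv A.1.nabla B.1.nabla
  iseqv := ⟨fun _ => GaugeEquiv.refl _, GaugeEquiv.symm, GaugeEquiv.trans⟩

variable (k) in
/-- Flat equisingular bundles: a finite dimensional graded vector space `E` together with a
`W`-equivalence class of flat equisingular `W`-connections. -/
structure EqBundle where
  E : GrVec k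
  cls : Quotient (connSetoid E)

namespace EqBundle

/-- `A` belongs to the given equivalence class. -/
def Rep (X : EqBundle k) (A : Conn X.E) : Prop :=
  ∃ h : IsFlatEquisingular A, (Quotient.mk (connSetoid X.E) ⟨A, h⟩) = X.cls

theorem exists_rep (X : EqBundle k) : ∃ A, X.Rep A := by
  obtain ⟨⟨A, h⟩, hA⟩ := Quotient.exists_rep X.cls
  exact ⟨A, h, hA⟩

theorem Rep.equiv {X : EqBundle k} {A B : Conn X.E} (hA : X.Rep A) (hB : X.Rep B) :
    GaugeEquiv A.nabla B.nabla := by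
  obtain ⟨h, hA⟩ := hA
  obtain ⟨h', hB⟩ := hB
  exact Quotient.exact (s := connSetoid X.E) (hA.trans hB.symm)

/-- `T : E → E'` is a morphism `(E, ∇) → (E', ∇')`. -/
def IsHom (X Y : EqBundle k) (T : X.E.V →ₗ[k] Y.E.V) : Prop :=
  IsGraded T ∧ ∃ A B, X.Rep A ∧ Y.Rep B ∧ IsMor T A.nabla B.nabla

theorem isHom_iff {X Y : EqBundle k} {A : Conn X.E} {B : Conn Y.E} (hA : X.Rep A) (hB : Y.Rep B)
    {T : X.E.V →ₗ[k] Y.E.V} : IsHom X Y T ↔ IsGraded T ∧ HasLift T A.nabla B.nabla := by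
  constructor
  · rintro ⟨hT, A', B', hA', hB', h⟩
    exact ⟨hT, ((isMor_iff hT).mp h).congr hT (hA'.equiv hA) (hB'.equiv hB)⟩
  · rintro ⟨hT, h⟩
    exact ⟨hT, A, B, hA, hB, (isMor_iff hT).mpr h⟩

/-- The space of morphisms between two flat equisingular bundles. -/
def homs (X Y : EqBundle k) : Submodule k (X.E.V →ₗ[k] Y.E.V) where
  carrier := {T | IsHom X Y T}
  add_mem' {S T} hS hT := by
    obtain ⟨A, hA⟩ := X.exists_rep
    obtain ⟨B, hB⟩ := Y.exists_rep
    have hS := (isHom_iff hA hB).mp hS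
    have hT := (isHom_iff hA hB).mp hT
    exact (isHom_iff hA hB).mpr
      ⟨fun n x hx => Submodule.add_mem _ (hS.1 n x hx) (hT.1 n x hx), hS.2.add hT.2⟩
  zero_mem' := by
    obtain ⟨A, hA⟩ := X.exists_rep
    obtain ⟨B, hB⟩ := Y.exists_rep
    exact (isHom_iff hA hB).mpr ⟨fun n x hx => Submodule.zero_mem _, HasLift.zero _ _⟩
  smul_mem' c T hT := by
    obtain ⟨A, hA⟩ := X.exists_rep
    obtain ⟨B, hB⟩ := Y.exists_rep
    have hT := (isHom_iff hA hB).mp hT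
    exact (isHom_iff hA hB).mpr
      ⟨fun n x hx => Submodule.smul_mem _ c (hT.1 n x hx), hT.2.smul c⟩

theorem id_mem (X : EqBundle k) : LinearMap.id ∈ homs X X := by
  obtain ⟨A, hA⟩ := X.exists_rep
  exact (isHom_iff hA hA).mpr ⟨isGraded_id, HasLift.id _⟩

theorem comp_mem {X Y Z : EqBundle k} {S : Y.E.V →ₗ[k] Z.E.V} {T : X.E.V →ₗ[k] Y.E.V}
    (hS : S ∈ homs Y Z) (hT : T ∈ homs X Y) : S ∘ₗ T ∈ homs X Z := by
  obtain ⟨A, hA⟩ := X.exists_rep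
  obtain ⟨B, hB⟩ := Y.exists_rep
  obtain ⟨C, hC⟩ := Z.exists_rep
  have hS := (isHom_iff hB hC).mp hS
  have hT := (isHom_iff hA hB).mp hT
  exact (isHom_iff hA hC).mpr ⟨IsGraded.comp hS.1 hT.1, hS.2.comp hS.1 hT.1 hT.2⟩

instance : Category (EqBundle k) where
  Hom X Y := homs X Y
  id X := ⟨LinearMap.id, id_mem X⟩
  comp f g := ⟨g.1 ∘ₗ f.1, comp_mem g.2 f.2⟩

instance : Preadditive (EqBundle k) where
  homGroup X Y := inferInstanceAs (AddCommGroup (homs X Y))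
  add_comp _ _ _ _ _ _ := Subtype.ext (LinearMap.comp_add ..)
  comp_add _ _ _ _ _ _ := Subtype.ext (LinearMap.add_comp ..)

instance : Linear k (EqBundle k) where
  homModule X Y := inferInstanceAs (Module k (homs X Y))
  smul_comp _ _ _ _ _ _ := Subtype.ext (LinearMap.comp_smul ..)
  comp_smul _ _ _ _ _ _ := Subtype.ext (LinearMap.smul_comp ..)

variable (k) in
/-- The functor `ω(E, ∇) = E` to finite dimensional vector spaces. -/
def omega : EqBundle k ⥤ FGModuleCat.{u} k where
  obj X := FGModuleCat.of k X.E.V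
  map f := FGModuleCat.ofHom f.1

instance : (omega k).Faithful where
  map_injective h := Subtype.ext (congrArg (fun f => f.hom.hom) h)

/-! ### The tensor structure -/

/-- The tensor product of equivalence classes of connections. -/
def tensorCls {E F : GrVec k} (c : Quotient (connSetoid E)) (d : Quotient (connSetoid F)) :
    Quotient (connSetoid (GrVec.tensor E F)) :=
  Quotient.map₂ (sa := connSetoid E) (sb := connSetoid F) (sc := connSetoid (GrVec.tensor E F))
    (fun A B => ⟨A.1.tensor B.1, A.2.tensor B.2⟩)
    (fun A A' h B B' h' => GaugeEquiv.tensor (isProdOps_tensor A.1 B.1)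
      (isProdOps_tensor A'.1 B'.1) h h') c d

/-- The tensor product `(E ⊗ E', ∇ ⊗ 1 + 1 ⊗ ∇')`. -/
def tensorObj (X Y : EqBundle k) : EqBundle k where
  E := GrVec.tensor X.E Y.E
  cls := tensorCls X.cls Y.cls

variable (k) in
/-- The unit object: `k` in degree `0` with the trivial connection. -/
def tensorUnit : EqBundle k where
  E := GrVec.unit k
  cls := Quotient.mk (connSetoid _) ⟨Conn.trivial _, IsFlatEquisingular.trivial _⟩

theorem Rep.tensor {X Y : EqBundle k} {A : Conn X.E} {B : Conn Y.E} (hA : X.Rep A) (hB : Y.Rep B) :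
    (tensorObj X Y).Rep (A.tensor B) := by
  obtain ⟨h, hA⟩ := hA
  obtain ⟨h', hB⟩ := hB
  refine ⟨h.tensor h', ?_⟩
  change _ = tensorCls X.cls Y.cls
  rw [← hA, ← hB]
  rfl

theorem rep_unit : (tensorUnit k).Rep (Conn.trivial _) := ⟨IsFlatEquisingular.trivial _, rfl⟩

theorem isGraded_of_tensor {E F G : GrVec k} {φ : E.V ⊗[k] F.V →ₗ[k] G.V}
    (h : ∀ i j, ∀ e ∈ E.gr i, ∀ f ∈ F.gr j, φ (e ⊗ₜ[k] f) ∈ G.gr (i + j)) :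
    IsGraded (E := GrVec.tensor E F) (F := G) φ := by
  intro n
  have : Submodule.span k
      {x | ∃ i j : ℤ, i + j = n ∧ ∃ e ∈ E.gr i, ∃ f ∈ F.gr j, x = e ⊗ₜ[k] f} ≤
        (G.gr n).comap φ := by
    refine Submodule.span_le.mpr ?_
    rintro _ ⟨i, j, rfl, e, he, f, hf, rfl⟩
    exact h i j e he f hf
  exact fun x hx => this hx

theorem isGraded_map {E F E₁ F₁ : GrVec k} {S : E.V →ₗ[k] E₁.V} {T : F.V →ₗ[k] F₁.V}
    (hS : IsGraded S) (hT : IsGraded T) :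
    IsGraded (E := GrVec.tensor E F) (F := GrVec.tensor E₁ F₁) (TensorProduct.map S T) :=
  isGraded_of_tensor (G := GrVec.tensor E₁ F₁) fun _ _ e he f hf => tmul_mem (hS _ e he) (hT _ f hf)

theorem eq_of_sodot {E F G : GrVec k} {f g : Sec (GrVec.tensor E F) →ₗ[k] Sec G}
    (h : ∀ (m : Sec E) (n : Sec F), f (sodot m n) = g (sodot m n)) : f = g := by
  refine LinearMap.ext fun x => ?_
  induction x using sodot_induction with
  | h₀ => rw [map_zero, map_zero]
  | h₂ x y hx hy => rw [map_add, map_add, hx, hy]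
  | h m n => exact h m n

theorem eq_of_sodot₃ {E F G H : GrVec k}
    {f g : Sec (GrVec.tensor (GrVec.tensor E F) G) →ₗ[k] Sec H}
    (h : ∀ (m : Sec E) (n : Sec F) (p : Sec G),
      f (sodot (sodot m n) p) = g (sodot (sodot m n) p)) : f = g := by
  refine eq_of_sodot fun x p => ?_
  induction x using sodot_induction with
  | h₀ => rw [zero_sodot, map_zero, map_zero]
  | h₂ x y hx hy => rw [add_sodot, map_add, map_add, hx, hy]
  | h m n => exact h m n p

theorem map_mem {X Y X' Y' : EqBundle k} {S : X.E.V →ₗ[k] X'.E.V} {T : Y.E.V →ₗ[k] Y'.E.V}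
    (hS : S ∈ homs X X') (hT : T ∈ homs Y Y') :
    TensorProduct.map S T ∈ homs (tensorObj X Y) (tensorObj X' Y') := by
  obtain ⟨A, hA⟩ := X.exists_rep
  obtain ⟨B, hB⟩ := Y.exists_rep
  obtain ⟨A', hA'⟩ := X'.exists_rep
  obtain ⟨B', hB'⟩ := Y'.exists_rep
  have hS := (isHom_iff hA hA').mp hS
  have hT := (isHom_iff hB hB').mp hT
  exact (isHom_iff (hA.tensor hB) (hA'.tensor hB')).mpr ⟨isGraded_map hS.1 hT.1,
    HasLift.tensor hS.1 hT.1 (isProdOps_tensor _ _) (isProdOps_tensor _ _) hS.2 hT.2⟩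

/-- An isomorphism of graded vector spaces which commutes with the operators. -/
def mkIso {X Y : EqBundle k} (e : X.E.V ≃ₗ[k] Y.E.V) (h : e.toLinearMap ∈ homs X Y)
    (h' : e.symm.toLinearMap ∈ homs Y X) : X ≅ Y where
  hom := ⟨e.toLinearMap, h⟩
  inv := ⟨e.symm.toLinearMap, h'⟩
  hom_inv_id := Subtype.ext (LinearMap.ext fun x => e.symm_apply_apply x)
  inv_hom_id := Subtype.ext (LinearMap.ext fun x => e.apply_symm_apply x)

theorem symm_mem {X Y : EqBundle k} {A : Conn X.E} {B : Conn Y.E} (hA : X.Rep A) (hB : Y.Rep B)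
    (e : X.E.V ≃ₗ[k] Y.E.V) (h₁ : IsGraded e.toLinearMap) (h₂ : IsGraded e.symm.toLinearMap)
    (hz : (ext₀ e.toLinearMap).restrictScalars k ∘ₗ A.nabla.z =
      B.nabla.z ∘ₗ (ext₀ e.toLinearMap).restrictScalars k)
    (hu : (ext₀ e.toLinearMap).restrictScalars k ∘ₗ A.nabla.u =
      B.nabla.u ∘ₗ (ext₀ e.toLinearMap).restrictScalars k) :
    e.toLinearMap ∈ homs X Y ∧ e.symm.toLinearMap ∈ homs Y X := by
  replace hz (x) : ext₀ e.toLinearMap (A.nabla.z x) = B.nabla.z (ext₀ e.toLinearMap x) :=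
    LinearMap.congr_fun hz x
  replace hu (x) : ext₀ e.toLinearMap (A.nabla.u x) = B.nabla.u (ext₀ e.toLinearMap x) :=
    LinearMap.congr_fun hu x
  have h12 (x : Sec X.E) : ext₀ e.symm.toLinearMap (ext₀ e.toLinearMap x) = x := by
    rw [ext₀_comp]
    have : e.symm.toLinearMap ∘ₗ e.toLinearMap = LinearMap.id := by ext; simp
    rw [this, ext₀_id]
  have h21 (x : Sec Y.E) : ext₀ e.toLinearMap (ext₀ e.symm.toLinearMap x) = x := by
    rw [ext₀_comp]
    have : e.toLinearMap ∘ₗ e.symm.toLinearMap = LinearMap.id := by ext; simp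
    rw [this, ext₀_id]
  refine ⟨(isHom_iff hA hB).mpr ⟨h₁, HasLift.of_commute h₁ hz hu⟩,
    (isHom_iff hB hA).mpr ⟨h₂, HasLift.of_commute h₂ (fun x => ?_) (fun x => ?_)⟩⟩
  · rw [← h12 (A.nabla.z _), hz, h21]
  · rw [← h12 (A.nabla.u _), hu, h21]

theorem trivial_z (c : Sec (GrVec.unit k)) :
    (Conn.trivial (GrVec.unit k)).nabla.z c = onSec _ dz c := by
  simp [Conn.nabla, Conn.trivial]

theorem trivial_u (c : Sec (GrVec.unit k)) :
    (Conn.trivial (GrVec.unit k)).nabla.u c = onSec _ du c := by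
  simp [Conn.nabla, Conn.trivial]

theorem nabla_smul_z {E : GrVec k} (A : Conn E) (r : FunBStar k) (m : Sec E) :
    A.nabla.z (r • m) = dz r • m + r • A.nabla.z m := by
  change onSec E dz (r • m) + A.z (r • m) = _ + r • (onSec E dz m + A.z m)
  rw [onSec_smul dz_mul, map_smul, smul_add, add_assoc]

theorem nabla_smul_u {E : GrVec k} (A : Conn E) (r : FunBStar k) (m : Sec E) :
    A.nabla.u (r • m) = du r • m + r • A.nabla.u m := by
  change onSec E du (r • m) + A.u (r • m) = _ + r • (onSec E du m + A.u m)
  rw [onSec_smul du_mul, map_smul, smul_add, add_assoc]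

theorem graded_assoc (E F G : GrVec k) :
    IsGraded (E := GrVec.tensor (GrVec.tensor E F) G) (F := GrVec.tensor E (GrVec.tensor F G))
      (TensorProduct.assoc k E.V F.V G.V).toLinearMap := by
  refine isGraded_of_tensor (E := GrVec.tensor E F) (F := G)
    (G := GrVec.tensor E (GrVec.tensor F G)) fun i j x hx g hg => ?_
  have : (GrVec.tensor E F).gr i ≤ ((GrVec.tensor E (GrVec.tensor F G)).gr (i + j)).comap
      ((TensorProduct.assoc k E.V F.V G.V).toLinearMap ∘ₗ
        (TensorProduct.mk k (E.V ⊗[k] F.V) G.V).flip g) := by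
    refine Submodule.span_le.mpr ?_
    rintro _ ⟨a, b, rfl, e, he, f, hf, rfl⟩
    rw [add_assoc]
    exact tmul_mem (E := E) (F := GrVec.tensor F G) he (tmul_mem hf hg)
  exact this hx

theorem graded_assoc_symm (E F G : GrVec k) :
    IsGraded (F := GrVec.tensor (GrVec.tensor E F) G) (E := GrVec.tensor E (GrVec.tensor F G))
      (TensorProduct.assoc k E.V F.V G.V).symm.toLinearMap := by
  refine isGraded_of_tensor (E := E) (F := GrVec.tensor F G)
    (G := GrVec.tensor (GrVec.tensor E F) G) fun i j e he x hx => ?_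
  have : (GrVec.tensor F G).gr j ≤ ((GrVec.tensor (GrVec.tensor E F) G).gr (i + j)).comap
      ((TensorProduct.assoc k E.V F.V G.V).symm.toLinearMap ∘ₗ
        (TensorProduct.mk k E.V (F.V ⊗[k] G.V)) e) := by
    refine Submodule.span_le.mpr ?_
    rintro _ ⟨a, b, rfl, f, hf, g, hg, rfl⟩
    rw [← add_assoc]
    exact tmul_mem (E := GrVec.tensor E F) (F := G) (tmul_mem he hf) hg
  exact this hx

theorem graded_comm (E F : GrVec k) :
    IsGraded (E := GrVec.tensor E F) (F := GrVec.tensor F E)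
      (TensorProduct.comm k E.V F.V).toLinearMap := by
  refine isGraded_of_tensor (E := E) (F := F) (G := GrVec.tensor F E) fun i j e he f hf => ?_
  rw [add_comm]
  exact tmul_mem (E := F) (F := E) hf he

theorem unit_mem {c : k} {i : ℤ} (hc : c ∈ (GrVec.unit k).gr i) : i = 0 ∨ c = 0 := by
  by_cases h : i = 0
  · exact Or.inl h
  · have : (GrVec.unit k).gr i = ⊥ := if_neg h
    rw [this] at hc
    exact Or.inr hc

theorem mem_unit (c : k) : (show (GrVec.unit k).V from c) ∈ (GrVec.unit k).gr 0 := by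
  have h : (⊤ : Submodule k k) = if (0 : ℤ) = 0 then ⊤ else ⊥ := (if_pos rfl).symm
  have : c ∈ (if (0 : ℤ) = 0 then ⊤ else ⊥ : Submodule k k) := by
    rw [← h]
    exact Submodule.mem_top
  exact this

theorem graded_lid (E : GrVec k) :
    IsGraded (E := GrVec.tensor (GrVec.unit k) E) (F := E)
      (TensorProduct.lid k E.V).toLinearMap := by
  refine isGraded_of_tensor (E := GrVec.unit k) (F := E) (G := E) fun i j c hc e he => ?_
  have h : (TensorProduct.lid k E.V) ((show k from c) ⊗ₜ[k] e) = (show k from c) • e :=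
    TensorProduct.lid_tmul ..
  have h' : (show k from c) • e ∈ E.gr (i + j) := by
    rcases unit_mem (k := k) hc with rfl | rfl
    · rw [zero_add]; exact Submodule.smul_mem _ _ he
    · exact (zero_smul k e).symm ▸ Submodule.zero_mem _
  rw [← h] at h'
  exact h'

theorem graded_lid_symm (E : GrVec k) :
    IsGraded (F := GrVec.tensor (GrVec.unit k) E) (E := E)
      (TensorProduct.lid k E.V).symm.toLinearMap := by
  intro n x hx
  rw [← zero_add n]
  exact tmul_mem (mem_unit 1) hx

theorem graded_rid (E : GrVec k) :
    IsGraded (E := GrVec.tensor E (GrVec.unit k)) (F := E)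
      (TensorProduct.rid k E.V).toLinearMap := by
  refine isGraded_of_tensor (E := E) (F := GrVec.unit k) (G := E) fun i j e he c hc => ?_
  have h : (TensorProduct.rid k E.V) (e ⊗ₜ[k] (show k from c)) = (show k from c) • e :=
    TensorProduct.rid_tmul ..
  have h' : (show k from c) • e ∈ E.gr (i + j) := by
    rcases unit_mem (k := k) hc with rfl | rfl
    · rw [add_zero]; exact Submodule.smul_mem _ _ he
    · exact (zero_smul k e).symm ▸ Submodule.zero_mem _
  rw [← h] at h'
  exact h'

theorem graded_rid_symm (E : GrVec k) :
    IsGraded (F := GrVec.tensor E (GrVec.unit k)) (E := E)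
      (TensorProduct.rid k E.V).symm.toLinearMap := by
  intro n x hx
  rw [← add_zero n]
  exact tmul_mem hx (mem_unit 1)

theorem unit_induction {p : Sec (GrVec.unit k) → Prop} (x : Sec (GrVec.unit k))
    (h : ∀ r : FunBStar k, p (r ⊗ₜ[k] (show (GrVec.unit k).V from (1 : k)))) : p x := by
  obtain ⟨r, rfl⟩ : ∃ r : FunBStar k, r ⊗ₜ[k] (1 : k) = x :=
    ⟨TensorProduct.rid k (FunBStar k) x, (TensorProduct.rid k (FunBStar k)).symm_apply_apply x⟩
  exact h r

/-- The associativity isomorphism of graded vector spaces. -/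
def assocE (E F G : GrVec k) : (GrVec.tensor (GrVec.tensor E F) G).V ≃ₗ[k]
    (GrVec.tensor E (GrVec.tensor F G)).V := TensorProduct.assoc k E.V F.V G.V

/-- The commutativity isomorphism of graded vector spaces. -/
def commE (E F : GrVec k) : (GrVec.tensor E F).V ≃ₗ[k] (GrVec.tensor F E).V :=
  TensorProduct.comm k E.V F.V

/-- The left unit isomorphism of graded vector spaces. -/
def lidE (E : GrVec k) : (GrVec.tensor (GrVec.unit k) E).V ≃ₗ[k] E.V := TensorProduct.lid k E.V

/-- The right unit isomorphism of graded vector spaces. -/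
def ridE (E : GrVec k) : (GrVec.tensor E (GrVec.unit k)).V ≃ₗ[k] E.V := TensorProduct.rid k E.V

theorem ext_assoc {E F G : GrVec k} (m : Sec E) (n : Sec F) (p : Sec G) :
    ext₀ (assocE E F G).toLinearMap (sodot (sodot m n) p) = sodot m (sodot n p) := assoc_odot m n p

theorem ext_comm {E F : GrVec k} (m : Sec E) (n : Sec F) :
    ext₀ (commE E F).toLinearMap (sodot m n) = sodot n m := comm_odot m n

theorem ext_lid {E : GrVec k} (r : FunBStar k) (n : Sec E) :
    ext₀ (lidE E).toLinearMap (sodot (r ⊗ₜ[k] (show (GrVec.unit k).V from (1 : k))) n) = r • n := by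
  have := lid_odot r (1 : k) n
  rwa [one_smul] at this

theorem ext_rid {E : GrVec k} (r : FunBStar k) (n : Sec E) :
    ext₀ (ridE E).toLinearMap (sodot n (r ⊗ₜ[k] (show (GrVec.unit k).V from (1 : k)))) = r • n := by
  have := rid_odot r (1 : k) n
  rwa [one_smul] at this

theorem assoc_comm_z {E F G : GrVec k} (A : Conn E) (B : Conn F) (C : Conn G) :
    (ext₀ (assocE E F G).toLinearMap).restrictScalars k ∘ₗ ((A.tensor B).tensor C).nabla.z =
      (A.tensor (B.tensor C)).nabla.z ∘ₗ (ext₀ (assocE E F G).toLinearMap).restrictScalars k := by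
  refine eq_of_sodot₃ fun m n p => ?_
  change ext₀ (assocE E F G).toLinearMap (((A.tensor B).tensor C).nabla.z (sodot (sodot m n) p)) =
    (A.tensor (B.tensor C)).nabla.z (ext₀ (assocE E F G).toLinearMap (sodot (sodot m n) p))
  rw [ext_assoc, (isProdOps_tensor _ _).z, (isProdOps_tensor _ _).z, (isProdOps_tensor _ _).z,
    (isProdOps_tensor _ _).z, add_sodot, sodot_add, map_add, map_add, ext_assoc, ext_assoc,
    ext_assoc, add_assoc]

theorem comm_comm_z {E F : GrVec k} (A : Conn E) (B : Conn F) :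
    (ext₀ (commE E F).toLinearMap).restrictScalars k ∘ₗ (A.tensor B).nabla.z =
      (B.tensor A).nabla.z ∘ₗ (ext₀ (commE E F).toLinearMap).restrictScalars k := by
  refine eq_of_sodot fun m n => ?_
  change ext₀ (commE E F).toLinearMap ((A.tensor B).nabla.z (sodot m n)) =
    (B.tensor A).nabla.z (ext₀ (commE E F).toLinearMap (sodot m n))
  rw [ext_comm, (isProdOps_tensor _ _).z, (isProdOps_tensor _ _).z, map_add, ext_comm, ext_comm,
    add_comm]

theorem lid_comm_z {E : GrVec k} (A : Conn E) :
    (ext₀ (lidE E).toLinearMap).restrictScalars k ∘ₗ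
        ((Conn.trivial (GrVec.unit k)).tensor A).nabla.z =
      A.nabla.z ∘ₗ (ext₀ (lidE E).toLinearMap).restrictScalars k := by
  refine eq_of_sodot fun m n => ?_
  change ext₀ (lidE E).toLinearMap (((Conn.trivial (GrVec.unit k)).tensor A).nabla.z (sodot m n)) =
    A.nabla.z (ext₀ (lidE E).toLinearMap (sodot m n))
  induction m using unit_induction with | h r => ?_
  rw [ext_lid, (isProdOps_tensor _ _).z, trivial_z, map_add, ext_lid, nabla_smul_z]
  exact congrArg (· + _) (ext_lid (dz r) n)

theorem rid_comm_z {E : GrVec k} (A : Conn E) :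
    (ext₀ (ridE E).toLinearMap).restrictScalars k ∘ₗ
        (A.tensor (Conn.trivial (GrVec.unit k))).nabla.z =
      A.nabla.z ∘ₗ (ext₀ (ridE E).toLinearMap).restrictScalars k := by
  refine eq_of_sodot fun n m => ?_
  change ext₀ (ridE E).toLinearMap ((A.tensor (Conn.trivial (GrVec.unit k))).nabla.z (sodot n m)) =
    A.nabla.z (ext₀ (ridE E).toLinearMap (sodot n m))
  induction m using unit_induction with | h r => ?_
  rw [ext_rid, (isProdOps_tensor _ _).z, trivial_z, map_add, ext_rid, nabla_smul_z, add_comm]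
  exact congrArg (· + _) (ext_rid (dz r) n)

theorem assoc_comm_u {E F G : GrVec k} (A : Conn E) (B : Conn F) (C : Conn G) :
    (ext₀ (assocE E F G).toLinearMap).restrictScalars k ∘ₗ ((A.tensor B).tensor C).nabla.u =
      (A.tensor (B.tensor C)).nabla.u ∘ₗ (ext₀ (assocE E F G).toLinearMap).restrictScalars k := by
  refine eq_of_sodot₃ fun m n p => ?_
  change ext₀ (assocE E F G).toLinearMap (((A.tensor B).tensor C).nabla.u (sodot (sodot m n) p)) =
    (A.tensor (B.tensor C)).nabla.u (ext₀ (assocE E F G).toLinearMap (sodot (sodot m n) p))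
  rw [ext_assoc, (isProdOps_tensor _ _).u, (isProdOps_tensor _ _).u, (isProdOps_tensor _ _).u,
    (isProdOps_tensor _ _).u, add_sodot, sodot_add, map_add, map_add, ext_assoc, ext_assoc,
    ext_assoc, add_assoc]

theorem comm_comm_u {E F : GrVec k} (A : Conn E) (B : Conn F) :
    (ext₀ (commE E F).toLinearMap).restrictScalars k ∘ₗ (A.tensor B).nabla.u =
      (B.tensor A).nabla.u ∘ₗ (ext₀ (commE E F).toLinearMap).restrictScalars k := by
  refine eq_of_sodot fun m n => ?_
  change ext₀ (commE E F).toLinearMap ((A.tensor B).nabla.u (sodot m n)) =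
    (B.tensor A).nabla.u (ext₀ (commE E F).toLinearMap (sodot m n))
  rw [ext_comm, (isProdOps_tensor _ _).u, (isProdOps_tensor _ _).u, map_add, ext_comm, ext_comm,
    add_comm]

theorem lid_comm_u {E : GrVec k} (A : Conn E) :
    (ext₀ (lidE E).toLinearMap).restrictScalars k ∘ₗ
        ((Conn.trivial (GrVec.unit k)).tensor A).nabla.u =
      A.nabla.u ∘ₗ (ext₀ (lidE E).toLinearMap).restrictScalars k := by
  refine eq_of_sodot fun m n => ?_
  change ext₀ (lidE E).toLinearMap (((Conn.trivial (GrVec.unit k)).tensor A).nabla.u (sodot m n)) =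
    A.nabla.u (ext₀ (lidE E).toLinearMap (sodot m n))
  induction m using unit_induction with | h r => ?_
  rw [ext_lid, (isProdOps_tensor _ _).u, trivial_u, map_add, ext_lid, nabla_smul_u]
  exact congrArg (· + _) (ext_lid (du r) n)

theorem rid_comm_u {E : GrVec k} (A : Conn E) :
    (ext₀ (ridE E).toLinearMap).restrictScalars k ∘ₗ
        (A.tensor (Conn.trivial (GrVec.unit k))).nabla.u =
      A.nabla.u ∘ₗ (ext₀ (ridE E).toLinearMap).restrictScalars k := by
  refine eq_of_sodot fun n m => ?_
  change ext₀ (ridE E).toLinearMap ((A.tensor (Conn.trivial (GrVec.unit k))).nabla.u (sodot n m)) =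
    A.nabla.u (ext₀ (ridE E).toLinearMap (sodot n m))
  induction m using unit_induction with | h r => ?_
  rw [ext_rid, (isProdOps_tensor _ _).u, trivial_u, map_add, ext_rid, nabla_smul_u, add_comm]
  exact congrArg (· + _) (ext_rid (du r) n)

/-- The associativity constraint. -/
def assocIso (X Y Z : EqBundle k) :
    tensorObj (tensorObj X Y) Z ≅ tensorObj X (tensorObj Y Z) :=
  have h : (assocE X.E Y.E Z.E).toLinearMap ∈
        homs (tensorObj (tensorObj X Y) Z) (tensorObj X (tensorObj Y Z)) ∧
      (assocE X.E Y.E Z.E).symm.toLinearMap ∈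
        homs (tensorObj X (tensorObj Y Z)) (tensorObj (tensorObj X Y) Z) := by
    obtain ⟨A, hA⟩ := X.exists_rep
    obtain ⟨B, hB⟩ := Y.exists_rep
    obtain ⟨C, hC⟩ := Z.exists_rep
    exact symm_mem ((hA.tensor hB).tensor hC) (hA.tensor (hB.tensor hC)) (assocE X.E Y.E Z.E)
      (graded_assoc _ _ _) (graded_assoc_symm _ _ _) (assoc_comm_z A B C) (assoc_comm_u A B C)
  mkIso (X := tensorObj (tensorObj X Y) Z) (Y := tensorObj X (tensorObj Y Z))
    (assocE X.E Y.E Z.E) h.1 h.2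

/-- The commutativity constraint. -/
def commIso (X Y : EqBundle k) : tensorObj X Y ≅ tensorObj Y X :=
  have h : (commE X.E Y.E).toLinearMap ∈ homs (tensorObj X Y) (tensorObj Y X) ∧
      (commE X.E Y.E).symm.toLinearMap ∈ homs (tensorObj Y X) (tensorObj X Y) := by
    obtain ⟨A, hA⟩ := X.exists_rep
    obtain ⟨B, hB⟩ := Y.exists_rep
    exact symm_mem (hA.tensor hB) (hB.tensor hA) (commE X.E Y.E) (graded_comm _ _)
      (graded_comm _ _) (comm_comm_z A B) (comm_comm_u A B)
  mkIso (X := tensorObj X Y) (Y := tensorObj Y X) (commE X.E Y.E) h.1 h.2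

/-- The left unit constraint. -/
def lidIso (X : EqBundle k) : tensorObj (tensorUnit k) X ≅ X :=
  have h : (lidE X.E).toLinearMap ∈ homs (tensorObj (tensorUnit k) X) X ∧
      (lidE X.E).symm.toLinearMap ∈ homs X (tensorObj (tensorUnit k) X) := by
    obtain ⟨A, hA⟩ := X.exists_rep
    exact symm_mem (rep_unit.tensor hA) hA (lidE X.E) (graded_lid _) (graded_lid_symm _)
      (lid_comm_z A) (lid_comm_u A)
  mkIso (X := tensorObj (tensorUnit k) X) (Y := X) (lidE X.E) h.1 h.2

/-- The right unit constraint. -/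
def ridIso (X : EqBundle k) : tensorObj X (tensorUnit k) ≅ X :=
  have h : (ridE X.E).toLinearMap ∈ homs (tensorObj X (tensorUnit k)) X ∧
      (ridE X.E).symm.toLinearMap ∈ homs X (tensorObj X (tensorUnit k)) := by
    obtain ⟨A, hA⟩ := X.exists_rep
    exact symm_mem (hA.tensor rep_unit) hA (ridE X.E) (graded_rid _) (graded_rid_symm _)
      (rid_comm_z A) (rid_comm_u A)
  mkIso (X := tensorObj X (tensorUnit k)) (Y := X) (ridE X.E) h.1 h.2

instance : MonoidalCategoryStruct (EqBundle k) where
  tensorObj := tensorObj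
  whiskerLeft X _ _ f := ⟨TensorProduct.map LinearMap.id f.1, map_mem (id_mem X) f.2⟩
  whiskerRight f Y := ⟨TensorProduct.map f.1 LinearMap.id, map_mem f.2 (id_mem Y)⟩
  tensorHom f g := ⟨TensorProduct.map f.1 g.1, map_mem f.2 g.2⟩
  tensorUnit := tensorUnit k
  associator := assocIso
  leftUnitor := lidIso
  rightUnitor := ridIso

variable (k) in
/-- The functor `ω` identifies the operations on both sides. -/
def inducing : Monoidal.InducingFunctorData (omega k) where
  μIso _ _ := Iso.refl _
  εIso := Iso.refl _
  whiskerLeft_eq _ _ _ _ := rfl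
  whiskerRight_eq _ _ := rfl
  tensorHom_eq _ _ := rfl
  associator_eq X Y Z := FGModuleCat.hom_ext (TensorProduct.ext_threefold fun _ _ _ => rfl)
  leftUnitor_eq X := FGModuleCat.hom_ext (TensorProduct.ext' fun _ _ => rfl)
  rightUnitor_eq X := FGModuleCat.hom_ext (TensorProduct.ext' fun _ _ => rfl)

instance : MonoidalCategory (EqBundle k) := Monoidal.induced (omega k) (inducing k)

instance : (omega k).Monoidal := Monoidal.fromInducedMonoidal (omega k) (inducing k)

instance : BraidedCategory (EqBundle k) :=
  BraidedCategory.ofFaithful (omega k) commIso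
    (fun _ _ => FGModuleCat.hom_ext (TensorProduct.ext' fun _ _ => rfl))

instance : (omega k).Braided where
  braided X Y := FGModuleCat.hom_ext (TensorProduct.ext' fun _ _ => rfl)

instance : SymmetricCategory (EqBundle k) := SymmetricCategory.ofFaithful (omega k)

end EqBundle

end Category

end Equising

namespace Equising

/-! ### The Hopf algebra `H_u` -/

section HopfAlgebra

variable (k : Type u) [Field k]

/-- The space of noncommutative polynomials in variables `f_n`, `n > 0`, with basis the words in the
`f_n`. With the structure below this is the graded dual of the enveloping algebra of the free Lie
algebra on generators `e_{-n}`, `n > 0`, the basis of words being dual to the basis of the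
monomials in the `e_{-n}`. -/
def Hu : Type u := List ℕ+ →₀ k

namespace Hu

instance : AddCommGroup (Hu k) := inferInstanceAs (AddCommGroup (List ℕ+ →₀ k))
instance : Module k (Hu k) := inferInstanceAs (Module k (List ℕ+ →₀ k))

variable {k}

/-- The word `w` as an element of `H_u`. -/
def word (w : List ℕ+) : Hu k := Finsupp.single w 1

/-- The linear map with prescribed values on words. -/
def lift {M : Type*} [AddCommGroup M] [Module k M] (f : List ℕ+ → M) : Hu k →ₗ[k] M :=
  Finsupp.linearCombination k f

@[simp] theorem lift_word {M : Type*} [AddCommGroup M] [Module k M] (f : List ℕ+ → M)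
    (w : List ℕ+) : lift f (word (k := k) w) = f w :=
  (Finsupp.linearCombination_single k 1 w).trans (one_smul k _)

theorem hom_ext {M : Type*} [AddCommGroup M] [Module k M] {f g : Hu k →ₗ[k] M}
    (h : ∀ w, f (word w) = g (word w)) : f = g :=
  Finsupp.lhom_ext' fun w => LinearMap.ext_ring (h w)

@[elab_as_elim]
theorem induction {p : Hu k → Prop} (x : Hu k) (h : ∀ w, p (word w)) (h₀ : p 0)
    (h₂ : ∀ x y, p x → p y → p (x + y)) (h₃ : ∀ (c : k) x, p x → p (c • x)) : p x := by
  refine Finsupp.induction_linear (motive := p) x h₀ h₂ fun w c => ?_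
  have : (Finsupp.single w c : List ℕ+ →₀ k) = c • Finsupp.single w 1 :=
    (Finsupp.smul_single_one w c).symm
  rw [this]
  exact h₃ c _ (h w)

/-- Prepend a letter to all words. -/
def cons (a : ℕ+) : Hu k →ₗ[k] Hu k := lift fun w => word (a :: w)

/-- Append a letter to all words. -/
def snoc (a : ℕ+) : Hu k →ₗ[k] Hu k := lift fun w => word (w ++ [a])

@[simp] theorem cons_word (a : ℕ+) (w : List ℕ+) : cons a (word (k := k) w) = word (a :: w) :=
  lift_word _ _

@[simp] theorem snoc_word (a : ℕ+) (w : List ℕ+) : snoc a (word (k := k) w) = word (w ++ [a]) :=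
  lift_word _ _

/-- The shuffle product of two words. -/
def shuffle : List ℕ+ → List ℕ+ → Hu k
  | [], w => word w
  | a :: v, [] => word (a :: v)
  | a :: v, b :: w => cons a (shuffle v (b :: w)) + cons b (shuffle (a :: v) w)
termination_by v w => v.length + w.length

theorem nil_shuffle (w : List ℕ+) : shuffle [] w = word (k := k) w := by
  rw [shuffle]

theorem shuffle_nil (w : List ℕ+) : shuffle w [] = word (k := k) w := by
  cases w <;> rw [shuffle]

theorem cons_shuffle_cons (a b : ℕ+) (v w : List ℕ+) : shuffle (k := k) (a :: v) (b :: w) =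
    cons a (shuffle v (b :: w)) + cons b (shuffle (a :: v) w) := by
  rw [shuffle]

theorem shuffle_comm : ∀ v w : List ℕ+, shuffle (k := k) v w = shuffle w v
  | [], w => by rw [nil_shuffle, shuffle_nil]
  | a :: v, [] => by rw [nil_shuffle, shuffle_nil]
  | a :: v, b :: w => by
    rw [cons_shuffle_cons, cons_shuffle_cons, shuffle_comm v (b :: w), shuffle_comm (a :: v) w,
      add_comm]
termination_by v w => v.length + w.length

/-- The shuffle product. -/
def mul : Hu k →ₗ[k] Hu k →ₗ[k] Hu k := lift fun v => lift fun w => shuffle v w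

instance : Mul (Hu k) := ⟨fun x y => mul x y⟩
instance : One (Hu k) := ⟨word []⟩

theorem mul_def (x y : Hu k) : x * y = mul x y := rfl
theorem one_def : (1 : Hu k) = word [] := rfl

theorem word_mul (v w : List ℕ+) : word (k := k) v * word w = shuffle v w := by
  simp [mul_def, mul]

theorem add_mul' (x y z : Hu k) : (x + y) * z = x * z + y * z := by simp [mul_def]
theorem mul_add' (x y z : Hu k) : x * (y + z) = x * y + x * z := by simp [mul_def]
theorem smul_mul' (c : k) (x y : Hu k) : (c • x) * y = c • (x * y) := by simp [mul_def]
theorem mul_smul' (c : k) (x y : Hu k) : x * (c • y) = c • (x * y) := by simp [mul_def]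
theorem zero_mul' (x : Hu k) : 0 * x = 0 := by simp [mul_def]
theorem mul_zero' (x : Hu k) : x * 0 = 0 := by simp [mul_def]

theorem mul_comm' (x y : Hu k) : x * y = y * x := by
  have : mul (k := k) = mul.flip := hom_ext fun v => hom_ext fun w => by
    simpa [mul] using shuffle_comm v w
  exact LinearMap.congr_fun (LinearMap.congr_fun this x) y

theorem one_mul' (x : Hu k) : 1 * x = x := by
  have : mul (k := k) 1 = LinearMap.id := hom_ext fun w => by
    simp [mul, one_def, nil_shuffle]
  exact LinearMap.congr_fun this x

theorem cons_mul_cons (a b : ℕ+) (x y : Hu k) :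
    cons a x * cons b y = cons a (x * cons b y) + cons b (cons a x * y) := by
  induction x using induction with
  | h₀ => simp only [map_zero, zero_mul', add_zero]
  | h₂ x x' hx hx' => simp only [map_add, add_mul', hx, hx']; abel
  | h₃ c x hx => simp only [map_smul, smul_mul', hx, smul_add]
  | h v =>
    induction y using induction with
    | h₀ => simp only [map_zero, mul_zero', add_zero]
    | h₂ x x' hx hx' => simp only [map_add, mul_add', hx, hx']; abel
    | h₃ c x hx => simp only [map_smul, mul_smul', hx, smul_add]
    | h w => simp only [cons_word, word_mul, cons_shuffle_cons]

theorem word_cons (a : ℕ+) (w : List ℕ+) : word (k := k) (a :: w) = cons a (word w) :=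
  (cons_word a w).symm

theorem mul_assoc_word : ∀ u v w : List ℕ+,
    word (k := k) u * word v * word w = word u * (word v * word w)
  | [], v, w => by rw [← one_def, one_mul', one_mul']
  | a :: u, [], w => by rw [← one_def, one_mul', mul_comm' _ 1, one_mul']
  | a :: u, b :: v, [] => by rw [← one_def, mul_comm' _ 1, one_mul', mul_comm' _ 1, one_mul']
  | a :: u, b :: v, c :: w => by
    have h1 := mul_assoc_word u (b :: v) (c :: w)
    have h2 := mul_assoc_word (a :: u) v (c :: w)
    have h3 := mul_assoc_word (a :: u) (b :: v) w
    simp only [word_cons] at h1 h2 h3 ⊢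
    have e := cons_mul_cons a b (word (k := k) u) (word v * cons c (word w))
    have e' := cons_mul_cons a c (word (k := k) u) (cons b (word v) * word w)
    have e'' : cons c (cons a (word (k := k) u) * (cons b (word v) * word w)) =
        cons c (cons a (word u * cons b (word v)) * word w) +
          cons c (cons b (cons a (word u) * word v) * word w) := by
      rw [← h3, cons_mul_cons a b, add_mul', map_add]
    rw [cons_mul_cons a b, add_mul', cons_mul_cons a c _ (word w), cons_mul_cons b c _ (word w), h1,
      h2, cons_mul_cons b c (word v) (word w)]
    simp only [mul_add', map_add, e, e', e'']
    abel
termination_by u v w => u.length + v.length + w.length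

theorem mul_assoc' (x y z : Hu k) : x * y * z = x * (y * z) := by
  induction x using induction with
  | h₀ => simp only [zero_mul']
  | h₂ x x' hx hx' => simp only [add_mul', hx, hx']
  | h₃ c x hx => simp only [smul_mul', hx]
  | h u =>
    induction y using induction with
    | h₀ => simp only [zero_mul', mul_zero']
    | h₂ x x' hx hx' => simp only [add_mul', mul_add', hx, hx']
    | h₃ c x hx => simp only [smul_mul', mul_smul', hx]
    | h v =>
      induction z using induction with
      | h₀ => simp only [mul_zero']
      | h₂ x x' hx hx' => simp only [mul_add', hx, hx']
      | h₃ c x hx => simp only [mul_smul', hx]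
      | h w => exact mul_assoc_word u v w

instance : CommRing (Hu k) where
  __ := (inferInstance : AddCommGroup (Hu k))
  left_distrib := mul_add'
  right_distrib := add_mul'
  zero_mul := zero_mul'
  mul_zero := mul_zero'
  mul_assoc := mul_assoc'
  one_mul := one_mul'
  mul_one x := by rw [mul_comm', one_mul']
  mul_comm := mul_comm'

instance : Algebra k (Hu k) := Algebra.ofModule smul_mul' mul_smul'

/-! ### The coproduct -/

/-- The deconcatenation of words. -/
def deconc : List ℕ+ → Hu k ⊗[k] Hu k
  | [] => 1 ⊗ₜ 1
  | a :: w => 1 ⊗ₜ word (a :: w) + (cons a).rTensor (Hu k) (deconc w)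

/-- The coproduct, `Δ(w) = ∑_{w = w'w''} w' ⊗ w''`. -/
def comul : Hu k →ₗ[k] Hu k ⊗[k] Hu k := lift deconc

/-- The counit. -/
def counit : Hu k →ₗ[k] k := lift fun w => if w = [] then 1 else 0

@[simp] theorem comul_one' : comul (1 : Hu k) = 1 ⊗ₜ 1 := by simp [comul, one_def, deconc]

@[simp] theorem counit_one' : counit (1 : Hu k) = 1 := by simp [counit, one_def]

@[simp] theorem counit_cons (a : ℕ+) (x : Hu k) : counit (cons a x) = 0 := by
  have : counit ∘ₗ cons (k := k) a = 0 := hom_ext fun w => by simp [counit]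
  exact LinearMap.congr_fun this x

theorem comul_cons (a : ℕ+) (x : Hu k) :
    comul (cons a x) = 1 ⊗ₜ cons a x + (cons a).rTensor (Hu k) (comul x) := by
  have : comul ∘ₗ cons (k := k) a = TensorProduct.mk k _ _ 1 ∘ₗ cons a +
      (cons a).rTensor (Hu k) ∘ₗ comul := hom_ext fun w => by simp [comul, deconc]
  exact LinearMap.congr_fun this x

/-- Induction on the length of words. -/
theorem cons_ext {M : Type*} [AddCommGroup M] [Module k M] {f g : Hu k →ₗ[k] M}
    (h₁ : f 1 = g 1) (h : ∀ a w, f (word w) = g (word w) → f (cons a (word w)) =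
      g (cons a (word w))) : f = g := by
  refine hom_ext fun w => ?_
  induction w with
  | nil => exact h₁
  | cons a w ih => rw [word_cons]; exact h a w ih

set_option synthInstance.maxHeartbeats 200000 in
instance : Coalgebra k (Hu k) where
  comul := comul
  counit := counit
  coassoc := by
    refine cons_ext ?_ fun a w ih => ?_
    · simp only [LinearMap.comp_apply, comul_one', LinearMap.rTensor_tmul, LinearMap.lTensor_tmul,
        LinearEquiv.coe_coe, TensorProduct.assoc_tmul]
    · have h1 (t : Hu k ⊗[k] Hu k) :
          TensorProduct.assoc k _ _ _ (comul.rTensor (Hu k) ((cons a).rTensor (Hu k) t)) =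
            1 ⊗ₜ (cons a).rTensor (Hu k) t + (cons a).rTensor (Hu k ⊗[k] Hu k)
              (TensorProduct.assoc k _ _ _ (comul.rTensor (Hu k) t)) := by
        induction t using TensorProduct.induction_on with
        | zero => simp
        | add x y hx hy => simp only [map_add, hx, hy, TensorProduct.tmul_add]; abel
        | tmul x y =>
          simp only [LinearMap.rTensor_tmul, comul_cons, TensorProduct.add_tmul, map_add,
            TensorProduct.assoc_tmul]
          congr 1
          generalize comul x = s
          induction s using TensorProduct.induction_on with
          | zero => simp
          | add p q hp hq => simp only [map_add, TensorProduct.add_tmul, hp, hq]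
          | tmul p q => simp
      have h2 (t : Hu k ⊗[k] Hu k) :
          comul.lTensor (Hu k) ((cons a).rTensor (Hu k) t) =
            (cons a).rTensor (Hu k ⊗[k] Hu k) (comul.lTensor (Hu k) t) := by
        induction t using TensorProduct.induction_on with
        | zero => simp
        | add x y hx hy => simp only [map_add, hx, hy]
        | tmul x y => simp
      simp only [LinearMap.comp_apply, LinearEquiv.coe_coe] at ih ⊢
      rw [comul_cons, map_add, map_add, map_add, h1, h2, ih]
      simp only [LinearMap.rTensor_tmul, LinearMap.lTensor_tmul, comul_one', comul_cons,
        TensorProduct.assoc_tmul, TensorProduct.tmul_add]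
      abel
  rTensor_counit_comp_comul := by
    refine cons_ext ?_ fun a w ih => ?_
    · simp
    · have (t : Hu k ⊗[k] Hu k) : counit.rTensor (Hu k) ((cons a).rTensor (Hu k) t) = 0 := by
        induction t using TensorProduct.induction_on with
        | zero => simp
        | add x y hx hy => simp only [map_add, hx, hy, add_zero]
        | tmul x y => simp
      simp only [LinearMap.comp_apply, comul_cons, map_add, this]
      simp
  lTensor_counit_comp_comul := by
    refine cons_ext ?_ fun a w ih => ?_
    · simp
    · have (t : Hu k ⊗[k] Hu k) : counit.lTensor (Hu k) ((cons a).rTensor (Hu k) t) =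
          (cons a).rTensor k (counit.lTensor (Hu k) t) := by
        induction t using TensorProduct.induction_on with
        | zero => simp
        | add x y hx hy => simp only [map_add, hx, hy]
        | tmul x y => simp
      rw [LinearMap.comp_apply] at ih ⊢
      rw [comul_cons, map_add, this, ih]
      simp only [LinearMap.lTensor_tmul, counit_cons, TensorProduct.tmul_zero, zero_add]
      simp

theorem counit_mul' (x y : Hu k) : counit (x * y) = counit x * counit y := by
  have : (LinearMap.mul k (Hu k)).compr₂ counit =
      (LinearMap.mul k k).compl₁₂ counit (counit (k := k)) := by
    refine hom_ext fun v => hom_ext fun w => ?_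
    simp only [LinearMap.compr₂_apply, LinearMap.mul_apply', LinearMap.compl₁₂_apply]
    cases v with
    | nil => rw [← one_def, one_mul, counit_one', one_mul]
    | cons a v =>
      cases w with
      | nil => rw [← one_def, mul_one, counit_one', mul_one]
      | cons b w => rw [word_cons, word_cons, cons_mul_cons, map_add, counit_cons, counit_cons,
        counit_cons, add_zero, zero_mul]
  exact LinearMap.congr_fun (LinearMap.congr_fun this x) y

theorem rTensor_cons_mul (a b : ℕ+) (s t : Hu k ⊗[k] Hu k) :
    (cons a).rTensor (Hu k) s * (cons b).rTensor (Hu k) t =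
      (cons a).rTensor (Hu k) (s * (cons b).rTensor (Hu k) t) +
        (cons b).rTensor (Hu k) ((cons a).rTensor (Hu k) s * t) := by
  induction s using TensorProduct.induction_on with
  | zero => simp
  | add x y hx hy => simp only [map_add, add_mul, hx, hy]; abel
  | tmul x y =>
    induction t using TensorProduct.induction_on with
    | zero => simp
    | add x y hx hy => simp only [map_add, mul_add, hx, hy]; abel
    | tmul x' y' =>
      simp only [LinearMap.rTensor_tmul, Algebra.TensorProduct.tmul_mul_tmul, cons_mul_cons,
        TensorProduct.add_tmul]

theorem rTensor_cons_mul_tmul (a : ℕ+) (s : Hu k ⊗[k] Hu k) (y : Hu k) :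
    (cons a).rTensor (Hu k) s * (1 ⊗ₜ y) = (cons a).rTensor (Hu k) (s * (1 ⊗ₜ y)) := by
  induction s using TensorProduct.induction_on with
  | zero => simp
  | add x y hx hy => simp only [map_add, add_mul, hx, hy]
  | tmul x y => simp

theorem comul_mul_word : ∀ v w : List ℕ+,
    comul (word (k := k) v * word w) = comul (word v) * comul (word w)
  | [], w => by
    rw [← one_def, one_mul, comul_one', ← Algebra.TensorProduct.one_def, one_mul]
  | a :: v, [] => by
    rw [← one_def, mul_one, comul_one', ← Algebra.TensorProduct.one_def, mul_one]
  | a :: v, b :: w => by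
    have h1 := comul_mul_word v (b :: w)
    have h2 := comul_mul_word (a :: v) w
    simp only [word_cons] at h1 h2 ⊢
    rw [cons_mul_cons, map_add, comul_cons a (word v * _), comul_cons b (_ * word w), h1, h2,
      comul_cons a (word v), comul_cons b (word w)]
    generalize comul (word (k := k) v) = s
    generalize comul (word (k := k) w) = t
    have e1 : (1 : Hu k) ⊗ₜ[k] cons a (word (k := k) v) * (1 ⊗ₜ[k] cons b (word w)) =
        1 ⊗ₜ[k] cons a (word v * cons b (word w)) + 1 ⊗ₜ[k] cons b (cons a (word v) * word w) := by
      rw [Algebra.TensorProduct.tmul_mul_tmul, one_mul, cons_mul_cons, TensorProduct.tmul_add]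
    have e2 := rTensor_cons_mul_tmul a s (cons b (word w))
    have e3 := rTensor_cons_mul_tmul b t (cons a (word v))
    rw [mul_comm ((cons b).rTensor (Hu k) t), mul_comm t] at e3
    simp only [mul_add, add_mul, map_add, e1, e2, e3, rTensor_cons_mul]
    abel
termination_by v w => v.length + w.length

theorem comul_mul' (x y : Hu k) : comul (x * y) = comul x * comul y := by
  have : (LinearMap.mul k (Hu k)).compr₂ comul =
      (LinearMap.mul k (Hu k ⊗[k] Hu k)).compl₁₂ comul comul :=
    hom_ext fun v => hom_ext fun w => comul_mul_word v w
  exact LinearMap.congr_fun (LinearMap.congr_fun this x) y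

instance : Bialgebra k (Hu k) :=
  Bialgebra.mk' k (Hu k) counit_one' (counit_mul' _ _) comul_one' (comul_mul' _ _)

/-! ### The antipode -/

theorem snoc_cons (a b : ℕ+) (x : Hu k) : snoc b (cons a x) = cons a (snoc b x) := by
  have : snoc b ∘ₗ cons (k := k) a = cons a ∘ₗ snoc b := hom_ext fun w => by simp
  exact LinearMap.congr_fun this x

theorem snoc_shuffle_snoc (a b : ℕ+) : ∀ v w : List ℕ+,
    shuffle (k := k) (v ++ [a]) (w ++ [b]) =
      snoc a (shuffle v (w ++ [b])) + snoc b (shuffle (v ++ [a]) w)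
  | [], [] => by
    simp only [List.nil_append, cons_shuffle_cons, nil_shuffle, shuffle_nil, cons_word, snoc_word]
    simp [add_comm]
  | [], d :: w => by
    have h := snoc_shuffle_snoc a b [] w
    simp only [List.nil_append, nil_shuffle, snoc_word] at h
    simp only [List.nil_append, List.cons_append, cons_shuffle_cons, nil_shuffle, cons_word, h,
      map_add, snoc_word, snoc_cons]
    abel
  | c :: v, [] => by
    have h := snoc_shuffle_snoc a b v []
    simp only [List.nil_append, shuffle_nil, snoc_word] at h
    simp only [List.nil_append, List.cons_append, cons_shuffle_cons, shuffle_nil, cons_word, h,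
      map_add, snoc_word, snoc_cons]
    abel
  | c :: v, d :: w => by
    have h1 := snoc_shuffle_snoc a b v (d :: w)
    have h2 := snoc_shuffle_snoc a b (c :: v) w
    simp only [List.cons_append] at h1 h2
    simp only [List.cons_append, cons_shuffle_cons, h1, h2, map_add, snoc_cons]
    abel
termination_by v w => v.length + w.length

/-- The antipode, `S(w) = (-1)^{|w|} w^{op}`. -/
def antipode : Hu k →ₗ[k] Hu k := lift fun w => (-1 : k) ^ w.length • word w.reverse

@[simp] theorem antipode_one' : antipode (1 : Hu k) = 1 := by simp [antipode, one_def]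

theorem antipode_word (w : List ℕ+) :
    antipode (word (k := k) w) = (-1 : k) ^ w.length • word w.reverse := by simp [antipode]

theorem antipode_cons (a : ℕ+) (x : Hu k) : antipode (cons a x) = -snoc a (antipode x) := by
  have : antipode ∘ₗ cons (k := k) a = -(snoc a ∘ₗ antipode) := hom_ext fun w => by
    simp [antipode, pow_succ]
  exact LinearMap.congr_fun this x

theorem antipode_antipode (x : Hu k) : antipode (antipode x) = x := by
  have : antipode ∘ₗ antipode (k := k) = LinearMap.id := hom_ext fun w => by
    simp [antipode, smul_smul, ← mul_pow]
  exact LinearMap.congr_fun this x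

theorem snoc_mul_snoc (a b : ℕ+) (x y : Hu k) :
    snoc a x * snoc b y = snoc a (x * snoc b y) + snoc b (snoc a x * y) := by
  induction x using induction with
  | h₀ => simp only [map_zero, zero_mul, add_zero]
  | h₂ x x' hx hx' => simp only [map_add, add_mul, hx, hx']; abel
  | h₃ c x hx => simp only [map_smul, smul_mul', hx, smul_add]
  | h v =>
    induction y using induction with
    | h₀ => simp only [map_zero, mul_zero, add_zero]
    | h₂ x x' hx hx' => simp only [map_add, mul_add, hx, hx']; abel
    | h₃ c x hx => simp only [map_smul, mul_smul', hx, smul_add]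
    | h w => simp only [snoc_word, word_mul, snoc_shuffle_snoc]

theorem antipode_mul_word : ∀ v w : List ℕ+,
    antipode (word (k := k) v * word w) = antipode (word v) * antipode (word w)
  | [], w => by rw [← one_def, one_mul, antipode_one', one_mul]
  | a :: v, [] => by rw [← one_def, mul_one, antipode_one', mul_one]
  | a :: v, b :: w => by
    have h1 := antipode_mul_word v (b :: w)
    have h2 := antipode_mul_word (a :: v) w
    simp only [word_cons] at h1 h2 ⊢
    rw [cons_mul_cons, map_add, antipode_cons a (word v * _), antipode_cons b (_ * word w), h1, h2,
      antipode_cons, antipode_cons, neg_mul_neg, snoc_mul_snoc, mul_neg, neg_mul, map_neg, map_neg,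
      neg_neg, neg_neg]
termination_by v w => v.length + w.length

theorem antipode_mul' (x y : Hu k) : antipode (x * y) = antipode x * antipode y := by
  have : (LinearMap.mul k (Hu k)).compr₂ antipode =
      (LinearMap.mul k (Hu k)).compl₁₂ antipode antipode :=
    hom_ext fun v => hom_ext fun w => antipode_mul_word v w
  exact LinearMap.congr_fun (LinearMap.congr_fun this x) y

/-- Append the word `p` to all words. -/
def app (p : List ℕ+) : Hu k →ₗ[k] Hu k := lift fun w => word (w ++ p)

theorem app_antipode (c : ℕ+) (p v : List ℕ+) :
    LinearMap.mul' k (Hu k) ((app (c :: p) ∘ₗ antipode).rTensor (Hu k) (comul (word v))) =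
      cons c (word p * word v) := by
  induction v generalizing c p with
  | nil =>
    rw [← one_def, comul_one']
    simp only [LinearMap.rTensor_tmul, LinearMap.comp_apply, antipode_one',
      LinearMap.mul'_apply, mul_one]
    simp [app, one_def]
  | cons d v ih =>
    have h (t : Hu k ⊗[k] Hu k) :
        (app (c :: p) ∘ₗ antipode).rTensor (Hu k) ((cons d).rTensor (Hu k) t) =
          -(app (d :: c :: p) ∘ₗ antipode).rTensor (Hu k) t := by
      rw [← LinearMap.comp_apply, ← LinearMap.rTensor_comp, ← LinearMap.neg_apply,
        ← LinearMap.rTensor_neg]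
      congr 2
      refine hom_ext fun w => ?_
      simp [antipode, app, pow_succ]
    have h' := congrArg (LinearMap.mul' k (Hu k)) (h (comul (word v)))
    rw [LinearMap.map_neg, ih] at h'
    have : app (c :: p) (1 : Hu k) = cons c (word p) := by simp [app, one_def]
    rw [word_cons, comul_cons, LinearMap.map_add, LinearMap.map_add, h']
    simp only [LinearMap.rTensor_tmul, LinearMap.comp_apply, antipode_one', LinearMap.mul'_apply]
    rw [this, cons_mul_cons, word_cons]
    abel

theorem mul_antipode_left (x : Hu k) :
    LinearMap.mul' k (Hu k) (antipode.rTensor (Hu k) (comul x)) = algebraMap k _ (counit x) := by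
  have : LinearMap.mul' k (Hu k) ∘ₗ antipode.rTensor (Hu k) ∘ₗ comul =
      Algebra.linearMap k (Hu k) ∘ₗ counit := by
    refine cons_ext ?_ fun a w _ => ?_
    · simp
    · have h (t : Hu k ⊗[k] Hu k) : antipode.rTensor (Hu k) ((cons a).rTensor (Hu k) t) =
          -(app [a] ∘ₗ antipode).rTensor (Hu k) t := by
        rw [← LinearMap.comp_apply, ← LinearMap.rTensor_comp, ← LinearMap.neg_apply,
          ← LinearMap.rTensor_neg]
        congr 2
        refine hom_ext fun w => ?_
        simp [antipode, app, pow_succ]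
      have h' := congrArg (LinearMap.mul' k (Hu k)) (h (comul (word w)))
      rw [LinearMap.map_neg, app_antipode, ← one_def, one_mul] at h'
      rw [LinearMap.comp_apply, LinearMap.comp_apply, LinearMap.comp_apply, comul_cons,
        LinearMap.map_add, LinearMap.map_add, h', LinearMap.rTensor_tmul, antipode_one',
        LinearMap.mul'_apply, one_mul, counit_cons, LinearMap.map_zero, add_neg_cancel]
  exact LinearMap.congr_fun this x

theorem mul_antipode_right (x : Hu k) :
    LinearMap.mul' k (Hu k) (antipode.lTensor (Hu k) (comul x)) = algebraMap k _ (counit x) := by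
  have h (t : Hu k ⊗[k] Hu k) : LinearMap.mul' k (Hu k) (antipode.lTensor (Hu k) t) =
      antipode (LinearMap.mul' k (Hu k) (antipode.rTensor (Hu k) t)) := by
    induction t using TensorProduct.induction_on with
    | zero => simp
    | add x y hx hy => simp only [map_add, hx, hy]
    | tmul x y => simp [antipode_mul', antipode_antipode]
  rw [h, mul_antipode_left, Algebra.algebraMap_eq_smul_one, map_smul, antipode_one']

instance : HopfAlgebra k (Hu k) where
  antipode := antipode
  mul_antipode_rTensor_comul := LinearMap.ext mul_antipode_left
  mul_antipode_lTensor_comul := LinearMap.ext mul_antipode_right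

end Hu

end HopfAlgebra

end Equising

namespace Equising

/-! ### Duality between `H_u` and the enveloping algebra of the free Lie algebra -/

section Duality

variable {k : Type u} [Field k]

namespace Hu

/-- The linear functional on `H_u` dual to the word `w`. -/
def coeff (w : List ℕ+) : Hu k →ₗ[k] k := Finsupp.lapply w

theorem coeff_word (v w : List ℕ+) : coeff v (word (k := k) w) = if w = v then 1 else 0 :=
  Finsupp.single_apply

theorem coeff_cons (n a : ℕ+) (x : Hu k) :
    coeff [n] (cons a x) = (if a = n then (1 : k) else 0) * counit x := by
  have : coeff (k := k) [n] ∘ₗ cons a = (if a = n then (1 : k) else 0) • counit := by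
    refine hom_ext fun w => ?_
    have hc : counit (word (k := k) w) = if w = [] then (1 : k) else 0 := lift_word _ _
    rw [LinearMap.comp_apply, cons_word, coeff_word, LinearMap.smul_apply, hc]
    by_cases h : a = n <;> by_cases h' : w = [] <;> simp [h, h']
  exact LinearMap.congr_fun this x

/-- The functional dual to the word `f_n` is primitive. -/
theorem coeff_mul (n : ℕ+) (x y : Hu k) :
    coeff [n] (x * y) = counit x * coeff [n] y + coeff [n] x * counit y := by
  have h1 : coeff (k := k) [n] (1 : Hu k) = 0 := by rw [one_def, coeff_word]; simp
  have hc (a b : ℕ+) (z z' : Hu k) : coeff [n] (cons a (z * cons b z')) = 0 := by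
    rw [coeff_cons, counit_mul', counit_cons, mul_zero, mul_zero]
  have : (LinearMap.mul k (Hu k)).compr₂ (coeff [n]) =
      (LinearMap.mul k k).compl₁₂ counit (coeff [n]) +
        (LinearMap.mul k k).compl₁₂ (coeff [n]) (counit (k := k)) := by
    refine hom_ext fun v => hom_ext fun w => ?_
    simp only [LinearMap.compr₂_apply, LinearMap.mul_apply', LinearMap.compl₁₂_apply,
      LinearMap.add_apply]
    cases v with
    | nil => rw [← one_def, one_mul, counit_one', one_mul, h1, zero_mul, add_zero]
    | cons a v =>
      cases w with
      | nil => rw [← one_def, mul_one, counit_one', mul_one, h1, mul_zero, zero_add]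
      | cons b w =>
        rw [word_cons, word_cons, cons_mul_cons, map_add, hc, counit_cons, counit_cons,
          mul_comm (cons a (word v)) (word w), hc]
        simp
  exact LinearMap.congr_fun (LinearMap.congr_fun this x) y

variable (k) in
/-- The algebra homomorphism from the enveloping algebra of the free Lie algebra on generators
`e_{-n}`, `n > 0`, to the algebra of linear functionals on the coalgebra `H_u` sending `e_{-n}` to the
functional dual to `f_n`. -/
def duality : UniversalEnvelopingAlgebra k (FreeLieAlgebra k ℕ+) →ₐ[k]
    WithConv (Hu k →ₗ[k] k) :=
  (FreeAlgebra.lift k fun n => WithConv.toConv (coeff [n])).comp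
    (FreeLieAlgebra.universalEnvelopingEquivFreeAlgebra k ℕ+).toAlgHom

/-- The monomial `e_{-n_1} ⋯ e_{-n_r}` in the enveloping algebra. -/
def monomial (w : List ℕ+) : UniversalEnvelopingAlgebra k (FreeLieAlgebra k ℕ+) :=
  (w.map fun n => UniversalEnvelopingAlgebra.ι k (FreeLieAlgebra.of k n)).prod

/-- The monomials in the `e_{-n}` are the dual basis to the basis of words. -/
theorem duality_monomial (w : List ℕ+) (x : Hu k) :
    (duality k (monomial w)).ofConv x = coeff w x := by
  have hgen (n : ℕ+) : duality k (UniversalEnvelopingAlgebra.ι k (FreeLieAlgebra.of k n)) =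
      WithConv.toConv (coeff [n]) := by simp [duality]
  suffices h : (duality k (monomial w)).ofConv = coeff w by rw [h]
  induction w with
  | nil =>
    refine hom_ext fun v => ?_
    have : duality k (monomial (k := k) []) = 1 := by simp [monomial]
    rw [this, coeff_word]
    change algebraMap k k (counit (word v)) = _
    simp [counit]
  | cons a w ih =>
    have hm : monomial (k := k) (a :: w) =
        UniversalEnvelopingAlgebra.ι k (FreeLieAlgebra.of k a) * monomial w := by simp [monomial]
    rw [hm, map_mul, hgen]
    refine hom_ext fun v => ?_
    change LinearMap.mul' k k (TensorProduct.map (coeff [a]) (duality k (monomial w)).ofConv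
      (comul (word v))) = _
    rw [ih]
    cases v with
    | nil =>
      rw [← one_def, comul_one']
      simp [one_def, coeff_word]
    | cons b v =>
      have h (t : Hu k ⊗[k] Hu k) : LinearMap.mul' k k (TensorProduct.map (coeff [a]) (coeff w)
          ((cons b).rTensor (Hu k) t)) = (if b = a then (1 : k) else 0) *
            coeff w (TensorProduct.lid k _ (counit.rTensor (Hu k) t)) := by
        induction t using TensorProduct.induction_on with
        | zero => simp
        | add x y hx hy => simp only [map_add, hx, hy, mul_add]
        | tmul x y =>
          simp only [LinearMap.rTensor_tmul, TensorProduct.map_tmul, LinearMap.mul'_apply, coeff_cons,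
            TensorProduct.lid_tmul, map_smul, smul_eq_mul, mul_assoc]
      have hcounit : counit.rTensor (Hu k) (comul (word v)) = 1 ⊗ₜ[k] word v :=
        Coalgebra.rTensor_counit_comul (R := k) (word v)
      rw [word_cons, comul_cons, map_add, map_add, h, hcounit, TensorProduct.map_tmul,
        LinearMap.mul'_apply, cons_word, one_def, coeff_word, coeff_word, TensorProduct.lid_tmul,
        one_smul, coeff_word, coeff_word]
      by_cases h1 : b = a <;> by_cases h2 : v = w <;> simp [h1, h2]

end Hu

end Duality

end Equising

namespace Equising

/-! ### The affine group schemes `U` and `U* = U ⋊ 𝔾ₘ` -/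

section GroupScheme

variable (k : Type u) [Field k] (A B C : Type u) [CommRing A] [Algebra k A] [CommRing B]
  [Algebra k B] [CommRing C] [Algebra k C]

/-- The group `U(A)` of `A`-points of `U = Spec H_u`: the algebra homomorphisms `H_u → A` with the
convolution product. -/
def UPts : Type u := WithConv (Hu k →ₐ[k] A)

instance : Monoid (UPts k A) := inferInstanceAs (Monoid (WithConv (Hu k →ₐ[k] A)))

namespace UPts

variable {k A B C}

/-- The algebra homomorphism underlying a point of `U`. -/
def hom (φ : UPts k A) : Hu k →ₐ[k] A := WithConv.ofConv φ

/-- A point of `U` given by an algebra homomorphism. -/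
def mk (φ : Hu k →ₐ[k] A) : UPts k A := WithConv.toConv φ

theorem ext {φ ψ : UPts k A} (h : ∀ x, φ.hom x = ψ.hom x) : φ = ψ :=
  WithConv.ofConv_injective (AlgHom.ext h)

/-- The convolution product of linear maps. -/
def conv (φ ψ : Hu k →ₗ[k] A) : Hu k →ₗ[k] A :=
  LinearMap.mul' k A ∘ₗ TensorProduct.map φ ψ ∘ₗ Hu.comul

theorem mul_hom (φ ψ : UPts k A) (x : Hu k) :
    (φ * ψ).hom x = conv φ.hom.toLinearMap ψ.hom.toLinearMap x := rfl

theorem one_hom (x : Hu k) : (1 : UPts k A).hom x = algebraMap k A (Hu.counit x) := rfl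

instance : Group (UPts k A) where
  inv φ := mk (φ.hom.comp (HopfAlgebra.antipodeAlgHom k (Hu k)))
  inv_mul_cancel φ := by
    refine ext fun x => ?_
    rw [mul_hom, one_hom, ← φ.hom.commutes]
    have := Hu.mul_antipode_left x
    rw [← this]
    change LinearMap.mul' k A (TensorProduct.map (φ.hom.toLinearMap ∘ₗ Hu.antipode)
      φ.hom.toLinearMap (Hu.comul x)) = _
    generalize Hu.comul x = t
    induction t using TensorProduct.induction_on with
    | zero => simp only [map_zero]
    | add x y hx hy => simp only [map_add, hx, hy]
    | tmul x y => simp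

/-- The map `U(A) → U(B)` induced by `f : A → B`. -/
def map (f : A →ₐ[k] B) : UPts k A →* UPts k B where
  toFun φ := mk (f.comp φ.hom)
  map_one' := ext fun x => by simp [mk, hom]; exact f.commutes _
  map_mul' φ ψ := ext fun x => by
    change f ((φ * ψ).hom x) = (mk (f.comp φ.hom) * mk (f.comp ψ.hom)).hom x
    rw [mul_hom, mul_hom]
    change f (LinearMap.mul' k A (TensorProduct.map φ.hom.toLinearMap ψ.hom.toLinearMap
      (Hu.comul x))) = LinearMap.mul' k B (TensorProduct.map (f.comp φ.hom).toLinearMap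
        (f.comp ψ.hom).toLinearMap (Hu.comul x))
    generalize Hu.comul x = t
    induction t using TensorProduct.induction_on with
    | zero => simp only [map_zero]
    | add x y hx hy => simp only [map_add, hx, hy]
    | tmul x y => simp

/-- The degree of a word, where `f_n` has degree `n`. -/
def deg (w : List ℕ+) : ℕ := (w.map fun n => (n : ℕ)).sum

theorem deg_cons (a : ℕ+) (w : List ℕ+) : deg (a :: w) = a + deg w := by simp [deg]

/-- Multiplication by `tⁿ` in degree `n`. -/
def scaleLin (t : A) (φ : Hu k →ₗ[k] A) : Hu k →ₗ[k] A :=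
  Hu.lift fun w => t ^ deg w * φ (Hu.word w)

theorem scaleLin_word (t : A) (φ : Hu k →ₗ[k] A) (w : List ℕ+) :
    scaleLin t φ (Hu.word w) = t ^ deg w * φ (Hu.word w) := Hu.lift_word _ _

theorem scaleLin_cons (t : A) (φ : Hu k →ₗ[k] A) (a : ℕ+) (x : Hu k) :
    scaleLin t φ (Hu.cons a x) = t ^ (a : ℕ) * scaleLin t (φ ∘ₗ Hu.cons a) x := by
  have : scaleLin t φ ∘ₗ Hu.cons a =
      LinearMap.mulLeft k (t ^ (a : ℕ)) ∘ₗ scaleLin t (φ ∘ₗ Hu.cons a) := Hu.hom_ext fun w => by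
    simp [scaleLin_word, deg_cons, pow_add, mul_assoc]
  exact LinearMap.congr_fun this x

theorem scaleLin_shuffle (t : A) : ∀ (v w : List ℕ+) (φ : Hu k →ₗ[k] A),
    scaleLin t φ (Hu.shuffle v w) = t ^ (deg v + deg w) * φ (Hu.shuffle v w)
  | [], w, φ => by rw [Hu.nil_shuffle, scaleLin_word]; simp [deg]
  | a :: v, [], φ => by rw [Hu.shuffle_nil, scaleLin_word]; simp [deg]
  | a :: v, b :: w, φ => by
    rw [Hu.cons_shuffle_cons, map_add, scaleLin_cons, scaleLin_cons, scaleLin_shuffle t v (b :: w),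
      scaleLin_shuffle t (a :: v) w, map_add]
    simp only [deg_cons, LinearMap.comp_apply]
    ring
termination_by v w => v.length + w.length

theorem scaleLin_mul (t : A) (φ : Hu k →ₐ[k] A) (x y : Hu k) :
    scaleLin t φ.toLinearMap (x * y) =
      scaleLin t φ.toLinearMap x * scaleLin t φ.toLinearMap y := by
  have : (LinearMap.mul k (Hu k)).compr₂ (scaleLin t φ.toLinearMap) =
      (LinearMap.mul k A).compl₁₂ (scaleLin t φ.toLinearMap) (scaleLin t φ.toLinearMap) := by
    refine Hu.hom_ext fun v => Hu.hom_ext fun w => ?_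
    simp only [LinearMap.compr₂_apply, LinearMap.mul_apply', LinearMap.compl₁₂_apply,
      scaleLin_word, Hu.word_mul, scaleLin_shuffle]
    rw [← Hu.word_mul, AlgHom.toLinearMap_apply, map_mul]
    simp only [AlgHom.toLinearMap_apply]
    ring
  exact LinearMap.congr_fun (LinearMap.congr_fun this x) y

theorem scaleLin_one (t : A) (φ : Hu k →ₐ[k] A) : scaleLin t φ.toLinearMap 1 = 1 := by
  rw [Hu.one_def, scaleLin_word, ← Hu.one_def]
  simp [deg]

theorem conv_cons (φ ψ : Hu k →ₗ[k] A) (a : ℕ+) (x : Hu k) :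
    conv φ ψ (Hu.cons a x) = φ 1 * ψ (Hu.cons a x) + conv (φ ∘ₗ Hu.cons a) ψ x := by
  simp only [conv, LinearMap.comp_apply, Hu.comul_cons, map_add, TensorProduct.map_tmul,
    LinearMap.mul'_apply]
  congr 2
  generalize Hu.comul x = t
  induction t using TensorProduct.induction_on with
  | zero => simp only [map_zero]
  | add x y hx hy => simp only [map_add, hx, hy]
  | tmul x y => simp

theorem scaleLin_conv (t : A) (ψ : Hu k →ₗ[k] A) (w : List ℕ+) : ∀ φ : Hu k →ₗ[k] A,
    scaleLin t (conv φ ψ) (Hu.word w) = conv (scaleLin t φ) (scaleLin t ψ) (Hu.word w) := by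
  induction w with
  | nil =>
    intro φ
    rw [scaleLin_word, ← Hu.one_def]
    simp only [conv, LinearMap.comp_apply, Hu.comul_one', TensorProduct.map_tmul,
      LinearMap.mul'_apply]
    rw [Hu.one_def, scaleLin_word, scaleLin_word]
    simp [deg]
  | cons a w ih =>
    intro φ
    have h1 : conv φ ψ ∘ₗ Hu.cons a = LinearMap.mulLeft k (φ 1) ∘ₗ ψ ∘ₗ Hu.cons a +
        conv (φ ∘ₗ Hu.cons a) ψ := LinearMap.ext fun x => conv_cons φ ψ a x
    have h2 : scaleLin t φ ∘ₗ Hu.cons a =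
        LinearMap.mulLeft k (t ^ (a : ℕ)) ∘ₗ scaleLin t (φ ∘ₗ Hu.cons a) :=
      LinearMap.ext fun x => scaleLin_cons t φ a x
    have h3 : conv (LinearMap.mulLeft k (t ^ (a : ℕ)) ∘ₗ scaleLin t (φ ∘ₗ Hu.cons a))
        (scaleLin t ψ) (Hu.word w) =
          t ^ (a : ℕ) * conv (scaleLin t (φ ∘ₗ Hu.cons a)) (scaleLin t ψ) (Hu.word w) := by
      simp only [conv, LinearMap.comp_apply]
      generalize Hu.comul (Hu.word (k := k) w) = s
      induction s using TensorProduct.induction_on with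
      | zero => simp only [map_zero, mul_zero]
      | add x y hx hy => simp only [map_add, hx, hy, mul_add]
      | tmul x y => simp [mul_assoc]
    have h4 : scaleLin t φ 1 = φ 1 := by
      rw [Hu.one_def, scaleLin_word]
      simp [deg]
    have h5 : scaleLin t (LinearMap.mulLeft k (φ 1) ∘ₗ ψ ∘ₗ Hu.cons a +
        conv (φ ∘ₗ Hu.cons a) ψ) (Hu.word w) = φ 1 * scaleLin t (ψ ∘ₗ Hu.cons a) (Hu.word w) +
          scaleLin t (conv (φ ∘ₗ Hu.cons a) ψ) (Hu.word w) := by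
      simp only [scaleLin_word, LinearMap.add_apply, LinearMap.comp_apply,
        LinearMap.mulLeft_apply]
      ring
    rw [Hu.word_cons, scaleLin_cons, conv_cons, h1, h2, h3, h4, h5, ih, scaleLin_cons]
    ring

/-- The action of `t ∈ 𝔾ₘ(A)` on `U(A)` defined by the grading, `(t φ)(w) = t^{|w|} φ(w)`. -/
def scale (t : A) : UPts k A →* UPts k A where
  toFun φ := mk (AlgHom.ofLinearMap (scaleLin t φ.hom.toLinearMap) (scaleLin_one t φ.hom)
    (scaleLin_mul t φ.hom))
  map_one' := ext fun x => by
    have : scaleLin t ((1 : UPts k A).hom.toLinearMap) = (1 : UPts k A).hom.toLinearMap :=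
      Hu.hom_ext fun w => by
        rw [scaleLin_word, AlgHom.toLinearMap_apply, one_hom]
        cases w with
        | nil => simp [deg]
        | cons a w => rw [Hu.word_cons, Hu.counit_cons, map_zero, mul_zero]
    exact LinearMap.congr_fun this x
  map_mul' φ ψ := ext fun x => by
    have : scaleLin t (φ * ψ).hom.toLinearMap =
        conv (scaleLin t φ.hom.toLinearMap) (scaleLin t ψ.hom.toLinearMap) :=
      Hu.hom_ext fun w => scaleLin_conv t ψ.hom.toLinearMap w φ.hom.toLinearMap
    exact LinearMap.congr_fun this x

theorem scale_word (t : A) (φ : UPts k A) (w : List ℕ+) :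
    (scale t φ).hom (Hu.word w) = t ^ deg w * φ.hom (Hu.word w) := scaleLin_word _ _ _

theorem ext_word {φ ψ : UPts k A} (h : ∀ w, φ.hom (Hu.word w) = ψ.hom (Hu.word w)) : φ = ψ :=
  ext fun x => LinearMap.congr_fun
    (Hu.hom_ext (f := φ.hom.toLinearMap) (g := ψ.hom.toLinearMap) h) x

variable (k A) in
/-- The action of `𝔾ₘ(A)` on `U(A)` by automorphisms. -/
def theta : Aˣ →* MulAut (UPts k A) where
  toFun t := (scale (t : A)).toMulEquiv (scale ((t⁻¹ : Aˣ) : A))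
    (MonoidHom.ext fun φ => ext_word fun w => by
      simp [scale_word, ← mul_assoc, ← mul_pow])
    (MonoidHom.ext fun φ => ext_word fun w => by
      simp [scale_word, ← mul_assoc, ← mul_pow])
  map_one' := MulEquiv.ext fun φ => ext_word fun w => by simp [scale_word]
  map_mul' t s := MulEquiv.ext fun φ => ext_word fun w => by
    simp [scale_word, mul_pow, mul_assoc]

theorem map_theta (f : A →ₐ[k] B) (t : Aˣ) (φ : UPts k A) :
    map f (theta k A t φ) = theta k B (Units.map (f : A →* B) t) (map f φ) :=
  ext_word fun w => by
    change f ((scale (t : A) φ).hom (Hu.word w)) =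
      (scale (f t) (map f φ)).hom (Hu.word w)
    rw [scale_word, scale_word, map_mul, map_pow]
    rfl

end UPts

/-- The group `U*(A) = U(A) ⋊ 𝔾ₘ(A)` of `A`-points of `U*`. -/
abbrev UStar : Type u := UPts k A ⋊[UPts.theta k A] Aˣ

variable {k A B}

/-- The map `U*(A) → U*(B)` induced by `f : A → B`. -/
def UStar.map (f : A →ₐ[k] B) : UStar k A →* UStar k B :=
  SemidirectProduct.map (UPts.map f) (Units.map (f : A →* B)) fun t =>
    MonoidHom.ext fun φ => UPts.map_theta f t φ

end GroupScheme

/-! ### Finite dimensional representations of `U*` -/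

section Representations

/-- Finite dimensional representations of the group scheme `U*`: vector spaces `V` with actions of
`U*(A)` by `A`-linear automorphisms of `A ⊗ V`, for all commutative `k`-algebras `A`, functorially
in `A`. -/
structure URep (k : Type u) [Field k] where
  V : Type u
  [grp : AddCommGroup V]
  [mod : Module k V]
  [fin : Module.Finite k V]
  ρ (A : Type u) [CommRing A] [Algebra k A] : UStar k A →* Module.End A (A ⊗[k] V)
  natural {A B : Type u} [CommRing A] [Algebra k A] [CommRing B] [Algebra k B] (f : A →ₐ[k] B)
    (g : UStar k A) (x : A ⊗[k] V) :
    ρ B (UStar.map f g) (f.toLinearMap.rTensor V x) = f.toLinearMap.rTensor V (ρ A g x)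

attribute [instance] URep.grp URep.mod URep.fin

namespace URep

variable {k : Type u} [Field k]

/-- The space of morphisms of representations. -/
def homs (X Y : URep k) : Submodule k (X.V →ₗ[k] Y.V) where
  carrier := {T | ∀ (A : Type u) [CommRing A] [Algebra k A] (g : UStar k A) (x : A ⊗[k] X.V),
    T.baseChange A (X.ρ A g x) = Y.ρ A g (T.baseChange A x)}
  add_mem' hS hT A _ _ g x := by
    rw [LinearMap.baseChange_add, LinearMap.add_apply, LinearMap.add_apply, hS, hT, map_add]
  zero_mem' A _ _ g x := by simp
  smul_mem' c T hT A _ _ g x := by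
    rw [LinearMap.baseChange_smul, LinearMap.smul_apply, LinearMap.smul_apply, hT]
    rw [← algebraMap_smul A c, ← algebraMap_smul A c, map_smul]

theorem id_mem (X : URep k) : LinearMap.id ∈ homs X X := fun A _ _ g x => by simp

theorem comp_mem {X Y Z : URep k} {S : Y.V →ₗ[k] Z.V} {T : X.V →ₗ[k] Y.V}
    (hS : S ∈ homs Y Z) (hT : T ∈ homs X Y) : S ∘ₗ T ∈ homs X Z := fun A _ _ g x => by
  rw [LinearMap.baseChange_comp, LinearMap.comp_apply, LinearMap.comp_apply, hT, hS]

instance : Category (URep k) where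
  Hom X Y := homs X Y
  id X := ⟨LinearMap.id, id_mem X⟩
  comp f g := ⟨g.1 ∘ₗ f.1, comp_mem g.2 f.2⟩

instance : Preadditive (URep k) where
  homGroup X Y := inferInstanceAs (AddCommGroup (homs X Y))
  add_comp _ _ _ _ _ _ := Subtype.ext (LinearMap.comp_add ..)
  comp_add _ _ _ _ _ _ := Subtype.ext (LinearMap.add_comp ..)

instance : Linear k (URep k) where
  homModule X Y := inferInstanceAs (Module k (homs X Y))
  smul_comp _ _ _ _ _ _ := Subtype.ext (LinearMap.comp_smul ..)
  comp_smul _ _ _ _ _ _ := Subtype.ext (LinearMap.smul_comp ..)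

variable (k) in
/-- The forgetful functor to finite dimensional vector spaces. -/
def forget : URep k ⥤ FGModuleCat.{u} k where
  obj X := FGModuleCat.of k X.V
  map f := FGModuleCat.ofHom f.1

instance : (forget k).Faithful where
  map_injective h := Subtype.ext (congrArg (fun f => f.hom.hom) h)

/-- The tensor product of representations. -/
def tensorObj (X Y : URep k) : URep k where
  V := X.V ⊗[k] Y.V
  ρ A _ _ :=
    { toFun g := box (X.ρ A g) (Y.ρ A g)
      map_one' := LinearMap.ext fun x => by
        induction x using odot_induction with
        | h₀ => simp only [map_zero]
        | h₂ x y hx hy => simp only [map_add, hx, hy]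
        | h m n => rw [box_odot]; simp
      map_mul' g h := LinearMap.ext fun x => by
        induction x using odot_induction with
        | h₀ => simp only [map_zero]
        | h₂ x y hx hy => simp only [map_add, hx, hy]
        | h m n => simp only [box_odot, map_mul, Module.End.mul_apply] }
  natural {A B} _ _ _ _ f g x := by
    have hf (m : A ⊗[k] X.V) (n : A ⊗[k] Y.V) :
        f.toLinearMap.rTensor (X.V ⊗[k] Y.V) (odot m n) =
          odot (f.toLinearMap.rTensor X.V m) (f.toLinearMap.rTensor Y.V n) := by
      induction m using TensorProduct.induction_on with
      | zero => simp
      | add x y hx hy => simp only [add_odot, map_add, hx, hy]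
      | tmul r e =>
        induction n using TensorProduct.induction_on with
        | zero => simp
        | add x y hx hy => simp only [odot_add, map_add, hx, hy]
        | tmul s f => simp
    induction x using odot_induction with
    | h₀ => simp only [map_zero]
    | h₂ x y hx hy => simp only [map_add, hx, hy]
    | h m n =>
      simp only [MonoidHom.coe_mk, OneHom.coe_mk, box_odot, hf, X.natural, Y.natural]

variable (k) in
/-- The trivial representation. -/
def tensorUnit : URep k where
  V := k
  ρ A _ _ := 1
  natural _ _ _ := rfl

theorem tensor_ρ (X Y : URep k) (A : Type u) [CommRing A] [Algebra k A] (g : UStar k A)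
    (m : A ⊗[k] X.V) (n : A ⊗[k] Y.V) :
    (tensorObj X Y).ρ A g (odot m n) = odot (X.ρ A g m) (Y.ρ A g n) := box_odot _ _ _ _

theorem mem_of_odot {X Y Z : URep k} {T : X.V ⊗[k] Y.V →ₗ[k] Z.V}
    (h : ∀ (A : Type u) [CommRing A] [Algebra k A] (g : UStar k A) (m : A ⊗[k] X.V)
      (n : A ⊗[k] Y.V), T.baseChange A (odot (X.ρ A g m) (Y.ρ A g n)) =
        Z.ρ A g (T.baseChange A (odot m n))) : T ∈ homs (tensorObj X Y) Z := fun A _ _ g => by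
  have key (x : A ⊗[k] (X.V ⊗[k] Y.V)) :
      T.baseChange A (box (X.ρ A g) (Y.ρ A g) x) = Z.ρ A g (T.baseChange A x) := by
    induction x using odot_induction with
    | h₀ => simp only [map_zero]
    | h₂ x y hx hy => simp only [map_add, hx, hy]
    | h m n => rw [box_odot, h]
  exact key

theorem map_mem {X Y X' Y' : URep k} {S : X.V →ₗ[k] X'.V} {T : Y.V →ₗ[k] Y'.V}
    (hS : S ∈ homs X X') (hT : T ∈ homs Y Y') :
    TensorProduct.map S T ∈ homs (tensorObj X Y) (tensorObj X' Y') :=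
  mem_of_odot (Z := tensorObj X' Y') fun A _ _ g m n => by
    refine (baseChange_map_odot S T _ _).trans ?_
    rw [hS, hT]
    exact (tensor_ρ X' Y' A g _ _).symm.trans (congrArg _ (baseChange_map_odot S T m n).symm)

/-- An isomorphism of representations. -/
def mkIso {X Y : URep k} (e : X.V ≃ₗ[k] Y.V) (h : e.toLinearMap ∈ homs X Y) : X ≅ Y where
  hom := ⟨e.toLinearMap, h⟩
  inv := ⟨e.symm.toLinearMap, fun A _ _ g x => by
    have h12 (x : A ⊗[k] X.V) :
        e.symm.toLinearMap.baseChange A (e.toLinearMap.baseChange A x) = x := by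
      rw [← LinearMap.comp_apply, ← LinearMap.baseChange_comp]
      simp
    have h21 (x : A ⊗[k] Y.V) :
        e.toLinearMap.baseChange A (e.symm.toLinearMap.baseChange A x) = x := by
      rw [← LinearMap.comp_apply, ← LinearMap.baseChange_comp]
      simp
    rw [← h12 (X.ρ A g _), h A g, h21]⟩
  hom_inv_id := Subtype.ext (LinearMap.ext fun x => e.symm_apply_apply x)
  inv_hom_id := Subtype.ext (LinearMap.ext fun x => e.apply_symm_apply x)

theorem assoc_mem (X Y Z : URep k) : (TensorProduct.assoc k X.V Y.V Z.V).toLinearMap ∈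
    homs (tensorObj (tensorObj X Y) Z) (tensorObj X (tensorObj Y Z)) :=
  mem_of_odot (X := tensorObj X Y) (Z := tensorObj X (tensorObj Y Z)) fun A _ _ g x p => by
    have key (x : A ⊗[k] (X.V ⊗[k] Y.V)) :
        (TensorProduct.assoc k X.V Y.V Z.V).toLinearMap.baseChange A
            (odot (box (X.ρ A g) (Y.ρ A g) x) (Z.ρ A g p)) =
          box (X.ρ A g) (box (Y.ρ A g) (Z.ρ A g))
            ((TensorProduct.assoc k X.V Y.V Z.V).toLinearMap.baseChange A (odot x p)) := by
      induction x using odot_induction with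
      | h₀ => simp only [map_zero, zero_odot]
      | h₂ x y hx hy => simp only [map_add, add_odot, hx, hy]
      | h m n => rw [box_odot, assoc_odot, assoc_odot, box_odot, box_odot]
    exact key x

theorem comm_mem (X Y : URep k) : (TensorProduct.comm k X.V Y.V).toLinearMap ∈
    homs (tensorObj X Y) (tensorObj Y X) :=
  mem_of_odot (Z := tensorObj Y X) fun A _ _ g m n =>
    (comm_odot _ _).trans ((tensor_ρ Y X A g n m).symm.trans (congrArg _ (comm_odot m n).symm))

theorem lid_mem (X : URep k) : (TensorProduct.lid k X.V).toLinearMap ∈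
    homs (tensorObj (tensorUnit k) X) X :=
  mem_of_odot (X := tensorUnit k) fun A _ _ g m n => by
    obtain ⟨r, rfl⟩ : ∃ r : A, r ⊗ₜ[k] (1 : k) = m :=
      ⟨TensorProduct.rid k A m, (TensorProduct.rid k A).symm_apply_apply m⟩
    refine (lid_odot r (1 : k) _).trans ?_
    refine Eq.trans ?_ (congrArg _ (lid_odot r (1 : k) n).symm)
    rw [map_smul]

theorem rid_mem (X : URep k) : (TensorProduct.rid k X.V).toLinearMap ∈
    homs (tensorObj X (tensorUnit k)) X :=
  mem_of_odot (Y := tensorUnit k) fun A _ _ g n m => by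
    obtain ⟨r, rfl⟩ : ∃ r : A, r ⊗ₜ[k] (1 : k) = m :=
      ⟨TensorProduct.rid k A m, (TensorProduct.rid k A).symm_apply_apply m⟩
    refine (rid_odot r (1 : k) _).trans ?_
    refine Eq.trans ?_ (congrArg _ (rid_odot r (1 : k) n).symm)
    rw [map_smul]

instance : MonoidalCategoryStruct (URep k) where
  tensorObj := tensorObj
  whiskerLeft X _ _ f := ⟨TensorProduct.map LinearMap.id f.1, map_mem (id_mem X) f.2⟩
  whiskerRight f Y := ⟨TensorProduct.map f.1 LinearMap.id, map_mem f.2 (id_mem Y)⟩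
  tensorHom f g := ⟨TensorProduct.map f.1 g.1, map_mem f.2 g.2⟩
  tensorUnit := tensorUnit k
  associator X Y Z := mkIso (X := tensorObj (tensorObj X Y) Z) (Y := tensorObj X (tensorObj Y Z))
    (TensorProduct.assoc k X.V Y.V Z.V) (assoc_mem X Y Z)
  leftUnitor X := mkIso (X := tensorObj (tensorUnit k) X) (TensorProduct.lid k X.V) (lid_mem X)
  rightUnitor X := mkIso (X := tensorObj X (tensorUnit k)) (TensorProduct.rid k X.V) (rid_mem X)

variable (k) in
/-- The forgetful functor identifies the operations on both sides. -/
def inducing : Monoidal.InducingFunctorData (forget k) where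
  μIso _ _ := Iso.refl _
  εIso := Iso.refl _
  whiskerLeft_eq _ _ _ _ := rfl
  whiskerRight_eq _ _ := rfl
  tensorHom_eq _ _ := rfl
  associator_eq X Y Z := FGModuleCat.hom_ext (TensorProduct.ext_threefold fun _ _ _ => rfl)
  leftUnitor_eq X := FGModuleCat.hom_ext (TensorProduct.ext' fun _ _ => rfl)
  rightUnitor_eq X := FGModuleCat.hom_ext (TensorProduct.ext' fun _ _ => rfl)

instance : MonoidalCategory (URep k) := Monoidal.induced (forget k) (inducing k)

instance : (forget k).Monoidal := Monoidal.fromInducedMonoidal (forget k) (inducing k)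

instance : BraidedCategory (URep k) :=
  BraidedCategory.ofFaithful (forget k)
    (fun X Y => mkIso (X := tensorObj X Y) (Y := tensorObj Y X) (TensorProduct.comm k X.V Y.V)
      (comm_mem X Y))
    (fun _ _ => FGModuleCat.hom_ext (TensorProduct.ext' fun _ _ => rfl))

instance : (forget k).Braided where
  braided X Y := FGModuleCat.hom_ext (TensorProduct.ext' fun _ _ => rfl)

instance : SymmetricCategory (URep k) := SymmetricCategory.ofFaithful (forget k)

end URep

end Representations

end Equising

namespace Equising

/-! ### Tannakian categories -/

section Tannakian

open scoped MonoidalCategory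

variable (k : Type u) [Field k]

/-- Tensor categories over `k`: `k`-linear abelian symmetric monoidal categories with `k`-bilinear
tensor product in which every object has a dual and `k` is the endomorphism ring of the unit. -/
structure IsTensorCategory (C : Type*) [Category C] [Preadditive C] [Linear k C]
    [MonoidalCategory C] [SymmetricCategory C] : Prop where
  abelian : ∃ a : Abelian C, a.toPreadditive = ‹Preadditive C›
  additive : MonoidalPreadditive C
  linear : MonoidalLinear k C
  dual : ∀ X : C, ∃ Y : C, Nonempty (ExactPairing X Y)
  endUnit : Function.Bijective fun c : k => c • 𝟙 (𝟙_ C)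

variable {k} in
/-- Fibre functors: exact faithful `k`-linear symmetric monoidal functors to finite dimensional
`k`-vector spaces. -/
structure IsFiberFunctor {C : Type*} [Category C] [Preadditive C] [Linear k C]
    [MonoidalCategory C] [SymmetricCategory C] (F : C ⥤ FGModuleCat.{u} k) [F.Braided] : Prop where
  additive : F.Additive
  linear : F.Linear k
  faithful : F.Faithful
  leftExact : Limits.PreservesFiniteLimits F
  rightExact : Limits.PreservesFiniteColimits F

/-- Neutral Tannakian categories over `k`: tensor categories over `k` which have a fibre functor to
finite dimensional `k`-vector spaces. -/
def IsTannakian (C : Type*) [Category C] [Preadditive C] [Linear k C]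
    [MonoidalCategory C] [SymmetricCategory C] : Prop :=
  IsTensorCategory k C ∧
    ∃ (F : C ⥤ FGModuleCat.{u} k) (_ : F.Braided), IsFiberFunctor F

end Tannakian

end Equising

end

/-! The category is linear algebra in disguise: an equisingular flat bundle amounts to a pair (E,
β), where β is an endomorphism of the graded space E raising the weight by at least 1, and a
morphism amounts to a graded linear map commuting with the endomorphisms. A representation of U*
amounts to the same data. The 𝔾ₘ-action is the grading, and the generator e_{-a} acts by the
component β_a of degree a. Since the Lie algebra is free, there are no relations, so the β_a, a ≥ 1,
are arbitrary maps of degree a, and only finitely many can be nonzero.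

Let Y be the degree operator. Conjugation by u^Y makes an invariant bundle map independent of u
(`flat_onSec`), so that [u∂_u, f] = [Y, f] for invariant f (`IsInvariant.du`). If f raises the
weight by d, then [Y, f] equals d·f up to terms raising it by d + 1 (`degComm_sub`). For d ≥ 1 the
factor d is invertible, and a map raising the weight far enough vanishes. Induction on d then gives
rigidity: an invariant weight-raising map which intertwines two connections along the fibres is zero
(`eq_zero_of_commute`). It also gives normal forms: over B* the fibre component can be gauged away
(`exists_frame`), and if it has a simple pole it can be brought on B to the shape z⁻¹ u^Y β u^{-Y}
with β constant (`exists_residue`). By flatness and rigidity the z-component follows the fibre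
component (`intertwine_z`, `exists_flat`), so everything is decided along the fibres.

Equisingularity is equivalent to this normal form up to gauge on B. If the fibre component is z⁻¹
u^Y β u^{-Y}, changing the section to v conjugates it by v^Y. The gauge transformation undoing this
is a finite sum of iterated integrals in v - 1, divided by powers of z; it is regular because v - 1
is divisible by z (`exists_retrivialize`). Conversely, for a frame g over B*, rigidity forces the
gauge transformation from the section 1 to v to be v^Y g⁻¹ v^{-Y} g (`gauge_eq_conjY`). Regularity
for every v = 1 + cz, read off at first order in c, shows that z times the fibre component is
regular (`IsFlatEquisingular.isRegular_smul`).

A horizontal lift of T between two normal forms is the constant map T, because a regular map has no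
z⁻¹ coefficient. It therefore exists exactly when T intertwines the residues (`hasLift_iff`). This
yields both the uniqueness of β and the description of morphisms, and tensor products go to β ⊗ 1 +
1 ⊗ γ (`res_tensor`).

For representations, the generic points of 𝔾ₘ and of U give a grading and an operator for every
word. The operators multiply by concatenation of words (`URep.op_append`) and shift the degree by
the degree of the word (`URep.op_mem`), so the letters determine them. Conversely the coaction x ↦ ∑
w ⊗ w(x) is a finite sum and defines a representation (`GrVec.rep`). Finally, kernels, cokernels,
sums and duals are constructed on the pairs (E, β), with dual residue -βᵗ, so ω is exact and the
category is Tannakian. -/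

noncomputable section

namespace Equising

/-! ### Homogeneous components and diagonal operators -/

namespace GrVec

variable {k : Type u} [Field k]

/-- The linear map on `E` which restricts to `f n` on the component of degree `n`. -/
def ofGr (E : GrVec k) {M : Type*} [AddCommGroup M] [Module k M] (f : ℤ → E.V →ₗ[k] M) :
    E.V →ₗ[k] M :=
  DirectSum.toModule k ℤ M (fun n => f n ∘ₗ (E.gr n).subtype) ∘ₗ
    (LinearEquiv.ofBijective (DirectSum.coeLinearMap E.gr)
      (show Function.Bijective (DirectSum.coeLinearMap E.gr) from E.internal)).symm.toLinearMap

theorem ofGr_of_mem (E : GrVec k) {M : Type*} [AddCommGroup M] [Module k M]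
    (f : ℤ → E.V →ₗ[k] M) {n : ℤ} {x : E.V} (hx : x ∈ E.gr n) : E.ofGr f x = f n x := by
  have : (LinearEquiv.ofBijective (DirectSum.coeLinearMap E.gr)
      (show Function.Bijective (DirectSum.coeLinearMap E.gr) from E.internal)).symm x =
      DirectSum.lof k ℤ (fun n => E.gr n) n ⟨x, hx⟩ := by
    rw [LinearEquiv.symm_apply_eq, LinearEquiv.ofBijective_apply, DirectSum.coeLinearMap_lof]
  rw [ofGr, LinearMap.comp_apply, LinearEquiv.coe_coe, this, DirectSum.toModule_lof]
  rfl

theorem hom_ext (E : GrVec k) {M : Type*} [AddCommGroup M] [Module k M] {f g : E.V →ₗ[k] M}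
    (h : ∀ n, ∀ x ∈ E.gr n, f x = g x) : f = g :=
  LinearMap.ext fun x => by
    induction x using E.induction with
    | h n x hx => exact h n x hx
    | h₂ x y hx hy => rw [map_add, map_add, hx, hy]

/-- The projection to the component of degree `m`. -/
def proj (E : GrVec k) (m : ℤ) : E.V →ₗ[k] E.V := E.ofGr fun n => if n = m then LinearMap.id else 0

theorem proj_of_mem (E : GrVec k) {n : ℤ} {x : E.V} (hx : x ∈ E.gr n) (m : ℤ) :
    E.proj m x = if n = m then x else 0 := by
  rw [proj, E.ofGr_of_mem _ hx]
  split_ifs <;> rfl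

theorem proj_self (E : GrVec k) {n : ℤ} {x : E.V} (hx : x ∈ E.gr n) : E.proj n x = x := by
  rw [E.proj_of_mem hx, if_pos rfl]

theorem proj_mem (E : GrVec k) (m : ℤ) (x : E.V) : E.proj m x ∈ E.gr m := by
  induction x using E.induction with
  | h n x hx =>
    rw [E.proj_of_mem hx]
    split_ifs with h
    · exact h ▸ hx
    · exact Submodule.zero_mem _
  | h₂ x y hx hy => rw [map_add]; exact Submodule.add_mem _ hx hy

theorem IsGraded.proj {E F : GrVec k} {T : E.V →ₗ[k] F.V} (hT : IsGraded T) (n : ℤ) (x : E.V) :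
    T (E.proj n x) = F.proj n (T x) := by
  induction x using E.induction with
  | h m x hx => rw [E.proj_of_mem hx, F.proj_of_mem (hT m x hx)]; split_ifs <;> simp
  | h₂ x y hx hy => simp only [map_add, hx, hy]

/-- An independent family of subspaces of a Noetherian space has only finitely many nonzero members.
-/
theorem finite_gr (E : GrVec k) : {n | E.gr n ≠ ⊥}.Finite :=
  WellFoundedGT.finite_ne_bot_of_iSupIndep E.internal.submodule_iSupIndep

/-- The finite set of degrees which occur in `E`. -/
def degs (E : GrVec k) : Finset ℤ := E.finite_gr.toFinset

theorem gr_of_notMem (E : GrVec k) {n : ℤ} (hn : n ∉ E.degs) : E.gr n = ⊥ := by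
  by_contra h
  exact hn (E.finite_gr.mem_toFinset.mpr h)

theorem proj_of_notMem (E : GrVec k) {n : ℤ} (hn : n ∉ E.degs) (x : E.V) : E.proj n x = 0 := by
  have := E.proj_mem n x
  rwa [E.gr_of_notMem hn, Submodule.mem_bot] at this

theorem sum_proj (E : GrVec k) (x : E.V) : ∑ n ∈ E.degs, E.proj n x = x := by
  induction x using E.induction with
  | h n x hx =>
    simp only [E.proj_of_mem hx]
    rw [Finset.sum_ite_eq]
    split_ifs with h
    · rfl
    · rw [E.gr_of_notMem h, Submodule.mem_bot] at hx
      exact hx.symm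
  | h₂ x y hx hy => simp only [map_add, Finset.sum_add_distrib, hx, hy]

theorem mem_gr_of_proj (E : GrVec k) {n : ℤ} {x : E.V} (h : ∀ m, m ≠ n → E.proj m x = 0) :
    x ∈ E.gr n := by
  rw [← E.sum_proj x]
  refine Submodule.sum_mem _ fun m _ => ?_
  by_cases hm : m = n
  · exact hm ▸ E.proj_mem m x
  · rw [h m hm]; exact Submodule.zero_mem _

theorem mem_wfil_iff (E : GrVec k) {n : ℤ} {x : E.V} :
    x ∈ E.wfil n ↔ ∀ m < n, E.proj m x = 0 := by
  constructor
  · intro hx m hm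
    have : E.wfil n ≤ LinearMap.ker (E.proj m) := iSup₂_le fun i hi y hy => by
      rw [LinearMap.mem_ker, E.proj_of_mem hy, if_neg (by omega)]
    exact this hx
  · intro h
    rw [← E.sum_proj x]
    refine Submodule.sum_mem _ fun m _ => ?_
    by_cases hm : m < n
    · rw [h m hm]; exact Submodule.zero_mem _
    · exact E.gr_le_wfil (not_lt.mp hm) (E.proj_mem m x)

/-- Only finitely many degrees occur, so the filtration is everything far down and zero far up. All
nilpotence arguments rest on this. -/
theorem exists_bound (E : GrVec k) :
    ∃ N : ℕ, (∀ n : ℤ, n ≤ -N → E.wfil n = ⊤) ∧ ∀ n : ℤ, (N : ℤ) ≤ n → E.wfil n = ⊥ := by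
  obtain ⟨N, hN⟩ : ∃ N : ℕ, ∀ n ∈ E.degs, n.natAbs < N :=
    -- The summand 1 makes the bound strict, so that the step of index N itself is already zero.
    ⟨E.degs.sup Int.natAbs + 1, fun n hn => Nat.lt_succ_of_le (Finset.le_sup (f := Int.natAbs) hn)⟩
  refine ⟨N, fun n hn => ?_, fun n hn => ?_⟩
  · rw [eq_top_iff]
    rintro x -
    refine E.mem_wfil_iff.mpr fun m hm => E.proj_of_notMem (fun h => ?_) x
    have := hN m h
    omega
  · rw [eq_bot_iff]
    intro x hx
    rw [Submodule.mem_bot, ← E.sum_proj x]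
    refine Finset.sum_eq_zero fun m hm => E.mem_wfil_iff.mp hx m ?_
    have := hN m hm
    omega

/-- The component of degree `a` of a linear map. -/
def comp {E F : GrVec k} (a : ℤ) (T : E.V →ₗ[k] F.V) : E.V →ₗ[k] F.V :=
  E.ofGr fun n => F.proj (n + a) ∘ₗ T

theorem comp_of_mem {E F : GrVec k} (a : ℤ) (T : E.V →ₗ[k] F.V) {n : ℤ} {x : E.V}
    (hx : x ∈ E.gr n) : comp a T x = F.proj (n + a) (T x) := E.ofGr_of_mem _ hx

theorem comp_mem {E F : GrVec k} (a : ℤ) (T : E.V →ₗ[k] F.V) {n : ℤ} {x : E.V}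
    (hx : x ∈ E.gr n) : comp a T x ∈ F.gr (n + a) := by
  rw [comp_of_mem a T hx]
  exact F.proj_mem _ _

/-- The linear map raises the weight by at least `d`. -/
def RaisesBy {E F : GrVec k} (d : ℤ) (T : E.V →ₗ[k] F.V) : Prop :=
  ∀ n, ∀ x ∈ E.gr n, T x ∈ F.wfil (n + d)

theorem RaisesBy.mono {E F : GrVec k} {d d' : ℤ} {T : E.V →ₗ[k] F.V} (hT : RaisesBy d T)
    (h : d' ≤ d) : RaisesBy d' T := fun n x hx => F.wfil_anti (by omega) (hT n x hx)

theorem RaisesBy.wfil {E F : GrVec k} {d : ℤ} {T : E.V →ₗ[k] F.V} (hT : RaisesBy d T) (n : ℤ) :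
    E.wfil n ≤ (F.wfil (n + d)).comap T :=
  iSup₂_le fun m hm x hx => F.wfil_anti (by omega) (hT m x hx)

theorem RaisesBy.comp {E F G : GrVec k} {d d' : ℤ} {S : F.V →ₗ[k] G.V} {T : E.V →ₗ[k] F.V}
    (hS : RaisesBy d S) (hT : RaisesBy d' T) : RaisesBy (d' + d) (S ∘ₗ T) := fun n x hx => by
  rw [← add_assoc]
  exact hS.wfil _ (hT n x hx)

theorem RaisesBy.add {E F : GrVec k} {d : ℤ} {S T : E.V →ₗ[k] F.V} (hS : RaisesBy d S)
    (hT : RaisesBy d T) : RaisesBy d (S + T) := fun n x hx =>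
  Submodule.add_mem _ (hS n x hx) (hT n x hx)

theorem RaisesBy.neg {E F : GrVec k} {d : ℤ} {T : E.V →ₗ[k] F.V}
    (hT : RaisesBy d T) : RaisesBy d (-T) := fun n x hx =>
  Submodule.neg_mem _ (hT n x hx)

theorem IsGraded.raisesBy {E F : GrVec k} {T : E.V →ₗ[k] F.V} (hT : IsGraded T) : RaisesBy 0 T :=
  fun n x hx => F.gr_le_wfil (by omega) (hT n x hx)

theorem RaisesBy.of_deg {E F : GrVec k} {d : ℤ} {T : E.V →ₗ[k] F.V}
    (hT : ∀ n, ∀ x ∈ E.gr n, T x ∈ F.gr (n + d)) : RaisesBy d T :=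
  fun n x hx => F.gr_le_wfil le_rfl (hT n x hx)

/-- A shift larger than the spread of the degrees carries the whole of E into a zero step of the
filtration of F. The bound depends only on E and F, which is what terminates the inductions on the
weight. -/
theorem exists_raisesBy_eq_zero (E F : GrVec k) :
    ∃ N : ℕ, ∀ T : E.V →ₗ[k] F.V, RaisesBy N T → T = 0 := by
  obtain ⟨N, hN, -⟩ := E.exists_bound
  obtain ⟨M, -, hM⟩ := F.exists_bound
  refine ⟨N + M, fun T hT => LinearMap.ext fun x => ?_⟩
  have h1 : x ∈ E.wfil (-N) := by rw [hN _ le_rfl]; trivial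
  have h2 := hT.wfil _ h1
  rw [Submodule.mem_comap, hM _ (by push_cast; omega), Submodule.mem_bot] at h2
  exact h2

/-- A linear map which raises the weight is the sum of its components of positive degree. -/
theorem exists_sum_comp (E F : GrVec k) : ∃ N : ℕ, ∀ M : ℕ, N ≤ M → ∀ T : E.V →ₗ[k] F.V,
    RaisesBy 1 T → ∑ a ∈ Finset.range M, comp (a + 1 : ℤ) T = T := by
  obtain ⟨N, hN⟩ := exists_raisesBy_eq_zero E F
  refine ⟨N, fun M hM T hT => ?_⟩
  -- The difference between T and the truncated sum of its components raises the weight by at least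
  -- M + 1, hence vanishes.
  rw [← sub_eq_zero, ← neg_eq_zero, neg_sub]
  refine hN _ (RaisesBy.mono (d := (M : ℤ) + 1) (fun n x hx => F.mem_wfil_iff.mpr fun m hm => ?_)
    (by omega))
  rw [LinearMap.sub_apply, map_sub, LinearMap.sum_apply, map_sum, sub_eq_zero]
  simp only [comp_of_mem _ T hx, F.proj_of_mem (F.proj_mem _ _)]
  by_cases h : m < n + 1
  · rw [F.mem_wfil_iff.mp (hT n x hx) m h]
    refine (Finset.sum_eq_zero fun a _ => if_neg ?_).symm
    omega
  -- In this range exactly one summand, the component of degree m - n, contributes; the index is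
  -- shifted by one because the degrees start at 1.
  · obtain ⟨a, rfl⟩ : ∃ a : ℕ, m = n + (a + 1) := ⟨(m - n - 1).toNat, by omega⟩
    rw [Finset.sum_eq_single a]
    · simp
    · intro b _ hb
      rw [if_neg]
      omega
    · intro h
      rw [Finset.mem_range] at h
      omega

theorem comp_sum {E F : GrVec k} {ι : Type*} (s : Finset ι) (a : ℤ) (T : ι → E.V →ₗ[k] F.V) :
    comp a (∑ i ∈ s, T i) = ∑ i ∈ s, comp a (T i) := E.hom_ext fun n x hx => by
  rw [comp_of_mem _ _ hx, LinearMap.sum_apply, LinearMap.sum_apply, map_sum]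
  exact Finset.sum_congr rfl fun i _ => (comp_of_mem _ _ hx).symm

theorem comp_of_deg {E F : GrVec k} {d : ℤ} {T : E.V →ₗ[k] F.V}
    (hT : ∀ n, ∀ x ∈ E.gr n, T x ∈ F.gr (n + d)) (a : ℤ) :
    comp a T = if d = a then T else 0 := E.hom_ext fun n x hx => by
  rw [comp_of_mem _ _ hx, F.proj_of_mem (hT n x hx)]
  by_cases h : d = a
  · simp [h]
  · simp [h]

/-- Maps of degree 0 pass through the decomposition into components, here and in the next statement.
A graded T therefore commutes with an endomorphism if and only if it commutes with its components.
-/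
theorem comp_comp_graded {E F G : GrVec k} (a : ℤ) {S : F.V →ₗ[k] G.V} {T : E.V →ₗ[k] F.V}
    (hT : IsGraded T) : comp a (S ∘ₗ T) = comp a S ∘ₗ T := E.hom_ext fun n x hx => by
  rw [comp_of_mem _ _ hx, LinearMap.comp_apply, LinearMap.comp_apply, comp_of_mem _ _ (hT n x hx)]

theorem graded_comp_comp {E F G : GrVec k} (a : ℤ) {S : F.V →ₗ[k] G.V} {T : E.V →ₗ[k] F.V}
    (hS : IsGraded S) : comp a (S ∘ₗ T) = S ∘ₗ comp a T := E.hom_ext fun n x hx => by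
  rw [comp_of_mem _ _ hx, LinearMap.comp_apply, LinearMap.comp_apply, comp_of_mem _ _ hx, hS.proj]

/-! ### Diagonal operators over a base ring -/

section Base

variable {A : Type*} [CommRing A] [Algebra k A]

theorem baseChange_ext (E : GrVec k) {M : Type*} [AddCommGroup M] [Module A M]
    {f g : A ⊗[k] E.V →ₗ[A] M} (h : ∀ n, ∀ x ∈ E.gr n, f (1 ⊗ₜ[k] x) = g (1 ⊗ₜ[k] x)) : f = g := by
  -- The target is only an A-module, so it first receives the k-structure through A.
  let := Module.compHom M (algebraMap k A)
  have : IsScalarTower k A M := ⟨fun a b c => by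
    rw [Algebra.smul_def, mul_smul]; rfl⟩
  refine TensorProduct.AlgebraTensorModule.curry_injective (LinearMap.ext_ring ?_)
  exact E.hom_ext h

/-- The operator on `A ⊗ E` which multiplies the component of degree `n` by `c n`. -/
def diag (E : GrVec k) (c : ℤ → A) : A ⊗[k] E.V →ₗ[A] A ⊗[k] E.V :=
  LinearMap.liftBaseChange A (E.ofGr fun n => TensorProduct.mk k A E.V (c n))

theorem diag_tmul (E : GrVec k) (c : ℤ → A) (a : A) {n : ℤ} {x : E.V} (hx : x ∈ E.gr n) :
    E.diag c (a ⊗ₜ[k] x) = (a * c n) ⊗ₜ[k] x := by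
  rw [diag, LinearMap.liftBaseChange_tmul, E.ofGr_of_mem _ hx, TensorProduct.mk_apply,
    TensorProduct.smul_tmul', smul_eq_mul]

theorem diag_mul (E : GrVec k) (c c' : ℤ → A) : E.diag c ∘ₗ E.diag c' = E.diag (c * c') :=
  E.baseChange_ext fun n x hx => by
    simp only [LinearMap.comp_apply, E.diag_tmul _ _ hx, Pi.mul_apply]
    ring_nf

theorem diag_one (E : GrVec k) : E.diag (1 : ℤ → A) = LinearMap.id :=
  E.baseChange_ext fun n x hx => by
    simp only [E.diag_tmul _ _ hx, Pi.one_apply, mul_one, LinearMap.id_apply]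

theorem diag_comm (E : GrVec k) (c c' : ℤ → A) (x : A ⊗[k] E.V) :
    E.diag c (E.diag c' x) = E.diag c' (E.diag c x) := by
  rw [← LinearMap.comp_apply, ← LinearMap.comp_apply, diag_mul, diag_mul, mul_comm]

theorem IsGraded.diag {E F : GrVec k} {T : E.V →ₗ[k] F.V} (hT : IsGraded T) (c : ℤ → A)
    (x : A ⊗[k] E.V) : T.baseChange A (E.diag c x) = F.diag c (T.baseChange A x) := by
  rw [← LinearMap.comp_apply, ← LinearMap.comp_apply]
  congr 1
  refine E.baseChange_ext fun n x hx => ?_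
  simp only [LinearMap.comp_apply, E.diag_tmul _ _ hx, LinearMap.baseChange_tmul,
    F.diag_tmul _ _ (hT n x hx)]

/-- The map `A ⊗ E → E` induced by a linear functional on `A`. -/
def contract {V : Type*} [AddCommGroup V] [Module k V] (l : A →ₗ[k] k) : A ⊗[k] V →ₗ[k] V :=
  TensorProduct.lid k V ∘ₗ l.rTensor V

@[simp] theorem contract_tmul {V : Type*} [AddCommGroup V] [Module k V] (l : A →ₗ[k] k) (a : A)
    (x : V) : contract l (a ⊗ₜ[k] x) = l a • x := by
  simp [contract]

theorem contract_baseChange {V W : Type*} [AddCommGroup V] [Module k V] [AddCommGroup W]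
    [Module k W] (l : A →ₗ[k] k) (T : V →ₗ[k] W) (x : A ⊗[k] V) :
    contract l (T.baseChange A x) = T (contract l x) := by
  induction x using TensorProduct.induction_on with
  | zero => simp only [map_zero]
  | add x y hx hy => simp only [map_add, hx, hy]
  | tmul a x => simp

/-- Elements of `A ⊗ V` are detected by linear functionals on `A`. -/
theorem eq_zero_of_contract {V : Type*} [AddCommGroup V] [Module k V] {x : A ⊗[k] V}
    (L : Set (A →ₗ[k] k)) (hL : ∀ a, (∀ l ∈ L, l a = 0) → a = 0)
    (h : ∀ l ∈ L, contract l x = 0) : x = 0 := by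
  let b := Module.Free.chooseBasis k V
  refine (b.baseChange A).ext_elem fun i => ?_
  rw [map_zero, Finsupp.zero_apply]
  refine hL _ fun l hl => ?_
  have key (y : A ⊗[k] V) : l ((b.baseChange A).repr y i) = b.repr (contract l y) i := by
    induction y using TensorProduct.induction_on with
    | zero => simp
    | add x y hx hy => simp only [map_add, Finsupp.add_apply, hx, hy]
    | tmul a x => simp [mul_comm]
  rw [key, h l hl]
  simp

variable (A) in
/-- The weight filtration of `A ⊗ E`. -/
def wfilA (E : GrVec k) (n : ℤ) : Submodule A (A ⊗[k] E.V) := (E.wfil n).baseChange A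

theorem tmul_mem_wfilA (E : GrVec k) {m n : ℤ} (h : n ≤ m) {x : E.V} (hx : x ∈ E.gr m) (a : A) :
    a ⊗ₜ[k] x ∈ E.wfilA A n :=
  Submodule.tmul_mem_baseChange_of_mem a (E.gr_le_wfil h hx)

theorem wfilA_anti (E : GrVec k) {m n : ℤ} (h : n ≤ m) : E.wfilA A m ≤ E.wfilA A n :=
  Submodule.baseChange_mono _ (E.wfil_anti h)

theorem wfilA_le (E : GrVec k) {n : ℤ} {N : Submodule A (A ⊗[k] E.V)}
    (h : ∀ m, n ≤ m → ∀ x ∈ E.gr m, (1 : A) ⊗ₜ[k] x ∈ N) : E.wfilA A n ≤ N := by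
  rw [wfilA, Submodule.baseChange_eq_span, Submodule.span_le]
  rintro _ ⟨y, hy, rfl⟩
  have : E.wfil n ≤ (N.restrictScalars k).comap (TensorProduct.mk k A E.V 1) :=
    iSup₂_le fun m hm x hx => h m hm x hx
  exact this hy

/-- The bundle map raises the weight by at least `d`. -/
def RaisesByA {E F : GrVec k} (d : ℤ) (f : A ⊗[k] E.V →ₗ[A] A ⊗[k] F.V) : Prop :=
  ∀ n, ∀ x ∈ E.wfilA A n, f x ∈ F.wfilA A (n + d)

variable {E F G : GrVec k} {d d' : ℤ}

theorem RaisesByA.of_gr {f : A ⊗[k] E.V →ₗ[A] A ⊗[k] F.V}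
    (h : ∀ n, ∀ x ∈ E.gr n, f (1 ⊗ₜ[k] x) ∈ F.wfilA A (n + d)) : RaisesByA d f := fun n =>
  E.wfilA_le (N := (F.wfilA A (n + d)).comap f) fun m hm x hx =>
    F.wfilA_anti (by omega) (h m x hx)

theorem RaisesByA.mono {f : A ⊗[k] E.V →ₗ[A] A ⊗[k] F.V} (hf : RaisesByA d f) (h : d' ≤ d) :
    RaisesByA d' f := fun n x hx => F.wfilA_anti (by omega) (hf n x hx)

theorem RaisesByA.comp {g : A ⊗[k] F.V →ₗ[A] A ⊗[k] G.V} {f : A ⊗[k] E.V →ₗ[A] A ⊗[k] F.V}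
    (hg : RaisesByA d g) (hf : RaisesByA d' f) : RaisesByA (d' + d) (g ∘ₗ f) := fun n x hx => by
  rw [← add_assoc]
  exact hg _ _ (hf _ _ hx)

theorem RaisesByA.add {f g : A ⊗[k] E.V →ₗ[A] A ⊗[k] F.V} (hf : RaisesByA d f)
    (hg : RaisesByA d g) : RaisesByA d (f + g) := fun n x hx =>
  Submodule.add_mem _ (hf n x hx) (hg n x hx)

theorem RaisesByA.sub {f g : A ⊗[k] E.V →ₗ[A] A ⊗[k] F.V} (hf : RaisesByA d f)
    (hg : RaisesByA d g) : RaisesByA d (f - g) := fun n x hx =>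
  Submodule.sub_mem _ (hf n x hx) (hg n x hx)

theorem RaisesByA.neg {f : A ⊗[k] E.V →ₗ[A] A ⊗[k] F.V} (hf : RaisesByA d f) :
    RaisesByA d (-f) := fun n x hx => Submodule.neg_mem _ (hf n x hx)

theorem RaisesByA.smul (a : A) {f : A ⊗[k] E.V →ₗ[A] A ⊗[k] F.V} (hf : RaisesByA d f) :
    RaisesByA d (a • f) := fun n x hx => Submodule.smul_mem _ a (hf n x hx)

theorem RaisesByA.zero : RaisesByA d (0 : A ⊗[k] E.V →ₗ[A] A ⊗[k] F.V) :=
  fun n x hx => Submodule.zero_mem _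

theorem RaisesByA.sum {ι : Type*} {s : Finset ι} {f : ι → A ⊗[k] E.V →ₗ[A] A ⊗[k] F.V}
    (hf : ∀ i ∈ s, RaisesByA d (f i)) : RaisesByA d (∑ i ∈ s, f i) := fun n x hx => by
  rw [LinearMap.sum_apply]
  exact Submodule.sum_mem _ fun i hi => hf i hi n x hx

theorem RaisesBy.baseChange {T : E.V →ₗ[k] F.V} (hT : RaisesBy d T) :
    RaisesByA d (T.baseChange A) := RaisesByA.of_gr fun n x hx => by
  rw [LinearMap.baseChange_tmul]
  exact Submodule.tmul_mem_baseChange_of_mem 1 (hT n x hx)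

theorem raisesByA_diag (E : GrVec k) (c : ℤ → A) : RaisesByA 0 (E.diag c) :=
  RaisesByA.of_gr fun n x hx => by
    rw [E.diag_tmul _ _ hx]
    exact E.tmul_mem_wfilA (by omega) hx _

/-- Contraction is not A-linear, but contracting a • z against l is contracting z against l(a ·).
The induction over the A-span therefore runs for all functionals at once. -/
theorem contract_mem_wfil (l : A →ₗ[k] k) {n : ℤ} {x : A ⊗[k] E.V} (hx : x ∈ E.wfilA A n) :
    contract l x ∈ E.wfil n := by
  have key (l : A →ₗ[k] k) (a : A) (z : A ⊗[k] E.V) :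
      contract l (a • z) = contract (l ∘ₗ LinearMap.mulLeft k a) z := by
    induction z using TensorProduct.induction_on with
    | zero => simp only [smul_zero, map_zero]
    | add x y hx hy => simp only [smul_add, map_add, hx, hy]
    | tmul b x => simp [TensorProduct.smul_tmul']
  rw [wfilA, Submodule.baseChange_eq_span] at hx
  induction hx using Submodule.span_induction generalizing l with
  | mem x h =>
    obtain ⟨y, hy, rfl⟩ := h
    change contract l ((1 : A) ⊗ₜ[k] y) ∈ _
    rw [contract_tmul]
    exact Submodule.smul_mem _ _ hy
  | zero => rw [map_zero]; exact Submodule.zero_mem _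
  | add x y _ _ hx hy => rw [map_add]; exact Submodule.add_mem _ (hx l) (hy l)
  | smul a x _ hx => rw [key]; exact hx _

theorem wfilA_bot (E : GrVec k) {n : ℤ} (h : E.wfil n = ⊥) : E.wfilA A n = ⊥ := by
  rw [wfilA, h, Submodule.baseChange_bot]

theorem wfilA_top (E : GrVec k) {n : ℤ} (h : E.wfil n = ⊤) : E.wfilA A n = ⊤ := by
  rw [wfilA, h, Submodule.baseChange_top]

/-- Same argument as over k; the bound does not depend on the base ring. -/
theorem exists_raisesByA_eq_zero (E F : GrVec k) :
    ∃ N : ℕ, ∀ (A : Type u) [CommRing A] [Algebra k A] (f : A ⊗[k] E.V →ₗ[A] A ⊗[k] F.V),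
      RaisesByA N f → f = 0 := by
  obtain ⟨N, hN, -⟩ := E.exists_bound
  obtain ⟨M, -, hM⟩ := F.exists_bound
  refine ⟨N + M, fun A _ _ f hf => LinearMap.ext fun x => ?_⟩
  have h1 : x ∈ E.wfilA A (-N) := by rw [E.wfilA_top (hN _ le_rfl)]; trivial
  have h2 := hf _ _ h1
  rwa [F.wfilA_bot (hM _ (by push_cast; omega)), Submodule.mem_bot] at h2

end Base

end GrVec

end Equising

end

noncomputable section

namespace Equising

open GrVec

/-! ### Invariant and regular bundle maps -/

section Bundle

variable {k : Type u} [Field k] [CharZero k] {E F G : GrVec k}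

theorem onSec_comp (E : GrVec k) (δ δ' : FunBStar k →ₗ[k] FunBStar k) (x : Sec E) :
    onSec E δ (onSec E δ' x) = onSec E (δ ∘ₗ δ') x := by
  rw [onSec, onSec, onSec, LinearMap.rTensor_comp]; rfl

@[simp] theorem onSec_tmul (δ : FunBStar k →ₗ[k] FunBStar k) (r : FunBStar k) (x : E.V) :
    onSec E δ (r ⊗ₜ[k] x) = δ r ⊗ₜ[k] x := LinearMap.rTensor_tmul ..

theorem mono_mul (m n : ℤ) (f g : LaurentSeries k) :
    mono m f * mono n g = mono (m + n) (f * g) := mono_mul_mono m n f g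

/-- The operator `u^Y`. -/
def uY (E : GrVec k) : Sec E →ₗ[FunBStar k] Sec E := E.diag fun n => mono n 1

/-- The operator `u^{-Y}`. -/
def uYi (E : GrVec k) : Sec E →ₗ[FunBStar k] Sec E := E.diag fun n => mono (-n) 1

theorem uY_uYi (x : Sec E) : uY E (uYi E x) = x := by
  have : uY E ∘ₗ uYi E = LinearMap.id := by
    rw [uY, uYi, diag_mul, ← E.diag_one]
    congr 1
    funext n
    simp [mono_mul, mono_zero_one]
  exact LinearMap.congr_fun this x

theorem uYi_uY (x : Sec E) : uYi E (uY E x) = x := by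
  rw [uY, uYi, diag_comm]
  exact uY_uYi x

/-- The operator `v^Y`, for a function `v` of `z`. -/
def vY (E : GrVec k) (v : LaurentSeries k) : Sec E →ₗ[FunBStar k] Sec E :=
  E.diag fun n => mono 0 (v ^ n)

theorem vY_vY_inv {v : LaurentSeries k} (hv : v ≠ 0) (x : Sec E) : vY E v (vY E v⁻¹ x) = x := by
  have : vY E v ∘ₗ vY E v⁻¹ = LinearMap.id := by
    rw [vY, vY, diag_mul, ← E.diag_one]
    congr 1
    funext n
    simp only [Pi.mul_apply, mono_mul, ← mul_zpow, mul_inv_cancel₀ hv, one_zpow, add_zero,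
      mono_zero_one, Pi.one_apply]
  exact LinearMap.congr_fun this x

/-- The degree operator `Y`. -/
def degOp (E : GrVec k) : Sec E →ₗ[FunBStar k] Sec E :=
  E.diag fun n => algebraMap k (FunBStar k) (n : k)

theorem du_mul_mono (n : ℤ) (r : FunBStar k) : du (r * mono n 1) =
    du r * mono n 1 + algebraMap k (FunBStar k) (n : k) * (r * mono n 1) := by
  rw [du_mul, du, coeffwise_mono]
  congr 1
  rw [LinearMap.smul_apply, LinearMap.id_apply, mono_smul, Algebra.algebraMap_eq_smul_one,
    smul_mul_assoc, one_mul, mul_smul_comm]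

/-- Since u∂_u(uⁿ) = n uⁿ, conjugating u∂_u by u^Y adds the degree operator Y. This is how Y enters
all later computations. -/
theorem du_uY (x : Sec E) : onSec E du (uY E x) = uY E (onSec E du x + degOp E x) := by
  induction x using TensorProduct.induction_on with
  | zero => simp only [map_zero, add_zero]
  | add x y hx hy => simp only [map_add, hx, hy]; abel
  | tmul r x =>
    induction x using E.induction with
    | h₂ x y hx hy => simp only [TensorProduct.tmul_add, map_add, hx, hy]; abel
    | h n x hx =>
      rw [onSec_tmul, map_add]
      simp only [uY, degOp, E.diag_tmul _ _ hx, onSec_tmul, du_mul_mono, TensorProduct.add_tmul]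
      ring_nf

theorem du_uYi (x : Sec E) : onSec E du (uYi E x) = uYi E (onSec E du x - degOp E x) := by
  have h := du_uY (uYi E x)
  rw [uY_uYi] at h
  have h1 : degOp E (uYi E x) = uYi E (degOp E x) := E.diag_comm _ _ _
  have h2 := congrArg (uYi E) h
  rw [uYi_uY, h1] at h2
  rw [map_sub, h2, add_sub_cancel_right]

/-- Replacing u by v u turns uⁿ into vⁿ uⁿ, so the frame u^Y picks up the factor v^Y. -/
theorem substU_uY {v : LaurentSeries k} (hv : v ≠ 0) (x : Sec E) :
    onSec E (substU v) (uY E x) = uY E (vY E v (onSec E (substU v) x)) := by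
  induction x using TensorProduct.induction_on with
  | zero => simp only [map_zero]
  | add x y hx hy => simp only [map_add, hx, hy]
  | tmul r x =>
    induction x using E.induction with
    | h₂ x y hx hy => simp only [TensorProduct.tmul_add, map_add, hx, hy]
    | h n x hx =>
      simp only [uY, vY, E.diag_tmul _ _ hx, onSec_tmul, substU_mul hv]
      rw [mul_assoc, mono_mul, zero_add, mul_one]
      congr 2
      rw [substU, coeffwise_mono, LinearMap.mulLeft_apply, mul_one]

/-- On the component of degree n the substitution u ↦ t⁻¹u produces t⁻ⁿ from uⁿ and t^Y produces tⁿ.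
The two cancel, so in the frame u^Y the group acts by substitution alone. -/
theorem rho_uY (t : kˣ) (x : Sec E) : rho E t (uY E x) =
    uY E (onSec E (substU (algebraMap k (LaurentSeries k) (t⁻¹ : kˣ))) x) := by
  induction x using TensorProduct.induction_on with
  | zero => simp only [map_zero]
  | add x y hx hy => simp only [map_add, hx, hy]
  | tmul r x =>
    induction x using E.induction with
    | h₂ x y hx hy => simp only [TensorProduct.tmul_add, map_add, hx, hy]
    | h n x hx =>
      simp only [uY, E.diag_tmul _ _ hx, onSec_tmul, substU_mul (scalar_ne_zero t), rho,
        TensorProduct.map_tmul, E.act_of_mem _ hx]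
      rw [TensorProduct.tmul_smul, TensorProduct.smul_tmul', ← Algebra.mul_smul_comm]
      congr 2
      rw [substU, coeffwise_mono, LinearMap.mulLeft_apply, mul_one, ← mono_smul,
        ← map_zpow₀, Algebra.smul_def, ← map_mul]
      congr 1
      rw [← Units.val_zpow_eq_zpow_val, ← Units.val_zpow_eq_zpow_val, ← Units.val_mul]
      simp

theorem rho_uYi (t : kˣ) (x : Sec E) :
    uYi E (rho E t x) = onSec E (substU (algebraMap k (LaurentSeries k) (t⁻¹ : kˣ))) (uYi E x) := by
  have := rho_uY t (uYi E x)
  rw [uY_uYi] at this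
  rw [this, uYi_uY]

/-- The conjugate of a bundle map by `u^Y`. -/
def flat (f : Sec E →ₗ[FunBStar k] Sec F) : Sec E →ₗ[FunBStar k] Sec F := uYi F ∘ₗ f ∘ₗ uY E

theorem flat_apply (f : Sec E →ₗ[FunBStar k] Sec F) (x : Sec E) :
    flat f x = uYi F (f (uY E x)) := rfl

theorem apply_eq_flat (f : Sec E →ₗ[FunBStar k] Sec F) (x : Sec E) :
    f x = uY F (flat f (uYi E x)) := by
  rw [flat_apply, uY_uYi, uY_uYi]

theorem isInvariant_iff {f : Sec E →ₗ[FunBStar k] Sec F} : IsInvariant f ↔ ∀ (t : kˣ) (x : Sec E),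
    flat f (onSec E (substU (algebraMap k (LaurentSeries k) (t⁻¹ : kˣ))) x) =
      onSec F (substU (algebraMap k (LaurentSeries k) (t⁻¹ : kˣ))) (flat f x) := by
  constructor
  · intro h t x
    rw [flat_apply, flat_apply, ← rho_uY, h t, rho_uYi]
  · intro h t x
    rw [apply_eq_flat f, rho_uYi, h, ← rho_uY, ← apply_eq_flat f]

/-- The projection to the functions which do not depend on `u`. -/
def constU (k : Type u) [Field k] : FunBStar k →ₗ[k] FunBStar k :=
  coeffwise fun n => if n = 0 then LinearMap.id else 0

/-- In characteristic zero 2 is not a root of unity, so the single element 2 of 𝔾ₘ already separates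
all characters. -/
theorem two_zpow_ne_one {n : ℤ} (hn : n ≠ 0) : (2 : k) ^ n ≠ 1 := by
  intro h
  have h2 : ((2 : ℚ) ^ n : ℚ) = 1 := by
    have : (((2 : ℚ) ^ n : ℚ) : k) = ((1 : ℚ) : k) := by push_cast; exact h
    exact_mod_cast this
  exact hn (zpow_right_injective₀ (a := (2 : ℚ)) (by norm_num) (by norm_num) (by simpa using h2))

/-- The substitution u ↦ 2u multiplies the coefficient of uⁿ by 2ⁿ, which differs from 1 unless n =
0. A fixed section therefore has only its u⁰ part. -/
theorem onSec_constU {x : Sec E}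
    (hx : onSec E (substU (algebraMap k (LaurentSeries k) 2)) x = x) :
    onSec E (constU k) x = x := by
  -- Division by 2ⁿ - 1 inverts the substitution minus the identity away from n = 0. At n = 0 the
  -- inverse of 0 is 0 by convention, which agrees with the right-hand side of `key`.
  let ψ : FunBStar k →ₗ[k] FunBStar k := coeffwise fun n => ((2 : k) ^ n - 1)⁻¹ • LinearMap.id
  have key : ψ ∘ₗ (substU (algebraMap k (LaurentSeries k) 2) - LinearMap.id) =
      LinearMap.id - constU k := by
    refine LinearMap.ext fun x => ?_
    induction x using funBStar_induction with
    | h₂ x y hx hy => rw [map_add, map_add, hx, hy]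
    | h n f =>
      simp only [ψ, constU, substU, LinearMap.comp_apply, LinearMap.sub_apply, coeffwise_mono,
        LinearMap.id_apply, map_sub, LinearMap.smul_apply, LinearMap.mulLeft_apply]
      rw [← map_zpow₀, ← Algebra.smul_def]
      by_cases hn : n = 0
      · simp [hn]
      · rw [if_neg hn, LinearMap.zero_apply, mono_smul, mono_smul, mono_smul, smul_smul, ← sub_smul,
          ← mul_sub_one, inv_mul_cancel₀ (sub_ne_zero.mpr (two_zpow_ne_one hn)), one_smul]
        have : (mono n 0 : FunBStar k) = 0 := AddMonoidAlgebra.single_zero _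
        rw [this, sub_zero]
  have h := congrArg (fun δ => onSec E δ x) key
  simp only [← onSec_comp] at h
  have h1 (δ δ' : FunBStar k →ₗ[k] FunBStar k) (x : Sec E) :
      onSec E (δ - δ') x = onSec E δ x - onSec E δ' x := by
    rw [onSec, LinearMap.rTensor_sub]; rfl
  have h2 (x : Sec E) : onSec E LinearMap.id x = x := by rw [onSec, LinearMap.rTensor_id]; rfl
  rw [h1, h1, h2, hx, sub_self, map_zero] at h
  exact (sub_eq_zero.mp h.symm).symm

/-- The hypothesis says that δ is linear over the functions of z alone, and these are the only
coefficients left after applying `constU`. -/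
theorem onSec_smul_constU {δ : FunBStar k →ₗ[k] FunBStar k}
    (hδ : ∀ r f, δ (r * mono 0 f) = δ r * mono 0 f) (r : FunBStar k) (x : Sec E) :
    onSec E δ (r • onSec E (constU k) x) = δ r • onSec E (constU k) x := by
  induction x using TensorProduct.induction_on with
  | zero => simp only [map_zero, smul_zero]
  | add x y hx hy => simp only [map_add, smul_add, hx, hy]
  | tmul s e =>
    induction s using funBStar_induction with
    | h₂ x y hx hy => simp only [map_add, smul_add, TensorProduct.add_tmul, hx, hy]
    | h n f =>
      rw [onSec_tmul, constU, coeffwise_mono]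
      split_ifs with h
      · simp only [LinearMap.id_apply, h, TensorProduct.smul_tmul', smul_eq_mul, onSec_tmul, hδ]
      · have : (mono n 0 : FunBStar k) = 0 := AddMonoidAlgebra.single_zero _
        simp [this]

theorem flat_constU {f : Sec E →ₗ[FunBStar k] Sec F} (hf : IsInvariant f) (x : E.V) :
    onSec F (constU k) (flat f (1 ⊗ₜ[k] x)) = flat f (1 ⊗ₜ[k] x) := by
  refine onSec_constU ?_
  -- The group element is 1/2, because ρ(t) substitutes t⁻¹u and the substitution u ↦ 2u is wanted.
  have := isInvariant_iff.mp hf (Units.mk0 (2 : k) two_ne_zero)⁻¹ (1 ⊗ₜ[k] x)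
  rw [onSec_tmul, substU_one, inv_inv, Units.val_mk0] at this
  exact this.symm

/-- The conjugate of an invariant bundle map by `u^Y` does not depend on `u`. -/
theorem flat_onSec {f : Sec E →ₗ[FunBStar k] Sec F} (hf : IsInvariant f)
    {δ : FunBStar k →ₗ[k] FunBStar k} (hδ : ∀ r f, δ (r * mono 0 f) = δ r * mono 0 f) (x : Sec E) :
    flat f (onSec E δ x) = onSec F δ (flat f x) := by
  induction x using TensorProduct.induction_on with
  | zero => simp only [map_zero]
  | add x y hx hy => simp only [map_add, hx, hy]
  | tmul r x =>
    have h (r : FunBStar k) : r ⊗ₜ[k] x = r • ((1 : FunBStar k) ⊗ₜ[k] x) := by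
      rw [TensorProduct.smul_tmul', smul_eq_mul, mul_one]
    rw [onSec_tmul, h r, h (δ r), map_smul, map_smul, ← flat_constU hf, onSec_smul_constU hδ]

theorem du_mono_zero (r : FunBStar k) (f : LaurentSeries k) :
    du (r * mono 0 f) = du r * mono 0 f := by
  rw [du_mul, du, coeffwise_mono]
  simp only [Int.cast_zero, zero_smul, LinearMap.zero_apply]
  have : (mono 0 0 : FunBStar k) = 0 := AddMonoidAlgebra.single_zero _
  rw [this, mul_zero, add_zero]

/-- The infinitesimal form of invariance. -/
theorem IsInvariant.du {f : Sec E →ₗ[FunBStar k] Sec F} (hf : IsInvariant f)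
    (x : Sec E) :
    onSec F Equising.du (f x) - f (onSec E Equising.du x) = degOp F (f x) - f (degOp E x) := by
  have h1 (y : Sec F) : degOp F (uY F y) = uY F (degOp F y) := F.diag_comm _ _ _
  rw [apply_eq_flat f x, apply_eq_flat f (degOp E x), apply_eq_flat f (onSec E _ x), du_uY,
    ← flat_onSec hf du_mono_zero, du_uYi, h1]
  simp only [map_add, map_sub]
  abel

theorem substU_mono_zero {v : LaurentSeries k} (hv : v ≠ 0) (r : FunBStar k)
    (f : LaurentSeries k) : substU v (r * mono 0 f) = substU v r * mono 0 f := by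
  rw [substU_mul hv, substU, coeffwise_mono]
  simp

/-- In the frame u^Y the map does not involve u, so the substitution only affects the two frames,
and they contribute v^Y and v^{-Y}. -/
theorem IsInvariant.substU {f : Sec E →ₗ[FunBStar k] Sec F} (hf : IsInvariant f)
    {v : LaurentSeries k} (hv : v ≠ 0) (x : Sec E) : onSec F (Equising.substU v) (f x) =
      vY F v (f (vY E v⁻¹ (onSec E (Equising.substU v) x))) := by
  have h (y : Sec E) : vY E v⁻¹ (onSec E (Equising.substU v) (uY E y)) =
      uY E (onSec E (Equising.substU v) y) := by
    rw [substU_uY hv, show uY E (vY E v _) = vY E v (uY E _) from E.diag_comm _ _ _]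
    have := vY_vY_inv (E := E) (inv_ne_zero hv) (uY E (onSec E (Equising.substU v) y))
    rwa [inv_inv] at this
  obtain ⟨y, rfl⟩ : ∃ y, x = uY E y := ⟨_, (uY_uYi x).symm⟩
  have h' : f (uY E y) = uY F (flat f y) := by rw [apply_eq_flat f, uYi_uY]
  rw [h, h', substU_uY hv, ← flat_onSec hf (substU_mono_zero hv), flat_apply,
    show uY F (vY F v _) = vY F v (uY F _) from F.diag_comm _ _ _, uY_uYi]

/-! ### Closure properties -/

theorem rho_smul (t : kˣ) (r : FunBStar k) (x : Sec E) : rho E t (r • x) =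
    substU (algebraMap k (LaurentSeries k) (t⁻¹ : kˣ)) r • rho E t x := by
  induction x using TensorProduct.induction_on with
  | zero => simp only [smul_zero, map_zero]
  | add x y hx hy => simp only [smul_add, map_add, hx, hy]
  | tmul b x =>
    rw [rho, TensorProduct.smul_tmul', TensorProduct.map_tmul, TensorProduct.map_tmul,
      TensorProduct.smul_tmul', smul_eq_mul, smul_eq_mul, substU_mul (scalar_ne_zero t)]

theorem IsInvariant.comp {g : Sec F →ₗ[FunBStar k] Sec G} {f : Sec E →ₗ[FunBStar k] Sec F}
    (hg : IsInvariant g) (hf : IsInvariant f) : IsInvariant (g ∘ₗ f) := fun t x => by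
  rw [LinearMap.comp_apply, hf t, hg t, LinearMap.comp_apply]

theorem IsInvariant.add {f g : Sec E →ₗ[FunBStar k] Sec F} (hf : IsInvariant f)
    (hg : IsInvariant g) : IsInvariant (f + g) := fun t x => by
  rw [LinearMap.add_apply, hf t, hg t, LinearMap.add_apply, map_add]

theorem IsInvariant.sub {f g : Sec E →ₗ[FunBStar k] Sec F} (hf : IsInvariant f)
    (hg : IsInvariant g) : IsInvariant (f - g) := fun t x => by
  rw [LinearMap.sub_apply, hf t, hg t, LinearMap.sub_apply, map_sub]

theorem IsInvariant.smul (φ : LaurentSeries k) {f : Sec E →ₗ[FunBStar k] Sec F}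
    (hf : IsInvariant f) : IsInvariant ((mono 0 φ : FunBStar k) • f) := fun t x => by
  rw [LinearMap.smul_apply, hf t, LinearMap.smul_apply, rho_smul, Equising.substU, coeffwise_mono]
  simp

theorem IsInvariant.id : IsInvariant (LinearMap.id : Sec E →ₗ[FunBStar k] Sec E) :=
  fun t x => rfl

theorem IsInvariant.sum {ι : Type*} {s : Finset ι} {f : ι → Sec E →ₗ[FunBStar k] Sec F}
    (hf : ∀ i ∈ s, IsInvariant (f i)) : IsInvariant (∑ i ∈ s, f i : Sec E →ₗ[FunBStar k] Sec F) := fun t x => by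
  rw [LinearMap.sum_apply, LinearMap.sum_apply, map_sum]
  exact Finset.sum_congr rfl fun i hi => hf i hi t x

/-- The section 1 ⊗ x with x of degree n has weight n, and sections of this kind generate. It
suffices that their images have the same weight. -/
theorem IsInvariant.of_gr {f : Sec E →ₗ[FunBStar k] Sec F}
    (h : ∀ (t : kˣ) (n : ℤ), ∀ x ∈ E.gr n,
      rho F t (f (1 ⊗ₜ[k] x)) = (t : k) ^ n • f (1 ⊗ₜ[k] x)) : IsInvariant f := fun t x => by
  induction x using TensorProduct.induction_on with
  | zero => simp only [map_zero]
  | add x y hx hy => simp only [map_add, hx, hy]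
  | tmul r x =>
    induction x using E.induction with
    | h₂ x y hx hy => simp only [TensorProduct.tmul_add, map_add, hx, hy]
    | h n x hx =>
      have h' (r : FunBStar k) : r ⊗ₜ[k] x = r • ((1 : FunBStar k) ⊗ₜ[k] x) := by
        rw [TensorProduct.smul_tmul', smul_eq_mul, mul_one]
      rw [rho, TensorProduct.map_tmul, E.act_of_mem _ hx, TensorProduct.tmul_smul, h', h' r,
        LinearMap.map_smul_of_tower, map_smul, map_smul, rho_smul, h t n x hx, smul_comm]

theorem isInvariant_diag {c : ℤ → FunBStar k} (hc : ∀ n, ∃ φ, c n = mono 0 φ) :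
    IsInvariant (E.diag c) := IsInvariant.of_gr fun t n x hx => by
  obtain ⟨φ, hφ⟩ := hc n
  rw [E.diag_tmul _ _ hx, one_mul, hφ, rho, TensorProduct.map_tmul, substU, coeffwise_mono,
    E.act_of_mem _ hx]
  simp

theorem isInvariant_vY (v : LaurentSeries k) : IsInvariant (vY E v) :=
  isInvariant_diag fun n => ⟨_, rfl⟩

/-! ### Regular bundle maps -/

theorem funB_smul_mem {x : Sec E} (hx : x ∈ regSec E) (p : LaurentPolynomial (PowerSeries k)) :
    funB k p • x ∈ regSec E := by
  obtain ⟨y, rfl⟩ := hx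
  induction y using TensorProduct.induction_on with
  | zero => simp only [map_zero, smul_zero]; exact Submodule.zero_mem _
  | add x y hx hy => simp only [map_add, smul_add]; exact Submodule.add_mem _ hx hy
  | tmul r e => exact ⟨(p * r) ⊗ₜ e, by simp [TensorProduct.smul_tmul']⟩

theorem tmul_mem_regSec {r : FunBStar k} (hr : r ∈ Set.range (funB k)) (x : E.V) :
    r ⊗ₜ[k] x ∈ regSec E := by
  obtain ⟨p, rfl⟩ := hr
  exact ⟨p ⊗ₜ x, rfl⟩

theorem one_tmul_mem_regSec (x : E.V) : (1 : FunBStar k) ⊗ₜ[k] x ∈ regSec E :=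
  tmul_mem_regSec ⟨1, map_one _⟩ x

theorem regSec_induction {p : Sec E → Prop} {x : Sec E} (hx : x ∈ regSec E)
    (h : ∀ (r : LaurentPolynomial (PowerSeries k)) (n : ℤ), ∀ e ∈ E.gr n, p (funB k r ⊗ₜ[k] e))
    (h₂ : ∀ x y, p x → p y → p (x + y)) : p x := by
  obtain ⟨y, rfl⟩ := hx
  induction y using TensorProduct.induction_on with
  | zero =>
    have := h 0 0 0 (Submodule.zero_mem _)
    rwa [TensorProduct.tmul_zero] at this
  | add x y hx hy => rw [map_add]; exact h₂ _ _ hx hy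
  | tmul r e =>
    rw [TensorProduct.map_tmul]
    induction e using E.induction with
    | h n e he => exact h r n e he
    | h₂ x y hx hy => rw [map_add, TensorProduct.tmul_add]; exact h₂ _ _ hx hy

theorem IsRegular.of_gr {f : Sec E →ₗ[FunBStar k] Sec F}
    (h : ∀ n, ∀ x ∈ E.gr n, f (1 ⊗ₜ[k] x) ∈ regSec F) : IsRegular f := fun x hx => by
  refine regSec_induction (p := fun x => f x ∈ regSec F) hx (fun r n e he => ?_) fun x y hx hy => ?_
  · have : funB k r ⊗ₜ[k] e = funB k r • ((1 : FunBStar k) ⊗ₜ[k] e) := by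
      rw [TensorProduct.smul_tmul', smul_eq_mul, mul_one]
    rw [this, map_smul]
    exact funB_smul_mem (h n e he) r
  · rw [map_add]
    exact Submodule.add_mem _ hx hy

theorem IsRegular.smul {r : FunBStar k} (hr : r ∈ Set.range (funB k))
    {f : Sec E →ₗ[FunBStar k] Sec F} (hf : IsRegular f) : IsRegular (r • f) := fun x hx => by
  obtain ⟨p, rfl⟩ := hr
  exact funB_smul_mem (hf x hx) p

theorem IsRegular.zero : IsRegular (0 : Sec E →ₗ[FunBStar k] Sec F) :=
  fun x hx => Submodule.zero_mem _

theorem IsRegular.id : IsRegular (LinearMap.id : Sec E →ₗ[FunBStar k] Sec E) := fun x hx => hx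

theorem IsRegular.neg {f : Sec E →ₗ[FunBStar k] Sec F} (hf : IsRegular f) : IsRegular (-f) :=
  fun x hx => Submodule.neg_mem _ (hf x hx)

theorem IsRegular.sum {ι : Type*} {s : Finset ι} {f : ι → Sec E →ₗ[FunBStar k] Sec F}
    (hf : ∀ i ∈ s, IsRegular (f i)) : IsRegular (∑ i ∈ s, f i) := fun x hx => by
  rw [LinearMap.sum_apply]
  exact Submodule.sum_mem _ fun i hi => hf i hi x hx

theorem isRegular_diag {c : ℤ → FunBStar k} (hc : ∀ n, c n ∈ Set.range (funB k)) :
    IsRegular (E.diag c) := IsRegular.of_gr fun n x hx => by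
  rw [E.diag_tmul _ _ hx, one_mul]
  exact tmul_mem_regSec (hc n) x

theorem mono_mem_range (n : ℤ) (φ : PowerSeries k) :
    mono n (HahnSeries.ofPowerSeries ℤ k φ) ∈ Set.range (funB k) :=
  ⟨AddMonoidAlgebra.single n φ, by
    rw [funB, mono]
    exact (AddMonoidAlgebra.mapAlgHom_single ..)⟩

theorem mono_one_mem_range (n : ℤ) : (mono n 1 : FunBStar k) ∈ Set.range (funB k) := by
  have := mono_mem_range n (1 : PowerSeries k)
  rwa [map_one] at this

theorem isRegular_uY : IsRegular (uY E) := isRegular_diag fun n => mono_one_mem_range n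

theorem isRegular_uYi : IsRegular (uYi E) := isRegular_diag fun n => mono_one_mem_range (-n)

/-- The coordinate u is invertible on B, so u^Y and u^{-Y} are both regular and regularity may be
tested in the frame u^Y. The next statement is the converse direction. -/
theorem IsRegular.flat {f : Sec E →ₗ[FunBStar k] Sec F} (hf : IsRegular f) : IsRegular (flat f) :=
  isRegular_uYi.comp (hf.comp isRegular_uY)

theorem IsRegular.of_flat {f : Sec E →ₗ[FunBStar k] Sec F} (hf : IsRegular (Equising.flat f)) :
    IsRegular f := by
  have : f = uY F ∘ₗ Equising.flat f ∘ₗ uYi E := LinearMap.ext fun x => apply_eq_flat f x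
  rw [this]
  exact isRegular_uY.comp (hf.comp isRegular_uYi)

end Bundle

end Equising

end

noncomputable section

namespace Equising

open GrVec

/-! ### Coefficients of bundle maps -/

section Coefficients

variable {k : Type u} [Field k] [CharZero k] {E F G : GrVec k}

/-- The coefficient of `z^m u^0`. -/
def zcoeff (m : ℤ) : FunBStar k →ₗ[k] k :=
  ({ toFun f := f.coeff m, map_add' _ _ := rfl, map_smul' _ _ := rfl } :
    LaurentSeries k →ₗ[k] k) ∘ₗ Finsupp.lapply 0 ∘ₗ
    (AddMonoidAlgebra.coeffLinearEquiv k :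
      LaurentPolynomial (LaurentSeries k) ≃ₗ[k] (ℤ →₀ LaurentSeries k)).toLinearMap

theorem zcoeff_mono (m n : ℤ) (f : LaurentSeries k) :
    zcoeff m (mono n f) = if n = 0 then f.coeff m else 0 := by
  change (Finsupp.single n f 0).coeff m = _
  rw [Finsupp.single_apply]
  split_ifs <;> rfl

/-- The function `z^m`. -/
def zpw (m : ℤ) : FunBStar k := mono 0 (HahnSeries.single m 1)

theorem zpw_mul (m n : ℤ) : (zpw m * zpw n : FunBStar k) = zpw (m + n) := by
  simp [zpw, mono_mul]

theorem zpw_zero : (zpw 0 : FunBStar k) = 1 := mono_zero_one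

theorem zpw_one_mem : (zpw 1 : FunBStar k) ∈ Set.range (funB k) := by
  have := mono_mem_range (k := k) 0 PowerSeries.X
  rwa [HahnSeries.ofPowerSeries_X] at this

/-- A bundle map of constant coefficients after conjugation by `u^Y`. -/
def tilde (T : E.V →ₗ[k] F.V) : Sec E →ₗ[FunBStar k] Sec F :=
  uY F ∘ₗ T.baseChange (FunBStar k) ∘ₗ uYi E

theorem flat_tilde (T : E.V →ₗ[k] F.V) : flat (tilde T) = T.baseChange (FunBStar k) :=
  LinearMap.ext fun x => by
    rw [flat_apply, tilde, LinearMap.comp_apply, LinearMap.comp_apply, uYi_uY, uYi_uY]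

theorem baseChange_onSec (T : E.V →ₗ[k] F.V) (δ : FunBStar k →ₗ[k] FunBStar k) (x : Sec E) :
    T.baseChange (FunBStar k) (onSec E δ x) = onSec F δ (T.baseChange (FunBStar k) x) := by
  induction x using TensorProduct.induction_on with
  | zero => simp only [map_zero]
  | add x y hx hy => simp only [map_add, hx, hy]
  | tmul r x => simp

theorem isInvariant_tilde (T : E.V →ₗ[k] F.V) : IsInvariant (tilde T) :=
  isInvariant_iff.mpr fun t x => by rw [flat_tilde, baseChange_onSec]

theorem isRegular_tilde (T : E.V →ₗ[k] F.V) : IsRegular (tilde T) :=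
  isRegular_uY.comp ((IsRegular.baseChange T).comp isRegular_uYi)

theorem raises_tilde {d : ℤ} {T : E.V →ₗ[k] F.V} (hT : RaisesBy d T) : RaisesByA d (tilde T) :=
  (((raisesByA_diag F _).comp (hT.baseChange.comp (raisesByA_diag E _)))).mono (by omega)

theorem tilde_add (S T : E.V →ₗ[k] F.V) : tilde (S + T) = tilde S + tilde T := by
  simp only [tilde, LinearMap.baseChange_add, LinearMap.add_comp, LinearMap.comp_add]

theorem tilde_sub (S T : E.V →ₗ[k] F.V) : tilde (S - T) = tilde S - tilde T := by
  simp only [tilde, LinearMap.baseChange_sub, LinearMap.sub_comp, LinearMap.comp_sub]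

theorem tilde_comp (S : F.V →ₗ[k] G.V) (T : E.V →ₗ[k] F.V) :
    tilde (S ∘ₗ T) = tilde S ∘ₗ tilde T := LinearMap.ext fun x => by
  simp only [tilde, LinearMap.baseChange_comp, LinearMap.comp_apply, uYi_uY]

/-- A map of degree 0 commutes with u^Y. -/
theorem tilde_graded {T : E.V →ₗ[k] F.V} (hT : IsGraded T) : tilde T = ext₀ T :=
  LinearMap.ext fun x => by
    rw [tilde, LinearMap.comp_apply, LinearMap.comp_apply, uYi, hT.diag]
    exact uY_uYi _

theorem tilde_zero : tilde (0 : E.V →ₗ[k] F.V) = 0 := by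
  rw [tilde, LinearMap.baseChange_zero, LinearMap.zero_comp, LinearMap.comp_zero]

/-- The coefficient of `z^m` of an invariant bundle map. -/
def cf (m : ℤ) (f : Sec E →ₗ[FunBStar k] Sec F) : E.V →ₗ[k] F.V :=
  contract (zcoeff m) ∘ₗ (flat f).restrictScalars k ∘ₗ TensorProduct.mk k (FunBStar k) E.V 1

theorem cf_apply (m : ℤ) (f : Sec E →ₗ[FunBStar k] Sec F) (x : E.V) :
    cf m f x = contract (zcoeff m) (flat f (1 ⊗ₜ[k] x)) := rfl

theorem cf_add (m : ℤ) (f g : Sec E →ₗ[FunBStar k] Sec F) : cf m (f + g) = cf m f + cf m g :=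
  LinearMap.ext fun x => by
    simp only [cf_apply, LinearMap.add_apply, flat_apply, map_add]

theorem raises_cf {d : ℤ} (m : ℤ) {f : Sec E →ₗ[FunBStar k] Sec F} (hf : RaisesByA d f) :
    RaisesBy d (cf m f) := fun n x hx => by
  rw [cf_apply]
  refine contract_mem_wfil _ ?_
  have h : RaisesByA d (flat f) :=
    ((raisesByA_diag F _).comp (hf.comp (raisesByA_diag E _))).mono (by omega)
  exact h _ _ (E.tmul_mem_wfilA le_rfl hx 1)

/-- The coefficients of a function regular on B are power series, so they have no negative powers of
z. -/
theorem zcoeff_funB {m : ℤ} (hm : m < 0) (p : LaurentPolynomial (PowerSeries k)) :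
    zcoeff m (funB k p) = 0 := by
  induction p using AddMonoidAlgebra.induction_linear with
  | zero => simp
  | add x y hx hy => rw [map_add, map_add, hx, hy, add_zero]
  | single n φ =>
    have : funB k (AddMonoidAlgebra.single n φ) = mono n (HahnSeries.ofPowerSeries ℤ k φ) :=
      AddMonoidAlgebra.mapAlgHom_single ..
    rw [this, zcoeff_mono]
    split_ifs
    · rw [PowerSeries.coeff_coe, if_pos hm]
    · rfl

theorem contract_regSec {m : ℤ} (hm : m < 0) {x : Sec E} (hx : x ∈ regSec E) :
    contract (zcoeff m) x = 0 := by
  refine regSec_induction (p := fun x => contract (zcoeff m) x = 0) hx (fun r n e he => ?_)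
    fun x y hx hy => by rw [map_add, hx, hy, add_zero]
  rw [contract_tmul, zcoeff_funB hm, zero_smul]

theorem cf_of_regular {m : ℤ} (hm : m < 0) {f : Sec E →ₗ[FunBStar k] Sec F} (hf : IsRegular f) :
    cf m f = 0 := LinearMap.ext fun x =>
  contract_regSec hm (hf.flat _ (one_tmul_mem_regSec x))

theorem flat_smul (r : FunBStar k) (f : Sec E →ₗ[FunBStar k] Sec F) :
    flat (r • f) = r • flat f := LinearMap.ext fun x => by
  simp only [flat_apply, LinearMap.smul_apply, map_smul]

theorem flat_sub (f g : Sec E →ₗ[FunBStar k] Sec F) : flat (f - g) = flat f - flat g :=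
  LinearMap.ext fun x => by simp only [flat_apply, LinearMap.sub_apply, map_sub]

/-- This recovers the residue of a connection in normal form from its fibre component, with m = -1.
-/
theorem cf_smul_tilde (m : ℤ) (T : E.V →ₗ[k] F.V) : cf m ((zpw m : FunBStar k) • tilde T) = T :=
  LinearMap.ext fun x => by
    rw [cf_apply, flat_smul, flat_tilde, LinearMap.smul_apply, LinearMap.baseChange_tmul,
      TensorProduct.smul_tmul', contract_tmul, smul_eq_mul, mul_one, zpw, zcoeff_mono, if_pos rfl,
      HahnSeries.coeff_single_same, one_smul]

/-- A power series minus its constant term is divisible by z. Powers of u other than u⁰ are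
discarded both by `constU` and by `zcoeff 0`. -/
theorem regSec_sub_zcoeff {x : Sec E} (hx : x ∈ regSec E) :
    (zpw (-1) : FunBStar k) • (onSec E (constU k) x - 1 ⊗ₜ[k] contract (zcoeff 0) x) ∈
      regSec E := by
  refine regSec_induction (p := fun x => (zpw (-1) : FunBStar k) •
    (onSec E (constU k) x - 1 ⊗ₜ[k] contract (zcoeff 0) x) ∈ regSec E) hx (fun r n e he => ?_)
    fun x y hx hy => ?_
  · rw [onSec_tmul, contract_tmul, TensorProduct.tmul_smul, TensorProduct.smul_tmul',
      ← TensorProduct.sub_tmul, TensorProduct.smul_tmul', smul_eq_mul]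
    have key : (zpw (-1) : FunBStar k) * (constU k (funB k r) - zcoeff 0 (funB k r) • 1) ∈
        (funB k).toLinearMap.range := by
      induction r using AddMonoidAlgebra.induction_linear with
      | zero => simp
      | add x y hx hy =>
        rw [map_add, map_add, map_add, add_smul, add_sub_add_comm, mul_add]
        exact Submodule.add_mem _ hx hy
      | single n φ =>
        have : funB k (AddMonoidAlgebra.single n φ) = mono n (HahnSeries.ofPowerSeries ℤ k φ) :=
          AddMonoidAlgebra.mapAlgHom_single ..
        rw [this, zcoeff_mono, constU, coeffwise_mono]
        by_cases hn : n = 0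
        · obtain ⟨ψ, hψ⟩ := PowerSeries.X_dvd_iff.mpr
            (show PowerSeries.constantCoeff (φ - PowerSeries.C (PowerSeries.constantCoeff φ)) = 0
              by simp)
          have h0 : (HahnSeries.ofPowerSeries ℤ k φ).coeff 0 = PowerSeries.constantCoeff φ := by
            rw [PowerSeries.coeff_coe]
            simp
          have h1 : (mono 0 (HahnSeries.ofPowerSeries ℤ k φ) : FunBStar k) -
              PowerSeries.constantCoeff φ • 1 =
                zpw 1 * mono 0 (HahnSeries.ofPowerSeries ℤ k ψ) := by
            rw [zpw, mono_mul, zero_add, ← HahnSeries.ofPowerSeries_X, ← map_mul, ← hψ, map_sub,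
              HahnSeries.ofPowerSeries_C, ← mono_zero_one, ← mono_smul, sub_eq_iff_eq_add,
              ← mono_add]
            congr 1
            rw [sub_add_eq_add_sub, add_sub_assoc, left_eq_add, sub_eq_zero, Algebra.smul_def,
              mul_one]
            rfl
          rw [if_pos hn, if_pos hn, LinearMap.id_apply, hn, h0, h1, ← mul_assoc, zpw_mul,
            show (-1 + 1 : ℤ) = 0 from rfl, zpw_zero, one_mul]
          exact mono_mem_range 0 ψ
        · have h0 : (mono n 0 : FunBStar k) = 0 := AddMonoidAlgebra.single_zero _
          rw [if_neg hn, if_neg hn, LinearMap.zero_apply, h0, zero_smul, sub_zero, mul_zero]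
          exact Submodule.zero_mem _
    exact tmul_mem_regSec key e
  · rw [map_add, map_add, TensorProduct.tmul_add, add_sub_add_comm, smul_add]
    exact Submodule.add_mem _ hx hy

/-- An invariant regular bundle map is congruent to its value at `z = 0` modulo `z`. -/
theorem IsRegular.sub_tilde {f : Sec E →ₗ[FunBStar k] Sec F} (hf : IsRegular f)
    (hi : IsInvariant f) : IsRegular ((zpw (-1) : FunBStar k) • (f - tilde (cf 0 f))) := by
  refine IsRegular.of_flat (IsRegular.of_gr fun n x hx => ?_)
  rw [flat_smul, flat_sub, flat_tilde, LinearMap.smul_apply, LinearMap.sub_apply,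
    LinearMap.baseChange_tmul, cf_apply]
  have := regSec_sub_zcoeff (hf.flat _ (one_tmul_mem_regSec x))
  rwa [flat_constU hi] at this

end Coefficients

/-! ### Unipotent bundle maps -/

section Unipotent

variable {k : Type u} [Field k] [CharZero k] {E F G : GrVec k}

/-- Y acts as the scalar n on the graded piece of index n of the weight filtration. -/
theorem degOp_mem {n : ℤ} {x : Sec E} (hx : x ∈ E.wfilA (FunBStar k) n) :
    degOp E x - algebraMap k (FunBStar k) n • x ∈ E.wfilA (FunBStar k) (n + 1) := by
  have := E.wfilA_le (A := FunBStar k) (n := n) (N := (E.wfilA (FunBStar k) (n + 1)).comap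
    (degOp E - LinearMap.lsmul (FunBStar k) (Sec E) (algebraMap k (FunBStar k) n)))
    fun m hm x hx => ?_
  · exact this hx
  · rw [Submodule.mem_comap, LinearMap.sub_apply, LinearMap.lsmul_apply, degOp, E.diag_tmul _ _ hx,
      TensorProduct.smul_tmul', ← TensorProduct.sub_tmul]
    rcases hm.eq_or_lt with rfl | hm
    · rw [one_mul, smul_eq_mul, mul_one, sub_self, TensorProduct.zero_tmul]
      exact Submodule.zero_mem _
    · exact E.tmul_mem_wfilA hm hx _

/-- The commutator with the degree operator. -/
def degComm (f : Sec E →ₗ[FunBStar k] Sec F) : Sec E →ₗ[FunBStar k] Sec F :=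
  degOp F ∘ₗ f - f ∘ₗ degOp E

theorem degComm_apply (f : Sec E →ₗ[FunBStar k] Sec F) (x : Sec E) :
    degComm f x = degOp F (f x) - f (degOp E x) := rfl

theorem du_apply {f : Sec E →ₗ[FunBStar k] Sec F} (hf : IsInvariant f) (x : Sec E) :
    onSec F du (f x) = f (onSec E du x) + degComm f x := by
  rw [degComm_apply, ← hf.du, add_sub_cancel]

/-- The commutator with the degree operator is multiplication by `d` on the leading part. -/
theorem degComm_sub {d : ℤ} {f : Sec E →ₗ[FunBStar k] Sec F} (hf : RaisesByA d f) :
    RaisesByA (d + 1) (degComm f - algebraMap k (FunBStar k) d • f) :=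
  RaisesByA.of_gr fun n x hx => by
    have h := degOp_mem (hf n _ (E.tmul_mem_wfilA le_rfl hx 1))
    have e' : degOp E (1 ⊗ₜ[k] x) = algebraMap k (FunBStar k) (n : k) ⊗ₜ[k] x := by
      rw [degOp, E.diag_tmul _ _ hx, one_mul]
    rw [LinearMap.sub_apply, degComm_apply, LinearMap.smul_apply, e']
    have e : f ((algebraMap k (FunBStar k) (n : k)) ⊗ₜ[k] x) =
        algebraMap k (FunBStar k) (n : k) • f (1 ⊗ₜ[k] x) := by
      rw [← map_smul, TensorProduct.smul_tmul', smul_eq_mul, mul_one]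
    rw [e, sub_sub, ← add_smul, ← map_add, ← Int.cast_add, ← add_assoc]
    exact h

theorem isInvariant_degOp : IsInvariant (degOp E) :=
  isInvariant_diag fun n => ⟨algebraMap k _ n, by
    rw [Algebra.algebraMap_eq_smul_one, Algebra.algebraMap_eq_smul_one, mono_smul, mono_zero_one]⟩

theorem isRegular_degOp : IsRegular (degOp E) :=
  isRegular_diag fun n => ⟨algebraMap k _ n, (funB k).commutes _⟩

theorem IsInvariant.degComm {f : Sec E →ₗ[FunBStar k] Sec F} (hf : IsInvariant f) :
    IsInvariant (degComm f) :=
  IsInvariant.sub (f := degOp F ∘ₗ f) (g := f ∘ₗ degOp E)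
    (IsInvariant.comp isInvariant_degOp hf) (IsInvariant.comp hf isInvariant_degOp)

theorem IsRegular.degComm {f : Sec E →ₗ[FunBStar k] Sec F} (hf : IsRegular f) :
    IsRegular (degComm f) := (isRegular_degOp.comp hf).sub (hf.comp isRegular_degOp)

theorem RaisesByA.degComm {d : ℤ} {f : Sec E →ₗ[FunBStar k] Sec F} (hf : RaisesByA d f) :
    RaisesByA d (degComm f) :=
  (((raisesByA_diag F _).comp hf).mono (by omega)).sub
    ((hf.comp (raisesByA_diag E _)).mono (by omega))

/-- Modulo terms raising the weight by d + 1, the commutator [Y, f] is d·f, and d is invertible in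
k. A gain for [Y, f] is therefore a gain for f. -/
theorem RaisesByA.of_degComm {d : ℤ} (hd : d ≠ 0) {f : Sec E →ₗ[FunBStar k] Sec F}
    (hf : RaisesByA d f) (h : RaisesByA (d + 1) (Equising.degComm f)) : RaisesByA (d + 1) f := by
  have e : f = algebraMap k (FunBStar k) (d : k)⁻¹ • (Equising.degComm f -
      (Equising.degComm f - algebraMap k (FunBStar k) d • f)) := LinearMap.ext fun x => by
    rw [LinearMap.smul_apply, LinearMap.sub_apply, LinearMap.sub_apply, sub_sub_cancel,
      LinearMap.smul_apply, smul_smul, ← map_mul, inv_mul_cancel₀ (Int.cast_ne_zero.mpr hd),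
      map_one, one_smul]
  rw [e]
  exact (h.sub (degComm_sub hf)).smul _

/-- If the weight gained can always be improved by one, it eventually exceeds the bound beyond which
every map is zero. -/
theorem eq_zero_of_raises {f : Sec E →ₗ[FunBStar k] Sec F}
    (h : ∀ d : ℤ, 1 ≤ d → RaisesByA d f → RaisesByA (d + 1) f) (h1 : RaisesByA 1 f) : f = 0 := by
  obtain ⟨N, hN⟩ := exists_raisesByA_eq_zero E F
  have key (n : ℕ) : RaisesByA (n + 1 : ℤ) f := by
    induction n with
    | zero => simpa using h1
    | succ n ih => exact_mod_cast h _ (by omega) ih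
  exact hN _ f ((key N).mono (by omega))

/-- An invariant bundle map which raises the weight and intertwines two connections along the
fibres vanishes. -/
theorem eq_zero_of_commute {f : Sec E →ₗ[FunBStar k] Sec F} (hi : IsInvariant f)
    (hf : RaisesByA 1 f) {C : Sec E →ₗ[FunBStar k] Sec E} {C' : Sec F →ₗ[FunBStar k] Sec F}
    (hC : RaisesByA 1 C) (hC' : RaisesByA 1 C')
    (h : ∀ x, f (onSec E du x + C x) = onSec F du (f x) + C' (f x)) : f = 0 := by
  -- As [u∂_u, f] = [Y, f], the intertwining relation says [Y, f] = fC - C'f. Since C and C' raise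
  -- the weight, the right side gains one more step than f.
  have e : degComm f = f ∘ₗ C - C' ∘ₗ f := LinearMap.ext fun x => by
    have := h x
    rw [du_apply hi, map_add, add_assoc, add_left_cancel_iff] at this
    rw [LinearMap.sub_apply, LinearMap.comp_apply, LinearMap.comp_apply, this, add_sub_cancel_right]
  refine eq_zero_of_raises (fun d hd hfd => RaisesByA.of_degComm (by omega) hfd ?_) hf
  rw [e]
  exact ((hfd.comp hC).mono (by omega)).sub ((hC'.comp hfd).mono (by omega))

theorem raises_pow {d : ℤ} {f : Sec E →ₗ[FunBStar k] Sec E} (hf : RaisesByA 1 f) (n : ℕ) :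
    RaisesByA n (f ^ n) := by
  induction n with
  | zero => exact fun n x hx => by simpa using hx
  | succ n ih => rw [pow_succ]; exact (RaisesByA.comp ih hf).mono (by push_cast; omega)

/-- A unipotent bundle map is invertible. -/
theorem exists_unipotent {X : Sec E →ₗ[FunBStar k] Sec E} (hX : RaisesByA 1 X)
    (hi : IsInvariant X) : ∃ h : Sec E ≃ₗ[FunBStar k] Sec E,
      h.toLinearMap = LinearMap.id + X ∧ IsInvariant h ∧ RaisesByA 1 (h.symm.toLinearMap - LinearMap.id) ∧
        IsInvariant h.symm ∧ (IsRegular X → IsRegular h.symm.toLinearMap) := by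
  obtain ⟨N, hN⟩ := exists_raisesByA_eq_zero E E
  have hnil : (-X) ^ N = 0 := hN _ _ (raises_pow (d := 1) hX.neg N)
  -- X is nilpotent, so the inverse of 1 + X is a finite geometric series. It inherits regularity
  -- from X.
  let Z : Sec E →ₗ[FunBStar k] Sec E := ∑ i ∈ Finset.range N, (-X) ^ i
  have h1 (x : Sec E) : Z x + X (Z x) = x := by
    have : Z x - (-X) (Z x) = x - ((-X) ^ N) x := LinearMap.congr_fun
      (mul_neg_geom_sum (R := Module.End (FunBStar k) (Sec E)) (-X) N) x
    rwa [hnil, LinearMap.zero_apply, sub_zero, LinearMap.neg_apply, sub_neg_eq_add] at this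
  have h2 (x : Sec E) : Z (x + X x) = x := by
    have : Z (x - (-X) x) = x - ((-X) ^ N) x := LinearMap.congr_fun
      (geom_sum_mul_neg (R := Module.End (FunBStar k) (Sec E)) (-X) N) x
    rwa [hnil, LinearMap.zero_apply, sub_zero, LinearMap.neg_apply, sub_neg_eq_add] at this
  let h : Sec E ≃ₗ[FunBStar k] Sec E :=
    LinearEquiv.ofLinearMap (LinearMap.id + X) Z (LinearMap.ext h1) (LinearMap.ext h2)
  have hh : h.toLinearMap = LinearMap.id + X := rfl
  have hhs : h.symm.toLinearMap = Z := rfl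
  have hinv : IsInvariant h := IsInvariant.add (f := LinearMap.id) (g := X) IsInvariant.id hi
  refine ⟨h, hh, hinv, ?_, fun t x => ?_, fun hr => ?_⟩
  · have e : Z - LinearMap.id = -(X ∘ₗ Z) := LinearMap.ext fun x => by
      change Z x - x = -X (Z x)
      rw [sub_eq_iff_eq_add, neg_add_eq_sub, eq_sub_iff_add_eq]
      exact h1 x
    have hZ : RaisesByA 0 Z := RaisesByA.sum fun i _ => (raises_pow (d := 1) hX.neg i).mono (by omega)
    rw [hhs, e]
    exact ((hX.comp hZ).mono (by omega)).neg
  · rw [LinearEquiv.symm_apply_eq, hinv, LinearEquiv.apply_symm_apply]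
  · rw [hhs]
    have hp (i : ℕ) : IsRegular ((-X) ^ i) := by
      induction i with
      | zero => exact IsRegular.id
      | succ n ih => rw [pow_succ]; exact ih.comp hr.neg
    exact IsRegular.sum fun i _ => hp i

end Unipotent

end Equising

end

noncomputable section

namespace Equising

open GrVec

/-! ### Gauge transformations -/

section Gauge

variable {k : Type u} [Field k] [CharZero k] {E F G : GrVec k}

/-- Invariant automorphisms which induce the identity on the associated graded bundle. -/
structure IsGauge (h : Sec E ≃ₗ[FunBStar k] Sec E) : Prop where
  invariant : IsInvariant h
  raises : RaisesByA 1 (h.toLinearMap - LinearMap.id)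
  raises_symm : RaisesByA 1 (h.symm.toLinearMap - LinearMap.id)

theorem IsGauge.refl : IsGauge (LinearEquiv.refl (FunBStar k) (Sec E)) := by
  refine ⟨fun t x => rfl, fun n x hx => ?_, fun n x hx => ?_⟩ <;>
  · change x - x ∈ _
    rw [sub_self]
    exact Submodule.zero_mem _

theorem IsGauge.symm {h : Sec E ≃ₗ[FunBStar k] Sec E} (hh : IsGauge h) : IsGauge h.symm :=
  ⟨fun t x => by rw [LinearEquiv.symm_apply_eq, hh.invariant, LinearEquiv.apply_symm_apply],
    hh.raises_symm, hh.raises⟩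

theorem IsGauge.trans {h g : Sec E ≃ₗ[FunBStar k] Sec E} (hh : IsGauge h) (hg : IsGauge g) :
    IsGauge (h.trans g) :=
  ⟨fun t x => by simp only [LinearEquiv.trans_apply, hh.invariant t x, hg.invariant t],
    raises_comp hg.raises hh.raises, raises_comp hh.raises_symm hg.raises_symm⟩

theorem RaisesByA.of_sub_id {f : Sec E →ₗ[FunBStar k] Sec E}
    (hf : RaisesByA 1 (f - LinearMap.id)) : RaisesByA 0 f := fun n x hx => by
  have := Submodule.add_mem _ (E.wfilA_anti (show n + 0 ≤ n + 1 by omega) (hf n x hx))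
    (show x ∈ E.wfilA (FunBStar k) (n + 0) by rwa [add_zero])
  rwa [LinearMap.sub_apply, LinearMap.id_apply, sub_add_cancel] at this

theorem IsInvariant.algebraMap_smul (c : k) {f : Sec E →ₗ[FunBStar k] Sec F}
    (hf : IsInvariant f) : IsInvariant (algebraMap k (FunBStar k) c • f) := by
  have : algebraMap k (FunBStar k) c = mono 0 (algebraMap k _ c) := by
    rw [Algebra.algebraMap_eq_smul_one, Algebra.algebraMap_eq_smul_one, mono_smul, mono_zero_one]
  rw [this]
  exact hf.smul _

theorem IsRegular.algebraMap_smul (c : k) {f : Sec E →ₗ[FunBStar k] Sec F}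
    (hf : IsRegular f) : IsRegular (algebraMap k (FunBStar k) c • f) :=
  hf.smul ⟨algebraMap k _ c, (funB k).commutes c⟩

/-- The effect of the gauge transformation `1 + X` on the leading part of a connection. -/
theorem exists_step {d : ℤ} (hd : 1 ≤ d) {X C : Sec E →ₗ[FunBStar k] Sec E} (hX : RaisesByA d X)
    (hXi : IsInvariant X) (hC : RaisesByA 1 C) (hCi : IsInvariant C) :
    ∃ (h : Sec E ≃ₗ[FunBStar k] Sec E) (C' : Sec E →ₗ[FunBStar k] Sec E),
      IsGauge h ∧ IsInvariant C' ∧ RaisesByA 1 C' ∧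
      (∀ x, h (onSec E du x + C x) = onSec E du (h x) + C' (h x)) ∧
      RaisesByA (d + 1) (C' - (C - algebraMap k (FunBStar k) d • X)) ∧
      (IsRegular X → IsRegular h.toLinearMap ∧ IsRegular h.symm.toLinearMap ∧
        (IsRegular ((zpw 1 : FunBStar k) • C) → IsRegular ((zpw 1 : FunBStar k) • C'))) := by
  obtain ⟨h, h1, h2, h3, h4, h5⟩ := exists_unipotent (hX.mono hd) hXi
  have hx (x : Sec E) : h x = x + X x := LinearMap.congr_fun h1 x
  have hg : IsGauge h := ⟨h2, by
    have : h.toLinearMap - LinearMap.id = X := LinearMap.ext fun x => by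
      change h x - x = X x
      rw [hx, add_sub_cancel_left]
    rw [this]
    exact hX.mono hd, h3⟩
  have hhC : RaisesByA 1 (h.toLinearMap ∘ₗ C - degComm X) :=
    (((RaisesByA.of_sub_id hg.raises).comp hC).mono (by omega)).sub ((RaisesByA.degComm hX).mono hd)
  have hhi : IsInvariant (h.toLinearMap ∘ₗ C - degComm X) :=
    IsInvariant.sub (f := h.toLinearMap ∘ₗ C) (g := degComm X)
      (IsInvariant.comp (g := h.toLinearMap) h2 hCi) hXi.degComm
  -- The new fibre component is forced: [u∂_u, h] = [Y, X] for h = 1 + X, so conjugation takes u∂_u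
  -- + C to u∂_u + (hC - [Y, X])h⁻¹.
  refine ⟨h, (h.toLinearMap ∘ₗ C - degComm X) ∘ₗ h.symm.toLinearMap, hg,
    IsInvariant.comp (f := h.symm.toLinearMap) hhi h4, ?_, fun x => ?_, ?_, fun hr => ?_⟩
  · exact (hhC.comp (RaisesByA.of_sub_id h3)).mono (by omega)
  · have e : onSec E du (h x) = h (onSec E du x) + degComm X x := by
      rw [hx, hx, map_add, du_apply hXi, add_assoc]
    rw [e, map_add]
    change _ = h (onSec E du x) + degComm X x + (h (C (h.symm (h x))) - degComm X (h.symm (h x)))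
    rw [LinearEquiv.symm_apply_apply]
    abel
  -- Every term of the error gains d + 1: XC and CX because C raises the weight, [Y, X] - dX by the
  -- computation of the leading part, and X² because 2d ≥ d + 1.
  · have e : (h.toLinearMap ∘ₗ C - degComm X) ∘ₗ h.symm.toLinearMap -
        (C - algebraMap k (FunBStar k) d • X) = (X ∘ₗ C - C ∘ₗ X -
          (degComm X - algebraMap k (FunBStar k) d • X) +
            algebraMap k (FunBStar k) d • X ∘ₗ X) ∘ₗ h.symm.toLinearMap := by
      refine LinearMap.ext fun y => ?_
      obtain ⟨x, rfl⟩ := h.surjective y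
      simp only [LinearMap.sub_apply, LinearMap.add_apply, LinearMap.comp_apply,
        LinearEquiv.coe_coe, LinearEquiv.symm_apply_apply, LinearMap.smul_apply]
      rw [hx (C x), hx x, map_add, map_add, smul_add]
      abel
    rw [e]
    refine (RaisesByA.comp (d := d + 1) ?_ (RaisesByA.of_sub_id h3)).mono (by omega)
    exact ((((hX.comp hC).mono (by omega)).sub ((hC.comp hX).mono (by omega))).sub
      (degComm_sub hX)).add (((hX.comp hX).smul _).mono (by omega))
  · have hh : IsRegular h.toLinearMap := by rw [h1]; exact IsRegular.id.add hr
    refine ⟨hh, h5 hr, fun hz => ?_⟩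
    -- Here zC' = (h(zC) - z[Y, X])h⁻¹ involves only regular maps, so the pole stays simple.
    have e : (zpw 1 : FunBStar k) • ((h.toLinearMap ∘ₗ C - degComm X) ∘ₗ h.symm.toLinearMap) =
        (h.toLinearMap ∘ₗ ((zpw 1 : FunBStar k) • C) - (zpw 1 : FunBStar k) • degComm X) ∘ₗ
          h.symm.toLinearMap := LinearMap.ext fun x => by
      simp only [LinearMap.sub_apply, LinearMap.comp_apply, LinearMap.smul_apply, map_smul,
        smul_sub]
    rw [e]
    exact ((hh.comp hz).sub (hr.degComm.smul zpw_one_mem)).comp (h5 hr)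

/-- Every connection along the fibres is trivialized by an invariant frame over `B*`. -/
theorem exists_frame {C : Sec E →ₗ[FunBStar k] Sec E} (hC : RaisesByA 1 C) (hCi : IsInvariant C) :
    ∃ g : Sec E ≃ₗ[FunBStar k] Sec E, IsGauge g ∧ ∀ x, g (onSec E du x + C x) = onSec E du (g x) := by
  obtain ⟨N, hN⟩ := exists_raisesByA_eq_zero E E
  -- Induction on the number m of weight steps still to be cleared, for C which already raises the
  -- weight by d.
  suffices key : ∀ (m : ℕ) (d : ℤ), 1 ≤ d → (N : ℤ) ≤ d + m → ∀ C : Sec E →ₗ[FunBStar k] Sec E,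
      RaisesByA d C → IsInvariant C → ∃ g : Sec E ≃ₗ[FunBStar k] Sec E, IsGauge g ∧
        ∀ x, g (onSec E du x + C x) = onSec E du (g x) from
    key N 1 le_rfl (by omega) C hC hCi
  intro m
  induction m with
  | zero =>
    intro d hd hNd C hC _
    refine ⟨LinearEquiv.refl _ _, IsGauge.refl, fun x => ?_⟩
    rw [hN _ C (hC.mono (by simpa using hNd))]
    change onSec E du x + 0 = _
    rw [add_zero]
    rfl
  | succ m ih =>
    intro d hd hNd C hC hCi
    -- The choice X = d⁻¹C cancels the leading part of C. It need not be regular at z = 0, which is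
    -- why the frame exists over B* only.
    obtain ⟨h, C', h1, h2, h3, h4, h5, -⟩ := exists_step hd
      (hC.smul (algebraMap k (FunBStar k) (d : k)⁻¹)) (hCi.algebraMap_smul _) (hC.mono hd) hCi
    have hd0 : (d : k) ≠ 0 := Int.cast_ne_zero.mpr (by omega)
    have e : C' = C' - (C - algebraMap k (FunBStar k) d • algebraMap k (FunBStar k) (d : k)⁻¹ • C) :=
      LinearMap.ext fun x => by
        rw [smul_smul, ← map_mul, mul_inv_cancel₀ hd0, map_one, one_smul]
        simp only [LinearMap.sub_apply, sub_self, sub_zero]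
    rw [← e] at h5
    obtain ⟨g, hg, hg'⟩ := ih (d + 1) (by omega) (by push_cast at hNd; omega) C' h5 h2
    exact ⟨h.trans g, h1.trans hg, fun x => by
      rw [LinearEquiv.trans_apply, h4, hg', LinearEquiv.trans_apply]⟩

/-- A connection along the fibres with a simple pole is gauge equivalent on `B` to one whose
coefficients are multiples of `z⁻¹`. -/
theorem exists_residue {C : Sec E →ₗ[FunBStar k] Sec E} (hC : RaisesByA 1 C) (hCi : IsInvariant C)
    (hz : IsRegular ((zpw 1 : FunBStar k) • C)) :
    ∃ (g : Sec E ≃ₗ[FunBStar k] Sec E) (β : E.V →ₗ[k] E.V), IsGauge g ∧ IsRegular g.toLinearMap ∧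
      IsRegular g.symm.toLinearMap ∧ RaisesBy 1 β ∧ ∀ x, g (onSec E du x + C x) =
        onSec E du (g x) + ((zpw (-1) : FunBStar k) • tilde β) (g x) := by
  obtain ⟨N, hN⟩ := exists_raisesByA_eq_zero E E
  -- The induction carries a partial residue β which agrees with C up to terms raising the weight by
  -- d.
  suffices key : ∀ (m : ℕ) (d : ℤ), 1 ≤ d → (N : ℤ) ≤ d + m →
      ∀ (C : Sec E →ₗ[FunBStar k] Sec E) (β : E.V →ₗ[k] E.V), RaisesByA 1 C → IsInvariant C →
      IsRegular ((zpw 1 : FunBStar k) • C) → RaisesBy 1 β →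
      RaisesByA d (C - (zpw (-1) : FunBStar k) • tilde β) →
      ∃ (g : Sec E ≃ₗ[FunBStar k] Sec E) (β : E.V →ₗ[k] E.V), IsGauge g ∧ IsRegular g.toLinearMap ∧
      IsRegular g.symm.toLinearMap ∧ RaisesBy 1 β ∧ ∀ x, g (onSec E du x + C x) =
        onSec E du (g x) + ((zpw (-1) : FunBStar k) • tilde β) (g x) by
    refine key N 1 le_rfl (by omega) C 0 hC hCi hz (fun n x _ => Submodule.zero_mem _) ?_
    rw [tilde_zero, smul_zero]
    exact hC.sub RaisesByA.zero
  intro m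
  induction m with
  | zero =>
    intro d hd hNd C β hC _ _ hβ hf
    refine ⟨LinearEquiv.refl _ _, β, IsGauge.refl, fun x hx => hx, fun x hx => hx, hβ, fun x => ?_⟩
    have := LinearMap.congr_fun (hN _ _ (hf.mono (by simpa using hNd))) x
    rw [LinearMap.sub_apply, LinearMap.zero_apply, sub_eq_zero] at this
    rw [this]
    rfl
  | succ m ih =>
    intro d hd hNd C β hC hCi hz hβ hf
    have hd0 : (d : k) ≠ 0 := Int.cast_ne_zero.mpr (by omega)
    let f := C - (zpw (-1) : FunBStar k) • tilde β
    have hfi : IsInvariant f :=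
      IsInvariant.sub (f := C) (g := (zpw (-1) : FunBStar k) • tilde β) hCi
        ((isInvariant_tilde β).smul _)
    have hz' (x : Sec E) : (zpw 1 : FunBStar k) • (zpw (-1) : FunBStar k) • x = x := by
      exact (smul_smul _ _ x).trans (by rw [zpw_mul, add_neg_cancel, zpw_zero, one_smul])
    have hz'' (x : Sec E) : (zpw (-1) : FunBStar k) • (zpw 1 : FunBStar k) • x = x := by
      exact (smul_smul _ _ x).trans (by rw [zpw_mul, neg_add_cancel, zpw_zero, one_smul])
    have hzf : IsRegular ((zpw 1 : FunBStar k) • f) := by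
      have : (zpw 1 : FunBStar k) • f = (zpw 1 : FunBStar k) • C - tilde β :=
        LinearMap.ext fun x => by
          simp only [f, LinearMap.smul_apply, LinearMap.sub_apply, smul_sub, hz']
      rw [this]
      exact hz.sub (isRegular_tilde β)
    -- The value at z = 0 of z times the remainder is the part that no regular gauge transformation
    -- removes, and it is moved into the residue. What is left is regular after division by z and
    -- serves as dX.
    let β₁ := cf 0 ((zpw 1 : FunBStar k) • f)
    have hβ₁ : RaisesBy d β₁ := raises_cf 0 (hf.smul _)
    let X := algebraMap k (FunBStar k) (d : k)⁻¹ • (zpw (-1) : FunBStar k) •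
      ((zpw 1 : FunBStar k) • f - tilde β₁)
    have hX : RaisesByA d X := (((hf.smul _).sub (raises_tilde hβ₁)).smul _).smul _
    have hXr : IsRegular X := (hzf.sub_tilde (hfi.smul _)).algebraMap_smul _
    have hXi : IsInvariant X := by
      refine IsInvariant.algebraMap_smul _ (IsInvariant.smul _ ?_)
      exact IsInvariant.sub (f := (zpw 1 : FunBStar k) • f) (g := tilde β₁) (hfi.smul _)
        (isInvariant_tilde β₁)
    obtain ⟨h, C', h1, h2, h3, h4, h5, h6⟩ := exists_step hd hX hXi hC hCi
    obtain ⟨h7, h8, h9⟩ := h6 hXr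
    have e : C' - (C - algebraMap k (FunBStar k) d • X) =
        C' - (zpw (-1) : FunBStar k) • tilde (β + β₁) := LinearMap.ext fun x => by
      have : algebraMap k (FunBStar k) d • X = (zpw (-1) : FunBStar k) •
          ((zpw 1 : FunBStar k) • f - tilde β₁) := LinearMap.ext fun x => by
        simp only [X]
        rw [smul_smul, ← map_mul, mul_inv_cancel₀ hd0, map_one, one_smul]
      rw [this, tilde_add]
      simp only [f, LinearMap.sub_apply, LinearMap.smul_apply, LinearMap.add_apply, smul_sub,
        smul_add, hz'']
      abel
    rw [e] at h5
    obtain ⟨g, γ, g1, g2, g3, g4, g5⟩ := ih (d + 1) (by omega) (by push_cast at hNd; omega) C'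
      (β + β₁) h3 h2 (h9 hz) (hβ.add (hβ₁.mono hd)) h5
    exact ⟨h.trans g, γ, h1.trans g1, g2.comp h7, h8.comp g3, g4, fun x => by
      rw [LinearEquiv.trans_apply, h4, g5, LinearEquiv.trans_apply]⟩

end Gauge

end Equising

end

noncomputable section

namespace Equising

open GrVec

/-! ### Flat invariant connections -/

section Flat

variable {k : Type u} [Field k] [CharZero k] {E F G : GrVec k}

/-- Flat invariant `W`-connections. -/
structure IsFlatW (A : Conn E) : Prop where
  weight_z : RaisesByA 1 A.z
  weight_u : RaisesByA 1 A.u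
  flat : ∀ x, A.nabla.z (A.nabla.u x) = A.nabla.u (A.nabla.z x)
  invariant_z : IsInvariant A.z
  invariant_u : IsInvariant A.u

theorem nabla_z (A : Conn E) (x : Sec E) : A.nabla.z x = onSec E dz x + A.z x := rfl

theorem nabla_u (A : Conn E) (x : Sec E) : A.nabla.u x = onSec E du x + A.u x := rfl

theorem isInvariant_onSec_dz : IsInvariant (onSec E dz) := fun t x => by
  have := (IsFlatEquisingular.trivial E).invariant_z t x
  rw [nabla_z, nabla_z] at this
  change onSec E dz (rho E t x) + 0 = rho E t (onSec E dz x + 0) at this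
  rwa [add_zero, add_zero] at this

theorem isInvariant_onSec_du : IsInvariant (onSec E du) := fun t x => by
  have := (IsFlatEquisingular.trivial E).invariant_u t x
  rw [nabla_u, nabla_u] at this
  change onSec E du (rho E t x) + 0 = rho E t (onSec E du x + 0) at this
  rwa [add_zero, add_zero] at this

/-- The derivations d/dz and u∂_u commute with the action, so invariance of the covariant
derivatives is invariance of the coefficients. -/
theorem IsFlatEquisingular.isFlatW {A : Conn E} (h : IsFlatEquisingular A) : IsFlatW A :=
  ⟨h.weight_z, h.weight_u, h.flat, fun t x => by
    have := h.invariant_z t x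
    rwa [nabla_z, nabla_z, map_add, isInvariant_onSec_dz t, add_right_inj] at this, fun t x => by
    have := h.invariant_u t x
    rwa [nabla_u, nabla_u, map_add, isInvariant_onSec_du t, add_right_inj] at this⟩

theorem IsFlatW.isFlatEquisingular {A : Conn E} (h : IsFlatW A) (he : IsEquisingular A.nabla) :
    IsFlatEquisingular A :=
  ⟨h.weight_z, h.weight_u, h.flat, fun t x => by
    rw [nabla_z, nabla_z, map_add, isInvariant_onSec_dz t, h.invariant_z t], fun t x => by
    rw [nabla_u, nabla_u, map_add, isInvariant_onSec_du t, h.invariant_u t], he⟩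

/-- The filtration is spanned by constant sections, so differentiating coefficients preserves it. -/
theorem onSec_mem_wfilA (δ : FunBStar k →ₗ[k] FunBStar k) {n : ℤ} {x : Sec E}
    (hx : x ∈ E.wfilA (FunBStar k) n) : onSec E δ x ∈ E.wfilA (FunBStar k) n := by
  rw [wfilA, Submodule.baseChange_eq_span] at hx
  induction hx using Submodule.closure_induction with
  | zero => rw [map_zero]; exact Submodule.zero_mem _
  | add x y _ _ hx hy => rw [map_add]; exact Submodule.add_mem _ hx hy
  | smul_mem r x hx =>
    obtain ⟨y, hy, rfl⟩ := hx
    change onSec E δ (r • (1 : FunBStar k) ⊗ₜ[k] y) ∈ _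
    rw [TensorProduct.smul_tmul', smul_eq_mul, mul_one, onSec_tmul]
    exact Submodule.tmul_mem_baseChange_of_mem _ hy

theorem dz_one : dz (1 : FunBStar k) = 0 := by
  rw [← map_one (algebraMap k (FunBStar k)), dz_algebraMap]

/-- A bundle map which intertwines the covariant derivatives along the fibres is horizontal. -/
theorem intertwine_z {A : Conn E} {B : Conn F} (hA : IsFlatW A) (hB : IsFlatW B)
    {τ : Sec E →ₗ[FunBStar k] Sec F} (hi : IsInvariant τ) {T : E.V →ₗ[k] F.V} (hT : IsGraded T)
    (hτ : RaisesByA 1 (τ - ext₀ T)) (hu : ∀ x, τ (A.nabla.u x) = B.nabla.u (τ x)) (x : Sec E) :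
    τ (A.nabla.z x) = B.nabla.z (τ x) := by
  -- The failure of τ to commute with ∇_z is linear over functions, because the Leibniz terms
  -- cancel.
  let f : Sec E →ₗ[FunBStar k] Sec F :=
    { toFun x := τ (A.nabla.z x) - B.nabla.z (τ x)
      map_add' x y := by simp only [map_add]; abel
      map_smul' r x := by
        rw [EqBundle.nabla_smul_z, map_add, map_smul, map_smul, map_smul, EqBundle.nabla_smul_z,
          add_sub_add_left_eq_sub, RingHom.id_apply, smul_sub] }
  have hf (x : Sec E) : f x = τ (A.nabla.z x) - B.nabla.z (τ x) := rfl
  have h0 : RaisesByA 0 τ := by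
    have : τ = (τ - ext₀ T) + ext₀ T := LinearMap.ext fun x => by
      rw [LinearMap.add_apply, LinearMap.sub_apply, sub_add_cancel]
    rw [this]
    exact (hτ.mono (by omega)).add hT.raisesBy.baseChange
  have hf1 : RaisesByA 1 f := RaisesByA.of_gr fun n x hx => by
    have hx1 := E.tmul_mem_wfilA (A := FunBStar k) (le_refl n) hx 1
    -- On a constant section the derivative of the constant part T drops out, and each remaining
    -- term contains a weight-raising factor.
    have e : f (1 ⊗ₜ[k] x) = τ (A.z (1 ⊗ₜ[k] x)) - B.z (τ (1 ⊗ₜ[k] x)) -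
        onSec F dz ((τ - ext₀ T) (1 ⊗ₜ[k] x)) := by
      have e1 : onSec F dz (ext₀ T (1 ⊗ₜ[k] x)) = 0 := by
        rw [ext₀, LinearMap.baseChange_tmul, onSec_tmul, dz_one, TensorProduct.zero_tmul]
      rw [hf, nabla_z, nabla_z, onSec_tmul, dz_one, TensorProduct.zero_tmul, zero_add,
        LinearMap.sub_apply, map_sub, e1]
      abel
    rw [e]
    refine Submodule.sub_mem _ (Submodule.sub_mem _ ?_ ?_) (onSec_mem_wfilA _ (hτ n _ hx1))
    · exact F.wfilA_anti (by omega) (h0 _ _ (hA.weight_z _ _ hx1))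
    · exact F.wfilA_anti (by omega) (hB.weight_z _ _ (h0 _ _ hx1))
  have hfi : IsInvariant f := fun t x => by
    rw [hf, hf, nabla_z, nabla_z, nabla_z, nabla_z, hi t, isInvariant_onSec_dz t,
      isInvariant_onSec_dz t, hA.invariant_z t, hB.invariant_z t, ← map_add, hi t, ← map_add,
      ← map_sub]
  -- Flatness on both sides makes the defect commute with ∇_u as well, and rigidity kills it.
  have := eq_zero_of_commute hfi hf1 hA.weight_u hB.weight_u fun x => by
    change f (A.nabla.u x) = B.nabla.u (f x)
    rw [hf, hf, hA.flat, hu, hu, map_sub, hB.flat]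
  exact sub_eq_zero.mp (LinearMap.congr_fun this x)

theorem raisesByA_sub_ext_id {f : Sec E →ₗ[FunBStar k] Sec E} (hf : RaisesByA 1 (f - LinearMap.id)) :
    RaisesByA 1 (f - ext₀ LinearMap.id) := by
  rwa [ext₀, LinearMap.baseChange_id]

/-- For flat connections equivalence need only be checked along the fibres; the z-component follows
by `intertwine_z`. -/
theorem gaugeEquiv_of_u {A B : Conn E} (hA : IsFlatW A) (hB : IsFlatW B)
    {h : Sec E ≃ₗ[FunBStar k] Sec E} (hh : IsGauge h) (h1 : IsRegular h.toLinearMap)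
    (h2 : IsRegular h.symm.toLinearMap) (hu : ∀ x, h (A.nabla.u x) = B.nabla.u (h x)) :
    GaugeEquiv A.nabla B.nabla :=
  ⟨h, h1, h2, hh.invariant, hh.raises, hh.raises_symm,
    intertwine_z hA hB (τ := h.toLinearMap) hh.invariant isGraded_id
      (raisesByA_sub_ext_id hh.raises) hu, hu⟩

/-- Likewise for constant lifts: T intertwines the z-components as soon as it intertwines the fibre
components. -/
theorem hasLift_of_u {A : Conn E} {B : Conn F} (hA : IsFlatW A) (hB : IsFlatW B)
    {T : E.V →ₗ[k] F.V} (hT : IsGraded T) (hu : ∀ x, ext₀ T (A.nabla.u x) = B.nabla.u (ext₀ T x)) :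
    HasLift T A.nabla B.nabla := by
  refine HasLift.of_commute hT (fun x => ?_) hu
  refine intertwine_z hA hB (IsInvariant.baseChange hT) hT (fun n x _ => ?_) hu x
  change ext₀ T x - ext₀ T x ∈ _
  rw [sub_self]
  exact Submodule.zero_mem _

/-- A connection along the fibres extends to a flat connection. -/
theorem exists_flat {C : Sec E →ₗ[FunBStar k] Sec E} (hC : RaisesByA 1 C) (hCi : IsInvariant C) :
    ∃ A : Conn E, A.u = C ∧ IsFlatW A := by
  obtain ⟨g, hg, hgu⟩ := exists_frame hC hCi
  -- The derivation d/dz is transported through the frame g. Since g takes ∇_u to u∂_u, flatness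
  -- becomes the commutation of d/dz and u∂_u. Z is the difference from d/dz, hence linear over
  -- functions.
  let Z : Sec E →ₗ[FunBStar k] Sec E :=
    { toFun x := g.symm (onSec E dz (g x)) - onSec E dz x
      map_add' x y := by simp only [map_add]; abel
      map_smul' r x := by
        rw [map_smul, onSec_smul dz_mul, onSec_smul dz_mul, map_add, map_smul, map_smul,
          LinearEquiv.symm_apply_apply, add_sub_add_left_eq_sub, RingHom.id_apply, smul_sub] }
  let A : Conn E := ⟨Z, C⟩
  have hz (x : Sec E) : A.nabla.z x = g.symm (onSec E dz (g x)) := by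
    change onSec E dz x + (g.symm (onSec E dz (g x)) - onSec E dz x) = _
    rw [add_sub_cancel]
  have hu (x : Sec E) : A.nabla.u x = g.symm (onSec E du (g x)) := by
    rw [LinearEquiv.eq_symm_apply]
    exact hgu x
  refine ⟨A, rfl, ⟨RaisesByA.of_gr fun n x hx => ?_, hC, fun x => ?_, fun t x => ?_, hCi⟩⟩
  · change g.symm (onSec E dz (g (1 ⊗ₜ[k] x))) - onSec E dz (1 ⊗ₜ[k] x) ∈ _
    have e : onSec E dz (g (1 ⊗ₜ[k] x)) =
        onSec E dz ((g.toLinearMap - LinearMap.id : Sec E →ₗ[FunBStar k] Sec E) (1 ⊗ₜ[k] x)) := by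
      change _ = onSec E dz (g (1 ⊗ₜ[k] x) - 1 ⊗ₜ[k] x)
      rw [map_sub, onSec_tmul, dz_one, TensorProduct.zero_tmul, sub_zero]
    rw [onSec_tmul, dz_one, TensorProduct.zero_tmul, sub_zero, e]
    refine E.wfilA_anti (show n + 1 ≤ n + 1 + 0 by omega) ((RaisesByA.of_sub_id hg.raises_symm) _ _ (onSec_mem_wfilA _
      (hg.raises n _ (E.tmul_mem_wfilA (le_refl n) hx 1))))
  · have hc (x : Sec E) : onSec E dz (onSec E du x) = onSec E du (onSec E dz x) := by
      rw [onSec_comp, onSec_comp]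
      congr 1
      exact congrArg _ (LinearMap.ext dz_du)
    rw [hz, hu, hu, hz, LinearEquiv.apply_symm_apply, LinearEquiv.apply_symm_apply, hc]
  · change g.symm (onSec E dz (g (rho E t x))) - onSec E dz (rho E t x) =
      rho E t (g.symm (onSec E dz (g x)) - onSec E dz x)
    rw [hg.invariant t, isInvariant_onSec_dz t, isInvariant_onSec_dz t, hg.symm.invariant t, map_sub]

/-! ### Pull-backs -/

/-- The pull-back of the trivial connection is trivial; read on sections, this is the chain rule. -/
theorem pull_dz {w : LaurentSeries k} (hw : w ≠ 0) (x : Sec E) :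
    onSec E (substU w) (onSec E dz (onSec E (substU w⁻¹) x)) +
      (mono 0 (LaurentSeries.derivative k w * w⁻¹) : FunBStar k) •
        onSec E (substU w) (onSec E du (onSec E (substU w⁻¹) x)) = onSec E dz x := by
  have := LinearMap.congr_fun (congrArg Ops.z (pull_trivial E hw)) x
  change onSec E (substU w) (onSec E dz (onSec E (substU w⁻¹) x) + 0) +
      (mono 0 (LaurentSeries.derivative k w * w⁻¹) : FunBStar k) •
        onSec E (substU w) (onSec E du (onSec E (substU w⁻¹) x) + 0) = onSec E dz x + 0 at this
  simpa only [add_zero] using this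

theorem onSec_substU_inv {w : LaurentSeries k} (hw : w ≠ 0) (x : Sec E) :
    onSec E (substU w) (onSec E (substU w⁻¹) x) = x := by
  rw [onSec_comp]
  have : substU w ∘ₗ substU w⁻¹ = (LinearMap.id : FunBStar k →ₗ[k] FunBStar k) :=
    LinearMap.ext fun x => substU_inv hw x
  rw [this, onSec, LinearMap.rTensor_id, LinearMap.id_apply]

theorem pull_du {w : LaurentSeries k} (hw : w ≠ 0) (x : Sec E) :
    onSec E (substU w) (onSec E du (onSec E (substU w⁻¹) x)) = onSec E du x := by
  have : onSec E du (onSec E (substU w) (onSec E (substU w⁻¹) x)) =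
      onSec E (substU w) (onSec E du (onSec E (substU w⁻¹) x)) := by
    rw [onSec_comp (δ' := substU w), onSec_comp (δ' := du)]
    congr 1
    exact congrArg _ (LinearMap.ext fun x => du_substU w x)
  rw [← this, onSec_substU_inv hw]

/-- The conjugate of a bundle map by `w^Y`. -/
def conjY (w : LaurentSeries k) (f : Sec E →ₗ[FunBStar k] Sec F) : Sec E →ₗ[FunBStar k] Sec F :=
  vY F w ∘ₗ f ∘ₗ vY E w⁻¹

/-- An invariant map depends on u only through u^Y, so substituting w u for u amounts to conjugation
by w^Y. -/
theorem conjY_substU {w : LaurentSeries k} (hw : w ≠ 0) {f : Sec E →ₗ[FunBStar k] Sec F}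
    (hf : IsInvariant f) (x : Sec E) :
    onSec F (substU w) (f (onSec E (substU w⁻¹) x)) = conjY w f x := by
  rw [hf.substU hw, onSec_substU_inv hw]
  rfl

theorem IsInvariant.conjY (w : LaurentSeries k) {f : Sec E →ₗ[FunBStar k] Sec F}
    (hf : IsInvariant f) : IsInvariant (conjY w f) :=
  IsInvariant.comp (g := vY F w) (f := f ∘ₗ vY E w⁻¹) (isInvariant_vY w)
    (IsInvariant.comp (g := f) hf (isInvariant_vY _))

theorem RaisesByA.conjY {d : ℤ} (w : LaurentSeries k) {f : Sec E →ₗ[FunBStar k] Sec F}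
    (hf : RaisesByA d f) : RaisesByA d (Equising.conjY w f) :=
  ((raisesByA_diag F _).comp (hf.comp (raisesByA_diag E _))).mono (by omega)

/-- The pull-back of an invariant connection under `u ↦ w u`. -/
def Conn.pull (A : Conn E) (w : LaurentSeries k) : Conn E where
  z := conjY w A.z + (mono 0 (LaurentSeries.derivative k w * w⁻¹) : FunBStar k) • conjY w A.u
  u := conjY w A.u

/-- The operators of the pull-back come from a connection with explicit coefficients, which brings
it within reach of the rigidity results. -/
theorem IsFlatW.nabla_pull {A : Conn E} (hA : IsFlatW A) {w : LaurentSeries k} (hw : w ≠ 0) :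
    (A.pull w).nabla = A.nabla.pull w := by
  refine Ops.ext (LinearMap.ext fun x => ?_) (LinearMap.ext fun x => ?_)
  · change onSec E dz x + (conjY w A.z x +
      (mono 0 (LaurentSeries.derivative k w * w⁻¹) : FunBStar k) • conjY w A.u x) =
      onSec E (substU w) (onSec E dz (onSec E (substU w⁻¹) x) + A.z (onSec E (substU w⁻¹) x)) +
      (mono 0 (LaurentSeries.derivative k w * w⁻¹) : FunBStar k) •
        onSec E (substU w) (onSec E du (onSec E (substU w⁻¹) x) + A.u (onSec E (substU w⁻¹) x))
    rw [map_add, map_add, conjY_substU hw hA.invariant_z, conjY_substU hw hA.invariant_u,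
      ← pull_dz hw x, smul_add]
    abel
  · change onSec E du x + conjY w A.u x =
      onSec E (substU w) (onSec E du (onSec E (substU w⁻¹) x) + A.u (onSec E (substU w⁻¹) x))
    rw [map_add, conjY_substU hw hA.invariant_u, pull_du hw]

theorem IsFlatW.pull {A : Conn E} (hA : IsFlatW A) {w : LaurentSeries k} (hw : w ≠ 0) :
    IsFlatW (A.pull w) := by
  refine ⟨(RaisesByA.conjY w hA.weight_z).add ((RaisesByA.conjY w hA.weight_u).smul _),
    RaisesByA.conjY w hA.weight_u,
    fun x => ?_, ?_, hA.invariant_u.conjY w⟩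
  · have hz (x : Sec E) : (A.pull w).nabla.z x =
        onSec E (substU w) (A.nabla.z (onSec E (substU w⁻¹) x)) +
      (mono 0 (LaurentSeries.derivative k w * w⁻¹) : FunBStar k) • (A.pull w).nabla.u x := by
      rw [hA.nabla_pull hw]
      rfl
    have hu (x : Sec E) : (A.pull w).nabla.u x =
        onSec E (substU w) (A.nabla.u (onSec E (substU w⁻¹) x)) := by
      rw [hA.nabla_pull hw]
      rfl
    have hi (x : Sec E) : onSec E (substU w⁻¹) (onSec E (substU w) x) = x := by
      have := onSec_substU_inv (inv_ne_zero hw) x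
      rwa [inv_inv] at this
    -- The logarithmic derivative of w depends on z alone, so u∂_u kills it and the correction term
    -- does not spoil flatness.
    have h0 (φ : LaurentSeries k) : du (mono 0 φ : FunBStar k) = 0 := by
      rw [du, coeffwise_mono, Int.cast_zero, zero_smul, LinearMap.zero_apply]
      exact AddMonoidAlgebra.single_zero _
    rw [hz, hz x, map_add, EqBundle.nabla_smul_u, h0, zero_smul, zero_add, add_left_inj, hu, hu,
      hi, hi, hA.flat]
  · exact IsInvariant.add (f := conjY w A.z) (hA.invariant_z.conjY w) ((hA.invariant_u.conjY w).smul _)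

end Flat

end Equising

end

noncomputable section

namespace Equising

open GrVec Polynomial

/-! ### Connections with constant residue are equisingular -/

section Residue

variable {k : Type u} [Field k] [CharZero k] {E F : GrVec k}

theorem tilde_id : tilde (LinearMap.id : E.V →ₗ[k] E.V) = LinearMap.id := by
  rw [tilde_graded isGraded_id, ext₀, LinearMap.baseChange_id]

variable (E) in
/-- `tilde` as a ring homomorphism. -/
def tildeHom : Module.End k E.V →+* Module.End (FunBStar k) (Sec E) where
  toFun T := tilde T
  map_one' := tilde_id
  map_mul' S T := tilde_comp S T
  map_zero' := tilde_zero
  map_add' S T := tilde_add S T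

variable (E) in
/-- Polynomials in a function `w` of `z` whose coefficients are endomorphisms of `E`, as bundle
maps. -/
def evalT (w : LaurentSeries k) :
    (Module.End k E.V)[X] →+* Module.End (FunBStar k) (Sec E) :=
  eval₂RingHom' (tildeHom E) (algebraMap (FunBStar k) _ (mono 0 w)) fun T =>
    (Algebra.commutes (mono 0 w : FunBStar k) (tildeHom E T)).symm

theorem evalT_C (w : LaurentSeries k) (T : Module.End k E.V) : evalT E w (C T) = tilde T :=
  eval₂_C _ _

theorem evalT_X (w : LaurentSeries k) :
    evalT E w X = algebraMap (FunBStar k) (Module.End (FunBStar k) (Sec E)) (mono 0 w) :=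
  eval₂_X _ _

theorem mono_zero_pow (w : LaurentSeries k) (n : ℕ) :
    (mono 0 w : FunBStar k) ^ n = mono 0 (w ^ n) := by
  induction n with
  | zero => rw [pow_zero, pow_zero, mono_zero_one]
  | succ n ih => rw [pow_succ, ih, mono_mul, add_zero, pow_succ]

theorem evalT_monomial (w : LaurentSeries k) (n : ℕ) (T : Module.End k E.V) :
    evalT E w (monomial n T) = (mono 0 (w ^ n) : FunBStar k) • tilde T := by
  rw [← C_mul_X_pow_eq_monomial, map_mul, map_pow, evalT_C, evalT_X, ← map_pow, mono_zero_pow,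
    ← Algebra.commutes, ← Algebra.smul_def]

theorem isInvariant_evalT (w : LaurentSeries k) (P : (Module.End k E.V)[X]) :
    IsInvariant (evalT E w P) := by
  induction P using Polynomial.induction_on' with
  | add P Q hP hQ => rw [map_add]; exact IsInvariant.add hP hQ
  | monomial n T => rw [evalT_monomial]; exact (isInvariant_tilde T).smul _

theorem isRegular_evalT (w : PowerSeries k) (P : (Module.End k E.V)[X]) :
    IsRegular (evalT E (HahnSeries.ofPowerSeries ℤ k w) P) := by
  induction P using Polynomial.induction_on' with
  | add P Q hP hQ => rw [map_add]; exact hP.add hQ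
  | monomial n T =>
    rw [evalT_monomial, ← map_pow]
    exact (isRegular_tilde T).smul (mono_mem_range 0 _)

theorem raises_evalT {d : ℤ} (w : LaurentSeries k) {P : (Module.End k E.V)[X]}
    (hP : ∀ i, RaisesBy d (P.coeff i)) : RaisesByA d (evalT E w P) := by
  rw [P.as_sum_range, map_sum]
  refine RaisesByA.sum fun i _ => ?_
  rw [evalT_monomial]
  exact (raises_tilde (hP i)).smul _

variable (E) in
/-- The degree operator on `E`. -/
def degE : Module.End k E.V := E.ofGr fun n => (n : k) • LinearMap.id

theorem degE_of_mem {n : ℤ} {x : E.V} (hx : x ∈ E.gr n) : degE E x = (n : k) • x :=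
  E.ofGr_of_mem _ hx

theorem graded_degE : IsGraded (degE E) := fun n x hx => by
  rw [degE_of_mem hx]
  exact Submodule.smul_mem _ _ hx

theorem tilde_degE : tilde (degE E) = degOp E := by
  rw [tilde_graded graded_degE]
  refine E.baseChange_ext fun n x hx => ?_
  rw [ext₀, LinearMap.baseChange_tmul, degE_of_mem hx, degOp, E.diag_tmul _ _ hx,
    TensorProduct.tmul_smul, TensorProduct.smul_tmul', one_mul, Algebra.algebraMap_eq_smul_one]

/-- Evaluation is a ring homomorphism and Y is the image of a constant polynomial, so commutators
with Y can be computed in the polynomial ring. -/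
theorem degComm_evalT (w : LaurentSeries k) (P : (Module.End k E.V)[X]) :
    degComm (evalT E w P) = evalT E w (C (degE E) * P - P * C (degE E)) := by
  rw [map_sub, map_mul, map_mul, evalT_C, tilde_degE]
  rfl

theorem RaisesBy.sum {ι : Type*} {s : Finset ι} {d : ℤ} {T : ι → E.V →ₗ[k] F.V}
    (h : ∀ i ∈ s, RaisesBy d (T i)) : RaisesBy d (∑ i ∈ s, T i) := fun n x hx => by
  rw [LinearMap.sum_apply]
  exact Submodule.sum_mem _ fun i hi => h i hi n x hx

theorem RaisesBy.smul (c : k) {d : ℤ} {T : E.V →ₗ[k] F.V} (h : RaisesBy d T) :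
    RaisesBy d (c • T) := fun n x hx => Submodule.smul_mem _ c (h n x hx)

/-- The primitive of a polynomial with coefficients in an algebra over `k` which vanishes at `0`. -/
def primitive {M : Type*} [Ring M] [Algebra k M] (P : M[X]) : M[X] :=
  X * ∑ i ∈ Finset.range (P.natDegree + 1), monomial i ((i + 1 : k)⁻¹ • P.coeff i)

theorem coeff_primitive_zero {M : Type*} [Ring M] [Algebra k M] (P : M[X]) :
    (primitive (k := k) P).coeff 0 = 0 := by
  rw [primitive, coeff_X_mul_zero]

theorem coeff_primitive_succ {M : Type*} [Ring M] [Algebra k M] (P : M[X]) (n : ℕ) :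
    (primitive (k := k) P).coeff (n + 1) = (n + 1 : k)⁻¹ • P.coeff n := by
  rw [primitive, coeff_X_mul, finsetSum_coeff]
  simp only [coeff_monomial]
  rw [Finset.sum_ite_eq' (Finset.range (P.natDegree + 1)) n]
  split_ifs with h
  · rfl
  · rw [coeff_eq_zero_of_natDegree_lt (by simpa using h), smul_zero]

theorem derivative_primitive {M : Type*} [Ring M] [Algebra k M] (P : M[X]) :
    derivative (primitive (k := k) P) = P := by
  ext n
  rw [coeff_derivative, coeff_primitive_succ]
  have : (n + 1 : M) = algebraMap k M (n + 1) := by simp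
  rw [this, ← Algebra.commutes, ← Algebra.smul_def, smul_smul,
    mul_inv_cancel₀ (Nat.cast_add_one_ne_zero n), one_smul]

variable (k) in
-- The integers n + 1 are invertible in k. A polynomial identity can thus be verified by comparing
-- derivatives and values at 0.
theorem eq_zero_of_derivative {M : Type*} [Ring M] [Algebra k M] {P : M[X]}
    (h : derivative P = 0) (h0 : P.coeff 0 = 0) : P = 0 := by
  ext n
  cases n with
  | zero => rw [h0, coeff_zero]
  | succ n =>
    have h1 := congrArg (fun Q => Q.coeff n) h
    simp only [coeff_derivative, coeff_zero] at h1
    have : (n + 1 : M) = algebraMap k M (n + 1) := by simp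
    rw [this, ← Algebra.commutes, ← Algebra.smul_def] at h1
    rw [coeff_zero]
    have h2 : P.coeff (n + 1) = (n + 1 : k)⁻¹ • (n + 1 : k) • P.coeff (n + 1) := by
      rw [smul_smul, inv_mul_cancel₀ (Nat.cast_add_one_ne_zero n), one_smul]
    rw [h2, h1, smul_zero]

/-- The iterated integrals which express the dependence of a connection on the trivialization. -/
def iterInt {M : Type*} [Ring M] [Algebra k M] (B : M[X]) : ℕ → M[X]
  | 0 => 1
  | n + 1 => -primitive (k := k) (B * iterInt B n)

/-- Both sides have the same constant term: B(0) = β for n = 0, and the higher iterated integrals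
vanish at 0. Their derivatives agree by the hypothesis on (1 + X)B together with the case n - 1. -/
theorem commutator_iterInt {M : Type*} [Ring M] [Algebra k M] {B : M[X]} {Y β : M}
    (hB : derivative ((1 + X) * B) = C Y * B - B * C Y) (hβ : B.coeff 0 = β) (n : ℕ) :
    C Y * iterInt (k := k) B (n + 1) - iterInt (k := k) B (n + 1) * C Y =
      iterInt (k := k) B n * C β - (1 + X) * B * iterInt (k := k) B n := by
  have hd (n : ℕ) : derivative (iterInt (k := k) B (n + 1)) = -(B * iterInt (k := k) B n) := by
    rw [iterInt, derivative_neg, derivative_primitive]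
  have h0 (n : ℕ) : (iterInt (k := k) B (n + 1)).coeff 0 = 0 := by
    rw [iterInt, coeff_neg, coeff_primitive_zero, neg_zero]
  have hX (P Q : M[X]) : P * ((1 + X) * Q) = (1 + X) * (P * Q) := by
    rw [add_mul, add_mul, one_mul, one_mul, mul_add, ← mul_assoc P X, ← X_mul, mul_assoc]
  have hd1 : derivative (iterInt (k := k) B 0) = 0 := derivative_one
  rw [← sub_eq_zero]
  induction n with
  | zero =>
    refine eq_zero_of_derivative k ?_ ?_
    · simp only [derivative_sub, Polynomial.derivative_mul (f := C _),
        Polynomial.derivative_mul (g := C _), Polynomial.derivative_mul (g := iterInt _ _),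
        derivative_C, hd, hd1, hB, zero_mul, zero_add, mul_zero, add_zero]
      simp only [iterInt, mul_one]
      noncomm_ring
    · simp only [iterInt, mul_one, one_mul, coeff_sub, mul_coeff_zero, coeff_neg,
        coeff_primitive_zero, coeff_add, coeff_one_zero, coeff_X_zero, coeff_C_zero, hβ]
      simp
  | succ n ih =>
    refine eq_zero_of_derivative k ?_ ?_
    · simp only [derivative_sub, Polynomial.derivative_mul (f := C _),
        Polynomial.derivative_mul (g := C _), Polynomial.derivative_mul (g := iterInt _ _),
        derivative_C, hd, hB, zero_mul, zero_add, mul_zero, add_zero]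
      -- Expanding [Y, B·Iₙ₊₁] by the Leibniz rule cancels the terms in [Y, B] and leaves B times
      -- the identity for n.
      have e : C Y * -(B * iterInt (k := k) B (n + 1)) - -(B * iterInt (k := k) B (n + 1)) * C Y -
          (-(B * iterInt (k := k) B n) * C β - ((C Y * B - B * C Y) * iterInt (k := k) B (n + 1) +
            (1 + X) * B * -(B * iterInt (k := k) B n))) =
          -(B * (C Y * iterInt (k := k) B (n + 1) - iterInt (k := k) B (n + 1) * C Y -
            (iterInt (k := k) B n * C β)) + (1 + X) * B * (B * iterInt (k := k) B n)) := by
        noncomm_ring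
      rw [e]
      have e2 : B * ((1 + X) * B * iterInt (k := k) B n) =
          (1 + X) * B * (B * iterInt (k := k) B n) := by
        rw [mul_assoc, hX, mul_assoc]
      rw [← e2, ← mul_add, neg_eq_zero]
      rw [sub_sub] at ih ⊢
      convert mul_zero B using 2
      rw [← ih]
      abel
    · simp only [coeff_sub, mul_coeff_zero, h0, mul_zero, zero_mul, sub_zero]

/-- Each integration from 0 adds one order of vanishing. This compensates the factor z⁻ⁿ put in
front of the n-th iterated integral. -/
theorem X_pow_dvd_iterInt {M : Type*} [Ring M] [Algebra k M] (B : M[X]) (n : ℕ) :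
    X ^ n ∣ iterInt (k := k) B n := by
  induction n with
  | zero => rw [pow_zero]; exact one_dvd _
  | succ n ih =>
    have h : X ^ n ∣ B * iterInt (k := k) B n := by
      obtain ⟨Q, hQ⟩ := ih
      exact ⟨B * Q, by rw [hQ, ← mul_assoc, ← mul_assoc, X_pow_mul]⟩
    rw [X_pow_dvd_iff] at h ⊢
    intro d hd
    cases d with
    | zero => rw [iterInt, coeff_neg, coeff_primitive_zero, neg_zero]
    | succ d => rw [iterInt, coeff_neg, coeff_primitive_succ, h d (by omega), smul_zero, neg_zero]

/-- Each factor B raises the weight by 1, so the series of iterated integrals is finite after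
evaluation. -/
theorem raises_iterInt {B : (Module.End k E.V)[X]} (hB : ∀ i, RaisesBy 1 (B.coeff i)) (n : ℕ) :
    ∀ i, RaisesBy n ((iterInt (k := k) B n).coeff i) := by
  induction n with
  | zero =>
    intro i
    rw [iterInt, coeff_one]
    split_ifs
    · exact isGraded_id.raisesBy
    · exact fun n x hx => Submodule.zero_mem _
  | succ n ih =>
    intro i
    rw [iterInt, coeff_neg]
    refine RaisesBy.neg ?_
    cases i with
    | zero => rw [coeff_primitive_zero]; exact fun n x hx => Submodule.zero_mem _
    | succ i =>
      rw [coeff_primitive_succ, coeff_mul]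
      refine RaisesBy.smul _ (RaisesBy.sum fun p _ => ?_)
      exact ((hB p.1).comp (ih p.2)).mono (by push_cast; omega)

/-- For T of degree d the factors wⁿ⁺ᵈ and w⁻ⁿ combine to wᵈ. -/
theorem conjY_tilde {d : ℤ} {T : E.V →ₗ[k] F.V} (hT : ∀ n, ∀ x ∈ E.gr n, T x ∈ F.gr (n + d))
    {w : LaurentSeries k} (hw : w ≠ 0) :
    conjY w (tilde T) = (mono 0 (w ^ d) : FunBStar k) • tilde T := by
  refine E.baseChange_ext fun n x hx => ?_
  have h1 : tilde T (1 ⊗ₜ[k] x) = (mono d 1 : FunBStar k) ⊗ₜ[k] T x := by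
    rw [tilde, LinearMap.comp_apply, LinearMap.comp_apply, uYi, E.diag_tmul _ _ hx, one_mul,
      LinearMap.baseChange_tmul, uY, F.diag_tmul _ _ (hT n x hx), mono_mul]
    simp
  have h2 : vY E w⁻¹ (1 ⊗ₜ[k] x) = (mono 0 (w⁻¹ ^ n) : FunBStar k) • (1 ⊗ₜ[k] x) := by
    rw [vY, E.diag_tmul _ _ hx, TensorProduct.smul_tmul', smul_eq_mul, one_mul, mul_one]
  rw [conjY, LinearMap.comp_apply, LinearMap.comp_apply, h2, map_smul, map_smul, h1,
    LinearMap.smul_apply, h1, vY, F.diag_tmul _ _ (hT n x hx), TensorProduct.smul_tmul',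
    TensorProduct.smul_tmul', smul_eq_mul, smul_eq_mul, mono_mul, mono_mul, mono_mul]
  congr 2
  · ring
  · rw [zpow_add₀ hw, inv_zpow, one_mul, mul_one, ← mul_assoc, inv_mul_cancel₀ (zpow_ne_zero _ hw),
      one_mul]

set_option maxHeartbeats 800000 in
/-- The gauge transformation between the trivializations of a connection with constant residue. -/
theorem exists_retrivialize {β : E.V →ₗ[k] E.V} (hβ : RaisesBy 1 β) {v : PowerSeries k}
    (hv : PowerSeries.constantCoeff v = 1) : ∃ H : Sec E →ₗ[FunBStar k] Sec E,
      IsInvariant H ∧ IsRegular H ∧ RaisesByA 1 (H - LinearMap.id) ∧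
      degComm H = H ∘ₗ ((zpw (-1) : FunBStar k) • tilde β) -
        ((zpw (-1) : FunBStar k) • conjY (HahnSeries.ofPowerSeries ℤ k v) (tilde β)) ∘ₗ H := by
  obtain ⟨N, hN⟩ := exists_sum_comp E E
  have hN := hN N le_rfl β hβ
  obtain ⟨M, hM⟩ := exists_raisesByA_eq_zero E E
  -- Because v(0) = 1, one has v - 1 = zφ with φ regular. This is the only place where the
  -- normalization of the section at z = 0 keeps the gauge transformation regular.
  obtain ⟨φ, hφ⟩ := PowerSeries.X_dvd_iff.mpr (show PowerSeries.constantCoeff (v - 1) = 0 by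
    rw [map_sub, hv, map_one, sub_self])
  let w : LaurentSeries k := HahnSeries.ofPowerSeries ℤ k (v - 1)
  have hw : HahnSeries.ofPowerSeries ℤ k v = 1 + w := by
    rw [← map_one (HahnSeries.ofPowerSeries ℤ k), ← map_add, add_sub_cancel]
  -- With w = v - 1 the conjugate v^Y β v^{-Y} = ∑ vᵃ β_a is the value at w of (1 + X)B. The
  -- exponent a of 1 + X accompanies the component of degree a + 1, since the degrees start at 1.
  let B : (Module.End k E.V)[X] := ∑ a ∈ Finset.range N, C (GrVec.comp (a + 1 : ℤ) β) * (1 + X) ^ a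
  have hcomp (a : ℤ) : degE E * GrVec.comp a β - GrVec.comp a β * degE E = (a : k) • GrVec.comp a β := by
    refine E.hom_ext fun n x hx => ?_
    change degE E (GrVec.comp a β x) - GrVec.comp a β (degE E x) = (a : k) • GrVec.comp a β x
    rw [degE_of_mem (comp_mem a β hx), degE_of_mem hx, map_smul, ← sub_smul]
    push_cast
    congr 1
    ring
  have hB0 : B.coeff 0 = β := by
    simp only [B, finsetSum_coeff, mul_coeff_zero, coeff_C_zero]
    conv_rhs => rw [← hN]
    refine Finset.sum_congr rfl fun a _ => ?_
    rw [coeff_one_add_X_pow]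
    simp
  -- Euler's identity: differentiating (1 + X)^{a+1} gives the factor a + 1, which is also the
  -- eigenvalue of [Y, ·] on the component of degree a + 1.
  have hBd : derivative ((1 + X) * B) = C (degE E) * B - B * C (degE E) := by
    simp only [B, Finset.mul_sum, Finset.sum_mul, derivative_sum, ← Finset.sum_sub_distrib]
    refine Finset.sum_congr rfl fun a _ => ?_
    have hc : Commute (C (degE E)) ((1 + X : (Module.End k E.V)[X]) ^ a) :=
      Commute.pow_right ((Commute.one_right _).add_right (commute_X _).symm) a
    have hc' : Commute (C (GrVec.comp (a + 1 : ℤ) β)) (1 + X : (Module.End k E.V)[X]) :=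
      (Commute.one_right _).add_right (commute_X _).symm
    rw [mul_assoc (C (GrVec.comp (a + 1 : ℤ) β)), ← hc.eq, ← mul_assoc, ← mul_assoc, ← mul_assoc,
      ← hc'.eq, mul_assoc, ← pow_succ', ← sub_mul, ← C_mul, ← C_mul, ← C_sub, hcomp,
      Polynomial.derivative_mul, derivative_C, zero_mul, zero_add]
    ext n : 1
    rw [coeff_C_mul, coeff_C_mul, coeff_derivative, coeff_one_add_X_pow, coeff_one_add_X_pow,
      smul_mul_assoc, ← mul_smul_comm]
    congr 1
    have h := congrArg (Nat.cast (R := Module.End k E.V)) (Nat.add_one_mul_choose_eq a n)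
    push_cast at h
    rw [← h, Algebra.smul_def]
    push_cast
    rfl
  have hBr (i : ℕ) : RaisesBy 1 (B.coeff i) := by
    simp only [B, finsetSum_coeff, coeff_C_mul]
    refine RaisesBy.sum fun a _ => ?_
    rw [coeff_one_add_X_pow, ← nsmul_eq_mul', ← Nat.cast_smul_eq_nsmul k]
    exact RaisesBy.smul _ (RaisesBy.mono (RaisesBy.of_deg fun n x hx => comp_mem _ β hx) (by omega))
  have hv0 := ofPowerSeries_ne_zero hv
  have hconj : conjY (HahnSeries.ofPowerSeries ℤ k v) (tilde β) = evalT E w ((1 + X) * B) := by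
    have e : tilde β = ∑ a ∈ Finset.range N, tilde (GrVec.comp (a + 1 : ℤ) β) := by
      conv_lhs => rw [← hN]
      exact map_sum (tildeHom E) _ _
    have e' : conjY (HahnSeries.ofPowerSeries ℤ k v) (tilde β) = ∑ a ∈ Finset.range N,
        conjY (HahnSeries.ofPowerSeries ℤ k v) (tilde (GrVec.comp (a + 1 : ℤ) β)) := by
      refine LinearMap.ext fun x => ?_
      rw [e]
      simp only [conjY, LinearMap.comp_apply, LinearMap.sum_apply, map_sum]
    have e1 : evalT E w (1 + X) = algebraMap (FunBStar k) (Module.End (FunBStar k) (Sec E))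
        (mono 0 (1 + w)) := by
      rw [map_add, map_one, evalT_X, mono_add, map_add, mono_zero_one, map_one]
    rw [e', map_mul, map_sum, Finset.mul_sum]
    refine Finset.sum_congr rfl fun a _ => ?_
    rw [conjY_tilde (fun n x hx => comp_mem _ β hx) hv0, map_mul, map_pow, evalT_C, e1, ← map_pow,
      mono_zero_pow, hw]
    refine LinearMap.ext fun x => ?_
    change _ = (mono 0 (1 + w) : FunBStar k) • tilde (GrVec.comp (a + 1 : ℤ) β)
      ((mono 0 ((1 + w) ^ a) : FunBStar k) • x)
    rw [map_smul, smul_smul, mono_mul, ← pow_succ', add_zero]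
    norm_cast
  -- The n-th term of the solution is z⁻ⁿ times the n-th iterated integral evaluated at v - 1. The
  -- sum is the ordered exponential solving the gauge equation.
  let h : ℕ → Sec E →ₗ[FunBStar k] Sec E := fun i =>
    (zpw (-i : ℤ) : FunBStar k) • evalT E w (iterInt (k := k) B i)
  have hreg (i : ℕ) : IsRegular (h i) := by
    obtain ⟨Q, hQ⟩ := X_pow_dvd_iterInt (k := k) B i
    have e : h i = (mono 0 (HahnSeries.ofPowerSeries ℤ k (φ ^ i)) : FunBStar k) • evalT E w Q := by
      change (zpw (-i : ℤ) : FunBStar k) • evalT E w (iterInt (k := k) B i) = _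
      rw [hQ, map_mul, map_pow, evalT_X, ← map_pow, mono_zero_pow, ← Algebra.smul_def, smul_smul]
      congr 1
      rw [zpw, mono_mul]
      congr 1
      change _ * HahnSeries.ofPowerSeries ℤ k (v - 1) ^ i = _
      rw [hφ, map_mul, mul_pow, HahnSeries.ofPowerSeries_X, map_pow, ← mul_assoc,
        HahnSeries.single_pow]
      simp
    rw [e]
    exact (isRegular_evalT (v - 1) Q).smul (mono_mem_range 0 _)
  have hinv (i : ℕ) : IsInvariant (h i) := (isInvariant_evalT w _).smul _
  have hrai (i : ℕ) : RaisesByA i (h i) := (raises_evalT w (raises_iterInt hBr i)).smul _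
  have hM0 : h M = 0 := hM _ _ (hrai M)
  have hh0 : h 0 = LinearMap.id := by
    change (zpw (-(0 : ℕ) : ℤ) : FunBStar k) • evalT E w 1 = _
    rw [map_one, Nat.cast_zero, neg_zero, zpw_zero, one_smul]
    rfl
  have hstep (i : ℕ) : degComm (h (i + 1)) = h i ∘ₗ ((zpw (-1) : FunBStar k) • tilde β) -
        ((zpw (-1) : FunBStar k) • conjY (HahnSeries.ofPowerSeries ℤ k v) (tilde β)) ∘ₗ h i := by
    have e : degComm (h (i + 1)) = (zpw (-(i + 1 : ℕ) : ℤ) : FunBStar k) •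
        degComm (evalT E w (iterInt (k := k) B (i + 1))) := LinearMap.ext fun x => by
      simp only [h, degComm_apply, LinearMap.smul_apply, map_smul, smul_sub]
    rw [e, degComm_evalT, commutator_iterInt hBd hB0, map_sub, map_mul, map_mul (evalT E w) (_ * _), evalT_C,
      ← hconj]
    have e2 : (zpw (-(i + 1 : ℕ) : ℤ) : FunBStar k) = zpw (-1) * zpw (-i : ℤ) := by
      rw [zpw_mul]
      congr 1
      push_cast
      ring
    refine LinearMap.ext fun x => ?_
    simp only [h, LinearMap.smul_apply, LinearMap.sub_apply, LinearMap.comp_apply,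
      Module.End.mul_apply, map_smul, smul_sub, e2, mul_smul]
    exact congrArg _ (smul_comm (zpw (-1) : FunBStar k) (zpw (-i : ℤ) : FunBStar k) _)
  let H : ℕ → Sec E →ₗ[FunBStar k] Sec E := fun n => ∑ i ∈ Finset.range n, h i
  -- The recursion expresses [Y, ·] of one partial sum through the preceding one. As the term of
  -- index M vanishes, consecutive sums agree and the recursion becomes the required equation.
  have hH : H (M + 1) = H M := by
    rw [show H (M + 1) = H M + h M from Finset.sum_range_succ h M, hM0, add_zero]
  refine ⟨H (M + 1), IsInvariant.sum fun i _ => hinv i, IsRegular.sum fun i _ => hreg i, ?_, ?_⟩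
  · have e : H (M + 1) - LinearMap.id = ∑ i ∈ Finset.range M, h (i + 1) := by
      rw [show H (M + 1) = _ from Finset.sum_range_succ' h M, hh0]
      exact LinearMap.ext fun x =>
        add_sub_cancel_right ((∑ i ∈ Finset.range M, h (i + 1) : Sec E →ₗ[FunBStar k] Sec E) x) x
    rw [e]
    exact RaisesByA.sum fun i _ => (hrai (i + 1)).mono (by push_cast; omega)
  · have hadd (f g : Sec E →ₗ[FunBStar k] Sec E) : degComm (f + g) = degComm f + degComm g :=
      LinearMap.ext fun x => by
        simp only [degComm_apply, LinearMap.add_apply, map_add]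
        abel
    have key (n : ℕ) : degComm (H (n + 1)) = H n ∘ₗ ((zpw (-1) : FunBStar k) • tilde β) -
        ((zpw (-1) : FunBStar k) • conjY (HahnSeries.ofPowerSeries ℤ k v) (tilde β)) ∘ₗ H n := by
      induction n with
      | zero =>
        have e : H 1 = LinearMap.id := (Finset.sum_range_one h).trans hh0
        have e0 : H 0 = 0 := Finset.sum_range_zero h
        rw [e, e0]
        refine LinearMap.ext fun x => ?_
        rw [degComm_apply, LinearMap.id_apply, LinearMap.id_apply, sub_self, LinearMap.zero_comp,
          LinearMap.comp_zero, LinearMap.sub_apply, LinearMap.zero_apply, sub_zero]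
      | succ n ih =>
        have e1 : H (n + 1 + 1) = H (n + 1) + h (n + 1) := Finset.sum_range_succ h (n + 1)
        have e2 : H (n + 1) = H n + h n := Finset.sum_range_succ h n
        rw [e1, hadd, ih, hstep, e2]
        refine LinearMap.ext fun x => ?_
        simp only [LinearMap.sub_apply, LinearMap.comp_apply, LinearMap.add_apply, map_add]
        abel
    rw [key, hH]

end Residue

end Equising

end

noncomputable section

namespace Equising

open GrVec

/-! ### Residues of equisingular connections -/

section Equisingular

variable {k : Type u} [Field k] [CharZero k] {E F G : GrVec k}

theorem conjY_smul (w : LaurentSeries k) (r : FunBStar k) (f : Sec E →ₗ[FunBStar k] Sec F) :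
    conjY w (r • f) = r • conjY w f := LinearMap.ext fun x => by
  simp only [conjY, LinearMap.comp_apply, LinearMap.smul_apply, map_smul]

theorem conjY_one (f : Sec E →ₗ[FunBStar k] Sec F) : conjY 1 f = f := by
  have h (E : GrVec k) : vY E (1 : LaurentSeries k) = LinearMap.id := by
    rw [vY, ← E.diag_one]
    congr 1
    funext n
    rw [one_zpow, mono_zero_one, Pi.one_apply]
  rw [conjY, inv_one, h, h]
  rfl

/-- Flat connections with constant residue are equisingular. -/
theorem IsFlatW.isEquisingular {A : Conn E} (hA : IsFlatW A) {β : E.V →ₗ[k] E.V}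
    (hβ : RaisesBy 1 β) (hu : A.u = (zpw (-1) : FunBStar k) • tilde β) :
    IsEquisingular A.nabla := by
  have hn : HahnSeries.ofPowerSeries ℤ k 1 ≠ 0 := ofPowerSeries_ne_zero (map_one _)
  -- All sections are compared with the constant section 1; equivalence being symmetric and
  -- transitive, this suffices.
  have key (v : PowerSeries k) (hv : PowerSeries.constantCoeff v = 1) :
      GaugeEquiv (A.nabla.pull (HahnSeries.ofPowerSeries ℤ k 1))
        (A.nabla.pull (HahnSeries.ofPowerSeries ℤ k v)) := by
    have hv0 := ofPowerSeries_ne_zero hv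
    obtain ⟨H, h1, h2, h3, h4⟩ := exists_retrivialize hβ hv
    obtain ⟨g, g1, g2, g3, g4, g5⟩ := exists_unipotent h3
      (IsInvariant.sub (f := H) (g := LinearMap.id) h1 IsInvariant.id)
    have hg : g.toLinearMap = H := by
      rw [g1]
      exact LinearMap.ext fun x => add_sub_cancel x (H x)
    rw [← hA.nabla_pull hn, ← hA.nabla_pull hv0]
    refine gaugeEquiv_of_u (hA.pull hn) (hA.pull hv0) (h := g)
      ⟨g2, by rw [hg]; exact h3, g3⟩ (by rw [hg]; exact h2) (g5 (h2.sub IsRegular.id)) fun x => ?_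
    have hgx (x : Sec E) : g x = H x := LinearMap.congr_fun hg x
    -- The equation for [Y, H] says precisely that H takes the fibre component for the section 1 to
    -- the one for v.
    rw [nabla_u, nabla_u, hgx, hgx, du_apply h1, h4, map_add, add_assoc]
    change _ + H (conjY _ A.u x) = _ + (_ + conjY _ A.u (H x))
    rw [map_one, conjY_one, hu, conjY_smul]
    refine congrArg _ ?_
    rw [LinearMap.sub_apply, LinearMap.comp_apply, LinearMap.comp_apply, sub_add_cancel]
  exact fun v v' hv hv' => (key v hv).symm.trans (key v' hv')

/-- Every endomorphism which raises the weight is the residue of an equisingular connection. -/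
theorem exists_isFlatEquisingular {β : E.V →ₗ[k] E.V} (hβ : RaisesBy 1 β) :
    ∃ A : Conn E, A.u = (zpw (-1) : FunBStar k) • tilde β ∧ IsFlatEquisingular A := by
  obtain ⟨A, hu, hA⟩ := exists_flat ((raises_tilde hβ).smul (zpw (-1) : FunBStar k))
    ((isInvariant_tilde β).smul _)
  exact ⟨A, hu, hA.isFlatEquisingular (hA.isEquisingular hβ hu)⟩

/-- If a polynomial with coefficients in a vector space takes values in a subspace, so do its
coefficients. -/
theorem coeff_mem_of_forall {M : Type*} [AddCommGroup M] [Module k M] (W : Submodule k M) (N : ℕ)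
    (w : ℕ → M) (h : ∀ c : k, ∑ l ∈ Finset.range N, c ^ l • w l ∈ W) {l : ℕ} (hl : l < N) :
    w l ∈ W := by
  by_contra hw
  -- A functional vanishing on W but not on the given coefficient would give a nonzero polynomial
  -- with only zero values, which is impossible over an infinite field.
  obtain ⟨f, hf, hfW⟩ := Submodule.exists_le_ker_of_notMem hw
  let P : Polynomial k := ∑ l ∈ Finset.range N, Polynomial.monomial l (f (w l))
  have hP : P = 0 := Polynomial.funext fun c => by
    have := hfW (h c)
    rw [LinearMap.mem_ker, map_sum] at this
    simp only [map_smul, smul_eq_mul] at this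
    simp only [P, Polynomial.eval_finsetSum, Polynomial.eval_monomial, Polynomial.eval_zero]
    rw [← this]
    exact Finset.sum_congr rfl fun l _ => mul_comm _ _
  have h1 : P.coeff l = f (w l) := by
    simp only [P, Polynomial.finsetSum_coeff, Polynomial.coeff_monomial]
    rw [Finset.sum_ite_eq', if_pos (Finset.mem_range.mpr hl)]
  rw [hP, Polynomial.coeff_zero] at h1
  exact hf h1.symm

/-- The sum is a polynomial in c with values in the regular sections, and the conclusion concerns
its coefficient of c¹. -/
theorem smul_mem_of_forall {ι : Type*} (s : Finset ι) (n : ι → ℕ) (y : ι → Sec E)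
    (h : ∀ c : k, ∑ i ∈ s, (1 + c • (zpw 1 : FunBStar k)) ^ n i • y i ∈ regSec E) :
    ∑ i ∈ s, (n i : FunBStar k) • (zpw 1 : FunBStar k) • y i ∈ regSec E := by
  -- N exceeds every exponent, so no binomial term is lost, and it exceeds 1 even when s is empty.
  let N := s.sup n + 2
  let w : ℕ → Sec E := fun l =>
    ∑ i ∈ s, (((n i).choose l : FunBStar k) * (zpw 1 : FunBStar k) ^ l) • y i
  have hw : w 1 ∈ regSec E := by
    refine coeff_mem_of_forall (regSec E) N w (fun c => ?_) (by omega)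
    have e : ∑ l ∈ Finset.range N, c ^ l • w l =
        ∑ i ∈ s, (1 + c • (zpw 1 : FunBStar k)) ^ n i • y i := by
      simp only [w, Finset.smul_sum]
      rw [Finset.sum_comm]
      refine Finset.sum_congr rfl fun i hi => ?_
      have hi' : n i < N := Nat.lt_of_le_of_lt (Finset.le_sup hi) (by omega)
      rw [add_comm 1, add_pow, Finset.sum_smul]
      symm
      refine Finset.sum_subset_zero_on_sdiff (Finset.range_mono (by omega)) (fun l hl => ?_)
        fun l hl => ?_
      · simp only [Finset.mem_sdiff, Finset.mem_range] at hl
        rw [Nat.choose_eq_zero_of_lt (by omega), Nat.cast_zero, zero_mul, zero_smul, smul_zero]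
      · rw [one_pow, mul_one, smul_pow, smul_mul_assoc, mul_comm, smul_assoc]
    rw [e]
    exact h c
  have e : w 1 = ∑ i ∈ s, (n i : FunBStar k) • (zpw 1 : FunBStar k) • y i :=
    Finset.sum_congr rfl fun i _ => by
      rw [Nat.choose_one_right, pow_one, mul_smul]
  rwa [e] at hw

end Equisingular

end Equising

end

noncomputable section

namespace Equising

open GrVec

/-! ### Equisingular connections have a simple pole along the fibres -/

section Pole

variable {k : Type u} [Field k] [CharZero k] {E F G : GrVec k}

theorem smul_lincomb {R M : Type*} [CommRing R] [AddCommGroup M] [Module R M] (z a b c : R) (y : M) :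
    (z * (c + (a - b))) • y = z • (c • y + (a • y - b • y)) := by
  rw [← sub_smul, ← add_smul, smul_smul]

/-- Writing a diagonal operator as a finite sum of projections displays v^Y as a Laurent polynomial
in v. -/
theorem GrVec.diag_eq_sum {A : Type*} [CommRing A] [Algebra k A] (E : GrVec k) (c : ℤ → A)
    (x : A ⊗[k] E.V) : E.diag c x = ∑ m ∈ E.degs, c m • (E.proj m).baseChange A x := by
  induction x using TensorProduct.induction_on with
  | zero => simp only [map_zero, smul_zero, Finset.sum_const_zero]
  | add x y hx hy => simp only [map_add, hx, hy, smul_add, Finset.sum_add_distrib]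
  | tmul a e =>
    have h : E.diag c (a ⊗ₜ[k] e) = ∑ m ∈ E.degs, E.diag c (a ⊗ₜ[k] E.proj m e) := by
      conv_lhs => rw [← E.sum_proj e]
      rw [TensorProduct.tmul_sum, map_sum]
    rw [h]
    refine Finset.sum_congr rfl fun m _ => ?_
    rw [E.diag_tmul _ _ (E.proj_mem m e), LinearMap.baseChange_tmul, TensorProduct.smul_tmul',
      smul_eq_mul, mul_comm]

theorem conjY_comp_inv {w : LaurentSeries k} (hw : w ≠ 0) {f : Sec F →ₗ[FunBStar k] Sec G}
    {g : Sec E →ₗ[FunBStar k] Sec F} (x : Sec E) :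
    conjY w f (conjY w g x) = conjY w (f ∘ₗ g) x := by
  have h (y : Sec F) : vY F w⁻¹ (vY F w y) = y := by
    have := vY_vY_inv (E := F) (inv_ne_zero hw) y
    rwa [inv_inv] at this
  simp only [conjY, LinearMap.comp_apply, h]

theorem conjY_id {w : LaurentSeries k} (hw : w ≠ 0) (x : Sec E) :
    conjY w (LinearMap.id : Sec E →ₗ[FunBStar k] Sec E) x = x := vY_vY_inv hw x

theorem raises_conjY_sub {w : LaurentSeries k} (hw : w ≠ 0) {f : Sec E →ₗ[FunBStar k] Sec E}
    (hf : RaisesByA 1 (f - LinearMap.id)) : RaisesByA 1 (conjY w f - LinearMap.id) := by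
  have : conjY w f - LinearMap.id = conjY w (f - LinearMap.id) := LinearMap.ext fun x => by
    have h := conjY_id hw x
    simp only [conjY, LinearMap.comp_apply, LinearMap.sub_apply, LinearMap.id_apply, map_sub] at h ⊢
    rw [h]
  rw [this]
  exact RaisesByA.conjY w hf

/-- A gauge transformation between two trivializations is determined by an invariant frame. -/
theorem gauge_eq_conjY {A : Conn E} (hA : IsFlatW A) {g : Sec E ≃ₗ[FunBStar k] Sec E}
    (hg : IsGauge g) (hgu : ∀ x, g (onSec E du x + A.u x) = onSec E du (g x))
    {w : LaurentSeries k} (hw : w ≠ 0) {h : Sec E ≃ₗ[FunBStar k] Sec E} (hh : IsGauge h)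
    (hu : ∀ x, h (onSec E du x + A.u x) = onSec E du (h x) + conjY w A.u (h x)) (x : Sec E) :
    h x = conjY w g.symm.toLinearMap (g x) := by
  have h1 (x : Sec E) : conjY w g.toLinearMap (onSec E du x + conjY w A.u x) =
      onSec E du (conjY w g.toLinearMap x) := by
    have hi (x : Sec E) : onSec E (substU w⁻¹) (onSec E (substU w) x) = x := by
      have := onSec_substU_inv (inv_ne_zero hw) x
      rwa [inv_inv] at this
    have e : onSec E du x + conjY w A.u x = onSec E (substU w)
        (onSec E du (onSec E (substU w⁻¹) x) + A.u (onSec E (substU w⁻¹) x)) := by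
      rw [map_add, conjY_substU hw hA.invariant_u, pull_du hw]
    rw [e, ← conjY_substU hw hg.invariant, hi, ← conjY_substU hw hg.invariant x,
      ← pull_du hw (onSec E (substU w) _), hi]
    exact congrArg _ (hgu _)
  -- Conjugating g by w^Y trivializes the pulled-back fibre component. The composite f of this
  -- frame, h and g⁻¹ commutes with u∂_u and is unipotent, so rigidity applied to f - 1 gives f = 1.
  let f : Sec E →ₗ[FunBStar k] Sec E := conjY w g.toLinearMap ∘ₗ h.toLinearMap ∘ₗ g.symm.toLinearMap
  have hfi : IsInvariant f := IsInvariant.comp (g := conjY w g.toLinearMap)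
    (f := h.toLinearMap ∘ₗ g.symm.toLinearMap) (IsInvariant.conjY w hg.invariant)
    (IsInvariant.comp (g := h.toLinearMap) (f := g.symm.toLinearMap) hh.invariant hg.symm.invariant)
  have hfr : RaisesByA 1 (f - LinearMap.id) :=
    raises_comp (raises_conjY_sub hw hg.raises) (raises_comp hh.raises hg.raises_symm)
  have hf0 := eq_zero_of_commute (f := f - LinearMap.id)
    (IsInvariant.sub (f := f) (g := LinearMap.id) hfi IsInvariant.id) hfr (C := 0) (C' := 0)
    RaisesByA.zero RaisesByA.zero fun x => by
      simp only [LinearMap.zero_apply, add_zero]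
      rw [LinearMap.sub_apply, LinearMap.sub_apply, map_sub]
      refine congrArg (· - onSec E du x) ?_
      change conjY w g.toLinearMap (h (g.symm (onSec E du x))) =
        onSec E du (conjY w g.toLinearMap (h (g.symm x)))
      rw [← h1, ← hu]
      congr 2
      rw [LinearEquiv.symm_apply_eq, hgu, LinearEquiv.apply_symm_apply]
  have hfx : conjY w g.toLinearMap (h x) = g x := by
    have := LinearMap.congr_fun hf0 (g x)
    rw [LinearMap.sub_apply, LinearMap.zero_apply, sub_eq_zero] at this
    change conjY w g.toLinearMap (h (g.symm (g x))) = g x at this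
    rwa [LinearEquiv.symm_apply_apply] at this
  rw [← hfx, conjY_comp_inv hw]
  have : g.symm.toLinearMap ∘ₗ g.toLinearMap = LinearMap.id :=
    LinearMap.ext fun x => g.symm_apply_apply x
  rw [this, conjY_id hw]

/-- An equisingular connection has at most a simple pole along the fibres. -/
theorem IsFlatEquisingular.isRegular_smul {A : Conn E} (hA : IsFlatEquisingular A) :
    IsRegular ((zpw 1 : FunBStar k) • A.u) := by
  have hW := hA.isFlatW
  obtain ⟨g, hg, hgu⟩ := exists_frame hW.weight_u hW.invariant_u
  refine IsRegular.of_gr fun n e he => ?_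
  rw [LinearMap.smul_apply]
  have he1 : (1 : FunBStar k) ⊗ₜ[k] e ∈ regSec E := one_tmul_mem_regSec e
  generalize (1 : FunBStar k) ⊗ₜ[k] e = y at he1
  -- Differences of two degrees are at least -D. Multiplying by v^D therefore makes all exponents
  -- nonnegative and the dependence on c polynomial.
  let D : ℕ := 2 * E.degs.sup Int.natAbs
  have hD (p : ℤ × ℤ) (hp : p ∈ E.degs ×ˢ E.degs) : 0 ≤ D + p.1 - p.2 := by
    rw [Finset.mem_product] at hp
    have h1 := Finset.le_sup (f := Int.natAbs) hp.1
    have h2 := Finset.le_sup (f := Int.natAbs) hp.2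
    omega
  let P (m : ℤ) : Sec E →ₗ[FunBStar k] Sec E := (E.proj m).baseChange (FunBStar k)
  let Y (p : ℤ × ℤ) : Sec E := P p.1 (g.symm (P p.2 (g y)))
  -- For v = 1 + cz the vector v^D v^Y g⁻¹ v^{-Y} g y is regular and equals the sum of v^{D+i-j} P_i
  -- g⁻¹ P_j g y over pairs of degrees i, j.
  have key := smul_mem_of_forall (E.degs ×ˢ E.degs) (fun p => (D + p.1 - p.2).toNat) Y fun c => by
    let v : PowerSeries k := 1 + PowerSeries.C c * PowerSeries.X
    have hv : PowerSeries.constantCoeff v = 1 := by simp [v]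
    have hv0 := ofPowerSeries_ne_zero hv
    have hn : HahnSeries.ofPowerSeries ℤ k 1 ≠ 0 := ofPowerSeries_ne_zero (map_one _)
    have hz : (1 + c • (zpw 1 : FunBStar k)) = mono 0 (HahnSeries.ofPowerSeries ℤ k v) := by
      rw [map_add, mono_add, map_one, mono_zero_one, zpw, ← mono_smul, map_mul,
        HahnSeries.ofPowerSeries_X, HahnSeries.ofPowerSeries_C, HahnSeries.C_mul_eq_smul]
    obtain ⟨h, h1, h2, h3, h4, h5, -, h7⟩ := hA.equisingular 1 v (map_one _) hv
    rw [← hW.nabla_pull hn, ← hW.nabla_pull hv0] at h7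
    have := h1 y he1
    change h y ∈ _ at this
    rw [gauge_eq_conjY hW hg hgu hv0 (h := h) ⟨h3, h4, h5⟩ (fun x => by
      have := h7 x
      rw [nabla_u, nabla_u, map_one] at this
      change h (onSec E du x + conjY 1 A.u x) = _ at this
      rwa [conjY_one] at this) y] at this
    have h8 := funB_smul_mem this (AddMonoidAlgebra.single 0 (v ^ D))
    have h9 : funB k (AddMonoidAlgebra.single 0 (v ^ D)) =
        mono 0 (HahnSeries.ofPowerSeries ℤ k v ^ D) := by
      rw [← map_pow]
      exact AddMonoidAlgebra.mapAlgHom_single ..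
    rw [h9] at h8
    convert h8 using 1
    rw [Finset.sum_product]
    change _ = _ • vY E _ (g.symm (vY E _ (g y)))
    rw [vY, E.diag_eq_sum, Finset.smul_sum]
    refine Finset.sum_congr rfl fun m hm => ?_
    rw [vY, E.diag_eq_sum, map_sum, map_sum, smul_smul, Finset.smul_sum]
    refine Finset.sum_congr rfl fun j hj => ?_
    rw [map_smul, map_smul, smul_smul, hz, mono_zero_pow, mono_mul, mono_mul]
    refine congrArg₂ (fun a (b : Sec E) => (mono 0 a : FunBStar k) • b) ?_ rfl
    rw [← zpow_natCast, Int.toNat_of_nonneg (hD (m, j) (Finset.mem_product.mpr ⟨hm, hj⟩)),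
      zpow_sub₀ hv0, zpow_add₀ hv0, zpow_natCast, inv_zpow, div_eq_mul_inv]
  -- The coefficient of c collects the exponents D + i - j. The terms in i and j assemble to the
  -- commutator of Y with g⁻¹.
  have hsum : ∑ p ∈ E.degs ×ˢ E.degs, (((D + p.1 - p.2).toNat : ℕ) : FunBStar k) •
      (zpw 1 : FunBStar k) • Y p = (zpw 1 : FunBStar k) • ((D : FunBStar k) • y +
        degComm g.symm.toLinearMap (g y)) := by
    have hPs (x : Sec E) : ∑ m ∈ E.degs, P m x = x := by
      have := E.diag_eq_sum (1 : ℤ → FunBStar k) x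
      rw [E.diag_one] at this
      simp only [Pi.one_apply, one_smul] at this
      exact this.symm
    have e1 : ∑ p ∈ E.degs ×ˢ E.degs, Y p = y := by
      rw [Finset.sum_product]
      simp only [Y]
      simp only [← map_sum, hPs, LinearEquiv.symm_apply_apply]
    have e2 : ∑ p ∈ E.degs ×ˢ E.degs, (algebraMap k (FunBStar k) (p.1 : k)) • Y p = degOp E y := by
      rw [Finset.sum_product, degOp, E.diag_eq_sum]
      refine Finset.sum_congr rfl fun m _ => ?_
      simp only [Y]
      rw [← Finset.smul_sum, ← map_sum, ← map_sum, hPs, LinearEquiv.symm_apply_apply]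
    have e3 : ∑ p ∈ E.degs ×ˢ E.degs, (algebraMap k (FunBStar k) (p.2 : k)) • Y p =
        g.symm (degOp E (g y)) := by
      rw [Finset.sum_product_right, degOp, E.diag_eq_sum, map_sum]
      refine Finset.sum_congr rfl fun m _ => ?_
      simp only [Y]
      rw [← Finset.smul_sum, hPs, map_smul]
    rw [degComm_apply]
    change _ = _ • (_ + (degOp E (g.symm (g y)) - g.symm (degOp E (g y))))
    rw [LinearEquiv.symm_apply_apply, ← e3, ← e2]
    conv_rhs => rw [← e1]
    rw [Finset.smul_sum, ← Finset.sum_sub_distrib, ← Finset.sum_add_distrib, Finset.smul_sum]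
    refine Finset.sum_congr rfl fun p hp => ?_
    refine Eq.trans ?_ (smul_lincomb _ _ _ _ _)
    rw [smul_smul, mul_comm]
    refine congrArg (fun a : FunBStar k => ((zpw 1 : FunBStar k) * a) • Y p) ?_
    have := congrArg (algebraMap k (FunBStar k) ∘ (Int.cast : ℤ → k))
      (Int.toNat_of_nonneg (hD p hp))
    simp only [Function.comp_apply, Int.cast_natCast, map_natCast] at this
    rw [this, Int.cast_sub, Int.cast_add, Int.cast_natCast, map_sub, map_add, map_natCast]
    ring
  -- The commutator with Y equals the one with u∂_u, and g⁻¹ takes u∂_u back to u∂_u + A_u; hence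
  -- [Y, g⁻¹]g = -A_u.
  have hdc : degComm g.symm.toLinearMap (g y) = -A.u y := by
    have h1 := du_apply (f := g.symm.toLinearMap) hg.symm.invariant (g y)
    have h2 : g.symm (onSec E du (g y)) = onSec E du y + A.u y := by
      rw [LinearEquiv.symm_apply_eq, hgu]
    change onSec E du (g.symm (g y)) = g.symm (onSec E du (g y)) + _ at h1
    rw [h2, LinearEquiv.symm_apply_apply, add_assoc, left_eq_add] at h1
    exact eq_neg_of_add_eq_zero_right h1
  rw [hsum, hdc, smul_add] at key
  have h1 : (zpw 1 : FunBStar k) • (D : FunBStar k) • y ∈ regSec E := by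
    obtain ⟨p, hp⟩ := zpw_one_mem (k := k)
    rw [← hp]
    refine funB_smul_mem ?_ p
    have : (D : FunBStar k) • y = (funB k (D : LaurentPolynomial (PowerSeries k))) • y := by
      rw [map_natCast]
    rw [this]
    exact funB_smul_mem he1 _
  have := Submodule.sub_mem _ h1 key
  rwa [sub_add_cancel_left, smul_neg, neg_neg] at this

end Pole

end Equising

end

noncomputable section

namespace Equising

open GrVec

/-! ### The classification of equisingular bundles by their residues -/

section Tensor

variable {k : Type u} [Field k] [CharZero k] {E F E₁ F₁ : GrVec k}

/-- A family c that is multiplicative in the degree defines an operator which is group-like for the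
tensor product; u^Y and u^{-Y} are the examples. -/
theorem diag_odot {A : Type*} [CommRing A] [Algebra k A] {c : ℤ → A}
    (hc : ∀ i j, c (i + j) = c i * c j) (m : A ⊗[k] E.V) (n : A ⊗[k] F.V) :
    (GrVec.tensor E F).diag c (odot m n) = odot (E.diag c m) (F.diag c n) := by
  induction m using TensorProduct.induction_on with
  | zero => simp only [zero_odot, map_zero]; exact map_zero _
  | add x y hx hy => simp only [add_odot, map_add] at hx hy ⊢; rw [← hx, ← hy]; exact map_add _ _ _
  | tmul r e =>
    induction n using TensorProduct.induction_on with
    | zero => simp only [odot_zero, map_zero]; exact map_zero _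
    | add x y hx hy => simp only [odot_add, map_add] at hx hy ⊢; rw [← hx, ← hy]; exact map_add _ _ _
    | tmul s f =>
      induction e using E.induction with
      | h₂ x y hx hy =>
        simp only [TensorProduct.tmul_add, add_odot, map_add] at hx hy ⊢
        rw [← hx, ← hy]; exact map_add _ _ _
      | h i e he =>
        induction f using F.induction with
        | h₂ x y hx hy =>
          simp only [TensorProduct.tmul_add, odot_add, map_add] at hx hy ⊢
          rw [← hx, ← hy]; exact map_add _ _ _
        | h j f hf =>
          rw [E.diag_tmul _ _ he, F.diag_tmul _ _ hf, odot_tmul, odot_tmul]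
          refine ((GrVec.tensor E F).diag_tmul c (r * s) (tmul_mem he hf)).trans ?_
          rw [hc, mul_mul_mul_comm]
          rfl

theorem mono_one_add (i j : ℤ) : (mono (i + j) 1 : FunBStar k) = mono i 1 * mono j 1 := by
  rw [mono_mul, one_mul]

theorem sbox_tilde (S : E.V →ₗ[k] E₁.V) (T : F.V →ₗ[k] F₁.V) :
    sbox (tilde S) (tilde T) =
      tilde (E := GrVec.tensor E F) (F := GrVec.tensor E₁ F₁) (TensorProduct.map S T) := by
  refine LinearMap.ext fun x => ?_
  induction x using sodot_induction with
  | h₀ => simp only [map_zero]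
  | h₂ x y hx hy => simp only [map_add, hx, hy]
  | h m n =>
    rw [sbox_sodot]
    have h1 : uYi (GrVec.tensor E F) (sodot m n) = sodot (uYi E m) (uYi F n) :=
      diag_odot (fun i j => by rw [neg_add, mono_one_add]) m n
    have h2 (m : Sec E₁) (n : Sec F₁) :
        uY (GrVec.tensor E₁ F₁) (sodot m n) = sodot (uY E₁ m) (uY F₁ n) :=
      diag_odot mono_one_add m n
    change _ = uY _ (ext₀ (E := GrVec.tensor E F) (F := GrVec.tensor E₁ F₁) (TensorProduct.map S T)
      (uYi _ (sodot m n)))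
    rw [h1, ext₀_sodot, h2]
    rfl

theorem smul_sbox (r : FunBStar k) (f : Sec E →ₗ[FunBStar k] Sec E₁)
    (g : Sec F →ₗ[FunBStar k] Sec F₁) : sbox (r • f) g = r • sbox f g := by
  refine LinearMap.ext fun x => ?_
  induction x using sodot_induction with
  | h₀ => simp only [map_zero]
  | h₂ x y hx hy => simp only [map_add, hx, hy]
  | h m n => rw [LinearMap.smul_apply, sbox_sodot, sbox_sodot, LinearMap.smul_apply, smul_sodot]

theorem sbox_smul (r : FunBStar k) (f : Sec E →ₗ[FunBStar k] Sec E₁)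
    (g : Sec F →ₗ[FunBStar k] Sec F₁) : sbox f (r • g) = r • sbox f g := by
  refine LinearMap.ext fun x => ?_
  induction x using sodot_induction with
  | h₀ => simp only [map_zero]
  | h₂ x y hx hy => simp only [map_add, hx, hy]
  | h m n => rw [LinearMap.smul_apply, sbox_sodot, sbox_sodot, LinearMap.smul_apply, sodot_smul]

/-- The tensor product of two normal forms is again a normal form, with residue β ⊗ 1 + 1 ⊗ γ. -/
theorem sbox_add_sbox (S : E.V →ₗ[k] E.V) (T : F.V →ₗ[k] F.V) :
    sbox ((zpw (-1) : FunBStar k) • tilde S) LinearMap.id +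
        sbox LinearMap.id ((zpw (-1) : FunBStar k) • tilde T) = (zpw (-1) : FunBStar k) •
      tilde (E := GrVec.tensor E F) (F := GrVec.tensor E F)
        (TensorProduct.map S LinearMap.id + TensorProduct.map LinearMap.id T) := by
  have h := tilde_add (E := GrVec.tensor E F) (F := GrVec.tensor E F)
    (TensorProduct.map S LinearMap.id) (TensorProduct.map LinearMap.id T)
  rw [smul_sbox, sbox_smul, ← tilde_id, ← tilde_id, sbox_tilde, sbox_tilde]
  exact (smul_add _ _ _).symm.trans (congrArg _ h.symm)

end Tensor

/-! ### Horizontal maps between connections in normal form -/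

section Hom

variable {k : Type u} [Field k] [CharZero k] {E F : GrVec k}

/-- A horizontal bundle map between connections with constant residues is constant. -/
theorem hasLift_iff {A : Conn E} {B : Conn F} (hA : IsFlatW A) (hB : IsFlatW B)
    {β : E.V →ₗ[k] E.V} {γ : F.V →ₗ[k] F.V} (hβ : A.u = (zpw (-1) : FunBStar k) • tilde β)
    (hγ : B.u = (zpw (-1) : FunBStar k) • tilde γ) {T : E.V →ₗ[k] F.V} (hT : IsGraded T) :
    HasLift T A.nabla B.nabla ↔ T ∘ₗ β = γ ∘ₗ T := by
  have hTβ (x : Sec E) : tilde T (A.u x) = (zpw (-1) : FunBStar k) • tilde (T ∘ₗ β) x := by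
    rw [hβ, tilde_comp, LinearMap.smul_apply, map_smul, LinearMap.comp_apply]
  have hγT (x : Sec E) : B.u (tilde T x) = (zpw (-1) : FunBStar k) • tilde (γ ∘ₗ T) x := by
    rw [hγ, tilde_comp, LinearMap.smul_apply, LinearMap.comp_apply]
  have hTd (x : Sec E) : onSec F du (tilde T x) = tilde T (onSec E du x) := by
    rw [tilde_graded hT]
    exact (baseChange_onSec T du x).symm
  constructor
  · rintro ⟨τ, h1, h2, h3, -, h5⟩
    -- The deviation f of a horizontal lift from the constant map is invariant, regular and
    -- weight-raising. The goal is f = 0.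
    obtain ⟨f, hf⟩ : ∃ f, f = τ - tilde T := ⟨_, rfl⟩
    have hf1 : RaisesByA 1 f := by
      rw [hf, tilde_graded hT]
      exact h3
    have hfi : IsInvariant f := by
      rw [hf]
      exact IsInvariant.sub (f := τ) (g := tilde T) h2 (isInvariant_tilde T)
    have hfr : IsRegular f := by rw [hf]; exact h1.sub (isRegular_tilde T)
    have hfx (x : Sec E) : τ x = f x + tilde T x := by
      rw [hf]; exact (sub_add_cancel (τ x) (tilde T x)).symm
    -- Horizontality of τ becomes [Y, f] = f A_u - B_u f + z⁻¹(Tβ - γT), the last factor conjugated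
    -- by u^Y.
    have hdc (x : Sec E) : degComm f x = f (A.u x) - B.u (f x) +
        (zpw (-1) : FunBStar k) • tilde (T ∘ₗ β - γ ∘ₗ T) x := by
      have h := h5 x
      rw [nabla_u, nabla_u, hfx, hfx, map_add, map_add, map_add, map_add, hTd, du_apply hfi, hTβ,
        hγT] at h
      have hs : (zpw (-1) : FunBStar k) • tilde (T ∘ₗ β - γ ∘ₗ T) x =
          (zpw (-1) : FunBStar k) • tilde (T ∘ₗ β) x -
            (zpw (-1) : FunBStar k) • tilde (γ ∘ₗ T) x := by
        rw [tilde_sub]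
        exact smul_sub _ _ _
      rw [hs]
      have : degComm f x = (f (onSec E du x) + degComm f x + tilde T (onSec E du x) +
          (B.u (f x) + (zpw (-1) : FunBStar k) • tilde (γ ∘ₗ T) x)) - f (onSec E du x) -
          tilde T (onSec E du x) - B.u (f x) - (zpw (-1) : FunBStar k) • tilde (γ ∘ₗ T) x := by abel
      rw [this, ← h]
      abel
    have hdc' : degComm f = (f ∘ₗ A.u - B.u ∘ₗ f) +
        (zpw (-1) : FunBStar k) • tilde (T ∘ₗ β - γ ∘ₗ T) := LinearMap.ext hdc
    have hf0 : f = 0 := by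
      refine eq_zero_of_raises (fun d hd hfd => RaisesByA.of_degComm (by omega) hfd ?_) hf1
      have hr : RaisesByA (d + 1) (f ∘ₗ A.u - B.u ∘ₗ f) :=
        ((hfd.comp hA.weight_u).mono (by omega)).sub ((hB.weight_u.comp hfd).mono (by omega))
      -- The left side [Y, f] is regular, so the coefficients of z⁻¹ must cancel. This expresses Tβ
      -- - γT through f A_u - B_u f, which gains one more step of weight than f, so f gains a step
      -- too.
      have hc : T ∘ₗ β - γ ∘ₗ T = -cf (-1) (f ∘ₗ A.u - B.u ∘ₗ f) := by
        have := cf_of_regular (m := -1) (by omega) hfr.degComm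
        rw [hdc', cf_add, cf_smul_tilde] at this
        exact eq_neg_of_add_eq_zero_right this
      rw [hdc']
      refine hr.add (RaisesByA.smul _ (raises_tilde ?_))
      rw [hc]
      exact (raises_cf _ hr).neg
    -- Once f = 0 the relation leaves only the term z⁻¹(Tβ - γT), which must vanish.
    have h0 : (zpw (-1) : FunBStar k) • tilde (T ∘ₗ β - γ ∘ₗ T) = 0 := by
      refine LinearMap.ext fun x => ?_
      have := hdc x
      rw [degComm_apply, hf0] at this
      simpa using this.symm
    have := cf_smul_tilde (-1) (T ∘ₗ β - γ ∘ₗ T)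
    rw [h0] at this
    have h00 : cf (-1) (0 : Sec E →ₗ[FunBStar k] Sec F) = 0 :=
      cf_of_regular (by omega) IsRegular.zero
    rw [h00] at this
    exact sub_eq_zero.mp this.symm
  · intro h
    refine hasLift_of_u hA hB hT fun x => ?_
    rw [← tilde_graded hT, nabla_u, nabla_u, map_add, hTd, hTβ, hγT, h]

end Hom

/-! ### The residue of an equisingular bundle -/

namespace EqBundle

variable {k : Type u} [Field k] [CharZero k]

/-- `β` is the residue of `X`: the class of `X` contains a connection `d + A_z dz + z⁻¹ u^Y β u^{-Y} du/u`. -/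
def HasRes (X : EqBundle k) (β : X.E.V →ₗ[k] X.E.V) : Prop :=
  ∃ A : Conn X.E, X.Rep A ∧ A.u = (zpw (-1) : FunBStar k) • tilde β

theorem Rep.isFlatW {X : EqBundle k} {A : Conn X.E} (hA : X.Rep A) : IsFlatW A :=
  hA.choose.isFlatW

theorem HasRes.raises {X : EqBundle k} {β : X.E.V →ₗ[k] X.E.V} (h : X.HasRes β) : RaisesBy 1 β := by
  obtain ⟨A, hA, hu⟩ := h
  rw [← cf_smul_tilde (-1) β, ← hu]
  exact raises_cf _ hA.isFlatW.weight_u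

theorem mem_homs_iff {X Y : EqBundle k} {β : X.E.V →ₗ[k] X.E.V} {γ : Y.E.V →ₗ[k] Y.E.V}
    (hX : X.HasRes β) (hY : Y.HasRes γ) {T : X.E.V →ₗ[k] Y.E.V} :
    T ∈ homs X Y ↔ IsGraded T ∧ T ∘ₗ β = γ ∘ₗ T := by
  obtain ⟨A, hA, hAu⟩ := hX
  obtain ⟨B, hB, hBu⟩ := hY
  refine (isHom_iff hA hB).trans (and_congr_right fun hT => ?_)
  exact hasLift_iff hA.isFlatW hB.isFlatW hAu hBu hT

/-- The simple pole of an equisingular connection allows the normal form along the fibres. A flat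
connection with this fibre component exists and is equivalent to the given one, because only the
fibre components need to be compared. -/
theorem exists_res (X : EqBundle k) : ∃ β, X.HasRes β := by
  obtain ⟨A, hA⟩ := X.exists_rep
  have hW := hA.isFlatW
  obtain ⟨g, β, h1, h2, h3, h4, h5⟩ := exists_residue hW.weight_u hW.invariant_u
    hA.choose.isRegular_smul
  obtain ⟨B, hBu, hB⟩ := exists_isFlatEquisingular h4
  refine ⟨β, B, ⟨hB, ?_⟩, hBu⟩
  rw [← hA.choose_spec]
  refine Quotient.sound (s := connSetoid X.E) (GaugeEquiv.symm ?_)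
  refine gaugeEquiv_of_u hW hB.isFlatW h1 h2 h3 fun x => ?_
  rw [nabla_u, nabla_u, hBu]
  exact h5 x

/-- The residue of an equisingular bundle. -/
def res (X : EqBundle k) : X.E.V →ₗ[k] X.E.V := X.exists_res.choose

theorem hasRes (X : EqBundle k) : X.HasRes X.res := X.exists_res.choose_spec

theorem mem_homs {X Y : EqBundle k} {T : X.E.V →ₗ[k] Y.E.V} :
    T ∈ homs X Y ↔ IsGraded T ∧ T ∘ₗ X.res = Y.res ∘ₗ T := mem_homs_iff X.hasRes Y.hasRes

/-- The identity is a morphism, and morphisms intertwine residues; so two residues of the same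
bundle coincide. -/
theorem HasRes.res_eq {X : EqBundle k} {β : X.E.V →ₗ[k] X.E.V} (h : X.HasRes β) : X.res = β := by
  have := ((mem_homs_iff X.hasRes h).mp (id_mem X)).2
  rwa [LinearMap.id_comp, LinearMap.comp_id] at this

theorem res_raises (X : EqBundle k) : RaisesBy 1 X.res := X.hasRes.raises

/-- The equisingular bundle with a given residue. -/
def ofRes (E : GrVec k) (β : E.V →ₗ[k] E.V) (hβ : RaisesBy 1 β) : EqBundle k where
  E := E
  cls := Quotient.mk (connSetoid E) ⟨(exists_isFlatEquisingular hβ).choose,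
    (exists_isFlatEquisingular hβ).choose_spec.2⟩

theorem res_ofRes (E : GrVec k) (β : E.V →ₗ[k] E.V) (hβ : RaisesBy 1 β) :
    (ofRes E β hβ).res = β :=
  HasRes.res_eq (X := ofRes E β hβ) ⟨_, ⟨(exists_isFlatEquisingular hβ).choose_spec.2, rfl⟩,
    (exists_isFlatEquisingular hβ).choose_spec.1⟩

theorem res_tensor (X Y : EqBundle k) : (tensorObj X Y).res =
    (TensorProduct.map X.res LinearMap.id + TensorProduct.map LinearMap.id Y.res :
      X.E.V ⊗[k] Y.E.V →ₗ[k] X.E.V ⊗[k] Y.E.V) := by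
  obtain ⟨A, hA, hAu⟩ := X.hasRes
  obtain ⟨B, hB, hBu⟩ := Y.hasRes
  refine HasRes.res_eq (X := tensorObj X Y) ⟨A.tensor B, hA.tensor hB, ?_⟩
  change sbox A.u LinearMap.id + sbox LinearMap.id B.u = _
  rw [hAu, hBu]
  exact sbox_add_sbox X.res Y.res

theorem res_unit : (tensorUnit k).res = 0 := by
  refine HasRes.res_eq (X := tensorUnit k) ⟨_, rep_unit, ?_⟩
  rw [tilde_zero, smul_zero]
  rfl

end EqBundle

end Equising

end

noncomputable section

namespace Equising

open GrVec

/-! ### The representation of `U*` defined by a graded vector space with an endomorphism -/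

section Coaction

variable {k : Type u} [Field k]

/-- All letters have positive degree, so a bound on the degree bounds both the letters and the
length. -/
theorem finite_deg_le (N : ℕ) : {w : List ℕ+ | UPts.deg w ≤ N}.Finite := by
  induction N with
  | zero =>
    refine (Set.finite_singleton []).subset fun w hw => ?_
    cases w with
    | nil => rfl
    | cons a w =>
      rw [Set.mem_ofPred_eq, UPts.deg_cons] at hw
      have := a.pos
      omega
  | succ N ih =>
    refine ((Set.finite_singleton []).union (Set.Finite.image2 List.cons
      (Set.finite_Iic (N + 1).toPNat') ih)).subset fun w hw => ?_
    cases w with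
    | nil => exact Or.inl rfl
    | cons a w =>
      rw [Set.mem_ofPred_eq, UPts.deg_cons] at hw
      have := a.pos
      refine Or.inr ⟨a, ?_, w, ?_, rfl⟩
      · rw [Set.mem_Iic, ← PNat.coe_le_coe, Nat.toPNat'_coe, if_pos (by omega)]
        omega
      · rw [Set.mem_ofPred_eq]
        omega

/-- The functional `x ⊗ y ↦ l(x) m(y)`. -/
def pair {M N : Type*} [AddCommGroup M] [Module k M] [AddCommGroup N] [Module k N]
    (l : M →ₗ[k] k) (m : N →ₗ[k] k) : M ⊗[k] N →ₗ[k] k :=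
  LinearMap.mul' k k ∘ₗ TensorProduct.map l m

@[simp] theorem pair_tmul {M N : Type*} [AddCommGroup M] [Module k M] [AddCommGroup N] [Module k N]
    (l : M →ₗ[k] k) (m : N →ₗ[k] k) (x : M) (y : N) : pair l m (x ⊗ₜ[k] y) = l x * m y := by
  simp [pair]

namespace Hu

theorem counit_word (w : List ℕ+) : counit (word (k := k) w) = if w = [] then 1 else 0 :=
  lift_word _ _

theorem coeff_nil : coeff (k := k) [] = counit := hom_ext fun w => by
  rw [coeff_word, counit_word]

theorem eq_zero_of_coeff {x : Hu k} (h : ∀ w, coeff w x = 0) : x = 0 := Finsupp.ext h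

theorem coeff_cons_cons (a b : ℕ+) (w : List ℕ+) (x : Hu k) :
    coeff (a :: w) (cons b x) = if b = a then coeff w x else 0 := by
  have : coeff (k := k) (a :: w) ∘ₗ cons b = if b = a then coeff w else 0 := hom_ext fun v => by
    rw [LinearMap.comp_apply, ← word_cons, coeff_word]
    by_cases h : b = a <;> simp [h, coeff_word]
  rw [← LinearMap.comp_apply, this]
  split_ifs <;> rfl

/-- Deconcatenation is dual to concatenation. Identities involving the coproduct thus become
identities about products of words. -/
theorem pair_comul (v w : List ℕ+) (x : Hu k) :
    pair (coeff v) (coeff w) (comul x) = coeff (v ++ w) x := by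
  have hr (l m : Hu k →ₗ[k] k) (a : ℕ+) (t : Hu k ⊗[k] Hu k) :
      pair l m ((cons a).rTensor (Hu k) t) = pair (l ∘ₗ cons a) m t := by
    induction t using TensorProduct.induction_on with
    | zero => simp only [map_zero]
    | add x y hx hy => simp only [map_add, hx, hy]
    | tmul x y => simp
  have h1 (v : List ℕ+) : coeff v (1 : Hu k) = if v = [] then 1 else 0 := by
    rw [one_def, coeff_word]
    simp [eq_comm]
  induction v generalizing x with
  | nil =>
    have : pair (coeff []) (coeff w) ∘ₗ comul = coeff (k := k) w := by
      refine cons_ext ?_ fun a u _ => ?_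
      · rw [LinearMap.comp_apply, comul_one', pair_tmul, h1, if_pos rfl, one_mul]
      · rw [LinearMap.comp_apply, comul_cons, map_add, pair_tmul, h1, if_pos rfl, one_mul, hr]
        have : coeff (k := k) [] ∘ₗ cons a = 0 := by
          rw [coeff_nil]; exact LinearMap.ext fun x => counit_cons a x
        rw [this]
        simp [pair]
    exact LinearMap.congr_fun this x
  | cons b v ih =>
    have : pair (coeff (b :: v)) (coeff w) ∘ₗ comul = coeff (k := k) (b :: v ++ w) := by
      refine cons_ext ?_ fun a u _ => ?_
      · rw [LinearMap.comp_apply, comul_one', pair_tmul, h1, h1, h1]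
        simp
      · rw [LinearMap.comp_apply, comul_cons, map_add, pair_tmul, h1, hr, List.cons_append,
          coeff_cons_cons, if_neg (by simp), zero_mul, zero_add]
        have : coeff (k := k) (b :: v) ∘ₗ cons a = if a = b then coeff v else 0 :=
          LinearMap.ext fun x => by
            rw [LinearMap.comp_apply, coeff_cons_cons]; split_ifs <;> rfl
        rw [this]
        split_ifs
        · exact ih _
        · simp [pair]
    exact LinearMap.congr_fun this x

theorem eq_zero_of_pair {x : Hu k ⊗[k] Hu k}
    (h : ∀ v w, pair (coeff v) (coeff w) x = 0) : x = 0 := by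
  refine eq_zero_of_contract (Set.range coeff) (fun a ha => eq_zero_of_coeff fun w =>
    ha _ ⟨w, rfl⟩) ?_
  rintro _ ⟨v, rfl⟩
  refine eq_zero_of_coeff fun w => ?_
  rw [← h v w]
  clear h
  induction x using TensorProduct.induction_on with
  | zero => simp
  | add x y hx hy => simp only [map_add, hx, hy]
  | tmul x y => simp

end Hu

/-! ### Word operators, the coaction and the representation of U* -/

namespace GrVec

variable (E : GrVec k) (β : E.V →ₗ[k] E.V)

/-- The operator by which a word acts, the letter `a` acting by the component of degree `a`
of `β`. -/
def wordOp (w : List ℕ+) : Module.End k E.V := (w.map fun a : ℕ+ => comp ((a : ℕ) : ℤ) β).prod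

theorem wordOp_nil : wordOp E β [] = 1 := rfl

theorem wordOp_singleton (a : ℕ+) : wordOp E β [a] = comp ((a : ℕ) : ℤ) β := List.prod_singleton

theorem wordOp_append (v w : List ℕ+) : wordOp E β (v ++ w) = wordOp E β v * wordOp E β w := by
  rw [wordOp, List.map_append, List.prod_append]
  rfl

theorem wordOp_mem (w : List ℕ+) {n : ℤ} {x : E.V} (hx : x ∈ E.gr n) :
    wordOp E β w x ∈ E.gr (n + UPts.deg w) := by
  induction w with
  | nil => simpa [wordOp_nil, UPts.deg] using hx
  | cons a w ih =>
    have := comp_mem ((a : ℕ) : ℤ) β ih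
    rw [add_assoc, add_comm (UPts.deg w : ℤ)] at this
    rw [UPts.deg_cons]
    push_cast
    exact this

/-- A word raises the weight by its degree, so words of large degree act by zero and the coaction is
a finite sum. -/
theorem exists_wordOp_eq_zero : ∃ N : ℕ, ∀ w, N < UPts.deg w → wordOp E β w = 0 := by
  obtain ⟨N, hN⟩ := exists_raisesBy_eq_zero E E
  exact ⟨N, fun w hw => hN _ ((RaisesBy.of_deg fun n x hx => wordOp_mem E β w hx).mono
    (by exact_mod_cast hw.le))⟩

/-- The coaction `x ↦ ∑ w ⊗ w(x)` of `H_u`. -/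
def coact : E.V →ₗ[k] Hu k ⊗[k] E.V :=
  ∑ w ∈ (finite_deg_le (exists_wordOp_eq_zero E β).choose).toFinset,
    TensorProduct.mk k (Hu k) E.V (Hu.word w) ∘ₗ wordOp E β w

/-- Words outside the finite range of summation act by zero, so the truncation is invisible. -/
theorem contract_coact (w : List ℕ+) (x : E.V) :
    contract (Hu.coeff w) (coact E β x) = wordOp E β w x := by
  rw [coact, LinearMap.sum_apply, map_sum]
  simp only [LinearMap.comp_apply, TensorProduct.mk_apply, contract_tmul, Hu.coeff_word, ite_smul,
    one_smul, zero_smul]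
  rw [Finset.sum_ite_eq']
  split_ifs with h
  · rfl
  · rw [Set.Finite.mem_toFinset, Set.mem_ofPred_eq, not_le] at h
    rw [(exists_wordOp_eq_zero E β).choose_spec w h, LinearMap.zero_apply]

theorem contract_rTensor {M N V : Type*} [CommRing M] [Algebra k M] [CommRing N] [Algebra k N]
    [AddCommGroup V] [Module k V] (l : N →ₗ[k] k) (f : M →ₗ[k] N) (z : M ⊗[k] V) :
    contract l (f.rTensor V z) = contract (l ∘ₗ f) z := by
  rw [contract, contract, LinearMap.comp_apply, LinearMap.comp_apply, LinearMap.rTensor_comp]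
  rfl

/-- The coassociativity of the coaction. -/
theorem coact_coassoc (x : E.V) : Hu.comul.rTensor E.V (coact E β x) =
    TensorProduct.rightComm k (Hu k) E.V (Hu k)
      ((coact E β).rTensor (Hu k) (TensorProduct.comm k (Hu k) E.V (coact E β x))) := by
  rw [← sub_eq_zero]
  -- Tested against pairs of words (v, w), coassociativity is the statement that vw acts as v after
  -- w.
  refine eq_zero_of_contract (Set.range fun p : List ℕ+ × List ℕ+ =>
    pair (Hu.coeff p.1) (Hu.coeff p.2)) (fun a ha => Hu.eq_zero_of_pair fun v w =>
      ha _ ⟨(v, w), rfl⟩) ?_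
  rintro _ ⟨⟨v, w⟩, rfl⟩
  have h1 : pair (Hu.coeff v) (Hu.coeff w) ∘ₗ Hu.comul = Hu.coeff (k := k) (v ++ w) :=
    LinearMap.ext fun x => Hu.pair_comul v w x
  have h2 (z : Hu k ⊗[k] E.V) (h : Hu k) : contract (pair (Hu.coeff v) (Hu.coeff w))
      (TensorProduct.rightComm k (Hu k) E.V (Hu k) (z ⊗ₜ[k] h)) =
        Hu.coeff w h • contract (Hu.coeff v) z := by
    induction z using TensorProduct.induction_on with
    | zero => simp
    | add x y hx hy => rw [TensorProduct.add_tmul, map_add, map_add, hx, hy, map_add, smul_add]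
    | tmul a y => simp [smul_smul, mul_comm]
  have h3 (z : Hu k ⊗[k] E.V) : contract (pair (Hu.coeff v) (Hu.coeff w))
      (TensorProduct.rightComm k (Hu k) E.V (Hu k)
        ((coact E β).rTensor (Hu k) (TensorProduct.comm k (Hu k) E.V z))) =
          wordOp E β v (contract (Hu.coeff w) z) := by
    induction z using TensorProduct.induction_on with
    | zero => simp only [map_zero]
    | add x y hx hy => simp only [map_add, hx, hy]
    | tmul a y =>
      rw [TensorProduct.comm_tmul, LinearMap.rTensor_tmul, h2, contract_coact, contract_tmul,
        map_smul]
  rw [map_sub, contract_rTensor, h1, h3, contract_coact, contract_coact, wordOp_append,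
    Module.End.mul_apply, sub_self]

variable {A B : Type u} [CommRing A] [Algebra k A] [CommRing B] [Algebra k B]

/-- The operator on `A ⊗ E` defined by a linear map `H_u → A`. -/
def uop (f : Hu k →ₗ[k] A) : A ⊗[k] E.V →ₗ[A] A ⊗[k] E.V :=
  LinearMap.liftBaseChange A (f.rTensor E.V ∘ₗ coact E β)

theorem uop_tmul (f : Hu k →ₗ[k] A) (a : A) (x : E.V) :
    uop E β f (a ⊗ₜ[k] x) = a • f.rTensor E.V (coact E β x) := rfl

theorem uop_one : uop E β (1 : UPts k A).hom.toLinearMap = LinearMap.id := by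
  refine E.baseChange_ext fun n x hx => ?_
  have h : ((1 : UPts k A).hom.toLinearMap) = Algebra.linearMap k A ∘ₗ Hu.counit :=
    LinearMap.ext fun x => UPts.one_hom x
  have h2 (z : Hu k ⊗[k] E.V) : (Algebra.linearMap k A ∘ₗ Hu.counit).rTensor E.V z =
      1 ⊗ₜ[k] contract Hu.counit z := by
    induction z using TensorProduct.induction_on with
    | zero => simp
    | add x y hx hy => simp only [map_add, hx, hy, TensorProduct.tmul_add]
    | tmul a y => simp [Algebra.algebraMap_eq_smul_one, TensorProduct.smul_tmul]
  rw [uop_tmul, h, h2, ← Hu.coeff_nil, contract_coact, one_smul]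
  rfl

/-- Coassociativity of the coaction, pushed forward along f and g, turns convolution into
composition. -/
theorem uop_conv (f g : Hu k →ₗ[k] A) : uop E β (UPts.conv f g) = uop E β f ∘ₗ uop E β g := by
  refine E.baseChange_ext fun n x hx => ?_
  have h1 (m : Hu k ⊗[k] E.V) (h : Hu k) : (LinearMap.mul' k A ∘ₗ TensorProduct.map f g).rTensor E.V
      (TensorProduct.rightComm k (Hu k) E.V (Hu k) (m ⊗ₜ[k] h)) = g h • f.rTensor E.V m := by
    induction m using TensorProduct.induction_on with
    | zero => simp
    | add x y hx hy => rw [TensorProduct.add_tmul, map_add, map_add, hx, hy, map_add, smul_add]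
    | tmul a y => simp [TensorProduct.smul_tmul', mul_comm]
  have h2 (z : Hu k ⊗[k] E.V) : (LinearMap.mul' k A ∘ₗ TensorProduct.map f g).rTensor E.V
      (TensorProduct.rightComm k (Hu k) E.V (Hu k)
        ((coact E β).rTensor (Hu k) (TensorProduct.comm k (Hu k) E.V z))) =
          uop E β f (g.rTensor E.V z) := by
    induction z using TensorProduct.induction_on with
    | zero => simp only [map_zero]
    | add x y hx hy => simp only [map_add, hx, hy]
    | tmul a y =>
      rw [TensorProduct.comm_tmul, LinearMap.rTensor_tmul, h1, LinearMap.rTensor_tmul, uop_tmul]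
  have h3 : UPts.conv f g = (LinearMap.mul' k A ∘ₗ TensorProduct.map f g) ∘ₗ Hu.comul := rfl
  rw [uop_tmul, h3, LinearMap.rTensor_comp, LinearMap.comp_apply, coact_coassoc, h2,
    LinearMap.comp_apply, uop_tmul, one_smul, one_smul]

/-- A word of degree |w| takes degree n to n + |w|, so moving t^Y past it costs t^{|w|}, the factor
by which t acts on U. -/
theorem uop_scale (t : Aˣ) (f : Hu k →ₗ[k] A) :
    uop E β (UPts.scaleLin (t : A) f) ∘ₗ E.diag (fun n => ((t ^ n : Aˣ) : A)) =
      E.diag (fun n => ((t ^ n : Aˣ) : A)) ∘ₗ uop E β f := by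
  refine E.baseChange_ext fun n x hx => ?_
  rw [LinearMap.comp_apply, LinearMap.comp_apply, E.diag_tmul _ _ hx, uop_tmul, uop_tmul, one_smul,
    coact, LinearMap.sum_apply, map_sum, map_sum, map_sum, Finset.smul_sum]
  refine Finset.sum_congr rfl fun w _ => ?_
  rw [LinearMap.comp_apply, TensorProduct.mk_apply, LinearMap.rTensor_tmul, LinearMap.rTensor_tmul,
    E.diag_tmul _ _ (wordOp_mem E β w hx), UPts.scaleLin_word, TensorProduct.smul_tmul', smul_eq_mul,
    one_mul, zpow_add, Units.val_mul, zpow_natCast, Units.val_pow_eq_pow_val]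
  ring_nf

theorem rTensor_smul_algHom {V : Type*} [AddCommGroup V] [Module k V] (f : A →ₐ[k] B) (a : A)
    (z : A ⊗[k] V) :
    f.toLinearMap.rTensor V (a • z) = f a • f.toLinearMap.rTensor V z := by
  induction z using TensorProduct.induction_on with
  | zero => simp
  | add x y hx hy => simp only [smul_add, map_add, hx, hy]
  | tmul b x => simp [TensorProduct.smul_tmul']

theorem uop_natural (f : A →ₐ[k] B) (φ : Hu k →ₗ[k] A) (x : A ⊗[k] E.V) :
    uop E β (f.toLinearMap ∘ₗ φ) (f.toLinearMap.rTensor E.V x) =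
      f.toLinearMap.rTensor E.V (uop E β φ x) := by
  induction x using TensorProduct.induction_on with
  | zero => simp only [map_zero]
  | add x y hx hy => simp only [map_add, hx, hy]
  | tmul a x =>
    rw [LinearMap.rTensor_tmul, uop_tmul, uop_tmul, rTensor_smul_algHom, LinearMap.rTensor_comp]
    rfl

theorem diag_natural (f : A →ₐ[k] B) (c : ℤ → A) (x : A ⊗[k] E.V) :
    E.diag (fun n => f (c n)) (f.toLinearMap.rTensor E.V x) =
      f.toLinearMap.rTensor E.V (E.diag c x) := by
  induction x using TensorProduct.induction_on with
  | zero => simp only [map_zero]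
  | add x y hx hy => simp only [map_add, hx, hy]
  | tmul a x =>
    induction x using E.induction with
    | h₂ x y hx hy => simp only [TensorProduct.tmul_add, map_add, hx, hy]
    | h n x hx =>
      rw [LinearMap.rTensor_tmul, E.diag_tmul _ _ hx, E.diag_tmul _ _ hx, LinearMap.rTensor_tmul]
      simp

/-- The representation of `U*` on `E` for which the generator `e_{-n}` acts by the component of
degree `n` of `β`. -/
@[reducible] def rep : URep k where
  V := E.V
  ρ A _ _ :=
    { toFun g := uop E β g.left.hom.toLinearMap ∘ₗ E.diag (fun n => ((g.right ^ n : Aˣ) : A))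
      map_one' := by
        have h : (fun n : ℤ => (((1 : UStar k A).right ^ n : Aˣ) : A)) = 1 := by
          funext n
          simp
        rw [h, diag_one, LinearMap.comp_id]
        exact uop_one E β
      map_mul' g h := by
        have h1 : (g * h).left.hom.toLinearMap = UPts.conv g.left.hom.toLinearMap
          (UPts.scaleLin (g.right : A) h.left.hom.toLinearMap) := rfl
        have h2 : (fun n : ℤ => (((g * h).right ^ n : Aˣ) : A)) =
            (fun n : ℤ => ((g.right ^ n : Aˣ) : A)) * (fun n : ℤ => ((h.right ^ n : Aˣ) : A)) := by
          funext n
          rw [SemidirectProduct.mul_right, mul_zpow]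
          rfl
        -- What remains is to exchange t^Y with an element of U. The twist this costs is the one in
        -- the multiplication of the semidirect product.
        rw [h1, h2, uop_conv, ← diag_mul]
        refine LinearMap.ext fun x => ?_
        exact congrArg _ (LinearMap.congr_fun (uop_scale E β g.right h.left.hom.toLinearMap) _) }
  natural {A B} _ _ _ _ f g x := by
    have h : (fun n : ℤ => (((UStar.map f g).right ^ n : Bˣ) : B)) =
        fun n => f ((g.right ^ n : Aˣ) : A) := by
      funext n
      change ((Units.map (f : A →* B) g.right ^ n : Bˣ) : B) = _
      rw [← map_zpow]
      rfl
    change uop E β (f.toLinearMap ∘ₗ g.left.hom.toLinearMap) (E.diag _ _) = _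
    rw [h, diag_natural, uop_natural]
    rfl

theorem rep_ρ (g : UStar k A) (x : A ⊗[k] E.V) : (rep E β).ρ A g x =
    uop E β g.left.hom.toLinearMap (E.diag (fun n => ((g.right ^ n : Aˣ) : A)) x) := rfl

end GrVec

end Coaction

end Equising

end

noncomputable section

namespace Equising

open GrVec

/-! ### The structure of a representation of `U*` -/

section Laurent

variable {k : Type u} [Field k]

variable (k) in
/-- The coordinate of the multiplicative group. -/
def unitT : (LaurentPolynomial k)ˣ :=
  ⟨LaurentPolynomial.T 1, LaurentPolynomial.T (-1), by rw [← LaurentPolynomial.T_add]; rfl,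
    by rw [← LaurentPolynomial.T_add]; rfl⟩

theorem laurent_ext {M : Type*} [AddCommGroup M] [Module k M] {f g : LaurentPolynomial k →ₗ[k] M}
    (h : ∀ n, f (LaurentPolynomial.T n) = g (LaurentPolynomial.T n)) : f = g :=
  AddMonoidAlgebra.lhom_ext' fun n => LinearMap.ext_ring (h n)

/-- The coefficient of `Tⁿ`. -/
def lcoeff (n : ℤ) : LaurentPolynomial k →ₗ[k] k :=
  Finsupp.lapply n ∘ₗ (AddMonoidAlgebra.coeffLinearEquiv k).toLinearMap

theorem lcoeff_T (m n : ℤ) : lcoeff (k := k) m (LaurentPolynomial.T n) = if n = m then 1 else 0 :=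
  Finsupp.single_apply

theorem eq_zero_of_lcoeff {p : LaurentPolynomial k} (h : ∀ n, lcoeff n p = 0) : p = 0 :=
  (AddMonoidAlgebra.coeffLinearEquiv k).injective ((Finsupp.ext h).trans (map_zero _).symm)

variable {A : Type u} [CommRing A] [Algebra k A]

/-- The evaluation of Laurent polynomials at a unit. -/
def evalU (t : Aˣ) : LaurentPolynomial k →ₐ[k] A :=
  AddMonoidAlgebra.lift k A ℤ ((Units.coeHom A).comp (zpowersHom Aˣ t))

theorem evalU_T (t : Aˣ) (n : ℤ) :
    evalU (k := k) t (LaurentPolynomial.T n) = ((t ^ n : Aˣ) : A) := by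
  refine (AddMonoidAlgebra.lift_single _ _ _).trans ?_
  rw [one_smul]
  rfl

theorem map_evalU (t : Aˣ) : Units.map (evalU (k := k) t : LaurentPolynomial k →* A) (unitT k) = t :=
  Units.ext ((evalU_T t 1).trans (by rw [zpow_one]))

theorem unitT_zpow (n : ℤ) : ((unitT k ^ n : (LaurentPolynomial k)ˣ) : LaurentPolynomial k) =
    LaurentPolynomial.T n := by
  induction n using Int.induction_on with
  | zero => rfl
  | succ n ih => rw [zpow_add_one, Units.val_mul, ih, LaurentPolynomial.T_add]; rfl
  | pred n ih => rw [zpow_sub_one, Units.val_mul, ih, sub_eq_add_neg, LaurentPolynomial.T_add]; rfl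

theorem map_unitT_zpow (f : LaurentPolynomial k →ₐ[k] A) (n : ℤ) :
    ((Units.map (f : LaurentPolynomial k →* A) (unitT k) ^ n : Aˣ) : A) =
      f (LaurentPolynomial.T n) := by
  rw [← map_zpow, Units.coe_map, unitT_zpow]
  rfl

/-- A homomorphism out of the Laurent polynomials is evaluation at the image of the coordinate. -/
theorem evalU_map (f : LaurentPolynomial k →ₐ[k] A) :
    (evalU (k := k) (Units.map (f : LaurentPolynomial k →* A) (unitT k))).toLinearMap =
      f.toLinearMap :=
  laurent_ext fun n => (evalU_T _ n).trans (map_unitT_zpow f n)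

variable {R S V : Type*} [CommRing R] [Algebra k R] [CommRing S] [Algebra k S]
  [AddCommGroup V] [Module k V]

theorem contract_pair_right (l : R →ₗ[k] k) (m : S →ₗ[k] k) (b : S) (z : R ⊗[k] V) :
    contract (pair l m) ((1 ⊗ₜ[k] b : R ⊗[k] S) •
      (Algebra.TensorProduct.includeLeft : R →ₐ[k] R ⊗[k] S).toLinearMap.rTensor V z) =
        m b • contract l z := by
  induction z using TensorProduct.induction_on with
  | zero => simp
  | add x y hx hy => simp only [map_add, smul_add, hx, hy]
  | tmul a y => simp [TensorProduct.smul_tmul', smul_smul, mul_comm]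

end Laurent

/-! ### The grading and the word operators of a representation -/

namespace URep

variable {k : Type u} [Field k] (X : URep k) {A : Type u} [CommRing A] [Algebra k A]

/-- The coaction of `H_u`, given by the generic point of `U`. -/
def ucoact : X.V →ₗ[k] Hu k ⊗[k] X.V :=
  (X.ρ (Hu k) (SemidirectProduct.inl (UPts.mk (AlgHom.id k (Hu k))))).restrictScalars k ∘ₗ
    TensorProduct.mk k (Hu k) X.V 1

/-- The coaction of the Laurent polynomials, given by the generic point of `𝔾ₘ`. -/
def tcoact : X.V →ₗ[k] LaurentPolynomial k ⊗[k] X.V :=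
  (X.ρ (LaurentPolynomial k) (SemidirectProduct.inr (unitT k))).restrictScalars k ∘ₗ
    TensorProduct.mk k (LaurentPolynomial k) X.V 1

theorem ucoact_apply (x : X.V) : X.ucoact x =
    X.ρ (Hu k) (SemidirectProduct.inl (UPts.mk (AlgHom.id k (Hu k)))) (1 ⊗ₜ[k] x) := rfl

theorem tcoact_apply (x : X.V) : X.tcoact x =
    X.ρ (LaurentPolynomial k) (SemidirectProduct.inr (unitT k)) (1 ⊗ₜ[k] x) := rfl

/-- Every point of U is the image of the generic point under the homomorphism it consists of. By
naturality its action is determined by the coaction; the next statement does the same for 𝔾ₘ. -/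
theorem ρ_inl (φ : UPts k A) (a : A) (x : X.V) :
    X.ρ A (SemidirectProduct.inl φ) (a ⊗ₜ[k] x) =
      a • φ.hom.toLinearMap.rTensor X.V (X.ucoact x) := by
  have h : UStar.map φ.hom (SemidirectProduct.inl (UPts.mk (AlgHom.id k (Hu k)))) =
      SemidirectProduct.inl φ := (SemidirectProduct.map_inl ..).trans (congrArg _ rfl)
  have := X.natural φ.hom (SemidirectProduct.inl (UPts.mk (AlgHom.id k (Hu k)))) (1 ⊗ₜ[k] x)
  rw [h, LinearMap.rTensor_tmul, AlgHom.toLinearMap_apply, map_one] at this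
  refine Eq.trans ?_ (congrArg (a • ·) this)
  rw [← map_smul, TensorProduct.smul_tmul', smul_eq_mul, mul_one]

theorem ρ_inr (t : Aˣ) (a : A) (x : X.V) :
    X.ρ A (SemidirectProduct.inr t) (a ⊗ₜ[k] x) =
      a • (evalU t).toLinearMap.rTensor X.V (X.tcoact x) := by
  have h : UStar.map (evalU (k := k) t) (SemidirectProduct.inr (unitT k)) =
      SemidirectProduct.inr t := (SemidirectProduct.map_inr ..).trans (congrArg _ (map_evalU t))
  have := X.natural (evalU t) (SemidirectProduct.inr (unitT k)) (1 ⊗ₜ[k] x)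
  rw [h, LinearMap.rTensor_tmul, AlgHom.toLinearMap_apply, map_one] at this
  refine Eq.trans ?_ (congrArg (a • ·) this)
  rw [← map_smul, TensorProduct.smul_tmul', smul_eq_mul, mul_one]

theorem ρ_eq (g : UStar k A) (x : A ⊗[k] X.V) : X.ρ A g x =
    X.ρ A (SemidirectProduct.inl g.left) (X.ρ A (SemidirectProduct.inr g.right) x) := by
  rw [← Module.End.mul_apply, ← map_mul, SemidirectProduct.inl_left_mul_inr_right]

/-- The operator by which the element dual to a word acts. -/
def op (w : List ℕ+) : Module.End k X.V := contract (Hu.coeff w) ∘ₗ X.ucoact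

theorem op_apply (w : List ℕ+) (x : X.V) : X.op w x = contract (Hu.coeff w) (X.ucoact x) := rfl

/-- The empty word is dual to the counit, which is the neutral point of U over k. -/
theorem op_nil : X.op [] = 1 := LinearMap.ext fun x => by
  have h : (SemidirectProduct.inl (1 : UPts k k) : UStar k k) = 1 := map_one _
  have := X.ρ_inl (1 : UPts k k) 1 x
  rw [h, map_one, one_smul, Module.End.one_apply] at this
  have h2 : (1 : UPts k k).hom.toLinearMap = Hu.counit := rfl
  rw [h2] at this
  rw [op_apply, Hu.coeff_nil, contract, LinearMap.comp_apply, ← this]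
  simp

/-- Acting by the generic point over H_u ⊗ R and then contracting both factors is the same as
contracting R first and acting afterwards. This isolates one factor in a product of two independent
points. -/
theorem contract_ρ_inl {R : Type u} [CommRing R] [Algebra k R] (l : Hu k →ₗ[k] k) (m : R →ₗ[k] k)
    (z : R ⊗[k] X.V) :
    contract (pair l m) (X.ρ (Hu k ⊗[k] R)
      (SemidirectProduct.inl (UPts.mk Algebra.TensorProduct.includeLeft))
        ((Algebra.TensorProduct.includeRight : R →ₐ[k] Hu k ⊗[k] R).toLinearMap.rTensor X.V z)) =
      contract l (X.ucoact (contract m z)) := by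
  induction z using TensorProduct.induction_on with
  | zero => simp only [map_zero]
  | add x y hx hy => simp only [map_add, hx, hy]
  | tmul a y =>
    rw [LinearMap.rTensor_tmul, ρ_inl]
    refine (contract_pair_right l m a (X.ucoact y)).trans ?_
    rw [contract_tmul, map_smul, map_smul]

/-- The two inclusions of H_u into H_u ⊗ H_u are independent points of U whose product is the
coproduct. The group law at this product, tested on the pair (v, w), gives multiplicativity. -/
theorem op_append (v w : List ℕ+) : X.op (v ++ w) = X.op v * X.op w := LinearMap.ext fun x => by
  let i₁ : UPts k (Hu k ⊗[k] Hu k) := UPts.mk Algebra.TensorProduct.includeLeft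
  let i₂ : UPts k (Hu k ⊗[k] Hu k) := UPts.mk Algebra.TensorProduct.includeRight
  have h : (i₁ * i₂).hom.toLinearMap = Hu.comul := LinearMap.ext fun y => by
    change LinearMap.mul' k _ (TensorProduct.map _ _ (Hu.comul y)) = Hu.comul y
    generalize Hu.comul y = t
    induction t using TensorProduct.induction_on with
    | zero => simp only [map_zero]
    | add x y hx hy => simp only [map_add, hx, hy]
    | tmul x y =>
      rw [TensorProduct.map_tmul, LinearMap.mul'_apply]
      change (x ⊗ₜ[k] 1) * (1 ⊗ₜ[k] y) = _
      rw [Algebra.TensorProduct.tmul_mul_tmul, one_mul, mul_one]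
  have h1 := X.ρ_inl (i₁ * i₂) 1 x
  rw [h, one_smul, map_mul, map_mul, Module.End.mul_apply, ρ_inl, one_smul] at h1
  have h2 := congrArg (contract (pair (Hu.coeff v) (Hu.coeff w))) h1
  have h3 : pair (Hu.coeff v) (Hu.coeff w) ∘ₗ Hu.comul = Hu.coeff (k := k) (v ++ w) :=
    LinearMap.ext fun x => Hu.pair_comul v w x
  rw [contract_rTensor, h3] at h2
  exact h2.symm.trans (X.contract_ρ_inl _ _ _)

/-- The projection to the component of degree `n`. -/
def pr (n : ℤ) : X.V →ₗ[k] X.V := contract (lcoeff n) ∘ₗ X.tcoact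

theorem pr_apply (n : ℤ) (x : X.V) : X.pr n x = contract (lcoeff n) (X.tcoact x) := rfl

theorem contract_ρ_inr {R : Type u} [CommRing R] [Algebra k R] (l : LaurentPolynomial k →ₗ[k] k)
    (m : R →ₗ[k] k) (z : R ⊗[k] X.V) :
    contract (pair l m) (X.ρ (LaurentPolynomial k ⊗[k] R)
      (SemidirectProduct.inr (Units.map ((Algebra.TensorProduct.includeLeft :
        LaurentPolynomial k →ₐ[k] LaurentPolynomial k ⊗[k] R) :
          LaurentPolynomial k →* LaurentPolynomial k ⊗[k] R) (unitT k)))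
        ((Algebra.TensorProduct.includeRight :
          R →ₐ[k] LaurentPolynomial k ⊗[k] R).toLinearMap.rTensor X.V z)) =
      contract l (X.tcoact (contract m z)) := by
  induction z using TensorProduct.induction_on with
  | zero => simp only [map_zero]
  | add x y hx hy => simp only [map_add, hx, hy]
  | tmul a y =>
    rw [LinearMap.rTensor_tmul, ρ_inr, evalU_map]
    refine (contract_pair_right l m a (X.tcoact y)).trans ?_
    rw [contract_tmul, map_smul, map_smul]

/-- Same argument with two independent points of 𝔾ₘ: the power Tⁱ becomes Tⁱ ⊗ Tⁱ, so distinct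
coefficients give orthogonal idempotents. -/
theorem pr_pr (m n : ℤ) (x : X.V) : X.pr m (X.pr n x) = if n = m then X.pr m x else 0 := by
  let P := LaurentPolynomial k
  let t₁ : (P ⊗[k] P)ˣ := Units.map
    ((Algebra.TensorProduct.includeLeft : P →ₐ[k] P ⊗[k] P) : P →* P ⊗[k] P) (unitT k)
  let t₂ : (P ⊗[k] P)ˣ := Units.map
    ((Algebra.TensorProduct.includeRight : P →ₐ[k] P ⊗[k] P) : P →* P ⊗[k] P) (unitT k)
  have h1 := X.ρ_inr (t₁ * t₂) 1 x
  rw [one_smul, map_mul, map_mul, Module.End.mul_apply, X.ρ_inr t₂, one_smul, evalU_map] at h1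
  have h2 := congrArg (contract (pair (lcoeff m) (lcoeff n))) h1
  have h3 : pair (lcoeff m) (lcoeff n) ∘ₗ (evalU (t₁ * t₂)).toLinearMap =
      if n = m then lcoeff (k := k) m else 0 := laurent_ext fun i => by
    have e : (t₁ * t₂) ^ i = t₁ ^ i * t₂ ^ i := (Commute.all t₁ t₂).mul_zpow i
    rw [LinearMap.comp_apply, AlgHom.toLinearMap_apply, evalU_T, e, Units.val_mul,
      map_unitT_zpow, map_unitT_zpow]
    change pair _ _ ((LaurentPolynomial.T i ⊗ₜ[k] 1) * (1 ⊗ₜ[k] LaurentPolynomial.T i)) = _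
    rw [Algebra.TensorProduct.tmul_mul_tmul, one_mul, mul_one, pair_tmul, lcoeff_T, lcoeff_T]
    by_cases h : n = m
    · subst h
      rw [if_pos rfl, lcoeff_T]
      split_ifs <;> simp
    · rw [if_neg h, LinearMap.zero_apply]
      by_cases h' : i = m
      · subst h'; simp [Ne.symm h]
      · simp [h']
  rw [contract_rTensor, h3] at h2
  refine (X.contract_ρ_inr _ _ _).symm.trans (h2.trans ?_)
  split_ifs with h
  · rfl
  · simp [contract]

theorem eq_of_lcoeff {V : Type*} [AddCommGroup V] [Module k V] {y z : LaurentPolynomial k ⊗[k] V}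
    (h : ∀ n, contract (lcoeff n) y = contract (lcoeff n) z) : y = z := by
  rw [← sub_eq_zero]
  refine eq_zero_of_contract (Set.range lcoeff) (fun a ha => eq_zero_of_lcoeff fun w =>
    ha _ ⟨w, rfl⟩) ?_
  rintro _ ⟨n, rfl⟩
  rw [map_sub, h, sub_self]

theorem eq_of_coeff {V : Type*} [AddCommGroup V] [Module k V] {y z : Hu k ⊗[k] V}
    (h : ∀ w, contract (Hu.coeff w) y = contract (Hu.coeff w) z) : y = z := by
  rw [← sub_eq_zero]
  refine eq_zero_of_contract (Set.range Hu.coeff) (fun a ha => Hu.eq_zero_of_coeff fun w =>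
    ha _ ⟨w, rfl⟩) ?_
  rintro _ ⟨n, rfl⟩
  rw [map_sub, h, sub_self]

/-- The component of degree `n`. -/
def gr (n : ℤ) : Submodule k X.V :=
  LinearMap.eqLocus X.tcoact (TensorProduct.mk k (LaurentPolynomial k) X.V (LaurentPolynomial.T n))

theorem mem_gr {n : ℤ} {x : X.V} : x ∈ X.gr n ↔ X.tcoact x = LaurentPolynomial.T n ⊗ₜ[k] x :=
  Iff.rfl

theorem pr_mem (n : ℤ) (x : X.V) : X.pr n x ∈ X.gr n := X.mem_gr.mpr <| eq_of_lcoeff fun m => by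
  rw [← pr_apply, pr_pr, contract_tmul, lcoeff_T]
  split_ifs with h
  · rw [h, one_smul]
  · rw [zero_smul]

theorem pr_of_mem {n : ℤ} {x : X.V} (hx : x ∈ X.gr n) (m : ℤ) :
    X.pr m x = if n = m then x else 0 := by
  rw [pr_apply, X.mem_gr.mp hx, contract_tmul, lcoeff_T, ite_smul, one_smul, zero_smul]

theorem ρ_inr_of_mem {n : ℤ} {x : X.V} (hx : x ∈ X.gr n) (t : Aˣ) (a : A) :
    X.ρ A (SemidirectProduct.inr t) (a ⊗ₜ[k] x) = (a * (t ^ n : Aˣ)) ⊗ₜ[k] x := by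
  rw [ρ_inr, X.mem_gr.mp hx, LinearMap.rTensor_tmul, AlgHom.toLinearMap_apply, evalU_T,
    TensorProduct.smul_tmul', smul_eq_mul]

/-- At t = 1 the coaction returns x. All coefficients of the coaction are homogeneous, so modulo the
span of the homogeneous vectors the coaction of x is zero, hence so is x. -/
theorem iSup_gr : ⨆ n, X.gr n = ⊤ := by
  rw [eq_top_iff]
  rintro x -
  have h : (SemidirectProduct.inr (1 : kˣ) : UStar k k) = 1 := map_one _
  have h1 := X.ρ_inr (1 : kˣ) 1 x
  rw [h, map_one, one_smul, Module.End.one_apply] at h1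
  have h2 : contract (evalU (k := k) (1 : kˣ)).toLinearMap (X.tcoact x) = x := by
    rw [contract, LinearMap.comp_apply, ← h1]
    simp
  have h3 : (⨆ n, X.gr n).mkQ.baseChange (LaurentPolynomial k) (X.tcoact x) = 0 :=
    eq_of_lcoeff fun n => by
      rw [contract_baseChange, map_zero, Submodule.mkQ_apply, Submodule.Quotient.mk_eq_zero]
      exact Submodule.mem_iSup_of_mem n (X.pr_mem n x)
  rw [← Submodule.Quotient.mk_eq_zero, ← Submodule.mkQ_apply, ← h2, ← contract_baseChange, h3,
    map_zero]

/-- The relation t φ = θ_t(φ) t in the semidirect product, for independent generic points t and φ,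
multiplies the coefficient of a word w by t^{|w|}. Comparing powers of t gives the shift of degrees.
-/
theorem op_mem (w : List ℕ+) {n : ℤ} {x : X.V} (hx : x ∈ X.gr n) :
    X.op w x ∈ X.gr (n + UPts.deg w) := by
  let P := LaurentPolynomial k
  let t : (P ⊗[k] Hu k)ˣ := Units.map
    ((Algebra.TensorProduct.includeLeft : P →ₐ[k] P ⊗[k] Hu k) : P →* P ⊗[k] Hu k) (unitT k)
  let φ : UPts k (P ⊗[k] Hu k) := UPts.mk Algebra.TensorProduct.includeRight
  have h0 : (SemidirectProduct.inr t * SemidirectProduct.inl φ : UStar k (P ⊗[k] Hu k)) =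
      SemidirectProduct.inl (UPts.theta k _ t φ) * SemidirectProduct.inr t := by
    rw [SemidirectProduct.inl_aut, map_inv, inv_mul_cancel_right]
  have h1 := congrArg (fun g => X.ρ _ g (1 ⊗ₜ[k] x)) h0
  simp only [map_mul, Module.End.mul_apply] at h1
  rw [X.ρ_inr_of_mem hx, ρ_inl, one_smul, ρ_inl, one_mul] at h1
  have h4 (m : ℤ) : pair (lcoeff m) (Hu.coeff w) ∘ₗ LinearMap.mulLeft k ((t ^ n : (P ⊗[k] Hu k)ˣ) : P ⊗[k] Hu k) ∘ₗ
      (UPts.theta k _ t φ).hom.toLinearMap = if n + UPts.deg w = m then Hu.coeff w else 0 := by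
    refine Hu.hom_ext fun u => ?_
    have : (UPts.theta k _ t φ).hom.toLinearMap (Hu.word u) =
      (t : P ⊗[k] Hu k) ^ UPts.deg u * (1 ⊗ₜ[k] Hu.word u) := UPts.scale_word _ φ u
    rw [LinearMap.comp_apply, LinearMap.comp_apply, this, LinearMap.mulLeft_apply, ← mul_assoc,
      ← Units.val_pow_eq_pow_val, ← Units.val_mul, ← zpow_natCast, ← zpow_add, map_unitT_zpow]
    change pair _ _ ((LaurentPolynomial.T (n + UPts.deg u) ⊗ₜ[k] 1) * (1 ⊗ₜ[k] Hu.word u)) = _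
    rw [Algebra.TensorProduct.tmul_mul_tmul, one_mul, mul_one, pair_tmul, lcoeff_T, Hu.coeff_word]
    by_cases h : u = w
    · subst h
      by_cases h' : n + UPts.deg u = m <;> simp [h', Hu.coeff_word]
    · rw [if_neg h, mul_zero]
      split_ifs <;> simp [Hu.coeff_word, h]
  have h5 (c : P ⊗[k] Hu k) (f : Hu k →ₗ[k] P ⊗[k] Hu k) (z : Hu k ⊗[k] X.V) :
      c • f.rTensor X.V z = (LinearMap.mulLeft k c ∘ₗ f).rTensor X.V z := by
    rw [LinearMap.rTensor_comp, LinearMap.comp_apply]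
    generalize f.rTensor X.V z = y
    induction y using TensorProduct.induction_on with
    | zero => simp
    | add x y hx hy => simp only [map_add, smul_add, hx, hy]
    | tmul a y => simp [TensorProduct.smul_tmul']
  have h6 (m : ℤ) : X.pr m (X.op w x) = if n + UPts.deg w = m then X.op w x else 0 := by
    have h2 := congrArg (contract (pair (lcoeff m) (Hu.coeff w))) h1
    rw [h5, contract_rTensor, h4] at h2
    refine (X.contract_ρ_inr _ _ _).symm.trans (h2.trans ?_)
    split_ifs with h
    · rfl
    · simp [contract]
  rw [← (h6 _).trans (if_pos rfl)]
  exact X.pr_mem _ _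

/-- The graded vector space underlying a representation. -/
@[reducible] def toGrVec [CharZero k] : GrVec k where
  V := X.V
  gr := X.gr
  internal := internal_of_act X.gr
    -- The element 2 of 𝔾ₘ acts by 2ⁿ in degree n, and these eigenvalues are distinct in
    -- characteristic zero.
    (contract (evalU (k := k) (Units.mk0 (2 : k) two_ne_zero)).toLinearMap ∘ₗ X.tcoact)
    (fun n x hx => by
      rw [LinearMap.comp_apply, X.mem_gr.mp hx, contract_tmul, AlgHom.toLinearMap_apply, evalU_T,
        Units.val_zpow_eq_zpow_val]
      rfl) X.iSup_gr

/-- A point of U* is a product of a point of U and a point of 𝔾ₘ, each determined by its coaction.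
The coaction of U is given by the operators of words, which are products of letters. -/
theorem mem_homs_iff {X Y : URep k} {T : X.V →ₗ[k] Y.V} : T ∈ homs X Y ↔
    (∀ x, T.lTensor (LaurentPolynomial k) (X.tcoact x) = Y.tcoact (T x)) ∧
      ∀ (a : ℕ+) x, T (X.op [a] x) = Y.op [a] (T x) := by
  constructor
  · intro h
    refine ⟨fun x => h _ _ _, fun a x => ?_⟩
    have := congrArg (contract (Hu.coeff [a]))
      (h (Hu k) (SemidirectProduct.inl (UPts.mk (AlgHom.id k (Hu k)))) (1 ⊗ₜ[k] x))
    rw [contract_baseChange] at this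
    exact this
  · rintro ⟨h1, h2⟩
    have h3 (w : List ℕ+) : ∀ x, T (X.op w x) = Y.op w (T x) := by
      induction w with
      | nil => intro x; rw [op_nil, op_nil]; rfl
      | cons a w ih =>
        intro x
        have e (Z : URep k) : Z.op (a :: w) = Z.op [a] * Z.op w := Z.op_append [a] w
        rw [e, e, Module.End.mul_apply, Module.End.mul_apply, h2, ih]
    have h4 (x : X.V) : T.baseChange (Hu k) (X.ucoact x) = Y.ucoact (T x) := eq_of_coeff fun w => by
      rw [contract_baseChange]
      exact h3 w x
    have h5 {R A : Type u} [CommRing R] [Algebra k R] [CommRing A] [Algebra k A] (f : R →ₗ[k] A)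
        (z : R ⊗[k] X.V) : T.baseChange A (f.rTensor X.V z) = f.rTensor Y.V (T.baseChange R z) := by
      induction z using TensorProduct.induction_on with
      | zero => simp only [map_zero]
      | add x y hx hy => simp only [map_add, hx, hy]
      | tmul a y => simp
    intro A _ _ g x
    rw [X.ρ_eq g x, Y.ρ_eq g]
    have h6 (x : A ⊗[k] X.V) : T.baseChange A (X.ρ A (SemidirectProduct.inl g.left) x) =
        Y.ρ A (SemidirectProduct.inl g.left) (T.baseChange A x) := by
      induction x using TensorProduct.induction_on with
      | zero => simp only [map_zero]
      | add x y hx hy => simp only [map_add, hx, hy]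
      | tmul a y =>
        rw [ρ_inl, LinearMap.baseChange_tmul, ρ_inl, map_smul, h5, h4]
    have h7 (x : A ⊗[k] X.V) : T.baseChange A (X.ρ A (SemidirectProduct.inr g.right) x) =
        Y.ρ A (SemidirectProduct.inr g.right) (T.baseChange A x) := by
      induction x using TensorProduct.induction_on with
      | zero => simp only [map_zero]
      | add x y hx hy => simp only [map_add, hx, hy]
      | tmul a y =>
        rw [ρ_inr, LinearMap.baseChange_tmul, ρ_inr, map_smul, h5, ← h1]
        rfl
    rw [h6, h7]

end URep

end Equising

end

noncomputable section

namespace Equising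

open GrVec

/-! ### Comparison of representations with graded vector spaces with an endomorphism -/

section Compare

variable {k : Type u} [Field k]

theorem tcoact_rep (E : GrVec k) (β : E.V →ₗ[k] E.V) {n : ℤ} {x : E.V} (hx : x ∈ E.gr n) :
    (rep E β).tcoact x = LaurentPolynomial.T n ⊗ₜ[k] x := by
  change uop E β (1 : UPts k _).hom.toLinearMap (E.diag (fun n => ((unitT k ^ n : (LaurentPolynomial k)ˣ) : LaurentPolynomial k))
    (1 ⊗ₜ[k] x)) = _
  rw [uop_one, LinearMap.id_apply, E.diag_tmul _ _ hx, unitT_zpow, one_mul]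

theorem ucoact_rep (E : GrVec k) (β : E.V →ₗ[k] E.V) (x : E.V) :
    (rep E β).ucoact x = coact E β x := by
  have h : (fun n : ℤ => ((1 ^ n : (Hu k)ˣ) : Hu k)) = 1 := by
    funext n
    simp
  rw [URep.ucoact_apply, rep_ρ, SemidirectProduct.right_inl, SemidirectProduct.left_inl, h,
    diag_one, LinearMap.id_apply, uop_tmul, one_smul]
  exact LinearMap.congr_fun (LinearMap.rTensor_id E.V (Hu k)) _

theorem op_rep (E : GrVec k) (β : E.V →ₗ[k] E.V) (w : List ℕ+) :
    (rep E β).op w = wordOp E β w := LinearMap.ext fun x => by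
  rw [URep.op_apply, ucoact_rep, contract_coact]

/-- The grading recovered from the representation is the original one: the projections agree on
homogeneous vectors. -/
theorem mem_gr_rep (E : GrVec k) (β : E.V →ₗ[k] E.V) {n : ℤ} {x : E.V} :
    x ∈ (rep E β).gr n ↔ x ∈ E.gr n := by
  refine ⟨fun hx => E.mem_gr_of_proj fun m hm => ?_, fun hx => tcoact_rep E β hx⟩
  have h : (rep E β).pr m = E.proj m := E.hom_ext fun i y hy => by
    rw [(rep E β).pr_of_mem (tcoact_rep E β hy), E.proj_of_mem hy]
  rw [← h, (rep E β).pr_of_mem hx, if_neg hm.symm]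

theorem rep_mem_homs_iff {E : GrVec k} {β : E.V →ₗ[k] E.V} {Y : URep k} {T : E.V →ₗ[k] Y.V} :
    T ∈ URep.homs (rep E β) Y ↔ (∀ n, ∀ x ∈ E.gr n, T x ∈ Y.gr n) ∧
      ∀ (a : ℕ+) x, T (comp ((a : ℕ) : ℤ) β x) = Y.op [a] (T x) := by
  refine URep.mem_homs_iff.trans (and_congr ⟨fun h n x hx => ?_, fun h x => ?_⟩
    (forall_congr' fun a => forall_congr' fun x => ?_))
  · rw [URep.mem_gr, ← h, tcoact_rep E β hx]
    rfl
  · have h0 : T.lTensor (LaurentPolynomial k) ∘ₗ (rep E β).tcoact = Y.tcoact ∘ₗ T :=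
      E.hom_ext fun n x hx => by
        rw [LinearMap.comp_apply, LinearMap.comp_apply, Y.mem_gr.mp (h n x hx), tcoact_rep E β hx]
        rfl
    exact LinearMap.congr_fun h0 x
  · rw [op_rep, wordOp_singleton]

theorem rep_mem_homs_rep_iff {E F : GrVec k} {β : E.V →ₗ[k] E.V} {γ : F.V →ₗ[k] F.V}
    {T : E.V →ₗ[k] F.V} : T ∈ URep.homs (rep E β) (rep F γ) ↔
      IsGraded T ∧ ∀ a : ℕ+, T ∘ₗ comp ((a : ℕ) : ℤ) β = comp ((a : ℕ) : ℤ) γ ∘ₗ T := by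
  refine rep_mem_homs_iff.trans (and_congr (forall_congr' fun n => forall_congr' fun x =>
    imp_congr Iff.rfl (mem_gr_rep F γ)) (forall_congr' fun a => ?_))
  rw [op_rep, wordOp_singleton]
  exact ⟨fun h => LinearMap.ext h, fun h => LinearMap.congr_fun h⟩

/-- A weight-raising endomorphism is the sum of its components of positive degree, and a graded map
respects this decomposition. -/
theorem comp_comm_iff {E F : GrVec k} {β : E.V →ₗ[k] E.V} {γ : F.V →ₗ[k] F.V}
    (hβ : RaisesBy 1 β) (hγ : RaisesBy 1 γ) {T : E.V →ₗ[k] F.V} (hT : IsGraded T) :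
    (∀ a : ℕ+, T ∘ₗ comp ((a : ℕ) : ℤ) β = comp ((a : ℕ) : ℤ) γ ∘ₗ T) ↔ T ∘ₗ β = γ ∘ₗ T := by
  refine ⟨fun h => ?_, fun h a => ?_⟩
  · obtain ⟨M, hM⟩ := exists_sum_comp E E
    obtain ⟨N, hN⟩ := exists_sum_comp F F
    rw [← hM (max M N) (le_max_left _ _) β hβ, ← hN (max M N) (le_max_right _ _) γ hγ]
    refine LinearMap.ext fun x => ?_
    simp only [LinearMap.comp_apply, LinearMap.sum_apply, map_sum]
    refine Finset.sum_congr rfl fun a _ => ?_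
    have := LinearMap.congr_fun (h a.succPNat) x
    rw [Nat.succPNat_coe] at this
    push_cast at this
    exact this
  · rw [← graded_comp_comp _ hT, h, comp_comp_graded _ hT]

/-- Every representation of `U*` is defined by an endomorphism which raises the weight. -/
theorem exists_rep [CharZero k] (X : URep k) :
    ∃ β : X.toGrVec.V →ₗ[k] X.toGrVec.V, RaisesBy 1 β ∧
      (LinearMap.id : X.V →ₗ[k] X.V) ∈ URep.homs (rep X.toGrVec β) X := by
  have hop (a : ℕ+) : ∀ n, ∀ x ∈ X.toGrVec.gr n, X.op [a] x ∈ X.toGrVec.gr (n + ((a : ℕ) : ℤ)) :=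
    fun n x hx => by
      have := X.op_mem [a] hx
      rw [UPts.deg_cons] at this
      simpa [UPts.deg] using this
  obtain ⟨N, hN⟩ := exists_raisesBy_eq_zero X.toGrVec X.toGrVec
  let op (a : ℕ+) : X.toGrVec.V →ₗ[k] X.toGrVec.V := X.op [a]
  -- β is the sum of the operators of the letters. Letters beyond N raise the weight so much that
  -- they act by zero, so a finite sum suffices; its index is the letter minus one.
  refine ⟨∑ a ∈ Finset.range N, op a.succPNat, RaisesBy.sum fun a _ =>
    (RaisesBy.of_deg (hop a.succPNat)).mono (by rw [Nat.succPNat_coe]; push_cast; omega),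
    rep_mem_homs_iff.mpr ⟨fun n x hx => hx, fun a x => ?_⟩⟩
  have h : comp ((a : ℕ) : ℤ) (∑ a ∈ Finset.range N, op a.succPNat) = op a := by
    rw [comp_sum]
    have h1 (b : ℕ) : comp ((a : ℕ) : ℤ) (op b.succPNat) = if b = a.natPred then op a else 0 := by
      rw [comp_of_deg (hop b.succPNat)]
      by_cases hb : b = a.natPred
      · subst hb
        simp [op]
      · rw [if_neg hb, if_neg]
        intro h
        refine hb ?_
        rw [Nat.succPNat_coe] at h
        have := a.natPred_add_one
        omega
    simp only [h1]
    rw [Finset.sum_ite_eq']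
    split_ifs with h2
    · rfl
    · rw [Finset.mem_range, not_lt] at h2
      refine (hN _ ((RaisesBy.of_deg (hop a)).mono ?_)).symm
      have := a.natPred_add_one
      omega
  rw [h]
  rfl

theorem ucoact_tensor (X Y : URep k) (x : X.V) (y : Y.V) :
    (URep.tensorObj X Y).ucoact (x ⊗ₜ[k] y : X.V ⊗[k] Y.V) =
      odot (X.ucoact x) (Y.ucoact y) := by
  rw [X.ucoact_apply, Y.ucoact_apply, ← URep.tensor_ρ, odot_tmul, one_mul]
  exact URep.ucoact_apply _ _

theorem tcoact_tensor (X Y : URep k) (x : X.V) (y : Y.V) :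
    (URep.tensorObj X Y).tcoact (x ⊗ₜ[k] y : X.V ⊗[k] Y.V) =
      odot (X.tcoact x) (Y.tcoact y) := by
  rw [X.tcoact_apply, Y.tcoact_apply, ← URep.tensor_ρ, odot_tmul, one_mul]
  exact URep.tcoact_apply _ _

/-- The functional dual to a single letter is primitive for the shuffle product (`Hu.coeff_mul`), so
a letter acts on tensor products by the Leibniz rule. -/
theorem op_tensor (X Y : URep k) (a : ℕ+) (x : X.V) (y : Y.V) :
    (URep.tensorObj X Y).op [a] (x ⊗ₜ[k] y : X.V ⊗[k] Y.V) =
      (X.op [a] x ⊗ₜ[k] y + x ⊗ₜ[k] Y.op [a] y : X.V ⊗[k] Y.V) := by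
  have h0 (Z : URep k) (z : Z.V) : contract Hu.counit (Z.ucoact z) = z := by
    rw [← Hu.coeff_nil, ← URep.op_apply, URep.op_nil]
    rfl
  have h1 (m : Hu k ⊗[k] X.V) (n : Hu k ⊗[k] Y.V) : contract (Hu.coeff [a]) (odot m n) =
      contract (Hu.coeff [a]) m ⊗ₜ[k] contract Hu.counit n +
        contract Hu.counit m ⊗ₜ[k] contract (Hu.coeff [a]) n := by
    induction m using TensorProduct.induction_on with
    | zero => simp
    | add x y hx hy =>
      simp only [add_odot, map_add, hx, hy, TensorProduct.add_tmul]; abel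
    | tmul r e =>
      induction n using TensorProduct.induction_on with
      | zero => simp
      | add x y hx hy => simp only [odot_add, map_add, hx, hy, TensorProduct.tmul_add]; abel
      | tmul s f =>
        rw [odot_tmul, contract_tmul, Hu.coeff_mul, add_comm, add_smul]
        simp only [contract_tmul, TensorProduct.smul_tmul_smul]
  have h2 := congrArg (contract (Hu.coeff [a])) (ucoact_tensor X Y x y)
  refine h2.trans ((h1 _ _).trans ?_)
  rw [h0, h0]
  rfl

theorem tmul_mem_gr_tensor (X Y : URep k) {i j : ℤ} {x : X.V} {y : Y.V} (hx : x ∈ X.gr i)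
    (hy : y ∈ Y.gr j) : (x ⊗ₜ[k] y : X.V ⊗[k] Y.V) ∈ (URep.tensorObj X Y).gr (i + j) := by
  refine (URep.mem_gr _).mpr ((tcoact_tensor X Y x y).trans ?_)
  rw [X.mem_gr.mp hx, Y.mem_gr.mp hy, odot_tmul, ← LaurentPolynomial.T_add]
  rfl

variable [CharZero k]

theorem proj_tmul {E F : GrVec k} (m : ℤ) {j : ℤ} (x : E.V) {y : F.V} (hy : y ∈ F.gr j) :
    (GrVec.tensor E F).proj m (x ⊗ₜ[k] y : E.V ⊗[k] F.V) =
      (E.proj (m - j) x ⊗ₜ[k] y : E.V ⊗[k] F.V) := by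
  induction x using E.induction with
  | h₂ x x' hx hx' =>
    rw [TensorProduct.add_tmul, map_add, TensorProduct.add_tmul, ← hx, ← hx']
    exact map_add _ _ _
  | h i x hx =>
    refine ((GrVec.tensor E F).proj_of_mem (tmul_mem hx hy) m).trans ?_
    rw [E.proj_of_mem hx]
    by_cases h : i + j = m
    · rw [if_pos h, if_pos (by omega)]
    · rw [if_neg h, if_neg (by omega), TensorProduct.zero_tmul]
      rfl

theorem tmul_proj {E F : GrVec k} (m : ℤ) {i : ℤ} {x : E.V} (y : F.V) (hx : x ∈ E.gr i) :
    (GrVec.tensor E F).proj m (x ⊗ₜ[k] y : E.V ⊗[k] F.V) =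
      (x ⊗ₜ[k] F.proj (m - i) y : E.V ⊗[k] F.V) := by
  induction y using F.induction with
  | h₂ x x' hx hx' =>
    rw [TensorProduct.tmul_add, map_add, TensorProduct.tmul_add, ← hx, ← hx']
    exact map_add _ _ _
  | h j y hy =>
    refine ((GrVec.tensor E F).proj_of_mem (tmul_mem hx hy) m).trans ?_
    rw [F.proj_of_mem hy]
    by_cases h : i + j = m
    · rw [if_pos h, if_pos (by omega)]
    · rw [if_neg h, if_neg (by omega), TensorProduct.tmul_zero]
      rfl

/-- The identity has degree 0, so on a product of homogeneous vectors the component of degree a can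
be taken in the factor that is moved. -/
theorem comp_tensor {E F : GrVec k} (a : ℤ) (S : E.V →ₗ[k] E.V) (T : F.V →ₗ[k] F.V) (x : E.V)
    (y : F.V) :
    comp (E := GrVec.tensor E F) (F := GrVec.tensor E F) a
      (TensorProduct.map S LinearMap.id + TensorProduct.map LinearMap.id T)
        (x ⊗ₜ[k] y : E.V ⊗[k] F.V) =
      (comp a S x ⊗ₜ[k] y + x ⊗ₜ[k] comp a T y : E.V ⊗[k] F.V) := by
  induction x using E.induction with
  | h₂ x x' hx hx' =>
    rw [TensorProduct.add_tmul, map_add, TensorProduct.add_tmul, TensorProduct.add_tmul]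
    refine (map_add _ _ _).trans ((congrArg₂ (· + ·) hx hx').trans ?_)
    exact add_add_add_comm _ _ _ _
  | h i x hx =>
    induction y using F.induction with
    | h₂ y y' hy hy' =>
      rw [TensorProduct.tmul_add, map_add, TensorProduct.tmul_add, TensorProduct.tmul_add]
      refine (map_add _ _ _).trans ((congrArg₂ (· + ·) hy hy').trans ?_)
      exact add_add_add_comm _ _ _ _
    | h j y hy =>
      refine (comp_of_mem a _ (tmul_mem hx hy)).trans ?_
      rw [comp_of_mem a S hx, comp_of_mem a T hy]
      refine (map_add _ _ _).trans (congrArg₂ (· + ·) ((proj_tmul _ _ hy).trans ?_)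
        ((tmul_proj _ _ hx).trans ?_))
      · rw [show i + j + a - j = i + a by omega]
      · rw [show i + j + a - i = j + a by omega]

/-- Both representations on E ⊗ F have the same grading, and in both a letter acts by the Leibniz
rule. -/
theorem id_mem_homs_tensor (E F : GrVec k) (β : E.V →ₗ[k] E.V) (γ : F.V →ₗ[k] F.V) :
    (LinearMap.id : E.V ⊗[k] F.V →ₗ[k] E.V ⊗[k] F.V) ∈ URep.homs
      (rep (GrVec.tensor E F) (TensorProduct.map β LinearMap.id + TensorProduct.map LinearMap.id γ))
      (URep.tensorObj (rep E β) (rep F γ)) := by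
  refine rep_mem_homs_iff.mpr ⟨fun n x hx => ?_, fun a x => ?_⟩
  · refine Submodule.span_le.mpr ?_ hx
    rintro _ ⟨i, j, rfl, e, he, f, hf, rfl⟩
    exact tmul_mem_gr_tensor _ _ ((mem_gr_rep E β).mpr he) ((mem_gr_rep F γ).mpr hf)
  · have h : (comp (E := GrVec.tensor E F) (F := GrVec.tensor E F) ((a : ℕ) : ℤ)
        (TensorProduct.map β LinearMap.id + TensorProduct.map LinearMap.id γ) :
          E.V ⊗[k] F.V →ₗ[k] E.V ⊗[k] F.V) = (URep.tensorObj (rep E β) (rep F γ)).op [a] := by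
      refine TensorProduct.ext' fun x y => (comp_tensor _ β γ x y).trans ?_
      rw [← wordOp_singleton, ← wordOp_singleton, ← op_rep, ← op_rep]
      exact (op_tensor (rep E β) (rep F γ) a x y).symm
    exact LinearMap.congr_fun h x

theorem op_unit (a : ℕ+) (c : k) : (URep.tensorUnit k).op [a] c = (0 : k) := by
  have h2 : contract (Hu.coeff [a]) (1 ⊗ₜ[k] c : Hu k ⊗[k] k) = 0 := by
    rw [contract_tmul, Hu.one_def, Hu.coeff_word, if_neg (by simp), zero_smul]
  exact h2

theorem id_mem_homs_unit :
    (LinearMap.id : k →ₗ[k] k) ∈ URep.homs (rep (GrVec.unit k) 0) (URep.tensorUnit k) := by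
  refine rep_mem_homs_iff.mpr ⟨fun n x hx => ?_, fun a x => ?_⟩
  · refine (URep.mem_gr _).mpr ?_
    rcases EqBundle.unit_mem (k := k) hx with rfl | rfl
    · rfl
    · exact (map_zero _).trans (TensorProduct.tmul_zero _ _).symm
  · have h1 : comp ((a : ℕ) : ℤ) (0 : (GrVec.unit k).V →ₗ[k] (GrVec.unit k).V) = 0 :=
      (GrVec.unit k).hom_ext fun n x hx => by
        rw [comp_of_mem _ _ hx]
        exact map_zero _
    rw [h1]
    exact (op_unit (k := k) a x).symm

end Compare

end Equising

end

noncomputable section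

namespace Equising

open GrVec

/-! ### The equivalence with the representations of `U*` -/

section Equivalence

open scoped MonoidalCategory

variable {k : Type u} [Field k] [CharZero k]

/-- On both sides a morphism is a graded map commuting with the residue; for representations this is
stated component by component. -/
theorem mem_homs_rep_res_iff {X Y : EqBundle k} {T : X.E.V →ₗ[k] Y.E.V} :
    T ∈ URep.homs (rep X.E X.res) (rep Y.E Y.res) ↔ T ∈ EqBundle.homs X Y := by
  rw [rep_mem_homs_rep_iff, EqBundle.mem_homs]
  exact and_congr_right fun hT => comp_comm_iff X.res_raises Y.res_raises hT

variable (k) in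
/-- The functor from equisingular bundles to representations of `U*`. -/
def toRep : EqBundle k ⥤ URep k where
  obj X := rep X.E X.res
  map f := ⟨f.1, mem_homs_rep_res_iff.mpr f.2⟩

/-- The functor `toRep` is compatible with tensor products. -/
def toRepμ (X Y : EqBundle k) :
    (toRep k).obj X ⊗ (toRep k).obj Y ≅ (toRep k).obj (X ⊗ Y) :=
  (URep.mkIso (X := (toRep k).obj (EqBundle.tensorObj X Y))
    (Y := URep.tensorObj ((toRep k).obj X) ((toRep k).obj Y))
    (LinearEquiv.refl k (X.E.V ⊗[k] Y.E.V)) (by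
      change LinearMap.id ∈ URep.homs (rep (GrVec.tensor X.E Y.E) (EqBundle.tensorObj X Y).res)
        (URep.tensorObj (rep X.E X.res) (rep Y.E Y.res))
      rw [EqBundle.res_tensor]
      exact id_mem_homs_tensor X.E Y.E X.res Y.res)).symm

variable (k) in
/-- The functor `toRep` is compatible with the unit objects. -/
def toRepε : 𝟙_ (URep k) ≅ (toRep k).obj (𝟙_ (EqBundle k)) :=
  (URep.mkIso (X := (toRep k).obj (EqBundle.tensorUnit k)) (Y := URep.tensorUnit k)
    (LinearEquiv.refl k k) (by
      change LinearMap.id ∈ URep.homs (rep (GrVec.unit k) (EqBundle.tensorUnit k).res)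
        (URep.tensorUnit k)
      rw [EqBundle.res_unit]
      exact id_mem_homs_unit)).symm

/-- The structure maps are the identity on underlying spaces, so the coherence conditions hold on
pure tensors by definition. -/
instance : (toRep k).Monoidal := Functor.CoreMonoidal.toMonoidal
  { εIso := toRepε k
    μIso := toRepμ
    μIso_hom_natural_left := fun f X => Subtype.ext (TensorProduct.ext' fun _ _ => rfl)
    μIso_hom_natural_right := fun X f => Subtype.ext (TensorProduct.ext' fun _ _ => rfl)
    associativity := fun X Y Z => Subtype.ext (TensorProduct.ext_threefold fun _ _ _ => rfl)
    left_unitality := fun X => Subtype.ext (TensorProduct.ext' fun _ _ => rfl)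
    right_unitality := fun X => Subtype.ext (TensorProduct.ext' fun _ _ => rfl) }

instance : (toRep k).Braided where
  braided X Y := Subtype.ext (TensorProduct.ext' fun _ _ => rfl)

instance : (toRep k).Faithful where
  map_injective {X Y} _ _ h :=
    Subtype.ext (congrArg (fun T : (toRep k).obj X ⟶ (toRep k).obj Y => T.1) h)

instance : (toRep k).Full where
  map_surjective f := ⟨⟨f.1, mem_homs_rep_res_iff.mp f.2⟩, rfl⟩

/-- A representation comes from a weight-raising endomorphism, and every such endomorphism is the
residue of an equisingular bundle. -/
instance : (toRep k).EssSurj where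
  mem_essImage X := by
    obtain ⟨β, hβ, h⟩ := exists_rep X
    refine ⟨EqBundle.ofRes X.toGrVec β hβ, ⟨URep.mkIso (LinearEquiv.refl k X.V) ?_⟩⟩
    change LinearMap.id ∈ URep.homs (rep X.toGrVec (EqBundle.ofRes X.toGrVec β hβ).res) X
    rw [EqBundle.res_ofRes]
    exact h

instance : (toRep k).IsEquivalence where

instance : (toRep k).Additive where
  map_add := rfl

instance : (toRep k).Linear k where
  map_smul _ _ := rfl

variable (k) in
/-- The composite of `toRep` with the forgetful functor is the fibre functor. -/
def toRepForget : toRep k ⋙ URep.forget k ≅ EqBundle.omega k :=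
  NatIso.ofComponents (fun X => Iso.refl (FGModuleCat.of k X.E.V)) fun _ => rfl

instance : NatTrans.IsMonoidal (toRepForget k).hom where
  unit := FGModuleCat.hom_ext (LinearMap.ext fun _ => rfl)
  tensor X Y := FGModuleCat.hom_ext (TensorProduct.ext' fun _ _ => rfl)

end Equivalence

end Equising

end

noncomputable section

namespace Equising

open GrVec Limits

/-! ### Subobjects, quotients and duals -/

namespace GrVec

variable {k : Type u} [Field k] (E : GrVec k)

theorem act_eq_sum (t : k) (x : E.V) : E.act t x = ∑ n ∈ E.degs, t ^ n • E.proj n x := by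
  conv_lhs => rw [← E.sum_proj x, map_sum]
  exact Finset.sum_congr rfl fun n _ => E.act_of_mem t (E.proj_mem n x)

variable [CharZero k] (N : Submodule k E.V) (hN : ∀ n, ∀ x ∈ N, E.proj n x ∈ N)

theorem act_mem (hN : ∀ n, ∀ x ∈ N, E.proj n x ∈ N) (t : k) : ∀ x ∈ N, E.act t x ∈ N := fun x hx => by
  rw [act_eq_sum]
  exact Submodule.sum_mem _ fun n _ => Submodule.smul_mem _ _ (hN n x hx)

/-- A homogeneous subspace. -/
@[reducible] def sub : GrVec k where
  V := N
  gr n := (E.gr n).comap N.subtype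
  -- The subspace is stable under 2^Y, whose distinct eigenvalues 2ⁿ make the pieces independent.
  internal := internal_of_act _ ((E.act 2).restrict (E.act_mem N hN 2))
    (fun n x hx => Subtype.ext (E.act_of_mem 2 hx)) (by
      rw [eq_top_iff]
      rintro x -
      have h : x = ∑ n ∈ E.degs, (⟨E.proj n x, hN n x x.2⟩ : N) := Subtype.ext (by
        rw [AddSubmonoidClass.coe_finsetSum]
        exact (E.sum_proj x).symm)
      rw [h]
      exact Submodule.sum_mem _ fun n _ => Submodule.mem_iSup_of_mem n (E.proj_mem n x))

/-- The quotient by a homogeneous subspace. -/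
@[reducible] def quo : GrVec k where
  V := E.V ⧸ N
  gr n := (E.gr n).map N.mkQ
  internal := internal_of_act _ (N.mapQ N (E.act 2) (E.act_mem N hN 2))
    (by
      rintro n _ ⟨x, hx, rfl⟩
      rw [Submodule.mkQ_apply, Submodule.mapQ_apply, E.act_of_mem 2 hx]
      rfl)
    (by rw [← Submodule.map_iSup, E.iSup_gr, Submodule.map_top, Submodule.range_mkQ])

theorem RaisesBy.restrict {d : ℤ} {β : E.V →ₗ[k] E.V} (hβ : RaisesBy d β) (h : ∀ x ∈ N, β x ∈ N) :
    RaisesBy (E := E.sub N hN) (F := E.sub N hN) d (β.restrict h) := fun n x hx => by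
  have hg : IsGraded (E := E.sub N hN) (F := E) N.subtype := fun _ _ hx => hx
  refine (E.sub N hN).mem_wfil_iff.mpr fun m hm => Subtype.ext ?_
  exact (hg.proj m _).trans (E.mem_wfil_iff.mp (hβ n x hx) m hm)

theorem RaisesBy.mapQ {d : ℤ} {β : E.V →ₗ[k] E.V} (hβ : RaisesBy d β) (h : ∀ x ∈ N, β x ∈ N) :
    RaisesBy (E := E.quo N hN) (F := E.quo N hN) d (N.mapQ N β h) := by
  have hg : IsGraded (E := E) (F := E.quo N hN) N.mkQ := fun _ x hx => ⟨x, hx, rfl⟩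
  rintro n _ ⟨x, hx, rfl⟩
  exact hg.wfil _ (hβ n x hx)

theorem IsGraded.ker_proj {E F : GrVec k} {T : E.V →ₗ[k] F.V} (hT : IsGraded T) (n : ℤ) :
    ∀ x ∈ LinearMap.ker T, E.proj n x ∈ LinearMap.ker T := fun x hx => by
  rw [LinearMap.mem_ker] at hx ⊢
  rw [hT.proj, hx, map_zero]

theorem IsGraded.range_proj {E F : GrVec k} {T : E.V →ₗ[k] F.V} (hT : IsGraded T) (n : ℤ) :
    ∀ x ∈ LinearMap.range T, F.proj n x ∈ LinearMap.range T := by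
  rintro _ ⟨x, rfl⟩
  exact ⟨E.proj n x, hT.proj n x⟩

end GrVec

/-! ### Factoring linear maps through injections and surjections -/

section Factor

variable {k : Type u} [Field k] {U V W : Type*} [AddCommGroup U] [Module k U] [AddCommGroup V]
  [Module k V] [AddCommGroup W] [Module k W]

/-- An injection of vector spaces has a retraction; dually, a surjection has a section, which is
used in `exists_cofactor`. -/
theorem exists_factor {f : U →ₗ[k] V} (hf : Function.Injective f) {h : W →ₗ[k] V}
    (hh : ∀ w, h w ∈ LinearMap.range f) : ∃ l : W →ₗ[k] U, ∀ w, f (l w) = h w := by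
  obtain ⟨r, hr⟩ := f.exists_leftInverse_of_injective (LinearMap.ker_eq_bot.mpr hf)
  refine ⟨r ∘ₗ h, fun w => ?_⟩
  obtain ⟨y, hy⟩ := hh w
  rw [LinearMap.comp_apply, ← hy]
  exact congrArg f (LinearMap.congr_fun hr y)

theorem exists_cofactor {g : U →ₗ[k] V} (hg : Function.Surjective g) {h : U →ₗ[k] W}
    (hh : LinearMap.ker g ≤ LinearMap.ker h) : ∃ l : V →ₗ[k] W, ∀ u, l (g u) = h u := by
  obtain ⟨s, hs⟩ := g.exists_rightInverse_of_surjective (LinearMap.range_eq_top.mpr hg)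
  refine ⟨h ∘ₗ s, fun u => ?_⟩
  have : s (g u) - u ∈ LinearMap.ker h := hh (by
    rw [LinearMap.mem_ker, map_sub, sub_eq_zero]
    exact LinearMap.congr_fun hs (g u))
  rw [LinearMap.mem_ker, map_sub, sub_eq_zero] at this
  exact this

end Factor

/-! ### The abelian structure, constructed on residues -/

namespace EqBundle

variable {k : Type u} [Field k] [CharZero k] {X Y Z : EqBundle k}

theorem graded (f : X ⟶ Y) : IsGraded f.1 := (mem_homs.mp f.2).1

theorem map_res (f : X ⟶ Y) (x : X.E.V) : f.1 (X.res x) = Y.res (f.1 x) :=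
  LinearMap.congr_fun (mem_homs.mp f.2).2 x

theorem mem_homs_ofRes_left {E : GrVec k} {β : E.V →ₗ[k] E.V} {hβ : RaisesBy 1 β}
    {T : E.V →ₗ[k] Y.E.V} :
    T ∈ homs (ofRes E β hβ) Y ↔ IsGraded T ∧ T ∘ₗ β = Y.res ∘ₗ T := by
  refine mem_homs.trans (and_congr Iff.rfl ?_)
  rw [res_ofRes]
  exact Iff.rfl

theorem mem_homs_ofRes_right {F : GrVec k} {γ : F.V →ₗ[k] F.V} {hγ : RaisesBy 1 γ}
    {T : X.E.V →ₗ[k] F.V} :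
    T ∈ homs X (ofRes F γ hγ) ↔ IsGraded T ∧ T ∘ₗ X.res = γ ∘ₗ T := by
  refine mem_homs.trans (and_congr Iff.rfl ?_)
  rw [res_ofRes]
  exact Iff.rfl

/-- A homogeneous subspace stable under the residue carries the restricted residue, which still
raises the weight; the bundle with this residue is the subobject. Quotients work in the same way. -/
theorem exists_sub (X : EqBundle k) (N : Submodule k X.E.V) (hN : ∀ n, ∀ x ∈ N, X.E.proj n x ∈ N)
    (h : ∀ x ∈ N, X.res x ∈ N) : ∃ (K : EqBundle k) (i : K ⟶ X),
      Function.Injective i.1 ∧ LinearMap.range i.1 = N :=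
  ⟨ofRes (X.E.sub N hN) (X.res.restrict h) (RaisesBy.restrict X.E N hN X.res_raises h),
    ⟨N.subtype, mem_homs_ofRes_left.mpr ⟨fun _ _ hx => hx, rfl⟩⟩, N.injective_subtype,
    N.range_subtype⟩

theorem exists_quo (X : EqBundle k) (N : Submodule k X.E.V) (hN : ∀ n, ∀ x ∈ N, X.E.proj n x ∈ N)
    (h : ∀ x ∈ N, X.res x ∈ N) : ∃ (Q : EqBundle k) (p : X ⟶ Q),
      Function.Surjective p.1 ∧ LinearMap.ker p.1 = N :=
  ⟨ofRes (X.E.quo N hN) (N.mapQ N X.res h) (RaisesBy.mapQ X.E N hN X.res_raises h),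
    ⟨N.mkQ, mem_homs_ofRes_right.mpr ⟨fun _ x hx => ⟨x, hx, rfl⟩, rfl⟩⟩, N.mkQ_surjective,
    N.ker_mkQ⟩

theorem exists_ker (f : X ⟶ Y) : ∃ (K : EqBundle k) (i : K ⟶ X),
    Function.Injective i.1 ∧ LinearMap.range i.1 = LinearMap.ker f.1 :=
  X.exists_sub _ (graded f).ker_proj fun x hx => by
    rw [LinearMap.mem_ker] at hx ⊢
    rw [map_res, hx, map_zero]

theorem exists_coker (f : X ⟶ Y) : ∃ (Q : EqBundle k) (p : Y ⟶ Q),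
    Function.Surjective p.1 ∧ LinearMap.ker p.1 = LinearMap.range f.1 :=
  Y.exists_quo _ (graded f).range_proj (by
    rintro _ ⟨x, rfl⟩
    exact ⟨X.res x, map_res f x⟩)

/-- A linear lift through an injective morphism is automatically graded and compatible with the
residues, as both can be tested after the injection. Descent along surjections, in `exists_desc`, is
dual. -/
theorem exists_lift {i : X ⟶ Y} (hi : Function.Injective i.1) (h : Z ⟶ Y)
    (hh : ∀ z, h.1 z ∈ LinearMap.range i.1) : ∃ l : Z ⟶ X, l ≫ i = h := by
  obtain ⟨l, hl⟩ := exists_factor hi hh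
  refine ⟨⟨l, mem_homs.mpr ⟨fun n x hx => X.E.mem_gr_of_proj fun m hm => hi ?_,
    LinearMap.ext fun x => hi ?_⟩⟩, Subtype.ext (LinearMap.ext hl)⟩
  · rw [(graded i).proj, hl, Y.E.proj_of_mem (graded h n x hx), if_neg hm.symm, map_zero]
  · rw [LinearMap.comp_apply, LinearMap.comp_apply, hl, map_res, map_res, hl]

theorem exists_desc {p : X ⟶ Y} (hp : Function.Surjective p.1) (h : X ⟶ Z)
    (hh : LinearMap.ker p.1 ≤ LinearMap.ker h.1) : ∃ l : Y ⟶ Z, p ≫ l = h := by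
  obtain ⟨l, hl⟩ := exists_cofactor hp hh
  refine ⟨⟨l, mem_homs.mpr ⟨fun n y hy => ?_, LinearMap.ext fun y => ?_⟩⟩,
    Subtype.ext (LinearMap.ext hl)⟩
  · obtain ⟨x, rfl⟩ := hp y
    have h1 : p.1 (X.E.proj n x) = p.1 x := by rw [(graded p).proj, Y.E.proj_self hy]
    rw [← h1, hl]
    exact graded h n _ (X.E.proj_mem n x)
  · obtain ⟨x, rfl⟩ := hp y
    rw [LinearMap.comp_apply, LinearMap.comp_apply, ← map_res, hl, hl, map_res]

/-- A monomorphism onto the kernel is a kernel. -/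
def isLimitKernelFork {K X Y : EqBundle k} {i : K ⟶ X} {f : X ⟶ Y}
    (hi : Function.Injective i.1) (h : LinearMap.range i.1 = LinearMap.ker f.1) (w : i ≫ f = 0) :
    IsLimit (KernelFork.ofι i w) :=
  have hl {W : EqBundle k} (g : W ⟶ X) (hg : g ≫ f = 0) : ∃ l : W ⟶ K, l ≫ i = g :=
    exists_lift hi g fun z => by
      rw [h]
      exact LinearMap.congr_fun (congrArg Subtype.val hg) z
  KernelFork.IsLimit.ofι _ _ (fun g hg => (hl g hg).choose) (fun g hg => (hl g hg).choose_spec)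
    fun g hg m hm => Subtype.ext (LinearMap.ext fun z => hi
      (LinearMap.congr_fun (congrArg Subtype.val (hm.trans (hl g hg).choose_spec.symm)) z))

/-- An epimorphism with kernel the image is a cokernel. -/
def isColimitCokernelCofork {X Y Q : EqBundle k} {f : X ⟶ Y} {p : Y ⟶ Q}
    (hp : Function.Surjective p.1) (h : LinearMap.ker p.1 = LinearMap.range f.1) (w : f ≫ p = 0) :
    IsColimit (CokernelCofork.ofπ p w) :=
  have hl {W : EqBundle k} (g : Y ⟶ W) (hg : f ≫ g = 0) : ∃ l : Q ⟶ W, p ≫ l = g :=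
    exists_desc hp g (by
      rw [h]
      rintro _ ⟨x, rfl⟩
      exact LinearMap.congr_fun (congrArg Subtype.val hg) x)
  CokernelCofork.IsColimit.ofπ _ _ (fun g hg => (hl g hg).choose)
    (fun g hg => (hl g hg).choose_spec) fun g hg m hm => Subtype.ext (LinearMap.ext fun z => by
      obtain ⟨y, rfl⟩ := hp z
      exact LinearMap.congr_fun (congrArg Subtype.val (hm.trans (hl g hg).choose_spec.symm)) y)

theorem comp_eq_zero_of_range {f : X ⟶ Y} {g : Y ⟶ Z}
    (h : LinearMap.range f.1 ≤ LinearMap.ker g.1) : f ≫ g = 0 :=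
  Subtype.ext (LinearMap.ext fun x => h ⟨x, rfl⟩)

/-- The kernel embedding composes to zero with a monomorphism, so it is zero, and its image is the
kernel of the underlying map. -/
theorem injective_of_mono (f : X ⟶ Y) [Mono f] : Function.Injective f.1 := by
  obtain ⟨K, i, hi, h⟩ := exists_ker f
  have h0 : i = 0 := (cancel_mono f).mp ((comp_eq_zero_of_range h.le).trans zero_comp.symm)
  rw [← LinearMap.ker_eq_bot, ← h, h0]
  exact LinearMap.range_zero

theorem surjective_of_epi (f : X ⟶ Y) [Epi f] : Function.Surjective f.1 := by
  obtain ⟨Q, p, hp, h⟩ := exists_coker f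
  have h0 : p = 0 := (cancel_epi f).mp ((comp_eq_zero_of_range h.ge).trans comp_zero.symm)
  rw [← LinearMap.range_eq_top, ← h, h0]
  exact LinearMap.ker_zero

instance : HasKernels (EqBundle k) where
  has_limit f := by
    obtain ⟨K, i, hi, h⟩ := exists_ker f
    exact ⟨⟨⟨_, isLimitKernelFork hi h (comp_eq_zero_of_range h.le)⟩⟩⟩

instance : HasCokernels (EqBundle k) where
  has_colimit f := by
    obtain ⟨Q, p, hp, h⟩ := exists_coker f
    exact ⟨⟨⟨_, isColimitCokernelCofork hp h (comp_eq_zero_of_range h.ge)⟩⟩⟩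

/-- A monomorphism is injective, hence a kernel of the projection onto its cokernel. -/
instance : IsNormalMonoCategory (EqBundle k) where
  normalMonoOfMono f _ := by
    obtain ⟨Q, p, hp, h⟩ := exists_coker f
    exact ⟨⟨Q, p, comp_eq_zero_of_range h.ge, isLimitKernelFork (injective_of_mono f) h.symm _⟩⟩

instance : IsNormalEpiCategory (EqBundle k) where
  normalEpiOfEpi f _ := by
    obtain ⟨K, i, hi, h⟩ := exists_ker f
    exact ⟨⟨K, i, comp_eq_zero_of_range h.le,
      isColimitCokernelCofork (surjective_of_epi f) h.symm _⟩⟩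

/-- The zero subspace of the unit object serves as the zero object. -/
instance : HasZeroObject (EqBundle k) where
  zero := by
    obtain ⟨K, i, hi, h⟩ := (tensorUnit k).exists_sub ⊥ (fun n x hx => by
      rw [Submodule.mem_bot] at hx ⊢; rw [hx, map_zero]) (fun x hx => by
      rw [Submodule.mem_bot] at hx ⊢; rw [hx, map_zero])
    have h0 (x : K.E.V) : x = 0 := hi (by
      rw [map_zero]
      exact (Submodule.mem_bot k).mp (h ▸ LinearMap.mem_range_self i.1 x))
    exact ⟨K, (IsZero.iff_id_eq_zero K).mpr (Subtype.ext (LinearMap.ext h0))⟩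

instance : HasBinaryBiproducts (EqBundle k) where
  has_binary_biproduct X Y := by
    -- The residue of a direct sum is the block diagonal endomorphism.
    let β : (GrVec.prod X.E Y.E).V →ₗ[k] (GrVec.prod X.E Y.E).V :=
      inl₀ X.E Y.E ∘ₗ X.res ∘ₗ fst₀ X.E Y.E + inr₀ X.E Y.E ∘ₗ Y.res ∘ₗ snd₀ X.E Y.E
    have hβ : RaisesBy 1 β := by
      have h1 := (graded_inl (F := X.E) (E := Y.E)).raisesBy.comp
        (X.res_raises.comp (graded_fst (F := X.E) (E := Y.E)).raisesBy)
      have h2 := (graded_inr (F := X.E) (E := Y.E)).raisesBy.comp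
        (Y.res_raises.comp (graded_snd (F := X.E) (E := Y.E)).raisesBy)
      exact RaisesBy.add (h1.mono (by omega)) (h2.mono (by omega))
    refine hasBinaryBiproduct_of_total
      { pt := ofRes (GrVec.prod X.E Y.E) β hβ
        fst := ⟨fst₀ X.E Y.E, mem_homs_ofRes_left.mpr ⟨graded_fst, ?_⟩⟩
        snd := ⟨snd₀ X.E Y.E, mem_homs_ofRes_left.mpr ⟨graded_snd, ?_⟩⟩
        inl := ⟨inl₀ X.E Y.E, mem_homs_ofRes_right.mpr ⟨graded_inl, ?_⟩⟩
        inr := ⟨inr₀ X.E Y.E, mem_homs_ofRes_right.mpr ⟨graded_inr, ?_⟩⟩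
        inl_fst := Subtype.ext rfl
        inl_snd := Subtype.ext rfl
        inr_fst := Subtype.ext rfl
        inr_snd := Subtype.ext rfl } ?_
    · exact LinearMap.ext fun x => add_zero (X.res x.1)
    · exact LinearMap.ext fun x => zero_add (Y.res x.2)
    · exact LinearMap.ext fun x => Prod.ext (add_zero (X.res x)).symm
        ((zero_add (Y.res 0)).trans (map_zero Y.res)).symm
    · exact LinearMap.ext fun x => Prod.ext ((add_zero (X.res 0)).trans (map_zero X.res)).symm
        (zero_add (Y.res x)).symm
    · exact Subtype.ext (LinearMap.ext fun x => Prod.ext (add_zero _) (zero_add _))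

instance : HasFiniteProducts (EqBundle k) := hasFiniteProducts_of_has_binary_and_terminal

instance : HasFiniteCoproducts (EqBundle k) := hasFiniteCoproducts_of_has_binary_and_initial

end EqBundle

end Equising

end

noncomputable section

namespace Equising

open GrVec Limits

/-! ### Exactness of the fibre functor -/

section Exact

variable {k : Type u} [Field k]

/-- Kernels of finite dimensional vector spaces. -/
def isLimitKernelForkFG {K X Y : FGModuleCat.{u} k} {i : K ⟶ X} {f : X ⟶ Y}
    (hi : Function.Injective i.hom.hom) (h : LinearMap.range i.hom.hom = LinearMap.ker f.hom.hom)
    (w : i ≫ f = 0) : IsLimit (KernelFork.ofι i w) :=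
  have hl {W : FGModuleCat.{u} k} (g : W ⟶ X) (hg : g ≫ f = 0) : ∃ l : W ⟶ K, l ≫ i = g := by
    obtain ⟨l, hl⟩ := exists_factor hi (h := g.hom.hom) fun z => by
      rw [h]
      exact LinearMap.congr_fun (congrArg (fun g => g.hom.hom) hg) z
    exact ⟨FGModuleCat.ofHom l, FGModuleCat.hom_ext (LinearMap.ext hl)⟩
  KernelFork.IsLimit.ofι _ _ (fun g hg => (hl g hg).choose) (fun g hg => (hl g hg).choose_spec)
    fun g hg m hm => FGModuleCat.hom_ext (LinearMap.ext fun z => hi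
      (LinearMap.congr_fun (congrArg (fun g => g.hom.hom) (hm.trans (hl g hg).choose_spec.symm)) z))

/-- Cokernels of finite dimensional vector spaces. -/
def isColimitCokernelCoforkFG {X Y Q : FGModuleCat.{u} k} {f : X ⟶ Y} {p : Y ⟶ Q}
    (hp : Function.Surjective p.hom.hom)
    (h : LinearMap.ker p.hom.hom = LinearMap.range f.hom.hom) (w : f ≫ p = 0) :
    IsColimit (CokernelCofork.ofπ p w) :=
  have hl {W : FGModuleCat.{u} k} (g : Y ⟶ W) (hg : f ≫ g = 0) : ∃ l : Q ⟶ W, p ≫ l = g := by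
    obtain ⟨l, hl⟩ := exists_cofactor hp (h := g.hom.hom) (by
      rw [h]
      rintro _ ⟨x, rfl⟩
      exact LinearMap.congr_fun (congrArg (fun g => g.hom.hom) hg) x)
    exact ⟨FGModuleCat.ofHom l, FGModuleCat.hom_ext (LinearMap.ext hl)⟩
  CokernelCofork.IsColimit.ofπ _ _ (fun g hg => (hl g hg).choose)
    (fun g hg => (hl g hg).choose_spec) fun g hg m hm => FGModuleCat.hom_ext
      (LinearMap.ext fun z => by
        obtain ⟨y, rfl⟩ := hp z
        exact LinearMap.congr_fun (congrArg (fun g => g.hom.hom)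
          (hm.trans (hl g hg).choose_spec.symm)) y)

end Exact

/-! ### Exactness of ω -/

namespace EqBundle

variable {k : Type u} [Field k] [CharZero k]

instance : (omega k).Additive where
  map_add := rfl

instance : (omega k).Linear k where
  map_smul _ _ := rfl

/-- The kernel was built on the kernel of the underlying map, so its image under ω is a kernel of
vector spaces. Cokernels are treated in the same way below. -/
instance {X Y : EqBundle k} (f : X ⟶ Y) : PreservesLimit (parallelPair f 0) (omega k) := by
  obtain ⟨K, i, hi, h⟩ := exists_ker f
  refine preservesLimit_of_preserves_limit_cone
    (isLimitKernelFork hi h (comp_eq_zero_of_range h.le)) ?_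
  exact (isLimitMapConeForkEquiv' (omega k) _).symm (isLimitKernelForkFG hi h _)

instance {X Y : EqBundle k} (f : X ⟶ Y) : PreservesColimit (parallelPair f 0) (omega k) := by
  obtain ⟨Q, p, hp, h⟩ := exists_coker f
  refine preservesColimit_of_preserves_colimit_cocone
    (isColimitCokernelCofork hp h (comp_eq_zero_of_range h.ge)) ?_
  exact (isColimitMapCoconeCoforkEquiv' (omega k) _).symm (isColimitCokernelCoforkFG hp h _)

variable (k) in
theorem isFiberFunctor_omega : IsFiberFunctor (omega k) where
  additive := inferInstance
  linear := inferInstance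
  faithful := inferInstance
  leftExact := by
    have := Preadditive.hasEqualizers_of_hasKernels (C := EqBundle k)
    exact (omega k).preservesFiniteLimits_of_preservesKernels
  rightExact := by
    have := Preadditive.hasCoequalizers_of_hasCokernels (C := EqBundle k)
    exact (omega k).preservesFiniteColimits_of_preservesCokernels

end EqBundle

/-! ### Duals -/

namespace GrVec

variable {k : Type u} [Field k] [CharZero k] (E : GrVec k)

/-- The dual graded vector space. -/
@[reducible] def dual : GrVec k where
  V := Module.Dual k E.V
  gr n := 
    { carrier := {φ | ∀ m, m ≠ -n → ∀ x ∈ E.gr m, φ x = 0}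
      add_mem' := fun ha hb m hm x hx => by
        rw [LinearMap.add_apply, ha m hm x hx, hb m hm x hx, add_zero]
      zero_mem' := fun _ _ _ _ => rfl
      smul_mem' := fun c φ hφ m hm x hx => by
        rw [LinearMap.smul_apply, hφ m hm x hx, smul_zero] }
  -- Forms of degree n live on the component of degree -n, where the transpose of (1/2)^Y is
  -- multiplication by 2ⁿ.
  internal := internal_of_act _ (Module.Dual.transpose (R := k) (E.act 2⁻¹))
    (fun n φ hφ => E.hom_ext fun m x hx => by
      rw [Module.Dual.transpose_apply, LinearMap.comp_apply, E.act_of_mem _ hx, map_smul,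
        LinearMap.smul_apply]
      by_cases hm : m = -n
      · rw [hm, inv_zpow', neg_neg]
      · rw [hφ m hm x hx, smul_zero, smul_zero])
    (by
      rw [eq_top_iff]
      rintro φ -
      have h : φ = ∑ n ∈ E.degs, φ ∘ₗ E.proj n := LinearMap.ext fun x => by
        rw [LinearMap.sum_apply]
        exact (congrArg φ (E.sum_proj x).symm).trans (map_sum _ _ _)
      rw [h]
      refine Submodule.sum_mem _ fun n _ => Submodule.mem_iSup_of_mem (-n) fun m hm x hx => ?_
      rw [LinearMap.comp_apply, E.proj_of_mem hx, if_neg (by omega), map_zero])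

theorem dual_proj (n : ℤ) (φ : Module.Dual k E.V) : E.dual.proj n φ = φ ∘ₗ E.proj (-n) := by
  induction φ using E.dual.induction with
  | h m φ hφ =>
    refine E.hom_ext fun i x hx => ?_
    rw [E.dual.proj_of_mem hφ, LinearMap.comp_apply, E.proj_of_mem hx]
    by_cases h : i = -n
    · rw [if_pos h]
      split_ifs with h'
      · rfl
      · exact (hφ i (by omega) x hx).symm
    · rw [if_neg h, map_zero]
      split_ifs with h'
      · exact hφ i (by omega) x hx
      · rfl
  | h₂ φ ψ hφ hψ => rw [map_add, hφ, hψ, LinearMap.add_comp]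

/-- A form of degree n vanishes on all steps of the filtration above -n, so precomposition with β
lowers the degrees on which it lives by at least d, that is, it raises its own weight by d. -/
theorem RaisesBy.transpose {E : GrVec k} {d : ℤ} {β : E.V →ₗ[k] E.V} (hβ : RaisesBy d β) :
    RaisesBy (E := E.dual) (F := E.dual) d (Module.Dual.transpose (R := k) β) := fun n φ hφ => by
  refine E.dual.mem_wfil_iff.mpr fun m hm => ?_
  rw [dual_proj]
  refine LinearMap.ext fun x => ?_
  have h : E.wfil (-m + d) ≤ LinearMap.ker φ := iSup₂_le fun i hi y hy => hφ i (by omega) y hy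
  exact h (hβ _ _ (E.proj_mem (-m) x))

end GrVec

/-! ### Dual bundles and the verification of the Tannakian axioms -/

namespace EqBundle

variable {k : Type u} [Field k] [CharZero k] (X : EqBundle k)

/-- The dual bundle. -/
def dual : EqBundle k := ofRes X.E.dual (-Module.Dual.transpose (R := k) X.res)
  (RaisesBy.neg X.res_raises.transpose)

theorem res_dual : X.dual.res = -Module.Dual.transpose (R := k) X.res := res_ofRes _ _ _

/-- The sign in the dual residue makes the two terms φ(β x) cancel, so evaluation is horizontal for
the residue 0 of the unit. -/
theorem contractLeft_comp_map (V : Type u) [AddCommGroup V] [Module k V] (β : Module.End k V) :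
    contractLeft k V ∘ₗ (TensorProduct.map (-Module.Dual.transpose (R := k) β) LinearMap.id +
      TensorProduct.map LinearMap.id β) = 0 ∘ₗ contractLeft k V :=
  TensorProduct.ext' fun φ x => by
    rw [LinearMap.comp_apply, LinearMap.add_apply, TensorProduct.map_tmul, TensorProduct.map_tmul,
      map_add, contractLeft_apply, contractLeft_apply]
    exact neg_add_cancel (φ (β x))

theorem contractLeft_mem : (contractLeft k X.E.V : _ →ₗ[k] k) ∈
    homs (tensorObj X.dual X) (tensorUnit k) := by
  refine mem_homs.mpr ⟨isGraded_of_tensor (E := X.E.dual) (F := X.E) (G := GrVec.unit k)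
    fun i j φ hφ x hx => ?_, ?_⟩
  · by_cases h : i + j = 0
    · rw [h]
      exact mem_unit _
    · have : contractLeft k X.E.V (φ ⊗ₜ[k] x) = 0 := hφ j (by omega) x hx
      exact this ▸ Submodule.zero_mem _
  · rw [res_tensor, res_unit, res_dual]
    exact contractLeft_comp_map X.E.V X.res

/-- The isomorphism of `V ⊗ V*` with the endomorphisms of `V`. -/
def endEquiv (V : Type u) [AddCommGroup V] [Module k V] [Module.Finite k V] :
    V ⊗[k] Module.Dual k V ≃ₗ[k] Module.End k V :=
  TensorProduct.comm k V (Module.Dual k V) ≪≫ₗ dualTensorHomEquiv k V V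

theorem endEquiv_tmul (V : Type u) [AddCommGroup V] [Module k V] [Module.Finite k V] (x y : V)
    (φ : Module.Dual k V) : endEquiv V (x ⊗ₜ[k] φ) y = φ y • x := by
  simp [endEquiv]

theorem endEquiv_coevaluation (V : Type u) [AddCommGroup V] [Module k V] [Module.Finite k V] :
    endEquiv V (coevaluation k V 1) = 1 := LinearMap.ext fun x => by
  rw [coevaluation_apply_one, map_sum, LinearMap.sum_apply]
  simp only [endEquiv_tmul, Module.Basis.coord_apply]
  exact (Module.Basis.ofVectorSpace k V).sum_repr x

/-- The degree of x ⊗ φ is the degree of the endomorphism y ↦ φ(y)x, so the grading of E ⊗ E* is the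
one by degree of endomorphisms. -/
theorem endEquiv_proj (E : GrVec k) (m : ℤ) (z : E.V ⊗[k] Module.Dual k E.V) :
    endEquiv E.V ((GrVec.tensor E E.dual).proj m z) = comp m (endEquiv E.V z) := by
  refine E.hom_ext fun n y hy => ?_
  rw [comp_of_mem _ _ hy]
  let P : E.V ⊗[k] Module.Dual k E.V →ₗ[k] E.V ⊗[k] Module.Dual k E.V :=
    (GrVec.tensor E E.dual).proj m
  have h : LinearMap.applyₗ y ∘ₗ (endEquiv E.V).toLinearMap ∘ₗ P =
      E.proj (n + m) ∘ₗ LinearMap.applyₗ y ∘ₗ (endEquiv E.V).toLinearMap := by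
    refine TensorProduct.ext (E.hom_ext fun i x hx => LinearMap.ext fun φ => ?_)
    have hP : P (x ⊗ₜ[k] φ) = x ⊗ₜ[k] (φ ∘ₗ E.proj (-(m - i))) :=
      (tmul_proj (E := E) (F := E.dual) m φ hx).trans
        (congrArg (fun ψ : Module.Dual k E.V => x ⊗ₜ[k] ψ) (dual_proj E _ φ))
    change endEquiv E.V (P (x ⊗ₜ[k] φ)) y = E.proj (n + m) (endEquiv E.V (x ⊗ₜ[k] φ) y)
    rw [hP, endEquiv_tmul, endEquiv_tmul, map_smul, E.proj_of_mem hx, LinearMap.comp_apply,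
      E.proj_of_mem hy]
    by_cases h : i = n + m
    · rw [if_pos h, if_pos (by omega)]
    · rw [if_neg h, if_neg (by omega), map_zero, zero_smul, smul_zero]
  exact LinearMap.congr_fun h z

/-- Under the identification with endomorphisms, the residue of E ⊗ E* is the commutator with β. -/
theorem endEquiv_map (V : Type u) [AddCommGroup V] [Module k V] [Module.Finite k V]
    (β : Module.End k V) (z : V ⊗[k] Module.Dual k V) :
    endEquiv V ((TensorProduct.map β LinearMap.id +
      TensorProduct.map LinearMap.id (-Module.Dual.transpose (R := k) β) :
        V ⊗[k] Module.Dual k V →ₗ[k] V ⊗[k] Module.Dual k V) z) =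
      β ∘ₗ endEquiv V z - endEquiv V z ∘ₗ β := by
  induction z using TensorProduct.induction_on with
  | zero => rw [map_zero, map_zero, LinearMap.comp_zero, LinearMap.zero_comp, sub_zero]
  | add z w hz hw =>
    rw [map_add, map_add, hz, hw, map_add, LinearMap.comp_add, LinearMap.add_comp]
    abel
  | tmul x φ =>
    refine LinearMap.ext fun y => ?_
    rw [LinearMap.add_apply, TensorProduct.map_tmul, TensorProduct.map_tmul, map_add,
      LinearMap.add_apply, endEquiv_tmul, LinearMap.sub_apply, LinearMap.comp_apply,
      LinearMap.comp_apply, endEquiv_tmul, endEquiv_tmul, endEquiv_tmul, map_smul, sub_eq_add_neg,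
      ← neg_smul]
    rfl

/-- The coevaluation vector corresponds to the identity, which commutes with β. -/
theorem map_coevaluation (V : Type u) [AddCommGroup V] [Module k V] [Module.Finite k V]
    (β : Module.End k V) : (TensorProduct.map β LinearMap.id +
      TensorProduct.map LinearMap.id (-Module.Dual.transpose (R := k) β) :
        V ⊗[k] Module.Dual k V →ₗ[k] V ⊗[k] Module.Dual k V) (coevaluation k V 1) = 0 := by
  refine (endEquiv V).injective ?_
  rw [endEquiv_map, endEquiv_coevaluation, map_zero]
  exact sub_self β

/-- The identity endomorphism has degree 0. -/
theorem coevaluation_mem_gr (E : GrVec k) :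
    (coevaluation k E.V 1 : E.V ⊗[k] Module.Dual k E.V) ∈ (GrVec.tensor E E.dual).gr 0 := by
  refine mem_gr_of_proj _ fun m hm => (endEquiv E.V).injective ?_
  refine (endEquiv_proj E m _).trans ?_
  rw [endEquiv_coevaluation, comp_of_deg (d := 0) (fun n x hx => by rwa [add_zero]), if_neg hm.symm]
  exact (map_zero (endEquiv E.V)).symm

theorem coevaluation_apply (V : Type u) [AddCommGroup V] [Module k V] [Module.Finite k V] (c : k) :
    coevaluation k V c = c • coevaluation k V 1 := by
  rw [← map_smul, smul_eq_mul, mul_one]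

theorem eq_zero_of_mem_unit {n : ℤ} (hn : n ≠ 0) {c : k}
    (hc : (show (GrVec.unit k).V from c) ∈ (GrVec.unit k).gr n) : c = 0 := by
  have h : c ∈ (if n = 0 then ⊤ else ⊥ : Submodule k k) := hc
  rwa [if_neg hn, Submodule.mem_bot] at h

theorem coevaluation_mem : (coevaluation k X.E.V : k →ₗ[k] _) ∈
    homs (tensorUnit k) (tensorObj X X.dual) := by
  refine mem_homs.mpr ⟨fun n c hc => ?_, ?_⟩
  · by_cases hn : n = 0
    · subst hn
      exact (coevaluation_apply (k := k) X.E.V c).symm ▸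
        Submodule.smul_mem (p := (tensorObj X X.dual).E.gr 0) (c : k) (coevaluation_mem_gr X.E)
    · have h := (congrArg (coevaluation k X.E.V) (eq_zero_of_mem_unit hn hc)).trans (map_zero _)
      exact h ▸ Submodule.zero_mem _
  · rw [res_unit, res_tensor, res_dual]
    exact LinearMap.ext_ring ((map_zero (coevaluation k X.E.V)).trans
      (map_coevaluation X.E.V X.res).symm)

open scoped MonoidalCategory

instance : MonoidalPreadditive (EqBundle k) where
  whiskerLeft_zero := Subtype.ext (TensorProduct.map_zero_right _)
  zero_whiskerRight := Subtype.ext (TensorProduct.map_zero_left _)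
  whiskerLeft_add f g := Subtype.ext (TensorProduct.map_add_right _ _ _)
  add_whiskerRight f g := Subtype.ext (TensorProduct.map_add_left _ _ _)

instance : MonoidalLinear k (EqBundle k) where
  whiskerLeft_smul X _ _ c f := Subtype.ext (TensorProduct.map_smul_right _ _ _)
  smul_whiskerRight c _ _ f X := Subtype.ext (TensorProduct.map_smul_left _ _ _)

theorem bijective_smul_id : Function.Bijective fun c : k => c • 𝟙 (𝟙_ (EqBundle k)) := by
  refine ⟨fun c d h => ?_, fun f => ?_⟩
  · have := LinearMap.congr_fun (congrArg Subtype.val h) (1 : k)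
    exact (mul_one c).symm.trans (this.trans (mul_one d))
  · let g : k →ₗ[k] k := f.1
    have h : g 1 • (LinearMap.id : k →ₗ[k] k) = g := LinearMap.ext_ring (mul_one (g 1))
    exact ⟨g 1, Subtype.ext h⟩

variable (k) in
theorem isTensorCategory : IsTensorCategory k (EqBundle k) where
  -- Kernels, cokernels, finite products and normality of monomorphisms and epimorphisms are found
  -- as instances, so nothing else has to be supplied and the additive structure is the given one.
  abelian := ⟨{ }, rfl⟩
  additive := inferInstance
  linear := inferInstance
  -- ω is faithful and keeps the underlying maps, so the triangle identities are those of finite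
  -- dimensional vector spaces.
  dual X := ⟨X.dual, ⟨{
    coevaluation' := ⟨coevaluation k X.E.V, X.coevaluation_mem⟩
    evaluation' := ⟨contractLeft k X.E.V, X.contractLeft_mem⟩
    coevaluation_evaluation' := Subtype.ext (contractLeft_assoc_coevaluation k X.E.V)
    evaluation_coevaluation' := Subtype.ext (contractLeft_assoc_coevaluation' k X.E.V) }⟩⟩
  endUnit := bijective_smul_id

end EqBundle

end Equising

end

theorem mainTheorem1 (k : Type u) [Field k] [CharZero k] :
    Equising.IsTannakian k (Equising.EqBundle k) ∧
    Equising.IsFiberFunctor (Equising.EqBundle.omega k) ∧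
    ∃ (F : Equising.EqBundle k ⥤ Equising.URep k) (_ : F.Braided),
      F.IsEquivalence ∧ F.Additive ∧ F.Linear k ∧
        ∃ iso : F ⋙ Equising.URep.forget k ≅ Equising.EqBundle.omega k,
          NatTrans.IsMonoidal iso.hom :=
  ⟨⟨Equising.EqBundle.isTensorCategory k, Equising.EqBundle.omega k, inferInstance,
      Equising.EqBundle.isFiberFunctor_omega k⟩,
    Equising.EqBundle.isFiberFunctor_omega k, Equising.toRep k, inferInstance, inferInstance,
    inferInstance, inferInstance, Equising.toRepForget k, inferInstance⟩
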